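/- Let $\phi\colon Q\to R$ be a surjective homomorphism of commutative noetherian local rings whose kernel is generated by a $Q$-regular sequence $\boldsymbol f=f_1,\dots,f_c$, and let $k$ be the residue field of $Q$. Let $A=\operatorname{Kos}^Q(\boldsymbol f)=\Lambda(\Sigma Q^c)$ be the Koszul complex, a dg algebra, with its canonical map $A\to R$ and with $\bar A=A_{\geq 1}$. Unadorned tensor products are over $Q$; $\mathsf s\colon N\to\Sigma N$ is the suspension; complexes are graded homologically and may be unbounded; all formulas follow the Koszul sign rule. *Conventions.* $\phi$ is Koszul if $B\otimes k$, for a degreewise free non-negatively graded dg algebra resolution $B\to R$ over $Q$, is formal and its homology is a Koszul $k$-algebra for some weight grading compatible with the homological grading. A strictly Koszul presentation of $\phi$ is a triple $(A,V,W)$: $V$ is a non-negatively graded, degreewise finite free $Q$-module, $W\subseteq V\otimes V$ is a graded direct summand, and $A=\mathsf T(V)/(W)$ carries an $A_\infty$-algebra structure $\{m_n\}$ with split unit, such that $\mathsf T(V\otimes k)/(W\otimes k)$ is Koszul for the tensor weight grading, $m_2\otimes k$ is the product and $m_n\otimes k=0$ for $n\ne 2$, there is a strict quasi-isomorphism of $A_\infty$-algebras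 $A\to R$, and the operations $\bar m_n$ induced on $\bar A$ satisfy $\bar m_1(V)\subseteq V$ and $\bar m_n\bigl(\bigcap_{i+2+j=n}V^{\otimes i}\otimes W\otimes V^{\otimes j}\bigr)\subseteq V$ for $n\ge2$. The map $\phi$ is strictly Koszul if it is Koszul and has a strictly Koszul presentation; the associated Priddy coalgebra is $\mathsf C(V,W)=\bigoplus_n\bigcap_{i+2+j=n}(\Sigma V)^{\otimes i}\otimes\Sigma^2W\otimes(\Sigma V)^{\otimes j}$ with the coproduct, counit, coderivation and curvature restricted from the bar construction of $A$ (the tensor coalgebra of $\Sigma\bar A$). A semifree resolution is a surjective quasi-isomorphism from a semifree complex. For $\alpha\in\mathbb N_0^c$ let $|\alpha|=\sum_i\alpha_i$, and let $y^{(\alpha)}$ be the sum of $\tau\cdot(y_1^{\otimes\alpha_1}\otimes\dots\otimes y_c^{\otimes\alpha_c})$ over all $\alpha$-shuffles $\tau$, where $y_1,\dots,y_c$ is the standard basis of $\Sigma^2Q^c$. 1. $\phi$ is strictly Koszul. More precisely, $(A,V,W)$ is a strictly Koszul presentation for $V=\Sigma Q^c$ and $W$ generated by all $a\otimes a$ and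 $a\otimes b+b\otimes a$. Its Priddy coalgebra is the curved coalgebra of symmetric tensors $\bigoplus_n\bigl((\Sigma^2Q^c)^{\otimes n}\bigr)^{S_n}$, with coproduct restricted from the tensor coalgebra, zero differential, and curvature $(f_1,\dots,f_c)\colon\Sigma^2Q^c\to Q$ (and zero on tensors of weight $\neq1$). Let $M$ be a complex of $R$-modules and $\gamma\colon G\to M$ a semifree resolution over $Q$. Regard $M$ as an $A_\infty$-module over $A$ by restriction along $A\to R$. 2. There is a strictly unital $A_\infty$-module structure $\{m_n^G\}$ over $A$ on $G$ with $m_1^G=\partial^G$ such that $\gamma$ is a strict morphism of $A_\infty$-modules. For every such structure the maps $$\sigma^{(\alpha)}=(-1)^{\frac{|\alpha|(|\alpha|-1)}2}\,m^G_{|\alpha|+1}\bigl((\mathsf s^{-1})^{\otimes|\alpha|}y^{(\alpha)}\otimes\mathrm{id}\bigr)\qquad(\alpha\in\mathbb N_0^c)$$ form a system of higher homotopies on $G$ corresponding to $\boldsymbol f$: $\sigma^{(\alpha)}$ has degree $2|\alpha|-1$; $\sigma^{(0)}=\partial^G$; $\sigma^{(0)}\sigma^{(\mathbf e_i)}+\sigma^{(\mathbf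 e_i)}\sigma^{(0)}=f_i\,\mathrm{id}_G$ for all $i$; $\sum_{\beta+\beta'=\alpha}\sigma^{(\beta)}\sigma^{(\beta')}=0$ whenever $|\alpha|>1$; and $\gamma\sigma^{(\alpha)}=0$ whenever $|\alpha|>0$. 3. Let $\{m_n^G\}$ and $\sigma^{(\alpha)}$ be as in 2, and let $C=\mathsf C(V,W)$ be as in 1. Let $D$ be the graded $Q$-dual of $Q[\chi_1,\dots,\chi_c]$ with $|\chi_i|=-2$, on which $\chi^\alpha$ acts by the transpose of multiplication. The Priddy resolution $R\otimes C\otimes G$, whose differential is the sum of $\mathrm{id}\otimes\partial^C\otimes\mathrm{id}$ (zero here) and of the maps $(-1)^{n(n-1)/2}\,\mathrm{id}_R\otimes\mathrm{id}^{\otimes i}\otimes m_{n+1}^G((\mathsf s^{-1})^{\otimes n}\otimes\mathrm{id}_G)$, with augmentation $r\otimes x\otimes g\mapsto r\,\epsilon(x)\gamma(g)$, and the Eisenbud–Shamash resolution $R\otimes D\otimes G$, with differential $\sum_\alpha 1\otimes\chi^\alpha\otimes\sigma^{(\alpha)}$ and augmentation $r\otimes\varphi\otimes g\mapsto r\,\varphi(1)\gamma(g)$,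 are semifree resolutions of $M$ over $R$. There is an isomorphism $\theta\colon D\to C$ of $Q$-modules sending the dual basis element $(\chi^\alpha)^\vee$ to $y^{(\alpha)}$ for all $\alpha$, and $\mathrm{id}_R\otimes\theta\otimes\mathrm{id}_G$ is an isomorphism of complexes of $R$-modules from the Eisenbud–Shamash resolution to the Priddy resolution that is compatible with the augmentations to $M$. -/

import Mathlib

open scoped TensorProduct DirectSum

universe u v w w'

noncomputable section

namespace AInfKoszul

/-! ### Graded modules, complexes and semifree resolutions

A graded module is a module `M` with an internal direct sum decomposition `deg : ℤ → Submodule Q M`;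
differentials lower degrees by one. -/

/-- The sign `(-1)^i`. -/
def sgn (i : ℤ) : ℤ := (Int.negOnePow i : ℤˣ)

section Graded

variable {Q : Type*} [CommRing Q] {M : Type*} [AddCommGroup M] [Module Q M]
  {N : Type*} [AddCommGroup N] [Module Q N]

/-- The linear involution `x ↦ (-1)^{|x|} x` of a graded module. It encodes Koszul signs. -/
def gradeSign (deg : ℤ → Submodule Q M) (h : DirectSum.IsInternal deg) : M →ₗ[Q] M :=
  (DirectSum.toModule Q ℤ M fun i => sgn i • (deg i).subtype) ∘ₗ
    ((LinearEquiv.ofBijective (DirectSum.coeLinearMap deg)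
      (show Function.Bijective (DirectSum.coeLinearMap deg) from h)).symm : M →ₗ[Q] ⨁ i, deg i)

theorem gradeSign_of_mem (deg : ℤ → Submodule Q M) (h : DirectSum.IsInternal deg) {i : ℤ} {x : M}
    (hx : x ∈ deg i) : gradeSign deg h x = sgn i • x := by
  have h' : Function.Bijective (DirectSum.coeLinearMap deg) := h
  have : (LinearEquiv.ofBijective (DirectSum.coeLinearMap deg) h').symm x
      = DirectSum.lof Q ℤ (fun i => deg i) i ⟨x, hx⟩ := by
    rw [LinearEquiv.symm_apply_eq, LinearEquiv.ofBijective_apply, DirectSum.coeLinearMap_lof]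
  rw [gradeSign, LinearMap.comp_apply, LinearEquiv.coe_coe, this, DirectSum.toModule_lof]
  rfl

/-- The grading of a tensor product of graded modules. -/
def tensDeg (degM : ℤ → Submodule Q M) (degN : ℤ → Submodule Q N) (i : ℤ) :
    Submodule Q (M ⊗[Q] N) :=
  ⨆ p : ℤ, Submodule.map₂ (TensorProduct.mk Q M N) (degM p) (degN (i - p))

/-- The grading of a module concentrated in a single degree `a`. -/
def concDeg (Q : Type*) [CommRing Q] (M : Type*) [AddCommGroup M] [Module Q M] (a i : ℤ) :
    Submodule Q M :=
  if i = a then ⊤ else ⊥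

/-- `(M, deg, d)` is a complex (homological indexing, unbounded). -/
structure IsComplex (deg : ℤ → Submodule Q M) (d : M →ₗ[Q] M) : Prop where
  internal : DirectSum.IsInternal deg
  d_mem : ∀ {i : ℤ} {x : M}, x ∈ deg i → d x ∈ deg (i - 1)
  d_d : ∀ x, d (d x) = 0

/-- A complex is semifree if it has an exhaustive filtration `0 = F 0 ⊆ F 1 ⊆ ⋯` by subcomplexes,
each of whose subquotients has a basis of classes of homogeneous elements and zero differential,
that is, is a direct sum of shifts of the base ring. -/
structure IsSemifree (deg : ℤ → Submodule Q M) (d : M →ₗ[Q] M) : Prop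
    extends IsComplex deg d where
  filtration : ∃ F : ℕ → Submodule Q M, F 0 = ⊥ ∧ (⨆ n, F n) = ⊤ ∧
    ∀ n, ∃ E : Set M, F (n + 1) = F n ⊔ Submodule.span Q E ∧
      LinearIndependent Q (fun e : E => (F n).mkQ e) ∧
      ∀ e ∈ E, (∃ i, e ∈ deg i) ∧ d e ∈ F n

end Graded

/-- The map `f`, assumed to commute with the differentials, is bijective in homology. -/
def IsQuasiIso {A B : Type*} [AddCommGroup A] [AddCommGroup B] (dA : A → A) (dB : B → B)
    (f : A → B) : Prop :=
  (∀ x, dA x = 0 → (∃ y, f x = dB y) → ∃ z, x = dA z) ∧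
    ∀ y, dB y = 0 → ∃ x, dA x = 0 ∧ ∃ z, f x - y = dB z

/-- `γ : G → M` is a semifree resolution over `Q`: `G` is semifree, and `γ` is a surjective
quasi-isomorphism of complexes. -/
structure IsSemifreeResolution {Q : Type*} [CommRing Q] {G : Type*} [AddCommGroup G] [Module Q G]
    {M : Type*} [AddCommGroup M] [Module Q M] (degG : ℤ → Submodule Q G) (dG : G →ₗ[Q] G)
    (degM : ℤ → Submodule Q M) (dM : M →ₗ[Q] M) (γ : G →ₗ[Q] M) : Prop where
  semifree : IsSemifree degG dG
  mem : ∀ {i : ℤ} {x : G}, x ∈ degG i → γ x ∈ degM i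
  comm : ∀ x, γ (dG x) = dM (γ x)
  surjective : Function.Surjective γ
  quasiIso : IsQuasiIso dG dM γ

/-! ### Differential graded algebras, Koszul algebras and Koszul homomorphisms -/

/-- A dg algebra structure on an associative unital algebra. -/
structure DGStructure (k : Type*) [CommRing k] (A : Type*) [Ring A] [Algebra k A] where
  deg : ℤ → Submodule k A
  internal : DirectSum.IsInternal deg
  one_mem : (1 : A) ∈ deg 0
  mul_mem : ∀ {i j : ℤ} {x y : A}, x ∈ deg i → y ∈ deg j → x * y ∈ deg (i + j)
  d : A →ₗ[k] A
  d_mem : ∀ {i : ℤ} {x : A}, x ∈ deg i → d x ∈ deg (i - 1)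
  d_d : ∀ x, d (d x) = 0
  leibniz : ∀ {i : ℤ} {x : A}, x ∈ deg i → ∀ y, d (x * y) = d x * y + sgn i • (x * d y)

/-- The base change `k ⊗ A` of a dg algebra. -/
def DGStructure.baseChange {Q : Type*} [CommRing Q] {A : Type*} [Ring A] [Algebra Q A]
    (𝒜 : DGStructure Q A) (k : Type*) [CommRing k] [Algebra Q k] :
    DGStructure k (k ⊗[Q] A) := by
  letI : DirectSum.Decomposition 𝒜.deg := 𝒜.internal.chooseDecomposition
  letI : GradedAlgebra 𝒜.deg :=
    { one_mem := 𝒜.one_mem, mul_mem := fun _ _ _ _ hx hy => 𝒜.mul_mem hx hy }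
  exact
  { deg := fun i => (𝒜.deg i).baseChange k
    internal := DirectSum.Decomposition.isInternal _
    one_mem := SetLike.GradedOne.one_mem (A := fun i => (𝒜.deg i).baseChange k)
    mul_mem := fun hx hy => SetLike.GradedMul.mul_mem (A := fun i => (𝒜.deg i).baseChange k) hx hy
    d := 𝒜.d.baseChange k
    d_mem := by
      intro i x hx
      rw [Submodule.baseChange_eq_span] at hx
      induction hx using Submodule.span_induction with
      | mem x hx =>
        obtain ⟨a, ha, rfl⟩ := hx
        simpa using Submodule.tmul_mem_baseChange_of_mem (1 : k) (𝒜.d_mem ha)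
      | zero => simp
      | add x y _ _ hx hy => rw [map_add]; exact add_mem hx hy
      | smul r x _ hx => rw [map_smul]; exact Submodule.smul_mem _ _ hx
    d_d := by
      intro x
      induction x using TensorProduct.induction_on with
      | zero => simp
      | tmul a b => simp [𝒜.d_d]
      | add x y hx hy => simp [hx, hy]
    leibniz := by
      intro i x hx y
      rw [Submodule.baseChange_eq_span] at hx
      induction hx using Submodule.span_induction with
      | mem x hx =>
        obtain ⟨a, ha, rfl⟩ := hx
        induction y using TensorProduct.induction_on with
        | zero => simp
        | tmul s b =>
          have e := map_zsmul (TensorProduct.mk Q k A s) (sgn i) (a * 𝒜.d b)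
          simp only [TensorProduct.mk_apply] at e
          simp only [TensorProduct.mk_apply, Algebra.TensorProduct.tmul_mul_tmul, one_mul,
            LinearMap.baseChange_tmul, 𝒜.leibniz ha, TensorProduct.tmul_add, e]
        | add y z hy hz => simp only [mul_add, map_add, hy, hz, smul_add]; abel
      | zero => simp
      | add x z _ _ hx hz => simp only [add_mul, map_add, hx, hz, smul_add]; abel
      | smul r x _ hx =>
        simp only [smul_mul_assoc, map_smul, hx, smul_add, smul_comm r (sgn i)] }

/-- A bundled dg algebra. -/
structure DGAlg (k : Type u) [CommRing k] where
  carrier : Type u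
  [ring : Ring carrier]
  [algebra : Algebra k carrier]
  str : DGStructure k carrier

attribute [instance] DGAlg.ring DGAlg.algebra

/-- Existence of a quasi-isomorphism of dg algebras `A → B`. -/
def DGAlg.QuasiIsoTo {k : Type u} [CommRing k] (A B : DGAlg k) : Prop :=
  ∃ f : A.carrier →ₐ[k] B.carrier, (∀ i x, x ∈ A.str.deg i → f x ∈ B.str.deg i) ∧
    (∀ x, f (A.str.d x) = B.str.d (f x)) ∧ IsQuasiIso A.str.d B.str.d f

/-- Two dg algebras are quasi-isomorphic if a zig-zag of quasi-isomorphisms connects them. -/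
def DGAlg.QuasiIsomorphic {k : Type u} [CommRing k] : DGAlg k → DGAlg k → Prop :=
  Relation.EqvGen DGAlg.QuasiIsoTo

/-- For an algebra `H` over a field `k`, the family `wt` is a weight grading `H = ⨁_{w ≥ 0} H_w` with
`H_0 = k`, and the left `H`-module `k = H / H_{>0}` has a linear free resolution: the `i`-th module
is free on generators of weight `i`, so that the matrices of all differentials have entries in
`H_1`. Such a resolution is automatically minimal. -/
structure IsKoszulGrading {k : Type u} [Field k] {H : Type u} [Ring H] [Algebra k H]
    (wt : ℕ → Submodule k H) : Prop where
  nontrivial : Nontrivial H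
  internal : DirectSum.IsInternal wt
  mul_mem : ∀ {i j : ℕ} {x y : H}, x ∈ wt i → y ∈ wt j → x * y ∈ wt (i + j)
  wt_zero : wt 0 = 1
  linear : ∃ (X : ℕ → Type u) (_ : Unique (X 0)) (δ : ∀ i, (X (i + 1) →₀ H) →ₗ[H] (X i →₀ H)),
    (∀ i x y, δ i (Finsupp.single x 1) y ∈ wt 1) ∧
    (∀ p : X 0 →₀ H, p ∈ LinearMap.range (δ 0) ↔ p default ∈ ⨆ n : ℕ, wt (n + 1)) ∧
    ∀ i, Function.Exact (δ (i + 1)) (δ i)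

/-- A dg algebra over a field is Koszul if it is formal, that is, quasi-isomorphic to a dg algebra
`H` with zero differential (which is then its homology algebra), and `H` is a Koszul algebra with
respect to some weight grading compatible with the homological grading. (As `H_0 = k` for the weight
grading, the augmentation is the projection to weight zero.) -/
def IsKoszulDG {k : Type u} [Field k] {K : Type u} [Ring K] [Algebra k K]
    (𝒦 : DGStructure k K) : Prop :=
  ∃ H : DGAlg k, H.str.d = 0 ∧ DGAlg.QuasiIsomorphic ⟨K, 𝒦⟩ H ∧
    ∃ wt : ℕ → Submodule k H.carrier, (∀ n, wt n = ⨆ i : ℤ, wt n ⊓ H.str.deg i) ∧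
      IsKoszulGrading wt

/-- `ε : A → R` is a dg algebra resolution over `Q`: `A` is concentrated in non-negative degrees,
degreewise free over `Q`, and `ε` is a quasi-isomorphism of dg algebras. -/
structure IsDGResolution {Q : Type*} [CommRing Q] {A : Type*} [Ring A] [Algebra Q A]
    {R : Type*} [CommRing R] [Algebra Q R] (𝒜 : DGStructure Q A) (ε : A →ₐ[Q] R) : Prop where
  nonneg : ∀ i < 0, 𝒜.deg i = ⊥
  free : ∀ i, Module.Free Q (𝒜.deg i)
  deg_ne : ∀ i ≠ 0, ∀ x ∈ 𝒜.deg i, ε x = 0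
  comm : ∀ x, ε (𝒜.d x) = 0
  quasiIso : IsQuasiIso 𝒜.d (0 : R → R) ε

/-- A finite local homomorphism `Q → R` of local rings with common residue field `k` is Koszul if
its derived fibre `A ⊗ k`, for a dg algebra resolution `A → R`, is a Koszul dg algebra. -/
def IsKoszulHom (Q : Type u) (R : Type v) [CommRing Q] [IsLocalRing Q] [CommRing R] [IsLocalRing R]
    [Algebra Q R] : Prop :=
  IsLocalHom (algebraMap Q R) ∧ Module.Finite Q R ∧
  Function.Surjective (fun q : Q => IsLocalRing.residue R (algebraMap Q R q)) ∧
  ∃ (A : Type u) (_ : Ring A) (_ : Algebra Q A) (𝒜 : DGStructure Q A) (ε : A →ₐ[Q] R),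
    IsDGResolution 𝒜 ε ∧ IsKoszulDG (𝒜.baseChange (IsLocalRing.ResidueField Q))

/-! ### Tensor algebras and tensor coalgebras -/

section Tensor

variable {Q : Type*} [CommRing Q] {N : Type*} [AddCommGroup N] [Module Q N]
  {X : Type*} [AddCommGroup X] [Module Q X]

/-- The linear map out of `T(N)` given on `N^{⊗ n}` by the multilinear map `F n`. -/
def evalFamily (F : ∀ n : ℕ, MultilinearMap Q (fun _ : Fin n => N) X) :
    TensorAlgebra Q N →ₗ[Q] X :=
  (DirectSum.toModule Q ℕ X fun n => PiTensorProduct.lift (F n)) ∘ₗ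
    (TensorAlgebra.toDirectSum (R := Q) (M := N)).toLinearMap

theorem evalFamily_tprod (F : ∀ n : ℕ, MultilinearMap Q (fun _ : Fin n => N) X) (n : ℕ)
    (a : Fin n → N) : evalFamily F (TensorAlgebra.tprod Q N n a) = F n a := by
  have h := TensorAlgebra.toDirectSum_tensorPower_tprod (R := Q) (M := N) a
  simp only [evalFamily, LinearMap.comp_apply, AlgHom.toLinearMap_apply, h]
  erw [DirectSum.toModule_lof]
  simp

/-- Functoriality of the tensor algebra. -/
def tensorMap {N' : Type*} [AddCommGroup N'] [Module Q N'] (f : N →ₗ[Q] N') :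
    TensorAlgebra Q N →ₐ[Q] TensorAlgebra Q N' :=
  TensorAlgebra.lift Q (TensorAlgebra.ι Q ∘ₗ f)

/-- The endomorphism `(x, z) ↦ (a x, 1 ⊗ a x + (a ⊗ 1) z)` of `T(N) × T(N) ⊗ T(N)`. -/
def deconcStep : N →ₗ[Q] Module.End Q
    (TensorAlgebra Q N × (TensorAlgebra Q N ⊗[Q] TensorAlgebra Q N)) where
  toFun a :=
    (LinearMap.mulLeft Q (TensorAlgebra.ι Q a) ∘ₗ LinearMap.fst Q _ _).prod
      (TensorProduct.mk Q _ _ 1 ∘ₗ LinearMap.mulLeft Q (TensorAlgebra.ι Q a) ∘ₗ LinearMap.fst Q _ _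
        + LinearMap.mulLeft Q (TensorAlgebra.ι Q a ⊗ₜ[Q] (1 : TensorAlgebra Q N)) ∘ₗ
          LinearMap.snd Q _ _)
  map_add' a b := by
    ext x <;> simp [add_mul, TensorProduct.tmul_add, TensorProduct.add_tmul]
  map_smul' r a := by
    ext x <;> simp [TensorProduct.smul_tmul']

/-- The deconcatenation coproduct
`Δ(a_1 ⊗ ⋯ ⊗ a_n) = ∑_i (a_1 ⊗ ⋯ ⊗ a_i) ⊗ (a_{i+1} ⊗ ⋯ ⊗ a_n)` of the tensor coalgebra,
see `deconc_list_prod`. -/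
def deconc : TensorAlgebra Q N →ₗ[Q] TensorAlgebra Q N ⊗[Q] TensorAlgebra Q N :=
  LinearMap.snd Q _ _ ∘ₗ
    (LinearMap.applyₗ ((1 : TensorAlgebra Q N), (1 : TensorAlgebra Q N ⊗[Q] TensorAlgebra Q N))) ∘ₗ
      (TensorAlgebra.lift Q (deconcStep (Q := Q) (N := N))).toLinearMap

theorem deconc_one : deconc (1 : TensorAlgebra Q N) = 1 ⊗ₜ 1 := by
  simp [deconc, Algebra.TensorProduct.one_def]

theorem deconc_aux (x : TensorAlgebra Q N) :
    TensorAlgebra.lift Q (deconcStep (Q := Q) (N := N)) x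
      ((1 : TensorAlgebra Q N), (1 : TensorAlgebra Q N ⊗[Q] TensorAlgebra Q N))
      = (x, deconc x) := by
  refine Prod.ext ?_ rfl
  have key : ∀ (x : TensorAlgebra Q N) (z : TensorAlgebra Q N × _),
      (TensorAlgebra.lift Q (deconcStep (Q := Q) (N := N)) x z).1 = x * z.1 := by
    intro x
    induction x using TensorAlgebra.induction with
    | algebraMap r => intro z; simp [Algebra.smul_def]
    | ι a => intro z; simp [deconcStep]
    | mul a b ha hb => intro z; simp [ha, hb, mul_assoc]
    | add a b ha hb => intro z; simp [ha, hb, add_mul]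
  simp [key]

theorem deconc_ι_mul (a : N) (x : TensorAlgebra Q N) :
    deconc (TensorAlgebra.ι Q a * x)
      = 1 ⊗ₜ (TensorAlgebra.ι Q a * x) + (TensorAlgebra.ι Q a ⊗ₜ 1) * deconc x := by
  have h := deconc_aux x
  have e : deconc (TensorAlgebra.ι Q a * x)
      = (TensorAlgebra.lift Q (deconcStep (Q := Q) (N := N)) (TensorAlgebra.ι Q a * x)
        ((1 : TensorAlgebra Q N), (1 : TensorAlgebra Q N ⊗[Q] TensorAlgebra Q N))).2 := rfl
  rw [e, map_mul, Module.End.mul_apply, h, TensorAlgebra.lift_ι_apply]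
  rfl

theorem deconc_list_prod (l : List N) :
    deconc (l.map (TensorAlgebra.ι Q)).prod
      = ∑ i ∈ Finset.range (l.length + 1),
          ((l.take i).map (TensorAlgebra.ι Q)).prod ⊗ₜ[Q]
            ((l.drop i).map (TensorAlgebra.ι Q)).prod := by
  induction l with
  | nil => simp [deconc_one]
  | cons a l ih =>
    rw [List.map_cons, List.prod_cons, deconc_ι_mul, ih, List.length_cons,
      Finset.sum_range_succ' _ (l.length + 1), add_comm, Finset.mul_sum]
    simp

/-- The part of homological degree `i` of `T(Σ^s N)`, for a graded module `N`. -/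
def tensorDeg (deg : ℤ → Submodule Q N) (s i : ℤ) : Submodule Q (TensorAlgebra Q N) :=
  Submodule.span Q {x | ∃ (n : ℕ) (a : Fin n → N) (δ : Fin n → ℤ), (∀ j, a j ∈ deg (δ j)) ∧
    ∑ j, (δ j + s) = i ∧ x = TensorAlgebra.tprod Q N n a}

/-- The part `N^{⊗ n}` of weight `n` of `T(N)`. -/
def tensorWt (Q : Type*) [CommRing Q] (N : Type*) [AddCommGroup N] [Module Q N] (n : ℕ) :
    Submodule Q (TensorAlgebra Q N) :=
  LinearMap.range (TensorAlgebra.ι Q (M := N)) ^ n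

/-- The inclusion `N ⊗ N → T(N)`. -/
def quadIncl (Q : Type*) [CommRing Q] (N : Type*) [AddCommGroup N] [Module Q N] :
    N ⊗[Q] N →ₗ[Q] TensorAlgebra Q N :=
  TensorProduct.lift ((LinearMap.mul Q (TensorAlgebra Q N)).compl₁₂
    (TensorAlgebra.ι Q) (TensorAlgebra.ι Q))

theorem quadIncl_tmul (a b : N) :
    quadIncl Q N (a ⊗ₜ b) = TensorAlgebra.ι Q a * TensorAlgebra.ι Q b := by
  simp [quadIncl]

/-- The quadratic algebra `T(V)/(W)` for `W ⊆ V ⊗ V`. -/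
abbrev QuadAlg (W : Submodule Q (N ⊗[Q] N)) : Type _ :=
  RingQuot fun a b : TensorAlgebra Q N => ∃ x ∈ W, a = quadIncl Q N x ∧ b = 0

/-- The projection `T(V) → T(V)/(W)`. -/
def quadMk (W : Submodule Q (N ⊗[Q] N)) : TensorAlgebra Q N →ₐ[Q] QuadAlg W :=
  RingQuot.mkAlgHom Q _

/-- The weight grading of `T(V)/(W)`. -/
def quadWt (W : Submodule Q (N ⊗[Q] N)) (n : ℕ) : Submodule Q (QuadAlg W) :=
  (tensorWt Q N n).map (quadMk W).toLinearMap

/-- The homological grading of `T(V)/(W)` induced by a grading of `V`. -/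
def quadDeg (deg : ℤ → Submodule Q N) (W : Submodule Q (N ⊗[Q] N)) (i : ℤ) :
    Submodule Q (QuadAlg W) :=
  (tensorDeg deg 0 i).map (quadMk W).toLinearMap

/-- The submodule `⋂_{i+2+j=n} V^{⊗ i} ⊗ W ⊗ V^{⊗ j}` of `V^{⊗ n}`; for `n < 2` this is all of
`V^{⊗ n}`. -/
def quadInter (W : Submodule Q (N ⊗[Q] N)) (n : ℕ) : Submodule Q (TensorAlgebra Q N) :=
  tensorWt Q N n ⊓ ⨅ (i : ℕ) (j : ℕ) (_ : i + 2 + j = n),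
    tensorWt Q N i * W.map (quadIncl Q N) * tensorWt Q N j

/-- The base change `W ⊗ k ⊆ (V ⊗ k) ⊗_k (V ⊗ k)`. -/
def quadBaseChange (k : Type*) [CommRing k] [Algebra Q k] (W : Submodule Q (N ⊗[Q] N)) :
    Submodule k ((k ⊗[Q] N) ⊗[k] (k ⊗[Q] N)) :=
  (W.baseChange k).map
    (TensorProduct.AlgebraTensorModule.distribBaseChange Q k N N).toLinearMap

end Tensor

/-! ### A∞-algebras and A∞-modules

The arguments of an operation are written as the beginning of a sequence `a : ℕ → A`. -/

/-- The sequence `a_0, …, a_{r-1}, x, a_{r+s}, a_{r+s+1}, …`. -/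
def insertOp {A : Type*} (a : ℕ → A) (r s : ℕ) (x : A) : ℕ → A :=
  fun i => if i < r then a i else if i = r then x else a (i + s - 1)

/-- A connective A∞-algebra with a split unit: operations `m n : A^{⊗ n} → A` of degree `n - 2`
for `n ≥ 1` (with the convention `m 0 = 0`) subject to the Stasheff identities
`∑ (-1)^{r + st} m_{r+1+t} (id^{⊗ r} ⊗ m_s ⊗ id^{⊗ t}) = 0`, a strict unit `one`, and a linear map
`aug` of degree `0` with `aug one = 1`, which amounts to the decomposition `A = Q ⊕ Ā` with
`Ā = ker aug`. The sign `(-1)^{s (|a_0| + ⋯ + |a_{r-1}|)}` comes from moving `m_s` past the first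
`r` arguments. -/
structure SplitAInfAlgebra (Q : Type*) [CommRing Q] (A : Type*) [AddCommGroup A] [Module Q A] where
  deg : ℤ → Submodule Q A
  internal : DirectSum.IsInternal deg
  connective : ∀ i < 0, deg i = ⊥
  m : ∀ n : ℕ, MultilinearMap Q (fun _ : Fin n => A) A
  m_zero : m 0 = 0
  m_mem : ∀ (n : ℕ) (a : Fin n → A) (δ : Fin n → ℤ), (∀ i, a i ∈ deg (δ i)) →
    m n a ∈ deg (∑ i, δ i + n - 2)
  stasheff : ∀ (n : ℕ) (a : ℕ → A) (δ : ℕ → ℤ), (∀ i, a i ∈ deg (δ i)) →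
    ∑ r ∈ Finset.range n, ∑ s ∈ Finset.Icc 1 (n - r),
      sgn (r + s * (n - r - s) + s * ∑ i ∈ Finset.range r, δ i) •
        m (n - s + 1) (fun i => insertOp a r s (m s fun j => a (r + j)) i) = 0
  one : A
  one_mem : one ∈ deg 0
  one_m : ∀ a : A, m 2 ![one, a] = a
  m_one : ∀ a : A, m 2 ![a, one] = a
  m_unit : ∀ n > 2, ∀ a : Fin n → A, (∃ i, a i = one) → m n a = 0
  aug : A →ₗ[Q] Q
  aug_one : aug one = 1
  aug_deg : ∀ i ≠ 0, ∀ x ∈ deg i, aug x = 0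

/-- A strictly unital A∞-module: `act n` is the operation `m_{n+1} : A^{⊗ n} ⊗ G → G`, of degree
`n - 1`. The Stasheff identity with `n` algebra arguments is
`∑_{r+s+t=n+1, t ≥ 1} (-1)^{r+st} m_{r+1+t} (id^{⊗ r} ⊗ m_s ⊗ id^{⊗ t})
  + ∑_{r+s=n+1} (-1)^r m_{r+1} (id^{⊗ r} ⊗ m_s) = 0`. -/
structure AInfModule {Q : Type*} [CommRing Q] {A : Type*} [AddCommGroup A] [Module Q A]
    (𝒜 : SplitAInfAlgebra Q A) (G : Type*) [AddCommGroup G] [Module Q G] where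
  deg : ℤ → Submodule Q G
  internal : DirectSum.IsInternal deg
  act : ∀ n : ℕ, MultilinearMap Q (fun _ : Fin n => A) (G →ₗ[Q] G)
  act_mem : ∀ (n : ℕ) (a : Fin n → A) (δ : Fin n → ℤ), (∀ i, a i ∈ 𝒜.deg (δ i)) →
    ∀ (p : ℤ) (g : G), g ∈ deg p → act n a g ∈ deg (∑ i, δ i + p + n - 1)
  stasheff : ∀ (n : ℕ) (a : ℕ → A) (δ : ℕ → ℤ), (∀ i, a i ∈ 𝒜.deg (δ i)) → ∀ g : G,
    ∑ r ∈ Finset.range n, ∑ s ∈ Finset.Icc 1 (n - r),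
      sgn (r + s * (n + 1 - r - s) + s * ∑ i ∈ Finset.range r, δ i) •
        act (n - s + 1) (fun i => insertOp a r s (𝒜.m s fun j => a (r + j)) i) g
    + ∑ r ∈ Finset.range (n + 1),
        sgn (r + (n - r + 1) * ∑ i ∈ Finset.range r, δ i) •
          act r (fun i => a i) (act (n - r) (fun j => a (r + j)) g) = 0
  one_act : ∀ g : G, act 1 (fun _ => 𝒜.one) g = g
  act_unit : ∀ n > 1, ∀ a : Fin n → A, (∃ i, a i = 𝒜.one) → act n a = 0

/-- A strict morphism of A∞-modules: a degree `0` linear map commuting with all operations. -/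
structure IsStrictMorphism {Q : Type*} [CommRing Q] {A : Type*} [AddCommGroup A] [Module Q A]
    {𝒜 : SplitAInfAlgebra Q A} {G : Type*} [AddCommGroup G] [Module Q G]
    {M : Type*} [AddCommGroup M] [Module Q M] (𝒢 : AInfModule 𝒜 G) (ℳ : AInfModule 𝒜 M)
    (γ : G →ₗ[Q] M) : Prop where
  mem : ∀ (i : ℤ) (x : G), x ∈ 𝒢.deg i → γ x ∈ ℳ.deg i
  comm : ∀ (n : ℕ) (a : Fin n → A) (g : G), γ (𝒢.act n a g) = ℳ.act n a (γ g)

/-! ### Bar construction and Priddy coalgebra -/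

namespace SplitAInfAlgebra

variable {Q : Type*} [CommRing Q] {A : Type*} [AddCommGroup A] [Module Q A]
  (𝒜 : SplitAInfAlgebra Q A) {X : Type*} [AddCommGroup X] [Module Q X]

/-- The complement `Ā` of the unit. -/
def bar : Submodule Q A := LinearMap.ker 𝒜.aug

/-- The projection `A → Ā` along the unit. -/
def proj : A →ₗ[Q] 𝒜.bar :=
  LinearMap.codRestrict _ (LinearMap.id - LinearMap.toSpanSingleton Q A 𝒜.one ∘ₗ 𝒜.aug) (by
    intro x
    simp [bar, 𝒜.aug_one])

/-- The grading of `Ā`. -/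
def barDeg (i : ℤ) : Submodule Q 𝒜.bar := (𝒜.deg i).comap 𝒜.bar.subtype

/-- The operations `m̄_n : Ā^{⊗ n} → Ā`. -/
def mBar (n : ℕ) : MultilinearMap Q (fun _ : Fin n => 𝒜.bar) 𝒜.bar :=
  𝒜.proj.compMultilinearMap ((𝒜.m n).compLinearMap fun _ => 𝒜.bar.subtype)

/-- The components `h_n : Ā^{⊗ n} → Q` of the operations along the unit. -/
def hBar (n : ℕ) : MultilinearMap Q (fun _ : Fin n => 𝒜.bar) Q :=
  𝒜.aug.compMultilinearMap ((𝒜.m n).compLinearMap fun _ => 𝒜.bar.subtype)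

/-- The map `a ↦ (-1)^{|a| + 1} a` of `Ā`, that is, the sign involution of `Σ Ā`. -/
def suspSign : 𝒜.bar →ₗ[Q] 𝒜.bar :=
  -(𝒜.proj ∘ₗ gradeSign 𝒜.deg 𝒜.internal ∘ₗ 𝒜.bar.subtype)

/-- For a multilinear map `F` on `Ā^{⊗ n}`, the map `F ∘ (s⁻¹)^{⊗ n}` on `(Σ Ā)^{⊗ n}`. The elements
of `Σ Ā` are written as elements of `Ā`, so that only the Koszul sign of
`(s⁻¹)^{⊗ n} (s a_0 ⊗ ⋯ ⊗ s a_{n-1}) = (-1)^{∑_j (n-1-j)(|a_j|+1)} a_0 ⊗ ⋯ ⊗ a_{n-1}` remains. -/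
def desusp {n : ℕ} (F : MultilinearMap Q (fun _ : Fin n => 𝒜.bar) X) :
    MultilinearMap Q (fun _ : Fin n => 𝒜.bar) X :=
  F.compLinearMap fun j => 𝒜.suspSign ^ (n - 1 - (j : ℕ))

/-- The tensor coalgebra of `Σ Ā`; its coproduct is `deconc`, its counit
`TensorAlgebra.algebraMapInv` and its homological grading `tensorDeg 𝒜.barDeg 1`. -/
abbrev BarC : Type _ := TensorAlgebra Q 𝒜.bar

/-- The map with components `(-1)^{k(k+1)/2} s m̄_k (s⁻¹)^{⊗ k} : (Σ Ā)^{⊗ k} → Σ Ā`. -/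
def barOp : 𝒜.BarC →ₗ[Q] 𝒜.bar :=
  evalFamily fun k => sgn ((k * (k + 1) / 2 : ℕ) : ℤ) • 𝒜.desusp (𝒜.mBar k)

/-- The coderivation `∑ (id^{⊗ i} ⊗ (-1)^{k(k+1)/2} s m̄_k (s⁻¹)^{⊗ k} ⊗ id^{⊗ j})` of the bar
construction. -/
def barD : 𝒜.BarC →ₗ[Q] 𝒜.BarC :=
  LinearMap.mul' Q _ ∘ₗ
    TensorProduct.map
      (LinearMap.mul' Q _ ∘ₗ
        TensorProduct.map (tensorMap 𝒜.suspSign).toLinearMap (TensorAlgebra.ι Q ∘ₗ 𝒜.barOp) ∘ₗ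
          deconc)
      LinearMap.id ∘ₗ deconc

/-- The curvature term of the bar construction, with components `h_1 s⁻¹` and `h_2 (s⁻¹)^{⊗ 2}`. -/
def barCurv : 𝒜.BarC →ₗ[Q] Q :=
  evalFamily fun k => if k = 1 ∨ k = 2 then 𝒜.desusp (𝒜.hBar k) else 0

end SplitAInfAlgebra

/-- A connected curved dg coalgebra, with coproduct, counit, coderivation `d` of degree `-1` and
curvature `h` of degree `-2` such that `d² = (h ⊗ id - id ⊗ h) Δ` and `h d = 0`. -/
structure CurvedDGCoalgebra (Q : Type*) [CommRing Q] (C : Type*) [AddCommGroup C] [Module Q C]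
    extends Coalgebra Q C where
  deg : ℤ → Submodule Q C
  internal : DirectSum.IsInternal deg
  comul_mem : ∀ (i : ℤ) (x : C), x ∈ deg i → comul x ∈ tensDeg deg deg i
  counit_deg : ∀ i ≠ 0, ∀ x ∈ deg i, counit x = 0
  nonneg : ∀ i < 0, deg i = ⊥
  connected : Function.Bijective (fun x : deg 0 => counit (x : C))
  d : C →ₗ[Q] C
  d_mem : ∀ (i : ℤ) (x : C), x ∈ deg i → d x ∈ deg (i - 1)
  coderivation : comul ∘ₗ d =
    (TensorProduct.map d LinearMap.id + TensorProduct.map (gradeSign deg internal) d) ∘ₗ comul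
  h : C →ₗ[Q] Q
  h_deg : ∀ i ≠ 2, ∀ x ∈ deg i, h x = 0
  d_d : d ∘ₗ d = ((TensorProduct.lid Q C).toLinearMap ∘ₗ TensorProduct.map h LinearMap.id
    - (TensorProduct.rid Q C).toLinearMap ∘ₗ TensorProduct.map LinearMap.id h) ∘ₗ comul
  h_d : h ∘ₗ d = 0

section Presentation

variable {Q : Type u} [CommRing Q] {A : Type*} [AddCommGroup A] [Module Q A]
  {V : Type u} [AddCommGroup V] [Module Q V]

/-- The map `V → Ā` induced by an identification of `A` with `T(V)/(W)`. -/
def genMap (𝒜 : SplitAInfAlgebra Q A) {W : Submodule Q (V ⊗[Q] V)} (e : QuadAlg W ≃ₗ[Q] A) :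
    V →ₗ[Q] 𝒜.bar :=
  𝒜.proj ∘ₗ e.toLinearMap ∘ₗ (quadMk W).toLinearMap ∘ₗ TensorAlgebra.ι Q

/-- `(A, V, W)` is a strictly Koszul presentation for `Q → R`, where the graded module `A`
is identified with `T(V)/(W)` through `e`, and `ε : A → R` is the resolution. -/
structure IsStrictlyKoszulPresentation [IsLocalRing Q] {R : Type*} [CommRing R] [Algebra Q R]
    (𝒜 : SplitAInfAlgebra Q A) (degV : ℤ → Submodule Q V) (W : Submodule Q (V ⊗[Q] V))
    (e : QuadAlg W ≃ₗ[Q] A) (ε : A →ₗ[Q] R) : Prop where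
  /-- `V` is a non-negatively graded, degreewise finite rank free module. -/
  V_internal : DirectSum.IsInternal degV
  V_nonneg : ∀ i < 0, degV i = ⊥
  V_free : ∀ i, Module.Free Q (degV i)
  V_finite : ∀ i, Module.Finite Q (degV i)
  /-- `W` is a graded direct summand of `V ⊗ V`. -/
  W_summand : ∃ W', IsCompl W W'
  W_graded : W = ⨆ i : ℤ, W ⊓ tensDeg degV degV i
  /-- `A ≅ T(V)/(W)` as graded modules with split unit. -/
  e_deg : ∀ i, (quadDeg degV W i).map e.toLinearMap = 𝒜.deg i
  e_one : e 1 = 𝒜.one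
  e_aug : ∀ n : ℕ, 0 < n → ∀ x ∈ quadWt W n, 𝒜.aug (e x) = 0
  /-- The algebra `T(V ⊗ k)/(W ⊗ k)` is Koszul with respect to the tensor weight grading. -/
  koszul : IsKoszulGrading (k := IsLocalRing.ResidueField Q)
    (quadWt (quadBaseChange (IsLocalRing.ResidueField Q) W))
  /-- Modulo the maximal ideal, the operations agree with the algebra structure of `T(V)/(W)`. -/
  mod_two : ∀ x y : QuadAlg W, 𝒜.m 2 ![e x, e y] - e (x * y) ∈
    IsLocalRing.maximalIdeal Q • (⊤ : Submodule Q A)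
  mod_ne : ∀ n : ℕ, n ≠ 2 → ∀ a : Fin n → A, 𝒜.m n a ∈
    IsLocalRing.maximalIdeal Q • (⊤ : Submodule Q A)
  /-- `ε` is a strict quasi-isomorphism of (strictly unital) A∞-algebras. -/
  ε_deg : ∀ i ≠ 0, ∀ x ∈ 𝒜.deg i, ε x = 0
  ε_one : ε 𝒜.one = 1
  ε_two : ∀ x y : A, ε (𝒜.m 2 ![x, y]) = ε x * ε y
  ε_ne : ∀ n : ℕ, n ≠ 2 → ∀ a : Fin n → A, ε (𝒜.m n a) = 0
  quasiIso : IsQuasiIso (fun a => 𝒜.m 1 ![a]) (0 : R → R) ε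
  /-- The strictness conditions: `m̄_1 (V) ⊆ V` and
  `m̄_n (⋂_{i+2+j=n} V^{⊗ i} ⊗ W ⊗ V^{⊗ j}) ⊆ V` for `n ≥ 2`. -/
  strict_one : ∀ v : V, 𝒜.mBar 1 ![genMap 𝒜 e v] ∈ LinearMap.range (genMap 𝒜 e)
  strict : ∀ n : ℕ, 2 ≤ n → ∀ x ∈ quadInter W n,
    evalFamily 𝒜.mBar (tensorMap (genMap 𝒜 e) x) ∈ LinearMap.range (genMap 𝒜 e)

/-- The underlying submodule `⨁_n ⋂_{i+2+j=n} (ΣV)^{⊗ i} ⊗ Σ²W ⊗ (ΣV)^{⊗ j}` of `T(ΣV)` of the Priddy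
coalgebra. The elements of `ΣV` are written as elements of `V`, and `Σ²W` is the image of `W` under
`s ⊗ s`, that is, under `a ⊗ b ↦ (-1)^{|a|} a ⊗ b`. -/
def priddy (degV : ℤ → Submodule Q V) (hV : DirectSum.IsInternal degV)
    (W : Submodule Q (V ⊗[Q] V)) : Submodule Q (TensorAlgebra Q V) :=
  ⨆ n : ℕ, quadInter (W.map (TensorProduct.map (gradeSign degV hV) LinearMap.id)) n

/-- The curved dg coalgebra `𝒞` is, through the injection `j`, the subcoalgebra `priddy` of the bar
construction of `A`, with the restricted structure. -/
structure IsPriddyCoalgebra [IsLocalRing Q] {R : Type*} [CommRing R] [Algebra Q R]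
    {𝒜 : SplitAInfAlgebra Q A} {degV : ℤ → Submodule Q V} {W : Submodule Q (V ⊗[Q] V)}
    {e : QuadAlg W ≃ₗ[Q] A} {ε : A →ₗ[Q] R} (P : IsStrictlyKoszulPresentation 𝒜 degV W e ε)
    {C : Type*} [AddCommGroup C] [Module Q C] (𝒞 : CurvedDGCoalgebra Q C)
    (j : C →ₗ[Q] 𝒜.BarC) : Prop where
  injective : Function.Injective j
  range_eq : LinearMap.range j =
    (priddy degV P.V_internal W).map (tensorMap (genMap 𝒜 e)).toLinearMap
  deg_eq : ∀ i, 𝒞.deg i = (tensorDeg 𝒜.barDeg 1 i).comap j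
  comul : TensorProduct.map j j ∘ₗ 𝒞.comul = deconc ∘ₗ j
  counit : 𝒞.counit = TensorAlgebra.algebraMapInv.toLinearMap ∘ₗ j
  d : j ∘ₗ 𝒞.d = 𝒜.barD ∘ₗ j
  h : 𝒞.h = 𝒜.barCurv ∘ₗ j

end Presentation

/-- `Q → R` is strictly Koszul: it is Koszul and admits a strictly Koszul presentation. -/
def IsStrictlyKoszul (Q : Type u) (R : Type v) [CommRing Q] [IsLocalRing Q] [CommRing R]
    [IsLocalRing R] [Algebra Q R] : Prop :=
  IsKoszulHom Q R ∧
    ∃ (A : Type u) (_ : AddCommGroup A) (_ : Module Q A) (𝒜 : SplitAInfAlgebra Q A)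
      (V : Type u) (_ : AddCommGroup V) (_ : Module Q V) (degV : ℤ → Submodule Q V)
      (W : Submodule Q (V ⊗[Q] V)) (e : QuadAlg W ≃ₗ[Q] A) (ε : A →ₗ[Q] R),
      IsStrictlyKoszulPresentation 𝒜 degV W e ε

/-! ### Twisted tensor products -/

section Twisted

variable {Q : Type*} [CommRing Q] {A : Type*} [AddCommGroup A] [Module Q A]
  {𝒜 : SplitAInfAlgebra Q A} {G : Type*} [AddCommGroup G] [Module Q G]

/-- The operation `m^G_{n+1}` restricted to `Ā`. -/
def AInfModule.actBar (𝒢 : AInfModule 𝒜 G) (n : ℕ) :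
    MultilinearMap Q (fun _ : Fin n => 𝒜.bar) (G →ₗ[Q] G) :=
  (𝒢.act n).compLinearMap fun _ => 𝒜.bar.subtype

/-- The map `x ↦ m^G_{n+1} ((s⁻¹)^{⊗ n} x ⊗ id)` for `x ∈ (Σ Ā)^{⊗ n}`. -/
def AInfModule.desuspAct (𝒢 : AInfModule 𝒜 G) : 𝒜.BarC →ₗ[Q] (G →ₗ[Q] G) :=
  evalFamily fun n => 𝒜.desusp (𝒢.actBar n)

/-- The map `x ↦ (-1)^{n(n-1)/2} m^G_{n+1} ((s⁻¹)^{⊗ n} x ⊗ id)` for `x ∈ (Σ Ā)^{⊗ n}`. -/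
def AInfModule.twist (𝒢 : AInfModule 𝒜 G) : 𝒜.BarC →ₗ[Q] (G →ₗ[Q] G) :=
  evalFamily fun n => sgn ((n * (n - 1) / 2 : ℕ) : ℤ) • 𝒜.desusp (𝒢.actBar n)

variable {C : Type*} [AddCommGroup C] [Module Q C] (R : Type*) [CommRing R] [Algebra Q R]

/-- The differential of the Priddy resolution `R ⊗ C ⊗ G`, for `j : C → B(A)`: the sum of
`id_R ⊗ ∂_C ⊗ id_G` and of the maps
`(-1)^{n(n-1)/2} id_R ⊗ id^{⊗ i} ⊗ m^G_{n+1} ((s⁻¹)^{⊗ n} ⊗ id_G)`. -/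
def priddyDiff (𝒢 : AInfModule 𝒜 G) (𝒞 : CurvedDGCoalgebra Q C) (j : C →ₗ[Q] 𝒜.BarC) :
    R ⊗[Q] (C ⊗[Q] G) →ₗ[R] R ⊗[Q] (C ⊗[Q] G) :=
  (TensorProduct.map 𝒞.d LinearMap.id +
    TensorProduct.map (gradeSign 𝒞.deg 𝒞.internal) (TensorProduct.lift (𝒢.twist ∘ₗ j)) ∘ₗ
      (TensorProduct.assoc Q C C G).toLinearMap ∘ₗ
        TensorProduct.map 𝒞.comul LinearMap.id).baseChange R

/-- The grading of `R ⊗ C ⊗ G` for graded `Q`-modules `C` and `G`. -/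
def resDeg (degC : ℤ → Submodule Q C) (degG : ℤ → Submodule Q G) (i : ℤ) :
    Submodule R (R ⊗[Q] (C ⊗[Q] G)) :=
  (tensDeg degC degG i).baseChange R

/-- The map `R ⊗ C ⊗ G → M`, `r ⊗ x ⊗ g ↦ r η(x) γ(g)`. -/
def resAug {M : Type*} [AddCommGroup M] [Module Q M] [Module R M] [IsScalarTower Q R M]
    (η : C →ₗ[Q] Q) (γ : G →ₗ[Q] M) : R ⊗[Q] (C ⊗[Q] G) →ₗ[R] M :=
  LinearMap.liftBaseChange R (TensorProduct.lift (LinearMap.toSpanSingleton Q (G →ₗ[Q] M) γ ∘ₗ η))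

end Twisted

/-! ### dg algebras and dg modules as A∞-algebras and A∞-modules -/

section OfDG

variable {Q : Type*} [CommRing Q] {A : Type*} [Ring A] [Algebra Q A]

/-- The operations of a dg algebra: `m_1 = d`, `m_2` is the product, `m_n = 0` for `n ≥ 3`. -/
def dgOps (d : A →ₗ[Q] A) : ∀ n : ℕ, MultilinearMap Q (fun _ : Fin n => A) A
  | 0 => 0
  | 1 => LinearMap.compMultilinearMap d (MultilinearMap.ofSubsingleton Q A A 0 LinearMap.id)
  | 2 => MultilinearMap.mkPiAlgebraFin Q 2 A
  | _ + 3 => 0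

theorem dgOps_one (d : A →ₗ[Q] A) (a : Fin 1 → A) : dgOps d 1 a = d (a 0) := rfl

theorem dgOps_two (d : A →ₗ[Q] A) (a : Fin 2 → A) : dgOps d 2 a = a 0 * a 1 := by
  simp [dgOps, MultilinearMap.mkPiAlgebraFin_apply]

theorem dgOps_ge (d : A →ₗ[Q] A) (n : ℕ) (hn : 3 ≤ n) : dgOps d n = 0 := by
  obtain ⟨m, rfl⟩ := Nat.exists_eq_add_of_le' hn
  rfl

theorem sgn_two_mul (i : ℤ) : sgn (2 * i) = 1 := by simp [sgn]

theorem sgn_add (i j : ℤ) : sgn (i + j) = sgn i * sgn j := by simp [sgn, Int.negOnePow_add]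

theorem sgn_zero : sgn 0 = 1 := by simp [sgn]

theorem sgn_one : sgn 1 = -1 := by simp [sgn]

theorem sgn_two : sgn 2 = 1 := rfl

theorem dgOps_stasheff (𝒜 : DGStructure Q A) (n : ℕ) (a : ℕ → A) (δ : ℕ → ℤ)
    (ha : ∀ i, a i ∈ 𝒜.deg (δ i)) :
    ∑ r ∈ Finset.range n, ∑ s ∈ Finset.Icc 1 (n - r),
      sgn (r + s * (n - r - s) + s * ∑ i ∈ Finset.range r, δ i) •
        dgOps 𝒜.d (n - s + 1)
          (fun i => insertOp a r s (dgOps 𝒜.d s fun j => a (r + j)) i) = 0 := by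
  match n with
  | 0 => simp
  | 1 => simp [dgOps_one, insertOp, 𝒜.d_d]
  | 2 =>
    have e1 : Finset.Icc 1 2 = {1, 2} := rfl
    have h := 𝒜.leibniz (ha 0) (a 1)
    simp [Finset.sum_range_succ, dgOps_one, dgOps_two, insertOp, e1, h, sgn_add, sgn_zero,
      sgn_one]
  | 3 =>
    have e1 : Finset.Icc 1 2 = {1, 2} := rfl
    have e2 : Finset.Icc 1 3 = {1, 2, 3} := rfl
    simp [Finset.sum_range_succ, dgOps_one, dgOps_two, dgOps_ge, insertOp, e1, e2,
      sgn_add, sgn_zero, sgn_one, sgn_two, sgn_two_mul, mul_assoc]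
  | n + 4 =>
    refine Finset.sum_eq_zero fun r hr => Finset.sum_eq_zero fun s hs => ?_
    rw [Finset.mem_Icc] at hs
    rw [Finset.mem_range] at hr
    by_cases h3 : 3 ≤ s
    · rw [(dgOps 𝒜.d (n + 4 - s + 1)).map_coord_zero ⟨r, by omega⟩, smul_zero]
      simp [insertOp, dgOps_ge _ s h3]
    · rw [dgOps_ge _ _ (by omega)]
      simp

/-- A connective dg algebra with a split unit, as an A∞-algebra. -/
def SplitAInfAlgebra.ofDG (𝒜 : DGStructure Q A) (hc : ∀ i < 0, 𝒜.deg i = ⊥) (aug : A →ₗ[Q] Q)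
    (aug_one : aug 1 = 1) (aug_deg : ∀ i ≠ 0, ∀ x ∈ 𝒜.deg i, aug x = 0) :
    SplitAInfAlgebra Q A where
  deg := 𝒜.deg
  internal := 𝒜.internal
  connective := hc
  m := dgOps 𝒜.d
  m_zero := rfl
  m_mem n a δ ha := by
    match n with
    | 0 => simp [dgOps]
    | 1 =>
      rw [dgOps_one]
      convert 𝒜.d_mem (ha 0) using 2
      simp
      ring
    | 2 =>
      rw [dgOps_two]
      convert 𝒜.mul_mem (ha 0) (ha 1) using 2
      simp [Fin.sum_univ_two]
    | n + 3 => simp [dgOps]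
  stasheff := dgOps_stasheff 𝒜
  one := 1
  one_mem := 𝒜.one_mem
  one_m a := by simp [dgOps_two]
  m_one a := by simp [dgOps_two]
  m_unit n hn a _ := by rw [dgOps_ge _ _ hn]; rfl
  aug := aug
  aug_one := aug_one
  aug_deg := aug_deg

variable {R : Type*} [CommRing R] [Algebra Q R] {M : Type*} [AddCommGroup M] [Module Q M]
  [Module R M] [IsScalarTower Q R M]

/-- The operations of a dg module structure on `M` restricted along `ε : A → R`: `m_1 = d`, `m_2` is
the action, `m_n = 0` for `n ≥ 3`. -/
def dgActs (ε : A →ₐ[Q] R) (d : M →ₗ[Q] M) :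
    ∀ n : ℕ, MultilinearMap Q (fun _ : Fin n => A) (M →ₗ[Q] M)
  | 0 => MultilinearMap.constOfIsEmpty Q _ d
  | 1 => LinearMap.compMultilinearMap
      ((Algebra.lsmul Q Q M : R →ₐ[Q] Module.End Q M).toLinearMap ∘ₗ ε.toLinearMap)
      (MultilinearMap.ofSubsingleton Q A A 0 LinearMap.id)
  | _ + 2 => 0

theorem dgActs_zero (ε : A →ₐ[Q] R) (d : M →ₗ[Q] M) (a : Fin 0 → A) (x : M) :
    dgActs ε d 0 a x = d x := rfl

theorem dgActs_one (ε : A →ₐ[Q] R) (d : M →ₗ[Q] M) (a : Fin 1 → A) (x : M) :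
    dgActs ε d 1 a x = ε (a 0) • x := rfl

theorem dgActs_ge (ε : A →ₐ[Q] R) (d : M →ₗ[Q] M) (n : ℕ) (hn : 2 ≤ n) : dgActs ε d n = 0 := by
  obtain ⟨m, rfl⟩ := Nat.exists_eq_add_of_le' hn
  rfl

theorem dgActs_stasheff (𝒜 : DGStructure Q A) (ε : A →ₐ[Q] R)
    (hε : ∀ x, ε (𝒜.d x) = 0) (hε' : ∀ i ≠ 0, ∀ x ∈ 𝒜.deg i, ε x = 0)
    (d : M →ₗ[R] M) (hd : ∀ x, d (d x) = 0) (n : ℕ) (a : ℕ → A) (δ : ℕ → ℤ)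
    (ha : ∀ i, a i ∈ 𝒜.deg (δ i)) (g : M) :
    ∑ r ∈ Finset.range n, ∑ s ∈ Finset.Icc 1 (n - r),
      sgn (r + s * (n + 1 - r - s) + s * ∑ i ∈ Finset.range r, δ i) •
        dgActs ε (d.restrictScalars Q) (n - s + 1)
          (fun i => insertOp a r s (dgOps 𝒜.d s fun j => a (r + j)) i) g
    + ∑ r ∈ Finset.range (n + 1),
        sgn (r + (n - r + 1) * ∑ i ∈ Finset.range r, δ i) •
          dgActs ε (d.restrictScalars Q) r (fun i => a i)
            (dgActs ε (d.restrictScalars Q) (n - r) (fun j => a (r + j)) g) = 0 := by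
  match n with
  | 0 => simp [dgActs_zero, hd, sgn]
  | 1 =>
    by_cases h0 : δ 0 = 0
    · simp [Finset.sum_range_succ, dgActs_zero, dgActs_one, dgOps_one, insertOp, hε, h0, sgn]
    · simp [Finset.sum_range_succ, dgActs_zero, dgActs_one, dgOps_one, insertOp, hε, sgn,
        hε' _ h0 _ (ha 0)]
  | 2 =>
    have e1 : Finset.Icc 1 2 = {1, 2} := rfl
    simp [Finset.sum_range_succ, dgActs_zero, dgActs_one, dgActs_ge, dgOps_one, dgOps_two,
      insertOp, e1, sgn_add, sgn_zero, sgn_one, sgn_two, sgn_two_mul, mul_smul]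
  | n + 3 =>
    have h1 : ∀ r ∈ Finset.range (n + 3), ∀ s ∈ Finset.Icc 1 (n + 3 - r),
        dgActs ε (d.restrictScalars Q) (n + 3 - s + 1)
          (fun i => insertOp a r s (dgOps 𝒜.d s fun j => a (r + j)) i) = 0 := by
      intro r hr s hs
      rw [Finset.mem_Icc] at hs
      rw [Finset.mem_range] at hr
      by_cases h3 : 3 ≤ s
      · refine MultilinearMap.map_coord_zero _ ⟨r, by omega⟩ ?_
        simp [insertOp, dgOps_ge _ s h3]
      · rw [dgActs_ge _ _ _ (by omega)]
        rfl
    have h2 : ∀ r ∈ Finset.range (n + 3 + 1),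
        dgActs ε (d.restrictScalars Q) r (fun i => a i)
            (dgActs ε (d.restrictScalars Q) (n + 3 - r) (fun j => a (r + j)) g) = 0 := by
      intro r hr
      rw [Finset.mem_range] at hr
      by_cases h3 : 2 ≤ r
      · rw [dgActs_ge _ _ r h3]; rfl
      · rw [dgActs_ge _ _ (n + 3 - r) (by omega)]; simp
    rw [Finset.sum_eq_zero fun r hr => Finset.sum_eq_zero fun s hs => ?_, zero_add,
      Finset.sum_eq_zero fun r hr => ?_]
    · rw [h2 r hr, smul_zero]
    · rw [h1 r hr s hs]; simp

/-- A complex of `R`-modules, as an A∞-module over `A` by restriction along a morphism of dg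
algebras `ε : A → R`. -/
def AInfModule.ofComplex (𝒜 : DGStructure Q A) (hc : ∀ i < 0, 𝒜.deg i = ⊥) (aug : A →ₗ[Q] Q)
    (aug_one : aug 1 = 1) (aug_deg : ∀ i ≠ 0, ∀ x ∈ 𝒜.deg i, aug x = 0) (ε : A →ₐ[Q] R)
    (hε : ∀ x, ε (𝒜.d x) = 0) (hε' : ∀ i ≠ 0, ∀ x ∈ 𝒜.deg i, ε x = 0)
    (degM : ℤ → Submodule R M) (d : M →ₗ[R] M) (hM : IsComplex degM d) :
    AInfModule (SplitAInfAlgebra.ofDG 𝒜 hc aug aug_one aug_deg) M where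
  deg i := (degM i).restrictScalars Q
  internal := hM.internal
  act := dgActs ε (d.restrictScalars Q)
  act_mem n a δ ha p g hg := by
    match n with
    | 0 =>
      rw [dgActs_zero]
      convert hM.d_mem hg using 2
      simp
    | 1 =>
      rw [dgActs_one]
      by_cases h0 : δ 0 = 0
      · have : ∑ i, δ i + p + (1 : ℕ) - 1 = p := by simp [h0]
        rw [this]
        exact (degM p).smul_mem _ hg
      · rw [hε' _ h0 _ (ha 0), zero_smul]
        exact zero_mem _
    | n + 2 => simp [dgActs]
  stasheff := dgActs_stasheff 𝒜 ε hε hε' d hM.d_d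
  one_act g := by
    rw [dgActs_one]
    exact (congrArg (· • g) (map_one ε)).trans (one_smul R g)
  act_unit n hn a _ := by rw [dgActs_ge _ _ _ hn]; rfl

end OfDG

/-! ### The Koszul complex -/

section Koszul

variable {Q : Type u} [CommRing Q] {c : ℕ}

/-- The homological grading of the exterior algebra on `Σ Q^c`. -/
def extDeg (Q : Type u) [CommRing Q] (c : ℕ) (i : ℤ) :
    Submodule Q (ExteriorAlgebra Q (Fin c → Q)) :=
  if 0 ≤ i then ⋀[Q]^(i.toNat) (Fin c → Q) else ⊥

theorem extDeg_nat (n : ℕ) : extDeg Q c (n : ℤ) = ⋀[Q]^n (Fin c → Q) := by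
  simp [extDeg]

theorem extDeg_neg (i : ℤ) (hi : i < 0) : extDeg Q c i = ⊥ := by
  simp [extDeg, hi]

theorem extDeg_internal : DirectSum.IsInternal (extDeg Q c) := by
  have h := DirectSum.Decomposition.isInternal (fun n : ℕ => ⋀[Q]^n (Fin c → Q))
  rw [DirectSum.isInternal_submodule_iff_iSupIndep_and_iSup_eq_top] at h ⊢
  refine ⟨?_, ?_⟩
  · rw [← iSupIndep_ne_bot]
    have hpos : ∀ i : {i : ℤ // extDeg Q c i ≠ ⊥}, 0 ≤ i.1 := fun i => by
      by_contra hi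
      exact i.2 (extDeg_neg _ (by omega))
    have hinj : Function.Injective (fun i : {i : ℤ // extDeg Q c i ≠ ⊥} => i.1.toNat) := by
      intro i j hij
      have h1 := hpos i
      have h2 := hpos j
      simp only at hij
      exact Subtype.ext (by omega)
    convert h.1.comp hinj with i
    simp only [extDeg, hpos i, if_true]
    rfl
  · rw [eq_top_iff, ← h.2]
    exact iSup_le fun n => (extDeg_nat (Q := Q) (c := c) n).symm.le.trans (le_iSup _ _)

/-- The linear form `e_i ↦ f_i` on `Q^c`. -/
def seqForm (f : Fin c → Q) : (Fin c → Q) →ₗ[Q] Q := ∑ i, f i • LinearMap.proj i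

theorem seqForm_single (f : Fin c → Q) (i : Fin c) : seqForm f (Pi.single i 1) = f i := by
  simp [seqForm, Pi.single_apply]

/-- The Koszul differential: the antiderivation of the exterior algebra with `e_i ↦ f_i`. -/
def koszulD (f : Fin c → Q) :
    ExteriorAlgebra Q (Fin c → Q) →ₗ[Q] ExteriorAlgebra Q (Fin c → Q) :=
  CliffordAlgebra.contractLeft (Q := (0 : QuadraticForm Q (Fin c → Q))) (seqForm f)

theorem koszulD_ι_mul (f : Fin c → Q) (a : Fin c → Q) (x : ExteriorAlgebra Q (Fin c → Q)) :
    koszulD f (ExteriorAlgebra.ι Q a * x)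
      = seqForm f a • x - ExteriorAlgebra.ι Q a * koszulD f x :=
  CliffordAlgebra.contractLeft_ι_mul _ _ _

theorem koszulD_algebraMap (f : Fin c → Q) (r : Q) :
    koszulD f (algebraMap Q (ExteriorAlgebra Q (Fin c → Q)) r) = 0 :=
  CliffordAlgebra.contractLeft_algebraMap _ (seqForm f) r

theorem koszulD_one (f : Fin c → Q) :
    koszulD f (1 : ExteriorAlgebra Q (Fin c → Q)) = 0 :=
  CliffordAlgebra.contractLeft_one _ (seqForm f)

theorem koszulD_koszulD (f : Fin c → Q) (x : ExteriorAlgebra Q (Fin c → Q)) :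
    koszulD f (koszulD f x) = 0 :=
  CliffordAlgebra.contractLeft_contractLeft _ _

theorem koszulD_mem (f : Fin c → Q) (n : ℕ) (x : ExteriorAlgebra Q (Fin c → Q))
    (hx : x ∈ ⋀[Q]^(n + 1) (Fin c → Q)) : koszulD f x ∈ ⋀[Q]^n (Fin c → Q) := by
  induction n generalizing x with
  | zero =>
    rw [zero_add, ExteriorAlgebra.exteriorPower, pow_one] at hx
    obtain ⟨a, rfl⟩ := hx
    have := koszulD_ι_mul f a 1
    rw [mul_one, koszulD_one, mul_zero, sub_zero] at this
    rw [this]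
    exact Submodule.smul_mem _ _ (SetLike.GradedOne.one_mem (A := fun i : ℕ => ⋀[Q]^i (Fin c → Q)))
  | succ n ih =>
    rw [ExteriorAlgebra.exteriorPower, pow_succ'] at hx
    induction hx using Submodule.mul_induction_on' with
    | mem_mul_mem m hm y hy =>
      obtain ⟨a, rfl⟩ := hm
      rw [koszulD_ι_mul]
      refine sub_mem (Submodule.smul_mem _ _ hy) ?_
      rw [ExteriorAlgebra.exteriorPower, pow_succ']
      exact Submodule.mul_mem_mul ⟨a, rfl⟩ (ih y hy)
    | add x _ y _ hx hy => rw [map_add]; exact add_mem hx hy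

theorem koszulD_leibniz (f : Fin c → Q) (n : ℕ) (x : ExteriorAlgebra Q (Fin c → Q))
    (hx : x ∈ ⋀[Q]^n (Fin c → Q)) (y : ExteriorAlgebra Q (Fin c → Q)) :
    koszulD f (x * y) = koszulD f x * y + sgn n • (x * koszulD f y) := by
  induction n generalizing x with
  | zero =>
    rw [ExteriorAlgebra.exteriorPower, pow_zero, Submodule.mem_one] at hx
    obtain ⟨r, rfl⟩ := hx
    rw [koszulD_algebraMap, ← Algebra.smul_def, map_smul, ← Algebra.smul_def]
    simp [sgn_zero]
  | succ n ih =>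
    rw [ExteriorAlgebra.exteriorPower, pow_succ'] at hx
    induction hx using Submodule.mul_induction_on' with
    | mem_mul_mem m hm z hz =>
      obtain ⟨a, rfl⟩ := hm
      have e := ih z hz
      have l1 : LinearMap.range (ExteriorAlgebra.ι Q (M := Fin c → Q)) = _ := rfl
      have e2 : sgn ((n + 1 : ℕ) : ℤ) = - sgn n := by
        push_cast
        rw [sgn_add, sgn_one, mul_neg_one]
      rw [mul_assoc, koszulD_ι_mul, koszulD_ι_mul, e, e2]
      simp only [sub_mul, smul_mul_assoc, mul_add, mul_assoc, neg_smul, mul_smul_comm]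
      abel
    | add x _ z _ hx hz => simp only [add_mul, map_add, hx, hz, smul_add]; abel

/-- The Koszul complex `Kos^Q(f)` as a dg algebra. -/
def koszulDG (f : Fin c → Q) : DGStructure Q (ExteriorAlgebra Q (Fin c → Q)) where
  deg := extDeg Q c
  internal := extDeg_internal
  one_mem := by
    have := extDeg_nat (Q := Q) (c := c) 0
    rw [Nat.cast_zero] at this
    rw [this]
    exact SetLike.GradedOne.one_mem (A := fun i : ℕ => ⋀[Q]^i (Fin c → Q))
  mul_mem := by
    intro i j x y hx hy
    rcases lt_or_ge i 0 with hi | hi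
    · rw [extDeg_neg i hi, Submodule.mem_bot] at hx
      simp [hx]
    rcases lt_or_ge j 0 with hj | hj
    · rw [extDeg_neg j hj, Submodule.mem_bot] at hy
      simp [hy]
    lift i to ℕ using hi
    lift j to ℕ using hj
    rw [extDeg_nat] at hx hy
    rw [← Nat.cast_add, extDeg_nat]
    exact SetLike.GradedMul.mul_mem (A := fun i : ℕ => ⋀[Q]^i (Fin c → Q)) hx hy
  d := koszulD f
  d_mem := by
    intro i x hx
    rcases lt_or_ge i 0 with hi | hi
    · rw [extDeg_neg i hi, Submodule.mem_bot] at hx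
      simp [hx]
    lift i to ℕ using hi
    rw [extDeg_nat] at hx
    cases i with
    | zero =>
      rw [ExteriorAlgebra.exteriorPower, pow_zero, Submodule.mem_one] at hx
      obtain ⟨r, rfl⟩ := hx
      rw [koszulD_algebraMap]
      exact zero_mem _
    | succ n =>
      have : ((n + 1 : ℕ) : ℤ) - 1 = n := by simp
      rw [this, extDeg_nat]
      exact koszulD_mem f n x hx
  d_d := koszulD_koszulD f
  leibniz := by
    intro i x hx y
    rcases lt_or_ge i 0 with hi | hi
    · rw [extDeg_neg i hi, Submodule.mem_bot] at hx
      simp [hx]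
    lift i to ℕ using hi
    rw [extDeg_nat] at hx
    exact koszulD_leibniz f i x hx y

theorem ext_aug_pos (n : ℕ) (x : ExteriorAlgebra Q (Fin c → Q))
    (hx : x ∈ ⋀[Q]^(n + 1) (Fin c → Q)) : ExteriorAlgebra.algebraMapInv x = 0 := by
  rw [ExteriorAlgebra.exteriorPower, pow_succ'] at hx
  induction hx using Submodule.mul_induction_on' with
  | mem_mul_mem m hm z hz =>
    obtain ⟨a, rfl⟩ := hm
    simp [ExteriorAlgebra.algebraMapInv]
  | add x _ z _ hx hz => simp [hx, hz]

theorem ext_aug_deg : ∀ i ≠ 0, ∀ x ∈ extDeg Q c i,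
    (ExteriorAlgebra.algebraMapInv (R := Q) (M := Fin c → Q)).toLinearMap x = 0 := by
  intro i hi x hx
  rcases lt_or_ge i 0 with h0 | h0
  · rw [extDeg_neg i h0, Submodule.mem_bot] at hx
    simp [hx]
  lift i to ℕ using h0
  rw [extDeg_nat] at hx
  obtain ⟨n, rfl⟩ : ∃ n, i = n + 1 := Nat.exists_eq_succ_of_ne_zero (by exact_mod_cast hi)
  exact ext_aug_pos n x hx

/-- The Koszul complex as an A∞-algebra with split unit. -/
def koszulAInf (f : Fin c → Q) : SplitAInfAlgebra Q (ExteriorAlgebra Q (Fin c → Q)) :=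
  SplitAInfAlgebra.ofDG (koszulDG f) extDeg_neg
    (ExteriorAlgebra.algebraMapInv (R := Q) (M := Fin c → Q)).toLinearMap
    (map_one ExteriorAlgebra.algebraMapInv) ext_aug_deg

/-- The submodule `W ⊆ V ⊗ V` generated by all `a ⊗ a` and `a ⊗ b + b ⊗ a`. -/
def extRel (Q : Type u) [CommRing Q] (V : Type u) [AddCommGroup V] [Module Q V] :
    Submodule Q (V ⊗[Q] V) :=
  Submodule.span Q ({x | ∃ a : V, x = a ⊗ₜ a} ∪ {x | ∃ a b : V, x = a ⊗ₜ b + b ⊗ₜ a})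

theorem quadMk_eq_zero {V : Type u} [AddCommGroup V] [Module Q V] {W : Submodule Q (V ⊗[Q] V)}
    {x : V ⊗[Q] V} (hx : x ∈ W) : quadMk W (quadIncl Q V x) = 0 := by
  have := RingQuot.mkAlgHom_rel Q
    (s := fun a b : TensorAlgebra Q V => ∃ x ∈ W, a = quadIncl Q V x ∧ b = 0) ⟨x, hx, rfl, rfl⟩
  rw [map_zero] at this
  exact this

theorem ext_lift_rel {V : Type u} [AddCommGroup V] [Module Q V] {x : V ⊗[Q] V}
    (hx : x ∈ extRel Q V) :
    TensorAlgebra.lift Q (ExteriorAlgebra.ι Q (M := V)) (quadIncl Q V x) = 0 := by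
  induction hx using Submodule.span_induction with
  | mem x hx =>
    rcases hx with ⟨a, rfl⟩ | ⟨a, b, rfl⟩
    · simp [quadIncl_tmul]
    · simp [quadIncl_tmul, ExteriorAlgebra.ι_add_mul_swap]
  | zero => simp
  | add x y _ _ hx hy => simp [hx, hy]
  | smul r x _ hx => simp [hx]

/-- The canonical isomorphism `T(V)/(W) ≅ Λ(V)` that is the identity on `V`. -/
def extEquiv (Q : Type u) [CommRing Q] (V : Type u) [AddCommGroup V] [Module Q V] :
    QuadAlg (extRel Q V) ≃ₐ[Q] ExteriorAlgebra Q V :=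
  AlgEquiv.ofAlgHom
    (RingQuot.liftAlgHom Q ⟨TensorAlgebra.lift Q (ExteriorAlgebra.ι Q), by
      rintro _ _ ⟨x, hx, rfl, rfl⟩
      rw [ext_lift_rel hx, map_zero]⟩)
    (ExteriorAlgebra.lift Q ⟨(quadMk (extRel Q V)).toLinearMap ∘ₗ TensorAlgebra.ι Q, by
      intro a
      have h : a ⊗ₜ[Q] a ∈ extRel Q V := Submodule.subset_span (Or.inl ⟨a, rfl⟩)
      have := quadMk_eq_zero h
      rw [quadIncl_tmul, map_mul] at this
      exact this⟩)
    (by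
      ext a
      simp [quadMk])
    (by
      ext a
      simp [quadMk])

theorem extEquiv_ι (V : Type u) [AddCommGroup V] [Module Q V] (a : V) :
    extEquiv Q V (quadMk _ (TensorAlgebra.ι Q a)) = ExteriorAlgebra.ι Q a := by
  simp [extEquiv, quadMk]

variable {R : Type v} [CommRing R] [Algebra Q R]

/-- The augmentation `Kos^Q(f) → R`, a morphism of algebras. -/
def koszulAug (Q : Type u) [CommRing Q] (c : ℕ) (R : Type v) [CommRing R] [Algebra Q R] :
    ExteriorAlgebra Q (Fin c → Q) →ₐ[Q] R :=
  (Algebra.ofId Q R).comp ExteriorAlgebra.algebraMapInv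

theorem koszulAug_deg : ∀ i ≠ 0, ∀ x ∈ extDeg Q c i, koszulAug Q c R x = 0 := by
  intro i hi x hx
  have := ext_aug_deg i hi x hx
  rw [AlgHom.toLinearMap_apply] at this
  rw [koszulAug, AlgHom.comp_apply, this, map_zero]

theorem koszulAug_d (f : Fin c → Q)
    (hf : RingHom.ker (algebraMap Q R) = Ideal.span (Set.range f))
    (x : ExteriorAlgebra Q (Fin c → Q)) : koszulAug Q c R (koszulD f x) = 0 := by
  have hf' : ∀ a, algebraMap Q R (seqForm f a) = 0 := by
    intro a
    have h1 : ∀ i, algebraMap Q R (f i) = 0 := fun i => by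
      have : f i ∈ RingHom.ker (algebraMap Q R) := hf ▸ Ideal.subset_span ⟨i, rfl⟩
      exact this
    simp [seqForm, h1]
  induction x using CliffordAlgebra.left_induction with
  | algebraMap r => rw [koszulD_algebraMap, map_zero]
  | add x y hx hy => rw [map_add, map_add, hx, hy, add_zero]
  | ι_mul x a _ =>
    have e := koszulD_ι_mul f a x
    have : koszulAug Q c R (ExteriorAlgebra.ι Q a) = 0 := by
      simp [koszulAug, ExteriorAlgebra.algebraMapInv]
    erw [e]
    rw [map_sub, map_mul, this, map_smul, Algebra.smul_def, hf']
    simp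

variable {M : Type w} [AddCommGroup M] [Module Q M] [Module R M] [IsScalarTower Q R M]

/-- A complex of `R`-modules as an A∞-module over the Koszul complex, by restricting scalars along
`Kos^Q(f) → R`. -/
def koszulRestrict (f : Fin c → Q) (hf : RingHom.ker (algebraMap Q R) = Ideal.span (Set.range f))
    (degM : ℤ → Submodule R M) (dM : M →ₗ[R] M) (hM : IsComplex degM dM) :
    AInfModule (koszulAInf f) M :=
  AInfModule.ofComplex (koszulDG f) extDeg_neg _ (map_one ExteriorAlgebra.algebraMapInv)
    ext_aug_deg (koszulAug Q c R) (koszulAug_d f hf) koszulAug_deg degM dM hM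

end Koszul

/-! ### Symmetric tensors -/

section Sym

variable {Q : Type u} [CommRing Q] {c : ℕ}

/-- The invariants of the symmetric group in `V^{⊗ n}`; `τ` acts by moving the factor in position `i`
to position `τ i`. (There are no signs: `V` is regarded as concentrated in an even degree.) -/
def symPower (Q : Type u) [CommRing Q] (V : Type u) [AddCommGroup V] [Module Q V] (n : ℕ) :
    Submodule Q (⨂[Q]^n V) :=
  ⨅ τ : Equiv.Perm (Fin n),
    LinearMap.eqLocus (PiTensorProduct.reindex Q (fun _ => V) τ).toLinearMap LinearMap.id

/-- The module `⨁_n (V^{⊗ n})^{S_n}` of symmetric tensors, as a submodule of `T(V)`. -/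
def symTensors (Q : Type u) [CommRing Q] (V : Type u) [AddCommGroup V] [Module Q V] :
    Submodule Q (TensorAlgebra Q V) :=
  ⨆ n : ℕ, (symPower Q V n).map TensorPower.toTensorAlgebra

/-- `𝒞` is the curved coalgebra of symmetric tensors on `Σ² Q^c`, with zero differential, coproduct
restricted from the tensor coalgebra, and curvature `(f_1, …, f_c) : Σ² Q^c → Q`. -/
structure IsCurvedSymCoalgebra (f : Fin c → Q)
    (𝒞 : CurvedDGCoalgebra Q (symTensors Q (Fin c → Q))) : Prop where
  deg_eq : ∀ i, 𝒞.deg i =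
    (tensorDeg (concDeg Q (Fin c → Q) 2) 0 i).comap (symTensors Q (Fin c → Q)).subtype
  comul : TensorProduct.map (symTensors Q (Fin c → Q)).subtype (symTensors Q (Fin c → Q)).subtype ∘ₗ
    𝒞.comul = deconc ∘ₗ (symTensors Q (Fin c → Q)).subtype
  counit : 𝒞.counit =
    TensorAlgebra.algebraMapInv.toLinearMap ∘ₗ (symTensors Q (Fin c → Q)).subtype
  d : 𝒞.d = 0
  h : 𝒞.h = seqForm f ∘ₗ TensorAlgebra.ιInv ∘ₗ (symTensors Q (Fin c → Q)).subtype

/-- The word `1 ⋯ 1 2 ⋯ 2 ⋯ c ⋯ c` in which `i` occurs `α i` times. -/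
def stdWord (α : Fin c →₀ ℕ) (j : Fin (∑ i, α i)) : Fin c :=
  (finSigmaFinEquiv.symm j).1

open Classical in
/-- The `α`-shuffles: the permutations that are increasing on each of the `c` consecutive blocks of
lengths `α_1, …, α_c`. -/
def shuffles (α : Fin c →₀ ℕ) : Finset (Equiv.Perm (Fin (∑ i, α i))) :=
  Finset.univ.filter fun τ => ∀ i, StrictMono fun k : Fin (α i) => τ (finSigmaFinEquiv ⟨i, k⟩)

/-- The symmetric tensor `y^{(α)} = ∑_τ τ · (y_1^{⊗ α_1} ⊗ ⋯ ⊗ y_c^{⊗ α_c})`, the sum being over the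
`α`-shuffles and `y_1, …, y_c` being the standard basis. -/
def symElt (Q : Type u) [CommRing Q] (α : Fin c →₀ ℕ) : TensorAlgebra Q (Fin c → Q) :=
  ∑ τ ∈ shuffles α, TensorPower.toTensorAlgebra
    (PiTensorProduct.reindex Q (fun _ => Fin c → Q) τ
      (PiTensorProduct.tprod Q fun j => (Pi.single (stdWord α j) 1 : Fin c → Q)))

end Sym

/-! ### Systems of higher homotopies and the Eisenbud–Shamash resolution -/

section Homotopies

variable {Q : Type u} [CommRing Q] {c : ℕ} {G : Type w} [AddCommGroup G] [Module Q G]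

/-- A system of higher homotopies on `γ : G → M` corresponding to `f`. -/
structure IsSystemOfHigherHomotopies (f : Fin c → Q) (degG : ℤ → Submodule Q G) (dG : G →ₗ[Q] G)
    {M : Type*} [AddCommGroup M] [Module Q M] (γ : G →ₗ[Q] M)
    (σ : (Fin c →₀ ℕ) → (G →ₗ[Q] G)) : Prop where
  degree : ∀ (α : Fin c →₀ ℕ) (i : ℤ) (x : G), x ∈ degG i →
    σ α x ∈ degG (i + (2 * (∑ j, α j : ℕ) - 1))
  zero : σ 0 = dG
  single : ∀ i, σ 0 ∘ₗ σ (Finsupp.single i 1) + σ (Finsupp.single i 1) ∘ₗ σ 0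
    = f i • LinearMap.id
  higher : ∀ α : Fin c →₀ ℕ, 1 < ∑ j, α j →
    ∑ p ∈ Finset.HasAntidiagonal.antidiagonal α, σ p.1 ∘ₗ σ p.2 = 0
  aug : ∀ α : Fin c →₀ ℕ, 0 < ∑ j, α j → γ ∘ₗ σ α = 0

/-- The inclusion of `T(Σ V)`, `V = Σ Q^c`, into the bar construction of the Koszul complex. -/
def koszulIncl (f : Fin c → Q) :
    TensorAlgebra Q (Fin c → Q) →ₗ[Q] (koszulAInf f).BarC :=
  (tensorMap (genMap (koszulAInf f) (extEquiv Q (Fin c → Q)).toLinearEquiv)).toLinearMap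

/-- The inclusion of the symmetric tensors into the bar construction of the Koszul complex. -/
def symIncl (f : Fin c → Q) : symTensors Q (Fin c → Q) →ₗ[Q] (koszulAInf f).BarC :=
  koszulIncl f ∘ₗ (symTensors Q (Fin c → Q)).subtype

/-- The maps
`σ^{(α)} = (-1)^{|α|(|α|-1)/2} m^G_{|α|+1} ((s⁻¹)^{⊗ |α|} y^{(α)} ⊗ id)`. -/
def homotopy {f : Fin c → Q} (𝒢 : AInfModule (koszulAInf f) G) (α : Fin c →₀ ℕ) : G →ₗ[Q] G :=
  sgn (((∑ i, α i) * ((∑ i, α i) - 1) / 2 : ℕ) : ℤ) • 𝒢.desuspAct (koszulIncl f (symElt Q α))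

/-- The graded dual `D` of `Q[χ_1, …, χ_c]`: the linear forms vanishing on all but finitely many of
the homogeneous components. -/
def gradedDual (Q : Type u) [CommRing Q] (c : ℕ) :
    Submodule Q (Module.Dual Q (MvPolynomial (Fin c) Q)) where
  carrier := {φ | ∃ N : ℕ, ∀ n ≥ N, ∀ p : MvPolynomial (Fin c) Q, p.IsHomogeneous n → φ p = 0}
  zero_mem' := ⟨0, by simp⟩
  add_mem' := by
    rintro φ ψ ⟨N, hN⟩ ⟨N', hN'⟩
    refine ⟨max N N', fun n hn p hp => ?_⟩
    simp [hN n (le_trans (le_max_left _ _) hn) p hp, hN' n (le_trans (le_max_right _ _) hn) p hp]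
  smul_mem' := by
    rintro r φ ⟨N, hN⟩
    exact ⟨N, fun n hn p hp => by simp [hN n hn p hp]⟩

/-- The type of elements of the graded dual `D` of `Q[χ_1, …, χ_c]`. -/
def GradedDual (Q : Type u) [CommRing Q] (c : ℕ) : Type u := gradedDual Q c

instance : AddCommGroup (GradedDual Q c) := inferInstanceAs (AddCommGroup (gradedDual Q c))

instance : Module Q (GradedDual Q c) := inferInstanceAs (Module Q (gradedDual Q c))

/-- The linear form on `Q[χ_1, …, χ_c]` given by an element of `D`. -/
def GradedDual.form : GradedDual Q c →ₗ[Q] Module.Dual Q (MvPolynomial (Fin c) Q) :=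
  (gradedDual Q c).subtype

theorem GradedDual.form_injective : Function.Injective (GradedDual.form (Q := Q) (c := c)) :=
  Subtype.val_injective

/-- The homological grading of `D`, where each `χ_i` has degree `-2`. -/
def dualDeg (Q : Type u) [CommRing Q] (c : ℕ) (i : ℤ) : Submodule Q (GradedDual Q c) where
  carrier := {φ | ∀ n : ℕ, 2 * (n : ℤ) ≠ i → ∀ p : MvPolynomial (Fin c) Q, p.IsHomogeneous n →
    φ.form p = 0}
  zero_mem' := by simp
  add_mem' := by
    intro φ ψ h h' n hn p hp
    simp [h n hn p hp, h' n hn p hp]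
  smul_mem' := by
    intro r φ h n hn p hp
    simp [h n hn p hp]

/-- The action of `χ^α` on `D`: `(χ^α φ)(p) = φ(χ^α p)`. -/
def chiAct (α : Fin c →₀ ℕ) : GradedDual Q c →ₗ[Q] GradedDual Q c :=
  LinearMap.restrict (p := gradedDual Q c) (q := gradedDual Q c)
    (Module.Dual.transpose (R := Q) (LinearMap.mulLeft Q (MvPolynomial.monomial α (1 : Q)))) (by
      rintro φ ⟨N, hN⟩
      refine ⟨N, fun n hn p hp => ?_⟩
      exact hN (α.degree + n) (by omega) _
        ((MvPolynomial.isHomogeneous_monomial (1 : Q) rfl).mul hp))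

theorem chiAct_apply (α : Fin c →₀ ℕ) (φ : GradedDual Q c) (p : MvPolynomial (Fin c) Q) :
    (chiAct α φ).form p = φ.form (MvPolynomial.monomial α 1 * p) := rfl

theorem chiAct_finite (φ : GradedDual Q c) : {α : Fin c →₀ ℕ | chiAct α φ ≠ 0}.Finite := by
  obtain ⟨N, hN⟩ := φ.2
  refine (Finsupp.finite_of_degree_lt N).subset fun α hα => ?_
  by_contra h
  refine hα (GradedDual.form_injective (MvPolynomial.basisMonomials (Fin c) Q |>.ext fun β => ?_))
  rw [Set.mem_ofPred_eq, not_lt] at h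
  rw [MvPolynomial.coe_basisMonomials, chiAct_apply, map_zero]
  exact hN (α.degree + β.degree) (by omega) _
    ((MvPolynomial.isHomogeneous_monomial (1 : Q) rfl).mul
      (MvPolynomial.isHomogeneous_monomial (1 : Q) rfl))

/-- The linear form `(χ^α)^∨` of the basis dual to the monomials. -/
def dualMonomial (Q : Type u) [CommRing Q] (α : Fin c →₀ ℕ) : GradedDual Q c :=
  ⟨MvPolynomial.lcoeff Q α, α.degree + 1, fun n hn p hp => by
    rw [MvPolynomial.lcoeff_apply]
    exact hp.coeff_eq_zero (by omega)⟩

theorem chiAct_support (σ : (Fin c →₀ ℕ) → (G →ₗ[Q] G)) (φ : GradedDual Q c) (g : G) :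
    (Function.support fun α : Fin c →₀ ℕ => chiAct α φ ⊗ₜ[Q] σ α g).Finite := by
  refine (chiAct_finite φ).subset fun α hα h => hα ?_
  simp only [h, TensorProduct.zero_tmul]

/-- The map `∑_α χ^α ⊗ σ^{(α)}` on `D ⊗ G`; only finitely many summands are non-zero on each
element. -/
def eisenbudMap (σ : (Fin c →₀ ℕ) → (G →ₗ[Q] G)) :
    GradedDual Q c ⊗[Q] G →ₗ[Q] GradedDual Q c ⊗[Q] G :=
  TensorProduct.lift (LinearMap.mk₂ Q
    (fun φ g => ∑ᶠ α : Fin c →₀ ℕ, chiAct α φ ⊗ₜ[Q] σ α g)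
    (fun φ ψ g => by
      rw [← finsum_add_distrib (chiAct_support σ φ g) (chiAct_support σ ψ g)]
      simp only [map_add, TensorProduct.add_tmul])
    (fun r φ g => by
      rw [smul_finsum' r (chiAct_support σ φ g)]
      simp only [map_smul, TensorProduct.smul_tmul'])
    (fun φ g g' => by
      rw [← finsum_add_distrib (chiAct_support σ φ g) (chiAct_support σ φ g')]
      simp only [map_add, TensorProduct.tmul_add])
    (fun r φ g => by
      rw [smul_finsum' r (chiAct_support σ φ g)]
      simp only [map_smul, TensorProduct.tmul_smul]))

/-- The differential `∑_α 1 ⊗ χ^α ⊗ σ^{(α)}` of the Eisenbud–Shamash resolution `R ⊗ D ⊗ G`. -/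
def eisenbudDiff (R : Type v) [CommRing R] [Algebra Q R] (σ : (Fin c →₀ ℕ) → (G →ₗ[Q] G)) :
    R ⊗[Q] (GradedDual Q c ⊗[Q] G) →ₗ[R] R ⊗[Q] (GradedDual Q c ⊗[Q] G) :=
  (eisenbudMap σ).baseChange R

/-- The map `D → Q`, `φ ↦ φ(1)`. -/
def dualCounit (Q : Type u) [CommRing Q] (c : ℕ) : GradedDual Q c →ₗ[Q] Q :=
  LinearMap.applyₗ (1 : MvPolynomial (Fin c) Q) ∘ₗ GradedDual.form

end Homotopies

end AInfKoszul

end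

open AInfKoszul

noncomputable section

namespace AInfKoszul

open Module

/-! ### Graded modules with homogeneous bases -/

section Graded

variable {Q : Type*} [CommRing Q] {M : Type*} [AddCommGroup M] [Module Q M]
  {N : Type*} [AddCommGroup N] [Module Q N]

/-! All objects have explicit bases: exterior monomials for `A`, words for the tensor algebra,
`y^(α)` for the symmetric tensors and the dual monomials for `D`. In these bases the theorem splits
into four largely independent arguments.

Presentation and coalgebra. The Koszul complex is exact by induction on the number of exterior
generators that occur (`koszulD_exact_aux`). All `f_i` lie in the maximal ideal, so the differential
vanishes after base change to `k` and the derived fibre is an exterior algebra. Its Koszulness is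
the exactness of the Cartan resolution, contracted one variable at a time and hence in every
characteristic (`cartan_exact`). On `Ā` the differential vanishes on `V`, the product vanishes on
`W`, and there are no higher operations, so strictness is immediate. An element lies in all `V^{⊗i}
⊗ W ⊗ V^{⊗j}` exactly when its coefficients are invariant under adjacent transpositions, so the
Priddy coalgebra consists of the symmetric tensors (`priddy_eq_symTensors`). The `α`-shuffles
correspond bijectively to the words in which each `i` occurs `α_i` times, so `y^(α)` is the sum of
these words (`symElt_eq_sum`). Cutting words gives `Δ y^(α) = ∑ y^(β) ⊗ y^(β')` over `β + β' = α`.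
Of the bar operations only the curvature `y_i ↦ f_i` survives.

Existence of the A∞-structure. A family of operators `Θ w` on `G`, indexed by words `w` in a basis
of `A`, determines a map `barDiff` on words with coefficients in `G`. The A∞-identities say that
`wordSum Θ ∘ barDiff` is zero, and then `barDiff` squares to zero (`barDiff_barDiff_prep`). The
family is built by induction on the degree of a word. The first defect commutes with the
differential of `G` up to sign (`comm_defect`) and lands in the kernel of `γ` (`aug_defect`). That
kernel is acyclic and `G` is semifree, so the defect is a boundary and can be removed by changing
`Θ` in that degree (`exists_succ`). Words containing the unit never need correction
(`wordSum_barDiff_unit`). Restoring the signs of the desuspensions gives the Stasheff identities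
(`wordAct_stasheff`).

Higher homotopies. The Stasheff identities for the words of content `α` in the exterior generators
are added up. The terms with `m_2` cancel in pairs under exchange of two adjacent letters, because
the generators anticommute. The terms with `m_1` contain `d e_i = f_i · 1`; strict unitality kills
them for words of length at least two, and for a single letter leaves `f_i`. What remains is `∑
σ^(β) σ^(β')` (`sum_homotopy_comp_single`, `sum_homotopy_comp`).

Resolutions and comparison. Both resolutions are base changes of `D (y^α ⊗ g) = ∑ y^β ⊗ σ^(β') g` on
`C ⊗ G`, where `D² = ∑ f_i χ_i` and `χ_i` lowers the `i`-th exponent. The key point,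
`exists_cycle_of_mem_smul_top`, is that an element whose differential is divisible by the ideal is,
modulo the ideal and a boundary, of the form `y^0 ⊗ g` with `g` a cycle of `G`. It is proved by
eliminating the variables one by one with the regular sequence, and it needs no boundedness. It
reduces homology over `R` to the quasi-isomorphism `γ` (`isSemifreeResolution_shamash`). Since the
two differentials have the same formula on corresponding bases, matching the bases is the required
isomorphism. -/

theorem gradedInduction {deg : ℤ → Submodule Q M} (h : DirectSum.IsInternal deg) {p : M → Prop}
    (hom : ∀ i, ∀ x ∈ deg i, p x) (zero : p 0) (add : ∀ x y, p x → p y → p (x + y)) (x : M) :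
    p x := by
  have hx : x ∈ ⨆ i, deg i := by rw [h.submodule_iSup_eq_top]; trivial
  exact Submodule.iSup_induction deg (motive := p) hx hom zero add

/-- The projection of a graded module to its component of degree `i`. -/
def gradedComp (deg : ℤ → Submodule Q M) (h : DirectSum.IsInternal deg) (i : ℤ) : M →ₗ[Q] M :=
  (deg i).subtype ∘ₗ DirectSum.component Q ℤ (fun i => deg i) i ∘ₗ
    ((LinearEquiv.ofBijective (DirectSum.coeLinearMap deg)
      (show Function.Bijective (DirectSum.coeLinearMap deg) from h)).symm : M →ₗ[Q] ⨁ i, deg i)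

theorem gradedComp_mem (deg : ℤ → Submodule Q M) (h : DirectSum.IsInternal deg) (i : ℤ) (x : M) :
    gradedComp deg h i x ∈ deg i :=
  Subtype.property _

theorem gradedComp_of_mem (deg : ℤ → Submodule Q M) (h : DirectSum.IsInternal deg) {i : ℤ} (j : ℤ)
    {x : M} (hx : x ∈ deg i) : gradedComp deg h j x = if i = j then x else 0 := by
  have h' : Function.Bijective (DirectSum.coeLinearMap deg) := h
  have : (LinearEquiv.ofBijective (DirectSum.coeLinearMap deg) h').symm x
      = DirectSum.lof Q ℤ (fun i => deg i) i ⟨x, hx⟩ := by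
    rw [LinearEquiv.symm_apply_eq, LinearEquiv.ofBijective_apply, DirectSum.coeLinearMap_lof]
  simp only [gradedComp, LinearMap.comp_apply, LinearEquiv.coe_coe, this]
  split_ifs with hij
  · subst hij
    simp [DirectSum.component.lof_self]
  · rw [DirectSum.component.of, dif_neg hij]
    simp

theorem map_gradedComp {degM : ℤ → Submodule Q M} (hM : DirectSum.IsInternal degM)
    {degN : ℤ → Submodule Q N} (hN : DirectSum.IsInternal degN) (f : M →ₗ[Q] N) (s : ℤ)
    (hf : ∀ i, ∀ x ∈ degM i, f x ∈ degN (i + s)) (i : ℤ) (x : M) :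
    f (gradedComp degM hM i x) = gradedComp degN hN (i + s) (f x) := by
  induction x using gradedInduction hM with
  | hom j x hx =>
    rw [gradedComp_of_mem _ _ _ hx, gradedComp_of_mem _ _ _ (hf j x hx)]
    simp only [add_left_inj]
    split_ifs <;> simp
  | zero => simp
  | add x y hx hy => simp [hx, hy]

variable {ι : Type*}

theorem internal_of_basis (b : Basis ι Q M) (δ : ι → ℤ) (deg : ℤ → Submodule Q M)
    (hdeg : ∀ i, deg i = Submodule.span Q (b '' {j | δ j = i})) : DirectSum.IsInternal deg := by
  have hb : ∀ j, b j ∈ deg (δ j) := fun j => by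
    rw [hdeg]; exact Submodule.subset_span ⟨j, rfl, rfl⟩
  let D : M →ₗ[Q] ⨁ i, deg i :=
    b.constr Q fun j => DirectSum.lof Q ℤ (fun i => deg i) (δ j) ⟨b j, hb j⟩
  have hD : ∀ i (x : M) (hx : x ∈ deg i), D x = DirectSum.lof Q ℤ (fun i => deg i) i ⟨x, hx⟩ := by
    intro i x hx
    have hx' := hx
    rw [hdeg] at hx'
    induction hx' using Submodule.span_induction with
    | mem x hx' =>
      obtain ⟨j, rfl, rfl⟩ := hx'
      simp [D]
    | zero =>
      rw [map_zero]; exact (map_zero (DirectSum.lof Q ℤ (fun i => deg i) i)).symm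
    | add x y h1 h2 ih1 ih2 =>
      rw [← hdeg] at h1 h2
      rw [map_add, ih1 h1, ih2 h2, ← map_add]
      rfl
    | smul r x h1 ih1 =>
      rw [← hdeg] at h1
      rw [map_smul, ih1 h1, ← map_smul]
      rfl
  have h1 : DirectSum.coeLinearMap deg ∘ₗ D = LinearMap.id := by
    refine b.ext fun j => ?_
    simp [D]
  have h2 : D ∘ₗ DirectSum.coeLinearMap deg = LinearMap.id := by
    refine DirectSum.linearMap_ext _ fun i => LinearMap.ext fun x => ?_
    simp [hD i x x.2]
  have h3 : Function.Bijective (DirectSum.coeLinearMap deg) :=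
    ⟨Function.LeftInverse.injective (g := D) (LinearMap.congr_fun h2),
      fun x => ⟨D x, LinearMap.congr_fun h1 x⟩⟩
  exact h3

/-- Projecting a basis element to degree `i` returns it or zero, so every element of degree `i` is a
combination of basis elements of that degree. Degree statements can therefore be checked on a
homogeneous basis. -/
theorem eq_span_of_basis (b : Basis ι Q M) (δ : ι → ℤ) (deg : ℤ → Submodule Q M)
    (h : DirectSum.IsInternal deg) (hb : ∀ j, b j ∈ deg (δ j)) (i : ℤ) :
    deg i = Submodule.span Q (b '' {j | δ j = i}) := by
  have key : ∀ x, gradedComp deg h i x ∈ Submodule.span Q (b '' {j | δ j = i}) := by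
    intro x
    have hx : x ∈ Submodule.span Q (Set.range b) := by rw [b.span_eq]; trivial
    induction hx using Submodule.span_induction with
    | mem x hx =>
      obtain ⟨j, rfl⟩ := hx
      rw [gradedComp_of_mem _ _ _ (hb j)]
      split_ifs with hj
      · exact Submodule.subset_span ⟨j, hj, rfl⟩
      · exact zero_mem _
    | zero => rw [map_zero]; exact zero_mem _
    | add x y _ _ hx hy => rw [map_add]; exact add_mem hx hy
    | smul r x _ hx => rw [map_smul]; exact Submodule.smul_mem _ _ hx
  refine le_antisymm (fun x hx => ?_) (Submodule.span_le.2 ?_)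
  · have := key x
    rwa [gradedComp_of_mem _ _ _ hx, if_pos rfl] at this
  · rintro _ ⟨j, rfl, rfl⟩
    exact hb j

end Graded

/-! ### Semifree complexes -/

section Semifree

variable {Q : Type*} [CommRing Q] {M : Type*} [AddCommGroup M] [Module Q M]

/-- Representatives of the bases of all subquotients assemble into one basis. The stage at which an
element is adjoined is a rank that the differential strictly lowers, which is the form needed for
recursive constructions. -/
theorem IsSemifree.exists_basis {deg : ℤ → Submodule Q M} {d : M →ₗ[Q] M} (h : IsSemifree deg d) :
    ∃ (B : Set M) (b : Basis B Q M) (rank : B → ℕ) (δ : B → ℤ), (∀ i, b i ∈ deg (δ i)) ∧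
      ∀ i, d (b i) ∈ Submodule.span Q (b '' {j | rank j < rank i}) := by
  obtain ⟨F, F0, Ftop, hF⟩ := h.filtration
  choose E hE hli hE' using hF
  let B : ℕ → Set M := fun n => ⋃ m < n, E m
  have Bsucc : ∀ n, B (n + 1) = B n ∪ E n := fun n => by
    simp only [B]
    rw [Set.biUnion_lt_succ]
  have hspan : ∀ n, Submodule.span Q (B n) = F n := by
    intro n
    induction n with
    | zero => simp [B, F0]
    | succ n ih => rw [Bsucc, Submodule.span_union, ih, hE]
  have hind : ∀ n, LinearIndepOn Q id (B n) := by
    intro n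
    induction n with
    | zero => simp [B]
    | succ n ih =>
      rw [Bsucc]
      exact ih.union_id_of_quotient (M' := F n) (by rw [← hspan]; exact Submodule.subset_span)
        (hli n)
  have hU : (⋃ n, B n) = ⋃ n, E n := by
    ext x
    simp only [B, Set.mem_iUnion, exists_prop]
    exact ⟨fun ⟨n, m, _, h⟩ => ⟨m, h⟩, fun ⟨m, h⟩ => ⟨m + 1, m, m.lt_succ_self, h⟩⟩
  have mono : Monotone B := fun m n hmn =>
    Set.biUnion_subset_biUnion_left fun k hk => lt_of_lt_of_le hk hmn
  have hindU : LinearIndependent Q fun x : (⋃ n, E n : Set M) => id (x : M) := by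
    rw [← hU]
    exact linearIndepOn_iUnion_of_directed mono.directed_le hind
  have hspanU : ⊤ ≤ Submodule.span Q (Set.range fun x : (⋃ n, E n : Set M) => (id (x : M))) := by
    have : Set.range (fun x : (⋃ n, E n : Set M) => (id (x : M))) = ⋃ n, E n := Subtype.range_coe
    rw [this, ← Ftop, ← hU]
    refine iSup_le fun n => ?_
    rw [← hspan]
    exact Submodule.span_mono (Set.subset_iUnion _ _)
  have hmem : ∀ x : (⋃ n, E n : Set M), ∃ n, (x : M) ∈ E n := fun x => Set.mem_iUnion.1 x.2
  classical
  have hdeg : ∀ x : (⋃ n, E n : Set M), ∃ i, (x : M) ∈ deg i := fun x => by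
    obtain ⟨n, hn⟩ := hmem x
    exact (hE' n _ hn).1
  choose δ hδ using hdeg
  -- The rank is the first stage containing the element, so anything in the span of earlier stages
  -- has strictly smaller rank.
  refine ⟨⋃ n, E n, Basis.mk hindU hspanU, fun x => Nat.find (hmem x), δ, fun i => ?_,
    fun i => ?_⟩
  · rw [Basis.mk_apply]; exact hδ i
  · have h1 := (hE' _ _ (Nat.find_spec (hmem i))).2
    rw [Basis.mk_apply]
    rw [← hspan] at h1
    refine Submodule.span_mono ?_ h1
    intro x hx
    simp only [B, Set.mem_iUnion, exists_prop] at hx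
    obtain ⟨m, hm, hx⟩ := hx
    refine ⟨⟨x, Set.mem_iUnion.2 ⟨m, hx⟩⟩, ?_, by rw [Basis.mk_apply]; rfl⟩
    exact lt_of_le_of_lt (Nat.find_min' _ hx) hm

/-- The filtration is built greedily: the next stage consists of the basis elements whose
differential lies in the previous one. Each differential involves finitely many basis elements, so
well-founded induction shows that every basis element enters at a finite stage. An arbitrary
well-founded relation, such as a lexicographic order, is thus enough. -/
theorem isSemifree_of_basis {ι : Type*} {deg : ℤ → Submodule Q M} {d : M →ₗ[Q] M}
    (hd : IsComplex deg d) (b : Basis ι Q M) (hb : ∀ i, ∃ n, b i ∈ deg n) {r : ι → ι → Prop}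
    (wf : WellFounded r) (hr : ∀ i, d (b i) ∈ Submodule.span Q (b '' {j | r j i})) :
    IsSemifree deg d := by
  let S : ℕ → Set ι := fun n =>
    Nat.rec ∅ (fun _ s => {i | d (b i) ∈ Submodule.span Q (b '' s)}) n
  have S0 : S 0 = ∅ := rfl
  have Ssucc : ∀ n, S (n + 1) = {i | d (b i) ∈ Submodule.span Q (b '' S n)} := fun n => rfl
  have mono : Monotone S := by
    refine monotone_nat_of_le_succ fun n => ?_
    induction n with
    | zero => rw [S0]; exact Set.empty_subset _
    | succ n ih =>
      intro i hi
      exact Submodule.span_mono (Set.image_mono ih) hi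
  have exh : ∀ i, ∃ n, i ∈ S n := by
    intro i
    induction i using wf.induction with
    | h i ih =>
      suffices ∃ n, d (b i) ∈ Submodule.span Q (b '' S n) by
        obtain ⟨n, hn⟩ := this
        exact ⟨n + 1, hn⟩
      have := hr i
      generalize d (b i) = x at this
      induction this using Submodule.span_induction with
      | mem x hx =>
        obtain ⟨j, hj, rfl⟩ := hx
        obtain ⟨n, hn⟩ := ih j hj
        exact ⟨n, Submodule.subset_span ⟨j, hn, rfl⟩⟩
      | zero => exact ⟨0, zero_mem _⟩
      | add x y _ _ hx hy =>
        obtain ⟨m, hm⟩ := hx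
        obtain ⟨n, hn⟩ := hy
        refine ⟨max m n, add_mem ?_ ?_⟩
        · exact Submodule.span_mono (Set.image_mono (mono (le_max_left m n))) hm
        · exact Submodule.span_mono (Set.image_mono (mono (le_max_right m n))) hn
      | smul a x _ hx =>
        obtain ⟨m, hm⟩ := hx
        exact ⟨m, Submodule.smul_mem _ _ hm⟩
  refine ⟨hd, fun n => Submodule.span Q (b '' S n), by simp [S0], ?_, fun n =>
    ⟨b '' (S (n + 1) \ S n), ?_, ?_, ?_⟩⟩
  · rw [eq_top_iff, ← b.span_eq, Submodule.span_le]
    rintro _ ⟨i, rfl⟩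
    obtain ⟨n, hn⟩ := exh i
    exact Submodule.mem_iSup_of_mem n (Submodule.subset_span ⟨i, hn, rfl⟩)
  · rw [← Submodule.span_union, ← Set.image_union, Set.union_sdiff_cancel (mono n.le_succ)]
  · have h1 : LinearIndepOn Q b (S n ∪ (S (n + 1) \ S n)) :=
      b.linearIndependent.linearIndepOn _
    have h2 := ((linearIndepOn_union_iff_quotient Set.disjoint_sdiff_right).1 h1).2
    choose g hg hg' using fun e : b '' (S (n + 1) \ S n) => e.2
    have h3 := LinearIndependent.comp h2 (fun e => ⟨g e, hg e⟩) (by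
      intro e e' he
      simp only [Subtype.mk.injEq] at he
      exact Subtype.ext (by rw [← hg' e, ← hg' e', he]))
    simpa [Function.comp_def, hg'] using h3
  · rintro _ ⟨i, hi, rfl⟩
    exact ⟨hb i, hi.1⟩

/-- Recursion along a basis whose differential decreases a rank function. -/
theorem exists_linearMap_rec {ι : Type*} {N : Type*} [AddCommGroup N] [Module Q N]
    (b : Basis ι Q M) (rank : ι → ℕ) (d : M →ₗ[Q] M)
    (hd : ∀ i, d (b i) ∈ Submodule.span Q (b '' {j | rank j < rank i})) (φ : ι → N → N) :
    ∃ Θ : M →ₗ[Q] N, ∀ i, Θ (b i) = φ i (Θ (d (b i))) := by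
  let T : ℕ → (M →ₗ[Q] N) := fun n =>
    Nat.rec 0 (fun _ t => b.constr Q fun i => φ i (t (d (b i)))) n
  have Tsucc : ∀ n i, T (n + 1) (b i) = φ i (T n (d (b i))) := fun n i =>
    b.constr_basis Q _ i
  have span_eq : ∀ (f g : M →ₗ[Q] N) (s : Set ι), (∀ i ∈ s, f (b i) = g (b i)) →
      ∀ x ∈ Submodule.span Q (b '' s), f x = g x := by
    intro f g s h x hx
    refine LinearMap.eqOn_span (f := f) (g := g) ?_ hx
    rintro _ ⟨i, hi, rfl⟩
    exact h i hi
  -- The `n`-th approximation is already correct on elements of rank less than `n`, since it depends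
  -- only on values in smaller rank.
  have stab : ∀ n i, rank i < n → T n (b i) = T (rank i + 1) (b i) := by
    intro n
    induction n using Nat.strong_induction_on with
    | h n ih =>
      intro i hi
      obtain ⟨n, rfl⟩ : ∃ m, n = m + 1 := ⟨n - 1, by omega⟩
      rw [Tsucc, Tsucc]
      congr 1
      refine span_eq _ _ _ (fun j (hj : rank j < rank i) => ?_) _ (hd i)
      rw [ih n (by omega) j (by omega), ih (rank i) (by omega) j hj]
  refine ⟨b.constr Q fun i => T (rank i + 1) (b i), fun i => ?_⟩
  rw [b.constr_basis, Tsucc]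
  congr 1
  refine span_eq _ _ _ (fun j (hj : rank j < rank i) => ?_) _ (hd i)
  rw [b.constr_basis, stab _ _ hj]

end Semifree

/-! ### Lifting against the acyclic kernel of a semifree resolution -/

section Resolution

variable {Q : Type*} [CommRing Q] {G : Type*} [AddCommGroup G] [Module Q G]
  {M : Type*} [AddCommGroup M] [Module Q M] {degG : ℤ → Submodule Q G} {dG : G →ₗ[Q] G}
  {degM : ℤ → Submodule Q M} {dM : M →ₗ[Q] M} {γ : G →ₗ[Q] M}

/-- The kernel of a semifree resolution is acyclic. -/
theorem IsSemifreeResolution.exists_of_ker (h : IsSemifreeResolution degG dG degM dM γ)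
    (hM : DirectSum.IsInternal degM) {i : ℤ} {y : G} (hy : y ∈ degG i) (hγ : γ y = 0)
    (hdy : dG y = 0) : ∃ z ∈ degG (i + 1), γ z = 0 ∧ dG z = y := by
  have hG := h.semifree.internal
  -- `z0` bounds `y` but need not lie in the kernel. Its image is a cycle, hence homologous to the
  -- image of a cycle `x`; subtracting `x` and adding the boundary of a lift of the homology moves
  -- `z0` into the kernel without changing its boundary. The component of degree `i + 1` then has
  -- the right degree.
  obtain ⟨z0, hz0⟩ := h.quasiIso.1 y hdy ⟨0, by rw [hγ, map_zero]⟩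
  obtain ⟨x, hx, w, hw⟩ := h.quasiIso.2 (γ z0) (by rw [← h.comm, ← hz0, hγ])
  obtain ⟨v, rfl⟩ := h.surjective w
  have h1 : γ (z0 - x + dG v) = 0 := by
    rw [map_add, map_sub, h.comm, ← hw]; abel
  have h2 : dG (z0 - x + dG v) = y := by
    rw [map_add, map_sub, hx, h.semifree.d_d, ← hz0]; abel
  refine ⟨gradedComp degG hG (i + 1) (z0 - x + dG v), gradedComp_mem _ _ _ _, ?_, ?_⟩
  · rw [map_gradedComp hG hM γ 0 (fun i x hx => by rw [add_zero]; exact h.mem hx), h1, map_zero]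
  · rw [map_gradedComp hG hG dG (-1) (fun i x hx => h.semifree.d_mem hx), h2,
      gradedComp_of_mem _ _ _ hy, if_pos (by ring)]

theorem sgn_mul_self (i : ℤ) : sgn i * sgn i = 1 := by
  rw [← sgn_add, ← two_mul, sgn_two_mul]

/-- Maps of degree `p` from a semifree resolution to its kernel that commute with the
differentials are null-homotopic. -/
theorem IsSemifreeResolution.exists_homotopy (h : IsSemifreeResolution degG dG degM dM γ)
    (hM : DirectSum.IsInternal degM) (p : ℤ) (O : G →ₗ[Q] G)
    (hO : ∀ i, ∀ x ∈ degG i, O x ∈ degG (i + p)) (hγ : γ ∘ₗ O = 0)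
    (hd : dG ∘ₗ O = sgn p • (O ∘ₗ dG)) :
    ∃ Θ : G →ₗ[Q] G, (∀ i, ∀ x ∈ degG i, Θ x ∈ degG (i + (p + 1))) ∧ γ ∘ₗ Θ = 0 ∧
      dG ∘ₗ Θ + sgn p • (Θ ∘ₗ dG) = O := by
  classical
  obtain ⟨B, b, rank, δ, hδ, hrank⟩ := h.semifree.exists_basis
  -- The choice at `b j` uses only the value on `dG (b j)`, which has smaller rank. The default
  -- value `0` is never taken, as `key` shows the equation to be solvable at each stage.
  let sol : B → G → G := fun j y =>
    if hy : ∃ z ∈ degG (δ j + p + 1), γ z = 0 ∧ dG z = O (b j) - sgn p • y then hy.choose else 0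
  obtain ⟨Θ, hΘ⟩ := exists_linearMap_rec b rank dG hrank sol
  have key : ∀ n j, rank j = n → Θ (b j) ∈ degG (δ j + p + 1) ∧ γ (Θ (b j)) = 0 ∧
      dG (Θ (b j)) = O (b j) - sgn p • Θ (dG (b j)) := by
    intro n
    induction n using Nat.strong_induction_on with
    | h n ih =>
      rintro j rfl
      have hdj := hrank j
      have hdeg : dG (b j) ∈ degG (δ j - 1) := h.semifree.d_mem (hδ j)
      have hex : ∃ z ∈ degG (δ j + p + 1), γ z = 0 ∧ dG z = O (b j) - sgn p • Θ (dG (b j)) := by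
        have e1 : γ (Θ (dG (b j))) = 0 := by
          have := LinearMap.eqOn_span (f := γ ∘ₗ Θ) (g := 0) (s := b '' {k | rank k < rank j})
            (by rintro _ ⟨k, hk, rfl⟩; exact (ih _ hk k rfl).2.1) hdj
          exact this
        have e2 : dG (Θ (dG (b j))) = O (dG (b j)) := by
          have := LinearMap.eqOn_span (f := dG ∘ₗ Θ + sgn p • (Θ ∘ₗ dG)) (g := O)
            (s := b '' {k | rank k < rank j})
            (by
              rintro _ ⟨k, hk, rfl⟩
              have := (ih _ hk k rfl).2.2
              simp [this]) hdj
          simpa [h.semifree.d_d] using this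
        -- Lower rank and degree `δ j - 1` are two conditions on the support of `dG (b j)`; both
        -- hold at once because they are read off from the same coordinates.
        have e3 : Θ (dG (b j)) ∈ degG (δ j + p) := by
          have hh : dG (b j) ∈ Submodule.span Q (b '' {k | rank k < rank j ∧ δ k = δ j - 1}) := by
            rw [eq_span_of_basis b δ degG h.semifree.internal hδ] at hdeg
            rw [Basis.mem_span_image] at hdj hdeg ⊢
            exact fun k hk => ⟨hdj hk, hdeg hk⟩
          refine (Submodule.span_le (p := (degG (δ j + p)).comap Θ)).2 ?_ hh
          rintro _ ⟨k, ⟨hk, hk'⟩, rfl⟩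
          have := (ih _ hk k rfl).1
          rw [hk'] at this
          change Θ (b k) ∈ degG (δ j + p)
          convert this using 2
          ring
        have hγO : ∀ x, γ (O x) = 0 := fun x => LinearMap.congr_fun hγ x
        have hdO : ∀ x, dG (O x) = sgn p • O (dG x) := fun x => LinearMap.congr_fun hd x
        refine h.exists_of_ker hM (sub_mem (hO _ _ (hδ j)) ?_) ?_ ?_
        · exact zsmul_mem e3 _
        · rw [map_sub, map_zsmul, e1, hγO]; simp
        · rw [map_sub, map_zsmul, e2, hdO]; simp
      have e : Θ (b j) = hex.choose := by
        rw [hΘ]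
        simp only [sol]
        rw [dif_pos hex]
      rw [e]
      exact hex.choose_spec
  refine ⟨Θ, fun i x hx => ?_, b.ext fun j => (key _ j rfl).2.1, b.ext fun j => ?_⟩
  · rw [eq_span_of_basis b δ degG h.semifree.internal hδ] at hx
    refine (Submodule.span_le (p := (degG (i + (p + 1))).comap Θ)).2 ?_ hx
    rintro _ ⟨k, rfl, rfl⟩
    have := (key _ k rfl).1
    rwa [add_assoc] at this
  · simp [(key _ j rfl).2.2]

end Resolution

end AInfKoszul

end

noncomputable section

namespace AInfKoszul

open Module

/-! ### The sign involution of a dg algebra -/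

section Sign

variable {Q : Type*} [CommRing Q] {A : Type*} [Ring A] [Algebra Q A] (𝒜 : DGStructure Q A)

/-- The sign involution `a ↦ (-1)^{|a|} a` of a dg algebra. -/
def DGStructure.sign : A →ₗ[Q] A := gradeSign 𝒜.deg 𝒜.internal

theorem DGStructure.sign_of_mem {i : ℤ} {a : A} (ha : a ∈ 𝒜.deg i) : 𝒜.sign a = sgn i • a :=
  gradeSign_of_mem _ _ ha

theorem DGStructure.sign_mem {i : ℤ} {a : A} (ha : a ∈ 𝒜.deg i) : 𝒜.sign a ∈ 𝒜.deg i := by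
  rw [𝒜.sign_of_mem ha]
  exact zsmul_mem ha _

theorem DGStructure.sign_one : 𝒜.sign 1 = 1 := by
  rw [𝒜.sign_of_mem 𝒜.one_mem, sgn_zero, one_smul]

theorem DGStructure.sign_sign (a : A) : 𝒜.sign (𝒜.sign a) = a := by
  induction a using gradedInduction 𝒜.internal with
  | hom i a ha => rw [𝒜.sign_of_mem ha, map_zsmul, 𝒜.sign_of_mem ha, smul_smul, sgn_mul_self,
      one_smul]
  | zero => simp
  | add a b ha hb => simp [ha, hb]

theorem DGStructure.d_sign (a : A) : 𝒜.d (𝒜.sign a) = -𝒜.sign (𝒜.d a) := by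
  induction a using gradedInduction 𝒜.internal with
  | hom i a ha =>
    rw [𝒜.sign_of_mem ha, map_zsmul, 𝒜.sign_of_mem (𝒜.d_mem ha), sub_eq_add_neg, sgn_add,
      show sgn (-1) = -1 by rfl]
    simp
  | zero => simp
  | add a b ha hb => simp only [map_add, ha, hb, neg_add]

theorem DGStructure.sign_mul (a b : A) : 𝒜.sign (a * b) = 𝒜.sign a * 𝒜.sign b := by
  induction a using gradedInduction 𝒜.internal with
  | hom i a ha =>
    induction b using gradedInduction 𝒜.internal with
    | hom j b hb =>
      rw [𝒜.sign_of_mem ha, 𝒜.sign_of_mem hb, 𝒜.sign_of_mem (𝒜.mul_mem ha hb), sgn_add,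
        smul_mul_smul_comm]
    | zero => simp
    | add a b ha hb => simp [mul_add, ha, hb]
  | zero => simp
  | add a b ha hb => simp [add_mul, ha, hb]

theorem DGStructure.d_mul (a b : A) : 𝒜.d (a * b) = 𝒜.d a * b + 𝒜.sign a * 𝒜.d b := by
  induction a using gradedInduction 𝒜.internal with
  | hom i a ha => rw [𝒜.leibniz ha, 𝒜.sign_of_mem ha, smul_mul_assoc]
  | zero => simp
  | add a b ha hb => simp only [add_mul, map_add, ha, hb]; abel

theorem DGStructure.d_one : 𝒜.d 1 = 0 := by
  have := 𝒜.d_mul 1 1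
  rw [𝒜.sign_one, mul_one, mul_one, one_mul] at this
  simpa using this

end Sign

/-! ### Words with coefficients in a module -/

section Words

variable {Q : Type*} [CommRing Q] {A : Type*} [Ring A] [Algebra Q A] (𝒜 : DGStructure Q A)
  {I : Type*} (e : Basis I Q A) {G : Type*} [AddCommGroup G] [Module Q G]

theorem basis_induction {Q M I : Type*} [CommRing Q] [AddCommGroup M] [Module Q M]
    (e : Basis I Q M) {p : M → Prop} (h : ∀ i, p (e i)) (zero : p 0)
    (add : ∀ x y, p x → p y → p (x + y)) (smul : ∀ (r : Q) x, p x → p (r • x)) (x : M) : p x := by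
  have hx : x ∈ Submodule.span Q (Set.range e) := by rw [e.span_eq]; trivial
  induction hx using Submodule.span_induction with
  | mem x hx => obtain ⟨i, rfl⟩ := hx; exact h i
  | zero => exact zero
  | add x y _ _ hx hy => exact add x y hx hy
  | smul r x _ hx => exact smul r x hx

/-- The operator prepending a letter to the words with coefficients in `G`. -/
def prep (G : Type*) [AddCommGroup G] [Module Q G] : A →ₗ[Q] Module.End Q (List I →₀ G) :=
  e.constr Q fun i => Finsupp.lmapDomain G Q (List.cons i)

theorem prep_single (i : I) (w : List I) (g : G) :
    prep e G (e i) (Finsupp.single w g) = Finsupp.single (i :: w) g := by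
  simp [prep, Finsupp.mapDomain_single]

/-- The operator `merge a` multiplies the first letter of a word by `(-1)^{|a|} a` from the left. -/
def merge (G : Type*) [AddCommGroup G] [Module Q G] : A →ₗ[Q] Module.End Q (List I →₀ G) where
  toFun a := Finsupp.lsum Q fun w => match w with
    | [] => 0
    | i :: w => prep e G (𝒜.sign a * e i) ∘ₗ Finsupp.lsingle w
  map_add' a b := by
    refine Finsupp.lhom_ext fun w g => ?_
    rcases w with _ | ⟨i, w⟩ <;> simp [add_mul]
  map_smul' r a := by
    refine Finsupp.lhom_ext fun w g => ?_
    rcases w with _ | ⟨i, w⟩ <;> simp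

theorem merge_nil (a : A) (g : G) : merge 𝒜 e G a (Finsupp.single [] g) = 0 := by
  simp [merge]

theorem merge_cons (a : A) (i : I) (w : List I) (g : G) :
    merge 𝒜 e G a (Finsupp.single (i :: w) g)
      = prep e G (𝒜.sign a * e i) (Finsupp.single w g) := by
  simp [merge]

theorem merge_prep (a c : A) (x : List I →₀ G) :
    merge 𝒜 e G a (prep e G c x) = prep e G (𝒜.sign a * c) x := by
  induction c using basis_induction e with
  | h i =>
    induction x using Finsupp.induction_linear with
    | zero => simp
    | add x y hx hy => simp [hx, hy]
    | single w g => rw [prep_single, merge_cons]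
  | zero => simp
  | add c c' h h' => simp [mul_add, h, h']
  | smul r c h => simp [h]

/-- The map on words with coefficients in `G` whose components are the operators `Θ w`. -/
def wordSum (Θ : List I → Module.End Q G) : (List I →₀ G) →ₗ[Q] G := Finsupp.lsum Q Θ

theorem wordSum_single (Θ : List I → Module.End Q G) (w : List I) (g : G) :
    wordSum Θ (Finsupp.single w g) = Θ w g := by
  simp [wordSum]

/-- The value of the two-sided bar differential on a word. -/
def barWord (Θ : List I → Module.End Q G) : List I → (G →ₗ[Q] (List I →₀ G))
  | [] => Finsupp.lsingle [] ∘ₗ Θ []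
  | i :: w => -(prep e G (𝒜.d (e i)) ∘ₗ Finsupp.lsingle w) + merge 𝒜 e G (e i) ∘ₗ Finsupp.lsingle w
      - prep e G (𝒜.sign (e i)) ∘ₗ barWord Θ w + Finsupp.lsingle [] ∘ₗ Θ (i :: w)

/-- The differential of the bar construction of `A` twisted by `G`. -/
def barDiff (Θ : List I → Module.End Q G) : Module.End Q (List I →₀ G) :=
  Finsupp.lsum Q (barWord 𝒜 e Θ)

variable (Θ : List I → Module.End Q G)

theorem barDiff_single (w : List I) (g : G) :
    barDiff 𝒜 e Θ (Finsupp.single w g) = barWord 𝒜 e Θ w g := by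
  simp [barDiff]

theorem barDiff_nil (g : G) :
    barDiff 𝒜 e Θ (Finsupp.single [] g) = Finsupp.single [] (Θ [] g) := by
  simp [barDiff_single, barWord]

theorem barDiff_prep (a : A) (x : List I →₀ G) :
    barDiff 𝒜 e Θ (prep e G a x) = -prep e G (𝒜.d a) x + merge 𝒜 e G a x
      - prep e G (𝒜.sign a) (barDiff 𝒜 e Θ x)
      + Finsupp.single [] (wordSum Θ (prep e G a x)) := by
  induction a using basis_induction e with
  | h i =>
    induction x using Finsupp.induction_linear with
    | zero => simp
    | add x y hx hy => simp only [map_add, hx, hy, Finsupp.single_add]; abel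
    | single w g =>
      rw [prep_single, barDiff_single, barDiff_single, wordSum_single]
      simp [barWord]
  | zero => simp
  | add c c' h h' => simp only [map_add, LinearMap.add_apply, h, h', Finsupp.single_add]; abel
  | smul r c h =>
    simp only [map_smul, LinearMap.smul_apply, h, ← Finsupp.smul_single, smul_add, smul_sub,
      smul_neg]

/-- Merging a letter into a word is compatible with the bar differential except in the empty word:
the Leibniz rule accounts for differentiated letters, associativity for repeated merging. This is
the input for the square of the differential on `prep`. -/
theorem barDiff_merge (a : A) (x : List I →₀ G) :
    -merge 𝒜 e G (𝒜.d a) x + barDiff 𝒜 e Θ (merge 𝒜 e G a x)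
      - merge 𝒜 e G (𝒜.sign a) (barDiff 𝒜 e Θ x)
      = Finsupp.single [] (wordSum Θ (merge 𝒜 e G a x)) := by
  induction x using Finsupp.induction_linear with
  | zero => simp
  | add x y hx hy =>
    simp only [map_add, Finsupp.single_add, ← hx, ← hy]
    abel
  | single w g =>
    rcases w with _ | ⟨i, w⟩
    · simp [merge_nil, barDiff_nil]
    · rw [← prep_single e, merge_prep, merge_prep, barDiff_prep, barDiff_prep]
      simp only [map_add, map_sub, map_neg, merge_prep, merge_nil, 𝒜.sign_sign, 𝒜.sign_mul,
        𝒜.d_mul, 𝒜.d_sign, LinearMap.add_apply, LinearMap.neg_apply, neg_mul]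
      -- Associativity of `A`: merging the product of two letters is merging them successively.
      have h : merge 𝒜 e G (𝒜.sign a * e i) (Finsupp.single w g)
          = merge 𝒜 e G (𝒜.sign a) (merge 𝒜 e G (e i) (Finsupp.single w g)) := by
        rcases w with _ | ⟨j, w⟩
        · simp [merge_nil]
        · rw [merge_cons, merge_cons, merge_prep, 𝒜.sign_mul, mul_assoc]
      rw [h]
      abel

/-- The square of the bar differential is determined by its component in the empty word. -/
theorem barDiff_barDiff_prep (a : A) (x : List I →₀ G) :
    barDiff 𝒜 e Θ (barDiff 𝒜 e Θ (prep e G a x))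
      = prep e G a (barDiff 𝒜 e Θ (barDiff 𝒜 e Θ x))
        + Finsupp.single [] (wordSum Θ (barDiff 𝒜 e Θ (prep e G a x))) := by
  have h := barDiff_merge 𝒜 e Θ a x
  rw [barDiff_prep 𝒜 e Θ a x]
  simp only [map_add, map_sub, map_neg, barDiff_prep 𝒜 e Θ (𝒜.d a), barDiff_prep 𝒜 e Θ (𝒜.sign a),
    barDiff_nil, 𝒜.d_d, 𝒜.d_sign, 𝒜.sign_sign, LinearMap.zero_apply, wordSum_single,
    Finsupp.single_add, Finsupp.single_sub, Finsupp.single_neg, ← h, LinearMap.neg_apply,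
    map_zero]
  abel

end Words

end AInfKoszul

end

noncomputable section

namespace AInfKoszul

open Module

/-! ### Words containing the unit -/

section Units

variable {Q : Type*} [CommRing Q] {A : Type*} [Ring A] [Algebra Q A] (𝒜 : DGStructure Q A)
  {I : Type*} (e : Basis I Q A) {G : Type*} [AddCommGroup G] [Module Q G] {o : I}

/-- The words of length at least two that contain the letter `o`. -/
def unitWords (Q : Type*) [CommRing Q] (G : Type*) [AddCommGroup G] [Module Q G] (o : I) :
    Submodule Q (List I →₀ G) :=
  Submodule.span Q {x | ∃ (w : List I) (g : G), o ∈ w ∧ 2 ≤ w.length ∧ x = Finsupp.single w g}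

theorem prep_mem_unitWords (a : A) {w : List I} (hw : o ∈ w) (g : G) :
    prep e G a (Finsupp.single w g) ∈ unitWords Q G o := by
  induction a using basis_induction e with
  | h i =>
    rw [prep_single]
    refine Submodule.subset_span ⟨i :: w, g, List.mem_cons_of_mem _ hw, ?_, rfl⟩
    have := List.length_pos_of_mem hw
    simp only [List.length_cons]
    omega
  | zero => simp
  | add c c' h h' => rw [map_add]; exact add_mem h h'
  | smul r c h => rw [map_smul]; exact Submodule.smul_mem _ _ h

theorem prep_mem_unitWords' (a : A) {x : List I →₀ G} (hx : x ∈ unitWords Q G o) :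
    prep e G a x ∈ unitWords Q G o := by
  refine (Submodule.span_le (p := (unitWords Q G o).comap (prep e G a))).2 ?_ hx
  rintro _ ⟨w, g, hw, -, rfl⟩
  exact prep_mem_unitWords e a hw g

variable (Θ : List I → Module.End Q G)

theorem wordSum_unitWords (hΘ : ∀ w, o ∈ w → 2 ≤ w.length → Θ w = 0) {x : List I →₀ G}
    (hx : x ∈ unitWords Q G o) : wordSum Θ x = 0 := by
  refine (Submodule.span_le (p := LinearMap.ker (wordSum Θ))).2 ?_ hx
  rintro _ ⟨w, g, hw, hl, rfl⟩
  simp [wordSum_single, hΘ w hw hl]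

theorem wordSum_prep_one (ho : e o = 1) (hΘ : ∀ w, o ∈ w → 2 ≤ w.length → Θ w = 0)
    (hΘ1 : Θ [o] = 1) (x : List I →₀ G) : wordSum Θ (prep e G 1 x) = x [] := by
  induction x using Finsupp.induction_linear with
  | zero => simp
  | add x y hx hy => simp [hx, hy]
  | single w g =>
    rw [← ho, prep_single, wordSum_single]
    rcases w with _ | ⟨i, w⟩
    · simp [hΘ1]
    · rw [hΘ _ (by simp) (by simp)]
      simp

/-- Prepending the unit is a contracting homotopy. Merging `1` into the first letter gives back
every nonempty word, and `Θ [o] = 1` supplies the empty one. -/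
theorem barDiff_prep_one (ho : e o = 1) (hΘ : ∀ w, o ∈ w → 2 ≤ w.length → Θ w = 0)
    (hΘ1 : Θ [o] = 1) (x : List I →₀ G) :
    barDiff 𝒜 e Θ (prep e G 1 x) = x - prep e G 1 (barDiff 𝒜 e Θ x) := by
  have h : merge 𝒜 e G 1 x + Finsupp.single [] (x []) = x := by
    induction x using Finsupp.induction_linear with
    | zero => simp
    | add x y hx hy =>
      rw [map_add, Finsupp.add_apply, Finsupp.single_add, add_add_add_comm, hx, hy]
    | single w g =>
      rcases w with _ | ⟨i, w⟩
      · simp [merge_nil]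
      · rw [merge_cons, 𝒜.sign_one, one_mul, prep_single]
        simp
  rw [barDiff_prep, 𝒜.d_one, 𝒜.sign_one, wordSum_prep_one e Θ ho hΘ hΘ1]
  rw [map_zero, LinearMap.zero_apply, neg_zero, zero_add, sub_add_eq_add_sub, h]

theorem barDiff_apply_nil (x : List I →₀ G) :
    (barDiff 𝒜 e Θ x) [] = wordSum Θ x := by
  have hp : ∀ (a : A) (x : List I →₀ G), (prep e G a x) [] = 0 := by
    intro a x
    induction a using basis_induction e with
    | h i =>
      induction x using Finsupp.induction_linear with
      | zero => simp
      | add x y hx hy => simp [hx, hy]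
      | single w g => rw [prep_single]; simp
    | zero => simp
    | add c c' h h' => simp [h, h']
    | smul r c h => simp [h]
  have hm : ∀ (a : A) (x : List I →₀ G), (merge 𝒜 e G a x) [] = 0 := by
    intro a x
    induction x using Finsupp.induction_linear with
    | zero => simp
    | add x y hx hy => simp [hx, hy]
    | single w g =>
      rcases w with _ | ⟨i, w⟩
      · simp [merge_nil]
      · rw [merge_cons, hp]
  induction x using Finsupp.induction_linear with
  | zero => simp
  | add x y hx hy => simp [hx, hy]
  | single w g =>
    rcases w with _ | ⟨i, w⟩
    · simp [barDiff_nil, wordSum_single]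
    · rw [← prep_single e, barDiff_prep]
      simp [hp, hm]

/-- If the unit is the first letter, merging it with `a` cancels the same term inside the
differential, and the rest still begins with a letter followed by the unit. If the unit comes later,
every term keeps it and the claim passes to the tail. -/
theorem merge_sub_prep_barDiff_mem (ho : e o = 1) (hΘ : ∀ w, o ∈ w → 2 ≤ w.length → Θ w = 0)
    (hΘ1 : Θ [o] = 1) (w : List I) (hw : o ∈ w) (a : A) (g : G) :
    merge 𝒜 e G a (Finsupp.single w g)
      - prep e G (𝒜.sign a) (barDiff 𝒜 e Θ (Finsupp.single w g)) ∈ unitWords Q G o := by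
  induction w generalizing a g with
  | nil => simp at hw
  | cons i w ih =>
    rw [← prep_single e]
    by_cases hi : i = o
    · subst hi
      rw [ho, merge_prep, mul_one, barDiff_prep_one 𝒜 e Θ ho hΘ hΘ1, map_sub, sub_sub_cancel]
      generalize barDiff 𝒜 e Θ (Finsupp.single w g) = x
      induction x using Finsupp.induction_linear with
      | zero => simp
      | add x y hx hy => rw [map_add, map_add]; exact add_mem hx hy
      | single v g' =>
        rw [← ho, prep_single]
        exact prep_mem_unitWords e _ (by simp) g'
    · have hw' : o ∈ w := by
        rcases List.mem_cons.1 hw with h | h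
        · exact absurd h.symm hi
        · exact h
      rw [merge_prep, barDiff_prep, prep_single, wordSum_single, hΘ (i :: w) (by simp [hw'])
        (by have := List.length_pos_of_mem hw'; simp only [List.length_cons]; omega)]
      have h1 := ih hw' (e i) g
      have h2 : -prep e G (𝒜.d (e i)) (Finsupp.single w g) + merge 𝒜 e G (e i) (Finsupp.single w g)
          - prep e G (𝒜.sign (e i)) (barDiff 𝒜 e Θ (Finsupp.single w g)) ∈ unitWords Q G o := by
        rw [add_sub_assoc]
        exact add_mem (neg_mem (prep_mem_unitWords e _ hw' g)) h1
      rw [LinearMap.zero_apply, Finsupp.single_zero, add_zero]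
      exact sub_mem (prep_mem_unitWords e _ hw' g) (prep_mem_unitWords' e _ h2)

/-- The twisting identity holds on words containing the unit. -/
theorem wordSum_barDiff_unit (ho : e o = 1) (hΘ : ∀ w, o ∈ w → 2 ≤ w.length → Θ w = 0)
    (hΘ1 : Θ [o] = 1) (w : List I) (hw : o ∈ w) (g : G) :
    wordSum Θ (barDiff 𝒜 e Θ (Finsupp.single w g)) = 0 := by
  rcases w with _ | ⟨i, w⟩
  · simp at hw
  by_cases hi : i = o
  · subst hi
    rw [← prep_single e, ho, barDiff_prep_one 𝒜 e Θ ho hΘ hΘ1, map_sub,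
      wordSum_prep_one e Θ ho hΘ hΘ1, barDiff_apply_nil, sub_self]
  · have hw' : o ∈ w := by
      rcases List.mem_cons.1 hw with h | h
      · exact absurd h.symm hi
      · exact h
    have h1 := merge_sub_prep_barDiff_mem 𝒜 e Θ ho hΘ hΘ1 w hw' (e i) g
    rw [← prep_single e, barDiff_prep, prep_single, wordSum_single, hΘ (i :: w) (by simp [hw'])
        (by have := List.length_pos_of_mem hw'; simp only [List.length_cons]; omega)]
    rw [LinearMap.zero_apply, Finsupp.single_zero, add_zero, add_sub_assoc]
    exact wordSum_unitWords Θ hΘ (add_mem (neg_mem (prep_mem_unitWords e _ hw' g)) h1)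

end Units

/-! ### Weights and degrees of words -/

section Weights

variable {Q : Type*} [CommRing Q] {A : Type*} [Ring A] [Algebra Q A] (𝒜 : DGStructure Q A)
  {I : Type*} (e : Basis I Q A) {G : Type*} [AddCommGroup G] [Module Q G]
  (δ : I → ℕ)

/-- The degree of a word in the bar construction. -/
def wordWt (δ : I → ℕ) (w : List I) : ℕ := (w.map fun i => δ i + 1).sum

theorem wordWt_nil : wordWt δ [] = 0 := rfl

theorem wordWt_cons (i : I) (w : List I) : wordWt δ (i :: w) = δ i + 1 + wordWt δ w := by
  simp [wordWt]

/-- The words of degree less than `m`. -/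
def wordsLT (Q : Type*) [CommRing Q] (G : Type*) [AddCommGroup G] [Module Q G] (m : ℤ) :
    Submodule Q (List I →₀ G) :=
  Submodule.span Q {x | ∃ (w : List I) (g : G), (wordWt δ w : ℤ) < m ∧ x = Finsupp.single w g}

/-- The grading of the module of words with coefficients in a graded module. -/
def wordsDeg (degG : ℤ → Submodule Q G) (q : ℤ) : Submodule Q (List I →₀ G) :=
  Submodule.span Q {x | ∃ (w : List I) (g : G), g ∈ degG (q - wordWt δ w) ∧ x = Finsupp.single w g}

variable {e δ}

theorem prep_mem_of_deg (he : ∀ i, e i ∈ 𝒜.deg (δ i)) {n : ℤ} {a : A} (ha : a ∈ 𝒜.deg n)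
    {S : Submodule Q (List I →₀ G)} {x : List I →₀ G}
    (h : ∀ i, (δ i : ℤ) = n → prep e G (e i) x ∈ S) : prep e G a x ∈ S := by
  rw [eq_span_of_basis e (fun i => (δ i : ℤ)) 𝒜.deg 𝒜.internal he] at ha
  refine (Submodule.span_le (p := S.comap ((prep e G).flip x))).2 ?_ ha
  rintro _ ⟨i, hi, rfl⟩
  exact h i hi

theorem prep_mem_wordsLT (he : ∀ i, e i ∈ 𝒜.deg (δ i)) {n m : ℤ} {a : A} (ha : a ∈ 𝒜.deg n)
    {x : List I →₀ G} (hx : x ∈ wordsLT δ Q G m) : prep e G a x ∈ wordsLT δ Q G (m + n + 1) := by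
  refine prep_mem_of_deg 𝒜 he ha fun i hi => ?_
  refine (Submodule.span_le (p := (wordsLT δ Q G (m + n + 1)).comap (prep e G (e i)))).2 ?_ hx
  rintro _ ⟨w, g, hw, rfl⟩
  rw [Submodule.comap_coe, Set.mem_preimage, prep_single]
  exact Submodule.subset_span ⟨i :: w, g, by rw [wordWt_cons]; push_cast; omega, rfl⟩

theorem prep_mem_wordsDeg (he : ∀ i, e i ∈ 𝒜.deg (δ i)) {degG : ℤ → Submodule Q G} {n q : ℤ} {a : A}
    (ha : a ∈ 𝒜.deg n) {x : List I →₀ G} (hx : x ∈ wordsDeg δ degG q) :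
    prep e G a x ∈ wordsDeg δ degG (q + n + 1) := by
  refine prep_mem_of_deg 𝒜 he ha fun i hi => ?_
  refine (Submodule.span_le (p := (wordsDeg δ degG (q + n + 1)).comap (prep e G (e i)))).2 ?_ hx
  rintro _ ⟨w, g, hg, rfl⟩
  rw [Submodule.comap_coe, Set.mem_preimage, prep_single]
  refine Submodule.subset_span ⟨i :: w, g, ?_, rfl⟩
  convert hg using 2
  rw [wordWt_cons]; push_cast; omega

theorem wordsLT_mono {m n : ℤ} (h : m ≤ n) :
    wordsLT δ Q G m ≤ wordsLT δ Q G n := by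
  refine Submodule.span_mono ?_
  rintro _ ⟨w, g, hw, rfl⟩
  exact ⟨w, g, lt_of_lt_of_le hw h, rfl⟩

theorem single_mem_wordsLT {m : ℤ} {w : List I} (h : (wordWt δ w : ℤ) < m) (g : G) :
    Finsupp.single w g ∈ wordsLT δ Q G m :=
  Submodule.subset_span ⟨w, g, h, rfl⟩

theorem single_mem_wordsDeg {degG : ℤ → Submodule Q G} {q : ℤ} {w : List I} {g : G}
    (h : g ∈ degG (q - wordWt δ w)) : Finsupp.single w g ∈ wordsDeg δ degG q :=
  Submodule.subset_span ⟨w, g, h, rfl⟩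

variable (Θ : List I → Module.End Q G)

/-- The bar differential of a word is, up to words of smaller degree, the differential of its
coefficient. -/
theorem barWord_sub_mem (he : ∀ i, e i ∈ 𝒜.deg (δ i)) (w : List I) (g : G) :
    barWord 𝒜 e Θ w g - sgn (wordWt δ w) • Finsupp.single w (Θ [] g)
      ∈ wordsLT δ Q G (wordWt δ w) := by
  induction w with
  | nil => simp [barWord, wordWt_nil, sgn_zero]
  | cons i w ih =>
    have h1 : prep e G (𝒜.d (e i)) (Finsupp.single w g) ∈ wordsLT δ Q G (wordWt δ (i :: w)) := by
      have := prep_mem_wordsLT 𝒜 he (𝒜.d_mem (he i))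
        (single_mem_wordsLT (Q := Q) (δ := δ) (w := w) (m := wordWt δ w + 1) (by omega) g)
      refine wordsLT_mono ?_ this
      rw [wordWt_cons]; push_cast; omega
    have h2 : merge 𝒜 e G (e i) (Finsupp.single w g) ∈ wordsLT δ Q G (wordWt δ (i :: w)) := by
      rcases w with _ | ⟨j, w⟩
      · simp [merge_nil]
      · rw [merge_cons]
        have := prep_mem_wordsLT 𝒜 he (𝒜.mul_mem (𝒜.sign_mem (he i)) (he j))
          (single_mem_wordsLT (Q := Q) (δ := δ) (w := w) (m := wordWt δ w + 1) (by omega) g)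
        refine wordsLT_mono ?_ this
        rw [wordWt_cons, wordWt_cons]; push_cast; omega
    have h3 := prep_mem_wordsLT 𝒜 he (𝒜.sign_mem (he i)) ih
    have h4 : Finsupp.single [] (Θ (i :: w) g) ∈ wordsLT δ Q G (wordWt δ (i :: w)) :=
      single_mem_wordsLT (by rw [wordWt_cons, wordWt_nil]; push_cast; omega) _
    have h5 := wordsLT_mono (Q := Q) (G := G) (δ := δ) (n := wordWt δ (i :: w))
      (by rw [wordWt_cons]; push_cast; omega) h3
    have e1 : prep e G (𝒜.sign (e i)) (sgn (wordWt δ w) • Finsupp.single w (Θ [] g))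
        = -(sgn (wordWt δ (i :: w)) • Finsupp.single (i :: w) (Θ [] g)) := by
      rw [map_zsmul, 𝒜.sign_of_mem (he i), map_zsmul, LinearMap.smul_apply, prep_single, smul_smul,
        wordWt_cons]
      push_cast
      rw [sgn_add, sgn_add, sgn_one, ← neg_smul]
      congr 1
      ring
    rw [map_sub, e1] at h5
    have := add_mem (sub_mem (add_mem (neg_mem h1) h2) h5) h4
    convert this using 1
    simp only [barWord, LinearMap.add_apply, LinearMap.sub_apply, LinearMap.neg_apply,
      LinearMap.comp_apply, Finsupp.lsingle_apply]
    abel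

theorem barWord_mem_wordsDeg (he : ∀ i, e i ∈ 𝒜.deg (δ i)) {degG : ℤ → Submodule Q G}
    (hΘ : ∀ w p, ∀ g ∈ degG p, Θ w g ∈ degG (p + wordWt δ w - 1)) (w : List I) {p : ℤ} {g : G}
    (hg : g ∈ degG p) : barWord 𝒜 e Θ w g ∈ wordsDeg δ degG (p + wordWt δ w - 1) := by
  have hs : ∀ w, Finsupp.single w g ∈ wordsDeg δ degG (p + wordWt δ w) := fun w =>
    single_mem_wordsDeg (by rwa [add_sub_cancel_right])
  have hn : ∀ w, Finsupp.single [] (Θ w g) ∈ wordsDeg δ degG (p + wordWt δ w - 1) := fun w =>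
    single_mem_wordsDeg (by rw [wordWt_nil, Nat.cast_zero, sub_zero]; exact hΘ w p g hg)
  induction w with
  | nil => exact hn []
  | cons i w ih =>
    simp only [barWord, LinearMap.add_apply, LinearMap.sub_apply, LinearMap.neg_apply,
      LinearMap.comp_apply, Finsupp.lsingle_apply]
    refine add_mem (sub_mem (add_mem (neg_mem ?_) ?_) ?_) (hn _)
    · convert prep_mem_wordsDeg 𝒜 he (𝒜.d_mem (he i)) (hs w) using 2
      rw [wordWt_cons]; push_cast; ring
    · rcases w with _ | ⟨j, w⟩
      · simp [merge_nil]
      · rw [merge_cons]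
        convert prep_mem_wordsDeg 𝒜 he (𝒜.mul_mem (𝒜.sign_mem (he i)) (he j)) (hs w) using 2
        rw [wordWt_cons, wordWt_cons]; push_cast; ring
    · convert prep_mem_wordsDeg 𝒜 he (𝒜.sign_mem (he i)) ih using 2
      rw [wordWt_cons]; push_cast; ring

theorem wordSum_mem {degG : ℤ → Submodule Q G}
    (hΘ : ∀ w p, ∀ g ∈ degG p, Θ w g ∈ degG (p + wordWt δ w - 1)) {q : ℤ} {x : List I →₀ G}
    (hx : x ∈ wordsDeg δ degG q) : wordSum Θ x ∈ degG (q - 1) := by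
  refine (Submodule.span_le (p := (degG (q - 1)).comap (wordSum Θ))).2 ?_ hx
  rintro _ ⟨w, g, hg, rfl⟩
  rw [Submodule.comap_coe, Set.mem_preimage, wordSum_single]
  change Θ w g ∈ degG (q - 1)
  convert hΘ w _ g hg using 2
  ring

end Weights

end AInfKoszul

end

noncomputable section

namespace AInfKoszul

open Module

/-! ### Obstruction theory for twisting families -/

section Construction

variable {Q : Type*} [CommRing Q] {A : Type*} [Ring A] [Algebra Q A] (𝒜 : DGStructure Q A)
  {I : Type*} (e : Basis I Q A) (o : I) (δ : I → ℕ)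
  {G : Type*} [AddCommGroup G] [Module Q G] {M : Type*} [AddCommGroup M] [Module Q M]
  (degG : ℤ → Submodule Q G) (dG : G →ₗ[Q] G) (γ : G →ₗ[Q] M)

/-- A strictly unital twisting family of operators on `G` that lie over zero on `M`, for which the
twisting identity holds on words of degree at most `m`. -/
structure IsTwistingFamily (m : ℕ) (Θ : List I → Module.End Q G) : Prop where
  nil : Θ [] = dG
  unit_one : Θ [o] = 1
  unit : ∀ w, o ∈ w → 2 ≤ w.length → Θ w = 0
  deg : ∀ w p, ∀ g ∈ degG p, Θ w g ∈ degG (p + wordWt δ w - 1)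
  aug : ∀ w, w ≠ [] → w ≠ [o] → γ ∘ₗ Θ w = 0
  mc : ∀ w, wordWt δ w ≤ m → ∀ g, wordSum Θ (barDiff 𝒜 e Θ (Finsupp.single w g)) = 0

variable {𝒜 e o δ degG dG γ}

theorem IsTwistingFamily.barDiff_barDiff {m : ℕ} {Θ : List I → Module.End Q G}
    (h : IsTwistingFamily 𝒜 e o δ degG dG γ m Θ) (hd : ∀ g, dG (dG g) = 0) (w : List I)
    (hw : wordWt δ w ≤ m) (g : G) :
    barDiff 𝒜 e Θ (barDiff 𝒜 e Θ (Finsupp.single w g)) = 0 := by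
  induction w with
  | nil => simp [barDiff_nil, h.nil, hd]
  | cons i w ih =>
    have hw' := hw
    rw [wordWt_cons] at hw'
    rw [← prep_single e, barDiff_barDiff_prep, ih (by omega), prep_single, h.mc _ hw]
    simp

/-- The defect of the twisting identity on a word is a cycle. -/
theorem IsTwistingFamily.comm_defect {m : ℕ} {Θ : List I → Module.End Q G}
    (h : IsTwistingFamily 𝒜 e o δ degG dG γ m Θ) (he : ∀ i, e i ∈ 𝒜.deg (δ i))
    (hd : ∀ g, dG (dG g) = 0) (w : List I) (hw : wordWt δ w = m + 1) (g : G) :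
    dG (wordSum Θ (barDiff 𝒜 e Θ (Finsupp.single w g)))
      = sgn (wordWt δ w) • wordSum Θ (barDiff 𝒜 e Θ (Finsupp.single w (dG g))) := by
  -- In the first degree not covered by the family, the square of the bar differential is the
  -- defect, placed in the empty word.
  have hsq : ∀ g, barDiff 𝒜 e Θ (barDiff 𝒜 e Θ (Finsupp.single w g))
      = Finsupp.single [] (wordSum Θ (barDiff 𝒜 e Θ (Finsupp.single w g))) := by
    intro g
    rcases w with _ | ⟨i, w⟩
    · simp [wordWt_nil] at hw
    · rw [wordWt_cons] at hw
      rw [← prep_single e, barDiff_barDiff_prep, h.barDiff_barDiff hd w (by omega)]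
      simp
  have hlow : ∀ x ∈ wordsLT δ Q G (m + 1), barDiff 𝒜 e Θ (barDiff 𝒜 e Θ x) = 0 := by
    intro x hx
    refine (Submodule.span_le (p := LinearMap.ker (barDiff 𝒜 e Θ ∘ₗ barDiff 𝒜 e Θ))).2 ?_ hx
    rintro _ ⟨v, g, hv, rfl⟩
    exact h.barDiff_barDiff hd v (by omega) g
  -- The third power of `barDiff` is evaluated in two ways. The differential of `w ⊗ g` is `± w ⊗ dG
  -- g` plus words of smaller degree, on which the square vanishes; comparing gives the commutation
  -- of the defect with `dG`.
  have h1 := hlow _ (by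
    have := barWord_sub_mem 𝒜 Θ he w g
    rwa [hw, ← hw, hw] at this)
  rw [map_sub, map_sub, map_zsmul, map_zsmul, ← barDiff_single, h.nil, hsq g, hsq (dG g), sub_eq_zero,
    barDiff_nil, h.nil] at h1
  have h2 := DFunLike.congr_fun h1 []
  rw [hw]
  simpa using h2

theorem repr_eq_zero_of_deg (he : ∀ i, e i ∈ 𝒜.deg (δ i)) {n : ℤ} {a : A} (ha : a ∈ 𝒜.deg n)
    {i : I} (hi : (δ i : ℤ) ≠ n) : e.repr a i = 0 := by
  rw [eq_span_of_basis e (fun i => (δ i : ℤ)) 𝒜.deg 𝒜.internal he, Basis.mem_span_image] at ha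
  by_contra h
  exact hi (ha (Finsupp.mem_support_iff.2 h))

/-- Among nonempty words only `[o]` survives `γ`. Hence only the coefficient of `1` in the first
letter and the empty-word component of the rest are seen. -/
theorem IsTwistingFamily.aug_prep {m : ℕ} {Θ : List I → Module.End Q G}
    (h : IsTwistingFamily 𝒜 e o δ degG dG γ m Θ) (a : A) (x : List I →₀ G) :
    γ (wordSum Θ (prep e G a x)) = e.repr a o • γ (x []) := by
  induction a using basis_induction e with
  | h i =>
    induction x using Finsupp.induction_linear with
    | zero => simp
    | add x y hx hy => simp only [map_add, hx, hy, Finsupp.add_apply, smul_add]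
    | single w g =>
      rw [prep_single, wordSum_single]
      by_cases hi : [i] = [o]
      · obtain rfl : i = o := by simpa using hi
        rcases w with _ | ⟨j, w⟩
        · simp [h.unit_one]
        · rw [h.unit _ (by simp) (by simp)]; simp
      · have hio : i ≠ o := by simpa using hi
        have : γ (Θ (i :: w) g) = 0 :=
          LinearMap.congr_fun (h.aug (i :: w) (by simp) (by simp [hio])) g
        simp [this, Finsupp.single_apply, hio]
  | zero => simp
  | add c c' h h' => simp [h, h', add_smul]
  | smul r c h => simp [h, smul_smul]

/-- The defect of the twisting identity lies over zero. -/
theorem IsTwistingFamily.aug_defect {m : ℕ} {Θ : List I → Module.End Q G}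
    (h : IsTwistingFamily 𝒜 e o δ degG dG γ m Θ) (he : ∀ i, e i ∈ 𝒜.deg (δ i))
    (hδo : δ o = 0) (hδ : ∀ i ≠ o, 0 < δ i)
    (hann : ∀ i (x : M), e.repr (𝒜.d (e i)) o • x = 0) {dM : M →ₗ[Q] M}
    (hγ : ∀ g, γ (dG g) = dM (γ g)) (w : List I) (hw : w ≠ []) (hwo : o ∉ w) (g : G) :
    γ (wordSum Θ (barDiff 𝒜 e Θ (Finsupp.single w g))) = 0 := by
  rcases w with _ | ⟨i, w⟩
  · exact absurd rfl hw
  have hio : i ≠ o := fun hi => hwo (by simp [hi])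
  have hpos := hδ i hio
  have h1 : γ (Θ (i :: w) g) = 0 :=
    LinearMap.congr_fun (h.aug (i :: w) hw (by simp [hio])) g
  have h2 : e.repr (𝒜.sign (e i)) o = 0 :=
    repr_eq_zero_of_deg he (𝒜.sign_mem (he i)) (by omega)
  have h3 : γ (wordSum Θ (merge 𝒜 e G (e i) (Finsupp.single w g))) = 0 := by
    rcases w with _ | ⟨j, w⟩
    · simp [merge_nil]
    · rw [merge_cons, h.aug_prep,
        repr_eq_zero_of_deg he (𝒜.mul_mem (𝒜.sign_mem (he i)) (he j)) (by omega), zero_smul]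
  -- The letter itself and its products have positive degree, hence no unit coefficient. The unit
  -- coefficient of its differential annihilates `M` by `hann`.
  rw [← prep_single e, barDiff_prep]
  simp only [map_add, map_sub, map_neg, h.aug_prep, h2, h3, hann, prep_single,
    wordSum_single, h.nil, hγ, h1]
  simp

theorem barWord_congr {Θ Θ' : List I → Module.End Q G} {m : ℕ}
    (h : ∀ w, wordWt δ w ≤ m → Θ' w = Θ w) (w : List I) (hw : wordWt δ w ≤ m) :
    barWord 𝒜 e Θ' w = barWord 𝒜 e Θ w := by
  induction w with
  | nil => rw [barWord, barWord, h _ hw]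
  | cons i w ih =>
    have hw' := hw
    rw [wordWt_cons] at hw'
    rw [barWord, barWord, h _ hw, ih (by omega)]

theorem wordSum_congr {Θ Θ' : List I → Module.End Q G} {m : ℤ}
    (h : ∀ w, (wordWt δ w : ℤ) < m → Θ' w = Θ w) {x : List I →₀ G} (hx : x ∈ wordsLT δ Q G m) :
    wordSum Θ' x = wordSum Θ x := by
  refine LinearMap.eqOn_span (f := wordSum Θ') (g := wordSum Θ) ?_ hx
  rintro _ ⟨w, g, hw, rfl⟩
  rw [wordSum_single, wordSum_single, h w hw]

/-- A twisting family can be corrected in the next degree. -/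
theorem IsTwistingFamily.exists_succ {m : ℕ} {Θ : List I → Module.End Q G}
    (h : IsTwistingFamily 𝒜 e o δ degG dG γ m Θ) (he : ∀ i, e i ∈ 𝒜.deg (δ i)) (ho : e o = 1)
    (hδo : δ o = 0) (hδ : ∀ i ≠ o, 0 < δ i)
    (hann : ∀ i (x : M), e.repr (𝒜.d (e i)) o • x = 0) {degM : ℤ → Submodule Q M}
    {dM : M →ₗ[Q] M} (hM : DirectSum.IsInternal degM)
    (hγ : IsSemifreeResolution degG dG degM dM γ) :
    ∃ Θ', IsTwistingFamily 𝒜 e o δ degG dG γ (m + 1) Θ' ∧ ∀ w, wordWt δ w ≤ m → Θ' w = Θ w := by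
  classical
  have hd := hγ.semifree.d_d
  -- The correction of degree `wordWt δ w - 1` is a null-homotopy of minus the defect, which has
  -- degree `wordWt δ w - 2`. Words with the unit, and words of another degree, receive no
  -- correction.
  have hex : ∀ w : List I, ∃ η : Module.End Q G, wordWt δ w = m + 1 → o ∉ w →
      (∀ p, ∀ g ∈ degG p, η g ∈ degG (p + wordWt δ w - 1)) ∧ γ ∘ₗ η = 0 ∧
      ∀ g, wordSum Θ (barDiff 𝒜 e Θ (Finsupp.single w g)) + dG (η g)
        + sgn (wordWt δ w) • η (dG g) = 0 := by
    intro w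
    by_cases hw : wordWt δ w = m + 1 ∧ o ∉ w
    · obtain ⟨hw, hwo⟩ := hw
      let O : G →ₗ[Q] G := -(wordSum Θ ∘ₗ barWord 𝒜 e Θ w)
      have hO : ∀ g, O g = -wordSum Θ (barDiff 𝒜 e Θ (Finsupp.single w g)) := fun g => by
        simp [O, barDiff_single]
      have hsg : sgn ((wordWt δ w : ℤ) - 2) = sgn (wordWt δ w) := by
        rw [sub_eq_add_neg, sgn_add, show sgn (-2) = 1 by rfl, mul_one]
      obtain ⟨η, h1, h2, h3⟩ := hγ.exists_homotopy hM ((wordWt δ w : ℤ) - 2) O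
        (fun p g hg => by
          rw [hO, barDiff_single]
          have := neg_mem (wordSum_mem Θ h.deg (barWord_mem_wordsDeg 𝒜 Θ he h.deg w hg))
          convert this using 2
          ring)
        (LinearMap.ext fun g => by
          rw [LinearMap.comp_apply, hO, map_neg, h.aug_defect he hδo hδ hann hγ.comm w
            (by rintro rfl; simp [wordWt_nil] at hw) hwo]
          simp)
        (LinearMap.ext fun g => by
          rw [LinearMap.comp_apply, hO, map_neg, h.comm_defect he hd w hw, hsg,
            LinearMap.smul_apply, LinearMap.comp_apply, hO, smul_neg])
      refine ⟨η, fun _ _ => ⟨fun p g hg => ?_, h2, fun g => ?_⟩⟩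
      · convert h1 p g hg using 2
        ring
      · have := LinearMap.congr_fun h3 g
        rw [hO, hsg] at this
        rw [add_assoc, show dG (η g) + sgn (wordWt δ w) • η (dG g) = _ from this, add_neg_cancel]
    · exact ⟨0, fun h1 h2 => absurd ⟨h1, h2⟩ hw⟩
  choose η hη using hex
  let Θ' : List I → Module.End Q G := fun w =>
    if wordWt δ w = m + 1 ∧ o ∉ w then Θ w + η w else Θ w
  have hlow : ∀ w, wordWt δ w ≤ m → Θ' w = Θ w := fun w hw => by
    simp only [Θ']
    rw [if_neg (by omega)]
  have hnil : Θ' [] = dG := by rw [hlow _ (by simp [wordWt_nil]), h.nil]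
  have hunit1 : Θ' [o] = 1 := by
    simp only [Θ']
    rw [if_neg (by simp), h.unit_one]
  have hunit : ∀ w, o ∈ w → 2 ≤ w.length → Θ' w = 0 := fun w hw hl => by
    simp only [Θ']
    rw [if_neg (by simp [hw]), h.unit w hw hl]
  refine ⟨Θ', ⟨hnil, hunit1, hunit, fun w p g hg => ?_, fun w h0 h1 => ?_, fun w hw g => ?_⟩, hlow⟩
  · simp only [Θ']
    split_ifs with hw
    · exact add_mem (h.deg w p g hg) ((hη w hw.1 hw.2).1 p g hg)
    · exact h.deg w p g hg
  · simp only [Θ']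
    split_ifs with hw
    · rw [LinearMap.comp_add, h.aug w h0 h1, (hη w hw.1 hw.2).2.1, add_zero]
    · exact h.aug w h0 h1
  -- For words containing the unit the twisting identity follows from strict unitality alone,
  -- whatever the other operators are.
  · by_cases hwo : o ∈ w
    · exact wordSum_barDiff_unit 𝒜 e Θ' ho hunit hunit1 w hwo g
    rcases Nat.lt_or_ge m (wordWt δ w) with hm | hm
    · have hwm : wordWt δ w = m + 1 := by omega
      obtain ⟨-, -, h3⟩ := hη w hwm hwo
      have hΘ' : Θ' w = Θ w + η w := if_pos ⟨hwm, hwo⟩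
      -- All proper suffixes have degree at most `m`, where nothing changed, so the differential of
      -- the word itself is altered only by the new empty-word component.
      have h4 : barWord 𝒜 e Θ' w g = barWord 𝒜 e Θ w g + Finsupp.single [] (η w g) := by
        rcases w with _ | ⟨i, w⟩
        · simp [wordWt_nil] at hwm
        · rw [barWord, barWord, barWord_congr (δ := δ) hlow w (by rw [wordWt_cons] at hwm; omega),
            hΘ']
          simp only [LinearMap.add_apply, LinearMap.comp_apply, Finsupp.lsingle_apply,
            Finsupp.single_add]
          abel
      have h5 := barWord_sub_mem 𝒜 Θ he w g
      -- After the leading term `± w ⊗ dG g` is removed, only words of degree at most `m` remain.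
      -- The leading term is what produces `η w (dG g)` in the homotopy equation.
      have h6 : wordSum Θ' (barWord 𝒜 e Θ w g - sgn (wordWt δ w) • Finsupp.single w (Θ [] g))
          = wordSum Θ (barWord 𝒜 e Θ w g - sgn (wordWt δ w) • Finsupp.single w (Θ [] g)) :=
        wordSum_congr (fun v hv => hlow v (by omega)) h5
      rw [map_sub, map_sub, map_zsmul, map_zsmul, wordSum_single, wordSum_single, hΘ', h.nil,
        sub_eq_iff_eq_add] at h6
      rw [barDiff_single, h4, map_add, h6, wordSum_single, hnil, ← h3 g, barDiff_single,
        LinearMap.add_apply, smul_add]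
      abel
    · rw [barDiff_single, barWord_congr (δ := δ) hlow w hm, ← barDiff_single]
      rw [← h.mc w hm g]
      refine wordSum_congr (δ := δ) (m := m + 1) (fun v hv => hlow v (by omega)) ?_
      have h5 := barWord_sub_mem 𝒜 Θ he w g
      rw [barDiff_single]
      have h7 : sgn (wordWt δ w) • Finsupp.single w (Θ [] g) ∈ wordsLT δ Q G (m + 1) :=
        zsmul_mem (single_mem_wordsLT (by omega) _) _
      have := add_mem (wordsLT_mono (n := m + 1) (by omega) h5) h7
      rwa [sub_add_cancel] at this

/-- Successive corrections do not change operators in degrees already treated. Every word has finite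
degree, so the corrections stabilise word by word and the limiting family satisfies all identities.
-/
theorem exists_isTwistingFamily (he : ∀ i, e i ∈ 𝒜.deg (δ i)) (ho : e o = 1)
    (hδo : δ o = 0) (hδ : ∀ i ≠ o, 0 < δ i)
    (hann : ∀ i (x : M), e.repr (𝒜.d (e i)) o • x = 0) {degM : ℤ → Submodule Q M}
    {dM : M →ₗ[Q] M} (hM : DirectSum.IsInternal degM)
    (hγ : IsSemifreeResolution degG dG degM dM γ) :
    ∃ Θ, ∀ m, IsTwistingFamily 𝒜 e o δ degG dG γ m Θ := by
  classical
  -- To start, only the differential and the action of the unit are prescribed. Each letter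
  -- contributes at least one to the degree, so the empty word is the only one of degree zero, and
  -- its identity is `dG² = 0`.
  have h0 : ∃ Θ, IsTwistingFamily 𝒜 e o δ degG dG γ 0 Θ := by
    refine ⟨fun w => if w = [] then dG else if w = [o] then 1 else 0, by simp, by simp,
      fun w hw hl => ?_, fun w p g hg => ?_, fun w h1 h2 => by simp [h1, h2], fun w hw g => ?_⟩
    · rw [if_neg (by rintro rfl; simp at hl), if_neg (by rintro rfl; simp at hl)]
    · split_ifs with h1 h2
      · subst h1
        rw [wordWt_nil]
        convert hγ.semifree.d_mem hg using 2
        push_cast; ring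
      · subst h2
        rw [wordWt_cons, wordWt_nil, hδo, Module.End.one_apply]
        convert hg using 2
        push_cast; ring
      · exact zero_mem _
    · rcases w with _ | ⟨i, w⟩
      · simp [barDiff_nil, wordSum_single, hγ.semifree.d_d]
      · rw [wordWt_cons] at hw; omega
  obtain ⟨Θ0, h0⟩ := h0
  choose! s hs hs' using fun (m : ℕ) (Θ : List I → Module.End Q G)
    (h : IsTwistingFamily 𝒜 e o δ degG dG γ m Θ) => h.exists_succ he ho hδo hδ hann hM hγ
  let T : ℕ → List I → Module.End Q G := fun n => Nat.rec Θ0 (fun m Θ => s m Θ) n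
  have hT : ∀ n, IsTwistingFamily 𝒜 e o δ degG dG γ n (T n) := by
    intro n
    induction n with
    | zero => exact h0
    | succ n ih => exact hs n _ ih
  have hst : ∀ n k w, wordWt δ w ≤ n → T (n + k) w = T n w := by
    intro n k w hw
    induction k with
    | zero => rfl
    | succ k ih => exact (hs' (n + k) _ (hT _) w (by omega)).trans ih
  let Θ : List I → Module.End Q G := fun w => T (wordWt δ w) w
  have hΘ : ∀ n w, wordWt δ w ≤ n → Θ w = T n w := fun n w hw => by
    obtain ⟨k, rfl⟩ := Nat.exists_eq_add_of_le hw
    exact (hst _ k w le_rfl).symm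
  refine ⟨Θ, fun m => ⟨?_, ?_, fun w hw hl => ?_, fun w p g hg => ?_, fun w h1 h2 => ?_,
    fun w hw g => ?_⟩⟩
  · exact (hT (wordWt δ [])).nil
  · exact (hT (wordWt δ [o])).unit_one
  · exact (hT _).unit w hw hl
  · exact (hT _).deg w p g hg
  · exact (hT _).aug w h1 h2
  · have hc : ∀ w, wordWt δ w ≤ m → T m w = Θ w := fun w hw => (hΘ m w hw).symm
    rw [← (hT m).mc w hw g, barDiff_single, barDiff_single, ← barWord_congr (δ := δ) hc w hw]
    refine wordSum_congr (δ := δ) (m := m + 1) (fun v hv => (hc v (by omega)).symm) ?_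
    have h5 := barWord_sub_mem 𝒜 (T m) he w g
    have h7 : sgn (wordWt δ w) • Finsupp.single w (T m [] g) ∈ wordsLT δ Q G (m + 1) :=
      zsmul_mem (single_mem_wordsLT (by omega) _) _
    have := add_mem (wordsLT_mono (n := m + 1) (by omega) h5) h7
    rwa [sub_add_cancel] at this

end Construction

end AInfKoszul

end

noncomputable section

namespace AInfKoszul

open Module

/-! ### Signs of desuspensions -/

section Signs

/-- The exponent of the sign of `(s⁻¹)^{⊗ n}`. -/
def desuspExp : ℕ → (ℕ → ℤ) → ℤ
  | 0, _ => 0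
  | n + 1, δ => n * δ 0 + desuspExp n fun i => δ (i + 1)

theorem insertOp_zero {A : Type*} (a : ℕ → A) (r s : ℕ) (x : A) :
    insertOp a (r + 1) s x 0 = a 0 := by
  simp [insertOp]

theorem insertOp_shift {A : Type*} (a : ℕ → A) (r s : ℕ) (x : A) :
    (fun i => insertOp a (r + 1) s x (i + 1)) = insertOp (fun i => a (i + 1)) r s x := by
  funext i
  simp only [insertOp, add_lt_add_iff_right, add_left_inj]
  split_ifs with h1 h2
  · rfl
  · rfl
  · congr 1; omega

theorem insertOp_zero_shift {A : Type*} (a : ℕ → A) (s : ℕ) (hs : 1 ≤ s) (x : A) :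
    (fun i => insertOp a 0 s x (i + 1)) = fun i => a (i + s) := by
  funext i
  simp only [insertOp]
  simp only [not_lt_zero, if_false, Nat.succ_ne_zero]
  congr 1; omega

theorem insertOp_zero_self {A : Type*} (a : ℕ → A) (s : ℕ) (x : A) : insertOp a 0 s x 0 = x := by
  simp [insertOp]

/-- The exponent is `∑ (n - 1 - j) δ_j`, so lowering `δ_r` by one lowers it by the coefficient of
`δ_r`. This and the next two lemmas compare the sign of `(s⁻¹)^{⊗ n}` before and after an inner
`m_1`, after an inner `m_2`, and after splitting the arguments in two. -/
theorem desuspExp_one (r n : ℕ) (hr : r < n) (δ : ℕ → ℤ) :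
    desuspExp n (insertOp δ r 1 (δ r - 1)) = desuspExp n δ - (n - 1 - r) := by
  induction r generalizing n δ with
  | zero =>
    obtain ⟨n, rfl⟩ : ∃ m, n = m + 1 := ⟨n - 1, by omega⟩
    rw [desuspExp, desuspExp, insertOp_zero_self, insertOp_zero_shift _ _ le_rfl]
    push_cast; ring
  | succ r ih =>
    obtain ⟨n, rfl⟩ : ∃ m, n = m + 1 := ⟨n - 1, by omega⟩
    have := ih n (by omega) fun i => δ (i + 1)
    rw [desuspExp, desuspExp, insertOp_zero, insertOp_shift, this]
    push_cast; ring

theorem desuspExp_two (r n : ℕ) (hr : r < n) (δ : ℕ → ℤ) :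
    desuspExp n (insertOp δ r 2 (δ r + δ (r + 1)))
      = desuspExp (n + 1) δ - ∑ i ∈ Finset.range r, δ i - δ r := by
  induction r generalizing n δ with
  | zero =>
    obtain ⟨n, rfl⟩ : ∃ m, n = m + 1 := ⟨n - 1, by omega⟩
    rw [desuspExp, desuspExp, desuspExp, insertOp_zero_self,
      insertOp_zero_shift _ _ (by norm_num)]
    push_cast
    simp only [Finset.range_zero, Finset.sum_empty]
    ring_nf
  | succ r ih =>
    obtain ⟨n, rfl⟩ : ∃ m, n = m + 1 := ⟨n - 1, by omega⟩
    have := ih n (by omega) fun i => δ (i + 1)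
    rw [desuspExp, desuspExp, insertOp_zero, insertOp_shift, this, Finset.sum_range_succ']
    push_cast; ring

theorem desuspExp_add (r n : ℕ) (hr : r ≤ n) (δ : ℕ → ℤ) :
    desuspExp n δ = desuspExp r δ + (n - r) * ∑ i ∈ Finset.range r, δ i
      + desuspExp (n - r) fun j => δ (r + j) := by
  induction r generalizing n δ with
  | zero => simp [desuspExp]
  | succ r ih =>
    obtain ⟨n, rfl⟩ : ∃ m, n = m + 1 := ⟨n - 1, by omega⟩
    have := ih n (by omega) fun i => δ (i + 1)
    rw [desuspExp, desuspExp, this, Finset.sum_range_succ', Nat.succ_sub_succ]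
    have e : (fun j => δ (r + j + 1)) = fun j => δ (r + 1 + j) := by
      funext j; congr 1; omega
    rw [e]
    push_cast; ring

/-- For a dg algebra the inner operation of a Stasheff term is `m_1` or `m_2`, so the sum over its
arity has at most two terms. -/
theorem sum_Icc_eq_of_three_le {X : Type*} [AddCommMonoid X] (f : ℕ → X)
    (k : ℕ)
    (hf : ∀ s, 3 ≤ s → s ≤ k → f s = 0) :
    ∑ s ∈ Finset.Icc 1 k, f s = (if 1 ≤ k then f 1 else 0) + if 2 ≤ k then f 2 else 0 := by
  induction k with
  | zero => simp
  | succ k ih =>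
    rw [Finset.sum_Icc_succ_top (by omega), ih fun s hs hk => hf s hs (by omega)]
    rcases k with _ | _ | k
    · simp
    · simp
    · rw [hf (k + 1 + 1 + 1) (by omega) le_rfl]
      simp

theorem sgn_eq_of_even {i j : ℤ} (h : Even (i - j)) : sgn i = sgn j := by
  obtain ⟨k, hk⟩ := h
  have : i = j + 2 * k := by omega
  rw [this, sgn_add, sgn_two_mul, mul_one]

end Signs

/-! ### From twisting families to Stasheff identities -/

section SeqWord

variable {Q : Type*} [CommRing Q] {A : Type*} [Ring A] [Algebra Q A] (𝒜 : DGStructure Q A)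
  {I : Type*} (e : Basis I Q A) {G : Type*} [AddCommGroup G] [Module Q G]

/-- The word `a_0 ⋯ a_{n-1}` with coefficient `g`. -/
def seqWord : ℕ → (ℕ → A) → G → (List I →₀ G)
  | 0, _, g => Finsupp.single [] g
  | n + 1, a, g => prep e G (a 0) (seqWord n (fun i => a (i + 1)) g)

/-- The recursion for the bar differential unrolls into three groups: differentiate a letter,
multiply two neighbours, or apply `Θ` to a tail. The sign in front comes from passing the earlier
letters, which have degree `|a_i| + 1` after suspension. These groups are the three kinds of terms
of the Stasheff identity. -/
theorem barDiff_seqWord (Θ : List I → Module.End Q G) (n : ℕ) (a : ℕ → A) (δ : ℕ → ℤ)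
    (ha : ∀ i, a i ∈ 𝒜.deg (δ i)) (g : G) :
    barDiff 𝒜 e Θ (seqWord e n a g)
      = ∑ r ∈ Finset.range n, -(sgn (∑ i ∈ Finset.range r, (δ i + 1)) •
          seqWord e n (insertOp a r 1 (𝒜.d (a r))) g)
        + ∑ r ∈ Finset.range (n - 1), sgn (∑ i ∈ Finset.range r, (δ i + 1)) •
          sgn (δ r) • seqWord e (n - 1) (insertOp a r 2 (a r * a (r + 1))) g
        + ∑ r ∈ Finset.range (n + 1), sgn (∑ i ∈ Finset.range r, (δ i + 1)) •
          seqWord e r a (wordSum Θ (seqWord e (n - r) (fun j => a (r + j)) g)) := by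
  induction n generalizing a δ with
  | zero => simp [seqWord, barDiff_nil, wordSum_single, sgn_zero]
  | succ n ih =>
    have h := ih (fun i => a (i + 1)) (fun i => δ (i + 1)) fun i => ha (i + 1)
    have e1 : ∀ x : List I →₀ G, -prep e G (𝒜.sign (a 0)) x = sgn (δ 0 + 1) • prep e G (a 0) x := by
      intro x
      rw [𝒜.sign_of_mem (ha 0), map_zsmul, sgn_add, sgn_one, mul_neg_one, neg_smul]
      rfl
    have e2 : ∀ r, sgn (∑ i ∈ Finset.range (r + 1), (δ i + 1))
        = sgn (δ 0 + 1) * sgn (∑ i ∈ Finset.range r, (δ (i + 1) + 1)) := by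
      intro r
      rw [Finset.sum_range_succ', add_comm, sgn_add]
    have e3 : ∀ r, (fun j => a (r + 1 + j)) = fun j => a (r + j + 1) := by
      intro r; funext j; congr 1; omega
    have hm : merge 𝒜 e G (a 0) (seqWord e n (fun i => a (i + 1)) g)
        + sgn (δ 0 + 1) • prep e G (a 0) (∑ r ∈ Finset.range (n - 1),
          sgn (∑ i ∈ Finset.range r, (δ (i + 1) + 1)) • sgn (δ (r + 1)) •
          seqWord e (n - 1) (insertOp (fun i => a (i + 1)) r 2 (a (r + 1) * a (r + 1 + 1))) g)
        = ∑ r ∈ Finset.range n, sgn (∑ i ∈ Finset.range r, (δ i + 1)) •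
          sgn (δ r) • seqWord e n (insertOp a r 2 (a r * a (r + 1))) g := by
      rcases n with _ | n
      · simp [seqWord, merge_nil]
      · rw [Finset.sum_range_succ', map_sum, Finset.smul_sum, add_comm]
        congr 1
        · refine Finset.sum_congr rfl fun r _ => ?_
          rw [e2, map_zsmul, map_zsmul, smul_smul, seqWord, insertOp_zero, insertOp_shift]
          rfl
        · simp only [Finset.range_zero, Finset.sum_empty, sgn_zero, one_smul, seqWord, merge_prep,
            insertOp_zero_self, insertOp_zero_shift a 2 (by norm_num)]
          rw [𝒜.sign_of_mem (ha 0), smul_mul_assoc, map_zsmul]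
          rfl
    have hd : -prep e G (𝒜.d (a 0)) (seqWord e n (fun i => a (i + 1)) g)
        + sgn (δ 0 + 1) • prep e G (a 0) (∑ r ∈ Finset.range n,
          -(sgn (∑ i ∈ Finset.range r, (δ (i + 1) + 1)) •
          seqWord e n (insertOp (fun i => a (i + 1)) r 1 (𝒜.d (a (r + 1)))) g))
        = ∑ r ∈ Finset.range (n + 1), -(sgn (∑ i ∈ Finset.range r, (δ i + 1)) •
          seqWord e (n + 1) (insertOp a r 1 (𝒜.d (a r))) g) := by
      rw [Finset.sum_range_succ', map_sum, Finset.smul_sum, add_comm]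
      congr 1
      · refine Finset.sum_congr rfl fun r _ => ?_
        rw [e2, map_neg, smul_neg, map_zsmul, smul_smul, seqWord, insertOp_zero, insertOp_shift]
      · simp only [Finset.range_zero, Finset.sum_empty, sgn_zero, one_smul, seqWord,
            insertOp_zero_self, insertOp_zero_shift a 1 le_rfl]
    have hc : sgn (δ 0 + 1) • prep e G (a 0) (∑ r ∈ Finset.range (n + 1),
          sgn (∑ i ∈ Finset.range r, (δ (i + 1) + 1)) • seqWord e r (fun i => a (i + 1))
            (wordSum Θ (seqWord e (n - r) (fun j => a (r + j + 1)) g)))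
        + Finsupp.single [] (wordSum Θ (seqWord e (n + 1) a g))
        = ∑ r ∈ Finset.range (n + 1 + 1), sgn (∑ i ∈ Finset.range r, (δ i + 1)) •
          seqWord e r a (wordSum Θ (seqWord e (n + 1 - r) (fun j => a (r + j)) g)) := by
      rw [Finset.sum_range_succ' _ (n + 1), map_sum, Finset.smul_sum]
      congr 1
      · refine Finset.sum_congr rfl fun r _ => ?_
        rw [e2, map_zsmul, smul_smul, seqWord, e3, Nat.succ_sub_succ]
      · simp [seqWord, sgn_zero]
    rw [seqWord, barDiff_prep, sub_eq_add_neg, e1, h, ← hd, ← hc]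
    rw [Nat.add_sub_cancel, ← hm]
    simp only [map_add, smul_add, seqWord]
    abel

theorem seqWord_sign (n : ℕ) (a : ℕ → A) (δ : ℕ → ℤ) (ha : ∀ i, a i ∈ 𝒜.deg (δ i)) (g : G) :
    seqWord e n (fun j => (𝒜.sign ^ (n - 1 - j)) (a j)) g
      = sgn (desuspExp n δ) • seqWord e n a g := by
  have hp : ∀ k i : ℕ, (𝒜.sign ^ k) (a i) = sgn (k * δ i) • a i := by
    intro k i
    induction k with
    | zero => simp [sgn_zero]
    | succ k ih =>
      rw [pow_succ', Module.End.mul_apply, ih, map_zsmul, 𝒜.sign_of_mem (ha i), smul_smul, ← sgn_add]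
      congr 2
      push_cast; ring
  induction n generalizing a δ with
  | zero => simp [seqWord, desuspExp, sgn_zero]
  | succ n ih =>
    have h := ih (fun i => a (i + 1)) (fun i => δ (i + 1)) (fun i => ha (i + 1))
      (fun k i => hp k (i + 1))
    have e1 : (fun i => (𝒜.sign ^ (n + 1 - 1 - (i + 1))) (a (i + 1)))
        = fun i => (𝒜.sign ^ (n - 1 - i)) (a (i + 1)) := by
      funext i; congr 2; omega
    rw [seqWord, seqWord, e1, h, desuspExp, hp, map_zsmul, map_zsmul, sgn_add, mul_smul,
      smul_comm]
    simp

theorem seqWord_zsmul (n : ℕ) (a : ℕ → A) (z : ℤ) (g : G) :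
    seqWord e n a (z • g) = z • seqWord e n a g := by
  induction n generalizing a with
  | zero => simp [seqWord]
  | succ n ih => rw [seqWord, seqWord, ih, map_zsmul]

theorem seqWord_mem_wordsDeg {δ' : I → ℕ} (he : ∀ i, e i ∈ 𝒜.deg (δ' i)) {degG : ℤ → Submodule Q G}
    (n : ℕ) (a : ℕ → A) (δ : ℕ → ℤ) (ha : ∀ i, a i ∈ 𝒜.deg (δ i)) {p : ℤ} {g : G}
    (hg : g ∈ degG p) :
    seqWord e n a g ∈ wordsDeg δ' degG (p + ∑ i ∈ Finset.range n, δ i + n) := by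
  induction n generalizing a δ with
  | zero => exact single_mem_wordsDeg (by simpa [wordWt_nil] using hg)
  | succ n ih =>
    have := prep_mem_wordsDeg 𝒜 he (ha 0) (ih (fun i => a (i + 1)) (fun i => δ (i + 1))
      fun i => ha (i + 1))
    rw [seqWord]
    convert this using 2
    rw [Finset.sum_range_succ']; push_cast; ring

theorem seqWord_length_mem (n : ℕ) (a : ℕ → A) (g : G) :
    seqWord e n a g ∈ Submodule.span Q
      {x | ∃ (w : List I) (g : G), w.length = n ∧ x = Finsupp.single w g} := by
  induction n generalizing a with
  | zero => exact Submodule.subset_span ⟨[], g, rfl, rfl⟩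
  | succ n ih =>
    have h := ih fun i => a (i + 1)
    rw [seqWord]
    generalize a 0 = b
    induction b using basis_induction e with
    | h i =>
      refine (Submodule.span_le (p := (Submodule.span Q _).comap (prep e G (e i)))).2 ?_ h
      rintro _ ⟨w, g, hw, rfl⟩
      rw [Submodule.comap_coe, Set.mem_preimage, prep_single]
      exact Submodule.subset_span ⟨i :: w, g, by simp [hw], rfl⟩
    | zero => simp
    | add c c' h h' => rw [map_add]; exact add_mem h h'
    | smul r c h => rw [map_smul]; exact Submodule.smul_mem _ _ h

theorem seqWord_unit_mem {o : I} (ho : e o = 1) (n : ℕ) (hn : 2 ≤ n) (a : ℕ → A)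
    (ha : ∃ i < n, a i = 1) (g : G) : seqWord e n a g ∈ unitWords Q G o := by
  suffices ∀ n, ∀ a : ℕ → A, (∃ i < n, a i = 1) → seqWord e n a g ∈ Submodule.span Q
      {x | ∃ (w : List I) (g : G), o ∈ w ∧ w.length = n ∧ x = Finsupp.single w g} by
    refine Submodule.span_mono ?_ (this n a ha)
    rintro _ ⟨w, g, hw, hl, rfl⟩
    exact ⟨w, g, hw, by omega, rfl⟩
  intro n
  induction n with
  | zero => rintro a ⟨i, hi, -⟩; omega
  | succ n ih =>
    rintro a ⟨i, hi, h1⟩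
    rw [seqWord]
    rcases i with _ | i
    · rw [h1, ← ho]
      refine (Submodule.span_le (p := (Submodule.span Q _).comap (prep e G (e o)))).2 ?_
        (seqWord_length_mem e n (fun i => a (i + 1)) g)
      rintro _ ⟨w, g, hw, rfl⟩
      rw [Submodule.comap_coe, Set.mem_preimage, prep_single]
      exact Submodule.subset_span ⟨o :: w, g, by simp, by simp [hw], rfl⟩
    · have h := ih (fun i => a (i + 1)) ⟨i, by omega, h1⟩
      generalize a 0 = b
      induction b using basis_induction e with
      | h i =>
        refine (Submodule.span_le (p := (Submodule.span Q _).comap (prep e G (e i)))).2 ?_ h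
        rintro _ ⟨w, g, hw, hl, rfl⟩
        rw [Submodule.comap_coe, Set.mem_preimage, prep_single]
        exact Submodule.subset_span ⟨i :: w, g, by simp [hw], by simp [hl], rfl⟩
      | zero => simp
      | add c c' h h' => rw [map_add]; exact add_mem h h'
      | smul r c h => rw [map_smul]; exact Submodule.smul_mem _ _ h

/-- The operations on `G` given by a family of operators indexed by words. -/
def wordAct (Θ : List I → Module.End Q G) (n : ℕ) :
    MultilinearMap Q (fun _ : Fin n => A) (G →ₗ[Q] G) :=
  LinearMap.compMultilinearMap
    ((LinearMap.lcomp Q G (Finsupp.lsingle [] : G →ₗ[Q] (List I →₀ G))) ∘ₗ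
      (LinearMap.llcomp Q (List I →₀ G) (List I →₀ G) G (wordSum Θ)) :
        Module.End Q (List I →₀ G) →ₗ[Q] (G →ₗ[Q] G))
    ((MultilinearMap.mkPiAlgebraFin Q n (Module.End Q (List I →₀ G))).compLinearMap
      fun j => prep e G ∘ₗ 𝒜.sign ^ (n - 1 - (j : ℕ)))

theorem wordAct_seq (Θ : List I → Module.End Q G) (n : ℕ) (a : ℕ → A) (g : G) :
    wordAct 𝒜 e Θ n (fun i => a i) g
      = wordSum Θ (seqWord e n (fun j => (𝒜.sign ^ (n - 1 - j)) (a j)) g) := by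
  have h : ∀ n, ∀ b : ℕ → A, (List.ofFn fun j : Fin n => prep e G (b j)).prod
      (Finsupp.single [] g) = seqWord e n b g := by
    intro n
    induction n with
    | zero => intro b; simp [seqWord]
    | succ n ih =>
      intro b
      rw [List.ofFn_succ, List.prod_cons, Module.End.mul_apply, seqWord, ← ih]
      rfl
  rw [← h n]
  simp [wordAct, MultilinearMap.mkPiAlgebraFin_apply]

/-- The exponent uses `|a_j|` where the Koszul sign of `(s⁻¹)^{⊗ n}` uses `|a_j| + 1`. The
difference is the factor `(-1)^{n(n-1)/2}`, so `Θ` has the same normalisation as `AInfModule.twist`.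
-/
theorem wordAct_seq_of_mem (Θ : List I → Module.End Q G) (n : ℕ) (a : ℕ → A) (δ : ℕ → ℤ)
    (ha : ∀ i, a i ∈ 𝒜.deg (δ i)) (g : G) :
    wordAct 𝒜 e Θ n (fun i => a i) g = sgn (desuspExp n δ) • wordSum Θ (seqWord e n a g) := by
  rw [wordAct_seq, seqWord_sign 𝒜 e n a δ ha, map_zsmul]

theorem insertOp_mem {r s : ℕ} {a : ℕ → A} {δ : ℕ → ℤ} (ha : ∀ i, a i ∈ 𝒜.deg (δ i)) {x : A} {n : ℤ}
    (hx : x ∈ 𝒜.deg n) (i : ℕ) : insertOp a r s x i ∈ 𝒜.deg (insertOp δ r s n i) := by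
  simp only [insertOp]
  split_ifs
  exacts [ha _, hx, ha _]

/-- Up to the common sign of `(s⁻¹)^{⊗ n}`, the identity is `wordSum Θ ∘ barDiff = 0` evaluated on
`a_0 ⋯ a_{n-1}`. `h1` and `h2` match the terms individually, with the three `desuspExp` lemmas
accounting for the signs. -/
theorem wordAct_stasheff (Θ : List I → Module.End Q G)
    (hΘ : ∀ x, wordSum Θ (barDiff 𝒜 e Θ x) = 0) (n : ℕ) (a : ℕ → A) (δ : ℕ → ℤ)
    (ha : ∀ i, a i ∈ 𝒜.deg (δ i)) (g : G) :
    ∑ r ∈ Finset.range n, ∑ s ∈ Finset.Icc 1 (n - r),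
      sgn (r + s * (n + 1 - r - s) + s * ∑ i ∈ Finset.range r, δ i) •
        wordAct 𝒜 e Θ (n - s + 1) (fun i => insertOp a r s (dgOps 𝒜.d s fun j => a (r + j)) i) g
    + ∑ r ∈ Finset.range (n + 1),
        sgn (r + (n - r + 1) * ∑ i ∈ Finset.range r, δ i) •
          wordAct 𝒜 e Θ r (fun i => a i) (wordAct 𝒜 e Θ (n - r) (fun j => a (r + j)) g) = 0 := by
  have hneg : ∀ (i : ℤ) (x : G), -(sgn i • x) = sgn (i + 1) • x := fun i x => by
    rw [sgn_add, sgn_one, mul_neg_one, neg_smul]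
  have hsum : ∀ r : ℕ, ∑ i ∈ Finset.range r, (δ i + 1) = ∑ i ∈ Finset.range r, δ i + r := by
    intro r; rw [Finset.sum_add_distrib]; simp
  have h1 : ∀ r ∈ Finset.range n, ∑ s ∈ Finset.Icc 1 (n - r),
      sgn (r + s * (n + 1 - r - s) + s * ∑ i ∈ Finset.range r, δ i) •
        wordAct 𝒜 e Θ (n - s + 1) (fun i => insertOp a r s (dgOps 𝒜.d s fun j => a (r + j)) i) g
      = sgn (desuspExp n δ) • (-(sgn (∑ i ∈ Finset.range r, (δ i + 1)) •
          wordSum Θ (seqWord e n (insertOp a r 1 (𝒜.d (a r))) g)))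
        + if r < n - 1 then sgn (desuspExp n δ) • (sgn (∑ i ∈ Finset.range r, (δ i + 1)) •
          sgn (δ r) • wordSum Θ (seqWord e (n - 1) (insertOp a r 2 (a r * a (r + 1))) g)) else 0 := by
    intro r hr
    rw [Finset.mem_range] at hr
    rw [sum_Icc_eq_of_three_le _ _ fun s hs hk => ?_, if_pos (by omega)]
    swap
    · rw [MultilinearMap.map_coord_zero _ ⟨r, by omega⟩ (by simp [insertOp, dgOps_ge _ s hs]),
        LinearMap.zero_apply, smul_zero]
    congr 1
    · have e1 : dgOps 𝒜.d 1 (fun j : Fin 1 => a (r + j)) = 𝒜.d (a r) := by simp [dgOps_one]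
      rw [wordAct_seq_of_mem 𝒜 e Θ _ _ (insertOp δ r 1 (δ r - 1))
        (insertOp_mem 𝒜 ha (by rw [e1]; exact 𝒜.d_mem (ha r))), e1,
        Nat.sub_add_cancel (by omega), desuspExp_one r n hr, hneg, smul_smul, smul_smul, ← sgn_add,
        ← sgn_add, hsum]
      congr 2
      push_cast; ring
    · by_cases hr2 : 2 ≤ n - r
      · have e1 : dgOps 𝒜.d 2 (fun j : Fin 2 => a (r + j)) = a r * a (r + 1) := by simp [dgOps_two]
        rw [if_pos hr2, if_pos (by omega), wordAct_seq_of_mem 𝒜 e Θ _ _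
          (insertOp δ r 2 (δ r + δ (r + 1)))
          (insertOp_mem 𝒜 ha (by rw [e1]; exact 𝒜.mul_mem (ha r) (ha (r + 1)))), e1,
          show n - 2 + 1 = n - 1 by omega, desuspExp_two r (n - 1) (by omega),
          Nat.sub_add_cancel (by omega), smul_smul, smul_smul, smul_smul, ← sgn_add, ← sgn_add,
          ← sgn_add, hsum]
        congr 1
        refine sgn_eq_of_even ⟨(n : ℤ) - 1 - r - δ r, ?_⟩
        push_cast; ring
      · rw [if_neg hr2, if_neg (by omega)]
  have h2 : ∀ r ∈ Finset.range (n + 1), sgn (r + (n - r + 1) * ∑ i ∈ Finset.range r, δ i) •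
      wordAct 𝒜 e Θ r (fun i => a i) (wordAct 𝒜 e Θ (n - r) (fun j => a (r + j)) g)
      = sgn (desuspExp n δ) • (sgn (∑ i ∈ Finset.range r, (δ i + 1)) •
          wordSum Θ (seqWord e r a (wordSum Θ (seqWord e (n - r) (fun j => a (r + j)) g)))) := by
    intro r hr
    rw [Finset.mem_range] at hr
    rw [wordAct_seq_of_mem 𝒜 e Θ r a δ ha, wordAct_seq_of_mem 𝒜 e Θ (n - r) (fun j => a (r + j))
      (fun j => δ (r + j)) (fun j => ha _), desuspExp_add r n (by omega) δ, hsum]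
    rw [seqWord_zsmul, map_zsmul, smul_smul, smul_smul, smul_smul, ← sgn_add, ← sgn_add, ← sgn_add]
    congr 2
    ring
  have h0 := congrArg (sgn (desuspExp n δ) • ·) (hΘ (seqWord e n a g))
  rw [barDiff_seqWord 𝒜 e Θ n a δ ha] at h0
  simp only [map_add, map_sum, map_neg, map_zsmul, smul_add, Finset.smul_sum, smul_zero] at h0
  rw [Finset.sum_congr rfl h1, Finset.sum_congr rfl h2, Finset.sum_add_distrib,
    ← Finset.sum_filter, show (Finset.range n).filter (fun r => r < n - 1) = Finset.range (n - 1) by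
      ext r; simp; omega]
  exact h0

end SeqWord

end AInfKoszul

end

noncomputable section

namespace AInfKoszul

open Module

/-! ### The A∞-module structure on a semifree resolution -/

section Existence

variable {Q : Type*} [CommRing Q] {A : Type*} [Ring A] [Algebra Q A] (𝒜 : DGStructure Q A)
  {I : Type*} (e : Basis I Q A) {G : Type*} [AddCommGroup G] [Module Q G]

theorem prep_apply_nil (a : A) (x : List I →₀ G) : (prep e G a x) [] = 0 := by
  induction a using basis_induction e with
  | h i =>
    induction x using Finsupp.induction_linear with
    | zero => simp
    | add x y hx hy => simp [hx, hy]
    | single w g => rw [prep_single]; simp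
  | zero => simp
  | add c c' h h' => simp [h, h']
  | smul r c h => simp [h]

/-- Extension of a finite sequence by a constant value. -/
def extendSeq {X : Type*} {n : ℕ} (x : X) (a : Fin n → X) (i : ℕ) : X :=
  if h : i < n then a ⟨i, h⟩ else x

theorem extendSeq_coe {X : Type*} {n : ℕ} (x : X) (a : Fin n → X) :
    (fun i : Fin n => extendSeq x a i) = a := by
  funext i
  simp [extendSeq]

theorem wordAct_eq (Θ : List I → Module.End Q G) (n : ℕ) (a : Fin n → A) (g : G) :
    wordAct 𝒜 e Θ n a g
      = wordSum Θ (seqWord e n (fun j => (𝒜.sign ^ (n - 1 - j)) (extendSeq 0 a j)) g) := by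
  rw [← wordAct_seq, extendSeq_coe]

theorem sign_pow_one (k : ℕ) : (𝒜.sign ^ k) 1 = 1 := by
  induction k with
  | zero => simp
  | succ k ih => rw [pow_succ', Module.End.mul_apply, ih, 𝒜.sign_one]

variable {𝒜 e} {o : I} {δ : I → ℕ} {degG : ℤ → Submodule Q G} {dG : G →ₗ[Q] G}
  {R : Type*} [CommRing R] [Algebra Q R]
  {M : Type*} [AddCommGroup M] [Module Q M] [Module R M] [IsScalarTower Q R M]

/-- A twisting family defines a strictly unital A∞-module. -/
def ainfModuleOfTwisting (hc : ∀ i < 0, 𝒜.deg i = ⊥) (aug : A →ₗ[Q] Q)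
    (aug_one : aug 1 = 1) (aug_deg : ∀ i ≠ 0, ∀ x ∈ 𝒜.deg i, aug x = 0)
    (he : ∀ i, e i ∈ 𝒜.deg (δ i)) (ho : e o = 1) {γ : G →ₗ[Q] M}
    (hG : DirectSum.IsInternal degG) (Θ : List I → Module.End Q G)
    (hΘ : ∀ m, IsTwistingFamily 𝒜 e o δ degG dG γ m Θ) :
    AInfModule (SplitAInfAlgebra.ofDG 𝒜 hc aug aug_one aug_deg) G where
  deg := degG
  internal := hG
  act := wordAct 𝒜 e Θ
  act_mem n a δ' ha p g hg := by
    have ha' : ∀ i, extendSeq 0 a i ∈ 𝒜.deg (extendSeq 0 δ' i) := by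
      intro i
      simp only [extendSeq]
      split_ifs
      · exact ha _
      · exact zero_mem _
    have h1 := wordAct_seq_of_mem 𝒜 e Θ n _ _ ha' g
    rw [extendSeq_coe] at h1
    rw [h1]
    have h2 := wordSum_mem Θ (hΘ 0).deg
      (seqWord_mem_wordsDeg 𝒜 e he n (extendSeq 0 a) (extendSeq 0 δ') ha' hg)
    refine zsmul_mem ?_ _
    convert h2 using 2
    rw [← Fin.sum_univ_eq_sum_range, extendSeq_coe]
    ring
  stasheff n a δ' ha g := by
    refine wordAct_stasheff 𝒜 e Θ (fun x => ?_) n a δ' ha g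
    induction x using Finsupp.induction_linear with
    | zero => simp
    | add x y hx hy => simp [hx, hy]
    | single w g => exact (hΘ _).mc w le_rfl g
  one_act g := by
    change wordAct 𝒜 e Θ 1 (fun _ => 1) g = g
    rw [wordAct_seq 𝒜 e Θ 1 (fun _ => (1 : A)) g, seqWord, sign_pow_one, seqWord, ← ho,
      prep_single, wordSum_single, (hΘ 0).unit_one, Module.End.one_apply]
  act_unit n hn a ha := by
    obtain ⟨i, hi⟩ := ha
    ext g
    rw [wordAct_eq, wordSum_unitWords Θ (hΘ 0).unit]
    · rfl
    · refine seqWord_unit_mem e ho n hn _ ⟨i, i.2, ?_⟩ g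
      simp only [extendSeq, i.2, dif_pos, Fin.eta]
      rw [hi]
      exact sign_pow_one 𝒜 _

theorem exists_ainfModule (hc : ∀ i < 0, 𝒜.deg i = ⊥) (aug : A →ₗ[Q] Q)
    (aug_one : aug 1 = 1) (aug_deg : ∀ i ≠ 0, ∀ x ∈ 𝒜.deg i, aug x = 0) (ε : A →ₐ[Q] R)
    (hε : ∀ x, ε (𝒜.d x) = 0) (hε' : ∀ i ≠ 0, ∀ x ∈ 𝒜.deg i, ε x = 0)
    (degM : ℤ → Submodule R M) (d : M →ₗ[R] M) (hM : IsComplex degM d)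
    (he : ∀ i, e i ∈ 𝒜.deg (δ i)) (ho : e o = 1) (hδo : δ o = 0) (hδ : ∀ i ≠ o, 0 < δ i)
    (hεo : ∀ a, ε a = algebraMap Q R (e.repr a o)) {γ : G →ₗ[Q] M}
    (hγ : IsSemifreeResolution degG dG (fun i => (degM i).restrictScalars Q)
      (d.restrictScalars Q) γ) :
    ∃ 𝒢 : AInfModule (SplitAInfAlgebra.ofDG 𝒜 hc aug aug_one aug_deg) G, 𝒢.deg = degG ∧
      𝒢.act 0 ![] = dG ∧ IsStrictMorphism 𝒢
        (AInfModule.ofComplex 𝒜 hc aug aug_one aug_deg ε hε hε' degM d hM) γ := by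
  have hsm : ∀ (a : A) (x : M), ε a • x = e.repr a o • x := fun a x => by
    rw [hεo, algebraMap_smul]
  -- `A` acts on `M` through the unit coefficient. A boundary maps to zero in `R`, so its unit
  -- coefficient annihilates `M`.
  obtain ⟨Θ, hΘ⟩ := exists_isTwistingFamily he ho hδo hδ
    (fun i x => by rw [← hsm, hε, zero_smul]) (degM := fun i => (degM i).restrictScalars Q)
    hM.internal hγ
  refine ⟨ainfModuleOfTwisting hc aug aug_one aug_deg he ho hγ.semifree.internal Θ hΘ, rfl, ?_,
    fun i x hx => hγ.mem hx, fun n a g => ?_⟩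
  · ext g
    change wordAct 𝒜 e Θ 0 ![] g = dG g
    rw [wordAct_eq, seqWord, wordSum_single, (hΘ 0).nil]
  · change γ (wordAct 𝒜 e Θ n a g) = dgActs ε (d.restrictScalars Q) n a (γ g)
    rw [wordAct_eq]
    match n with
    | 0 =>
      rw [seqWord, wordSum_single, (hΘ 0).nil, dgActs_zero]
      exact hγ.comm g
    | 1 =>
      rw [seqWord, seqWord, (hΘ 0).aug_prep, dgActs_one, hsm]
      simp [extendSeq]
    | n + 2 =>
      rw [seqWord, seqWord, (hΘ 0).aug_prep, prep_apply_nil, dgActs_ge _ _ _ (by omega)]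
      simp

end Existence

/-! ### The case of the Koszul complex -/

section KoszulBasis

variable {Q : Type u} [CommRing Q] {c : ℕ}

/-- The standard basis of the exterior algebra. -/
abbrev extBasis (Q : Type u) [CommRing Q] (c : ℕ) :
    Basis (Finset (Fin c)) Q (ExteriorAlgebra Q (Fin c → Q)) :=
  (Pi.basisFun Q (Fin c)).ExteriorAlgebra

theorem extBasis_mem (s : Finset (Fin c)) : extBasis Q c s ∈ extDeg Q c s.card := by
  rw [extDeg_nat, extBasis, ExteriorAlgebra.basis_apply]
  exact SetLike.coe_mem (exteriorPower.ιMulti_family Q s.card _ _)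

theorem extBasis_empty : extBasis Q c ∅ = 1 := by
  rw [extBasis, ExteriorAlgebra.basis_apply_ofCard _ Finset.card_empty]
  exact (ExteriorAlgebra.ιMulti_apply _).trans (by simp)

theorem extBasis_repr_empty (a : ExteriorAlgebra Q (Fin c → Q)) :
    (extBasis Q c).repr a ∅ = ExteriorAlgebra.algebraMapInv a := by
  have : (extBasis Q c).coord ∅ = ExteriorAlgebra.algebraMapInv.toLinearMap := by
    refine (extBasis Q c).ext fun s => ?_
    rw [Basis.coord_apply, Basis.repr_self]
    by_cases hs : s = ∅
    · subst hs
      rw [extBasis_empty]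
      simp
    · rw [ext_aug_deg (s.card : ℤ) (by simpa using hs) _ (extBasis_mem s)]
      simp [hs]
  exact LinearMap.congr_fun this a

variable {R : Type v} [CommRing R] [Algebra Q R] {M : Type w} [AddCommGroup M] [Module Q M]
  [Module R M] [IsScalarTower Q R M] {G : Type w'} [AddCommGroup G] [Module Q G]

theorem exists_koszul_ainfModule (f : Fin c → Q)
    (hf : RingHom.ker (algebraMap Q R) = Ideal.span (Set.range f))
    (degM : ℤ → Submodule R M) (dM : M →ₗ[R] M) (hM : IsComplex degM dM)
    (degG : ℤ → Submodule Q G) (dG : G →ₗ[Q] G) (γ : G →ₗ[Q] M)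
    (hγ : IsSemifreeResolution degG dG (fun i => (degM i).restrictScalars Q)
      (dM.restrictScalars Q) γ) :
    ∃ 𝒢 : AInfModule (koszulAInf f) G, 𝒢.deg = degG ∧ 𝒢.act 0 ![] = dG ∧
      IsStrictMorphism 𝒢 (koszulRestrict f hf degM dM hM) γ :=
  exists_ainfModule (𝒜 := koszulDG f) (e := extBasis Q c) (o := ∅) (δ := Finset.card) _ _ _ _ _ _ _
    degM dM hM extBasis_mem extBasis_empty Finset.card_empty
    (fun _ hs => Finset.card_pos.2 (Finset.nonempty_iff_ne_empty.2 hs))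
    (fun a => by rw [extBasis_repr_empty]; rfl) hγ

end KoszulBasis

end AInfKoszul

end

noncomputable section

namespace AInfKoszul

open Module

/-! ### Exactness of the Koszul complex -/

section Exactness

variable {Q : Type u} [CommRing Q] {c : ℕ}

/-- The ideal generated by the elements `f_i` with `i < j`. -/
def partialIdeal (f : Fin c → Q) (j : ℕ) : Ideal Q := Ideal.span (f '' {i | (i : ℕ) < j})

theorem partialIdeal_eq_ofList (f : Fin c → Q) (j : ℕ) :
    partialIdeal f j = Ideal.ofList ((List.ofFn f).take j) := by
  rw [partialIdeal, Ideal.ofList]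
  congr 1
  ext x
  simp only [Set.mem_image, Set.mem_ofPred_eq]
  rw [List.mem_take_iff_getElem]
  simp only [List.length_ofFn, List.getElem_ofFn]
  constructor
  · rintro ⟨i, hi, rfl⟩
    exact ⟨i, by omega, rfl⟩
  · rintro ⟨i, hi, rfl⟩
    exact ⟨⟨i, by omega⟩, by simp; omega, rfl⟩

theorem partialIdeal_top (f : Fin c → Q) : partialIdeal f c = Ideal.span (Set.range f) := by
  rw [partialIdeal, ← Set.image_univ]
  congr 2
  ext i
  simp

theorem partialIdeal_zero (f : Fin c → Q) : partialIdeal f 0 = ⊥ := by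
  simp [partialIdeal]

theorem partialIdeal_mono (f : Fin c → Q) {i j : ℕ} (h : i ≤ j) :
    partialIdeal f i ≤ partialIdeal f j :=
  Ideal.span_mono (Set.image_mono fun _ hk => lt_of_lt_of_le hk h)

theorem mem_partialIdeal (f : Fin c → Q) {i : Fin c} {j : ℕ} (h : (i : ℕ) < j) :
    f i ∈ partialIdeal f j :=
  Ideal.subset_span ⟨i, h, rfl⟩

theorem partialIdeal_succ (f : Fin c → Q) (j : Fin c) :
    partialIdeal f (j + 1) = partialIdeal f j ⊔ Ideal.span {f j} := by
  rw [partialIdeal, partialIdeal, ← Ideal.span_union]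
  congr 1
  rw [← Set.image_singleton, ← Set.image_union]
  congr 1
  ext i
  simp only [Set.mem_ofPred_eq, Set.mem_union, Set.mem_singleton_iff, Fin.ext_iff]
  omega

/-- The regularity of `f j` on the quotient by the earlier elements, rewritten as a statement about
ideal membership. It is used both here and for the Eisenbud–Shamash complex. -/
theorem mem_partialIdeal_of_mul {f : Fin c → Q}
    (hreg : RingTheory.Sequence.IsRegular Q (List.ofFn f)) (j : Fin c) {q : Q}
    (h : f j * q ∈ partialIdeal f j) : q ∈ partialIdeal f j := by
  have h1 := hreg.regular_mod_prev j (by simp)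
  rw [← partialIdeal_eq_ofList, List.getElem_ofFn] at h1
  have e : (partialIdeal f j • ⊤ : Submodule Q Q) = partialIdeal f j := by simp
  rw [e] at h1
  rw [← Submodule.Quotient.mk_eq_zero]
  refine h1 ?_
  simp only [smul_zero]
  rw [← Submodule.Quotient.mk_smul, Submodule.Quotient.mk_eq_zero]
  exact h

/-- The contraction with the `i`-th coordinate. -/
def coordContract (Q : Type u) [CommRing Q] {c : ℕ} (i : Fin c) :
    ExteriorAlgebra Q (Fin c → Q) →ₗ[Q] ExteriorAlgebra Q (Fin c → Q) :=
  koszulD (Pi.single i 1)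

/-- The standard generators of the exterior algebra. -/
def extGen (Q : Type u) [CommRing Q] {c : ℕ} (i : Fin c) : ExteriorAlgebra Q (Fin c → Q) :=
  ExteriorAlgebra.ι Q (Pi.single i 1)

theorem koszulD_extGen_mul (f : Fin c → Q) (i : Fin c) (x : ExteriorAlgebra Q (Fin c → Q)) :
    koszulD f (extGen Q i * x) = f i • x - extGen Q i * koszulD f x := by
  rw [extGen, koszulD_ι_mul, seqForm_single]

theorem coordContract_extGen_mul (i j : Fin c) (x : ExteriorAlgebra Q (Fin c → Q)) :
    coordContract Q i (extGen Q j * x)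
      = (if i = j then x else 0) - extGen Q j * coordContract Q i x := by
  rw [coordContract, koszulD_extGen_mul, Pi.single_apply]
  simp only [eq_comm (a := j)]
  split_ifs <;> simp

theorem koszulD_anticomm (f g : Fin c → Q) (x : ExteriorAlgebra Q (Fin c → Q)) :
    koszulD f (koszulD g x) = -koszulD g (koszulD f x) :=
  CliffordAlgebra.contractLeft_comm _ _ _

theorem koszulD_eq_sum (f : Fin c → Q) (x : ExteriorAlgebra Q (Fin c → Q)) :
    koszulD f x = ∑ i, f i • coordContract Q i x := by
  have : seqForm f = ∑ i, f i • seqForm (Pi.single i (1 : Q)) := by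
    refine LinearMap.pi_ext' fun j => LinearMap.ext_ring ?_
    simp [seqForm_single, Pi.single_apply]
  simp only [koszulD, coordContract, this, map_sum, map_smul, LinearMap.sum_apply,
    LinearMap.smul_apply]

theorem extGen_mul_self (i : Fin c) : extGen Q i * extGen Q i = 0 := ExteriorAlgebra.ι_sq_zero _

theorem extGen_anticomm (i j : Fin c) : extGen Q i * extGen Q j = -(extGen Q j * extGen Q i) :=
  eq_neg_of_add_eq_zero_left (ExteriorAlgebra.ι_add_mul_swap _ _)

theorem ι_eq_sum (a : Fin c → Q) : ExteriorAlgebra.ι Q a = ∑ i, a i • extGen Q i := by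
  conv_lhs => rw [← (Pi.basisFun Q (Fin c)).sum_repr a]
  simp [extGen]

/-- The composite of the idempotents `x ↦ ρ_i (e_i x)` over a list of indices. -/
def contractProj (Q : Type u) [CommRing Q] {c : ℕ} :
    List (Fin c) → Module.End Q (ExteriorAlgebra Q (Fin c → Q))
  | [] => 1
  | i :: l => coordContract Q i ∘ₗ LinearMap.mulLeft Q (extGen Q i) ∘ₗ contractProj Q l

/-- The idempotent at `i` kills multiples of `e_i` since `e_i² = 0`. The one at another index
commutes with left multiplication by `e_i`, as two sign changes cancel. -/
theorem contractProj_extGen_mul (l : List (Fin c)) (i : Fin c) (x : ExteriorAlgebra Q (Fin c → Q)) :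
    contractProj Q l (extGen Q i * x) = if i ∈ l then 0 else extGen Q i * contractProj Q l x := by
  induction l with
  | nil => simp [contractProj]
  | cons j l ih =>
    simp only [contractProj, LinearMap.comp_apply, LinearMap.mulLeft_apply, ih, List.mem_cons]
    by_cases hl : i ∈ l
    · simp [hl]
    · simp only [hl, if_false, or_false]
      by_cases hij : i = j
      · subst hij
        rw [if_pos rfl, ← mul_assoc, extGen_mul_self, zero_mul, map_zero]
      · rw [if_neg hij, ← mul_assoc, extGen_anticomm, neg_mul, mul_assoc, map_neg,
          coordContract_extGen_mul j i, if_neg (Ne.symm hij), zero_sub, neg_neg]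

/-- The composite over all indices kills everything divisible by a generator on the left and fixes
`1`, so it is the projection to the scalars. -/
theorem contractProj_all (x : ExteriorAlgebra Q (Fin c → Q)) :
    contractProj Q (List.finRange c) x
      = algebraMap Q _ (ExteriorAlgebra.algebraMapInv x) := by
  have h1 : ∀ l : List (Fin c), contractProj Q l 1 = 1 := by
    intro l
    induction l with
    | nil => rfl
    | cons j l ih =>
      simp only [contractProj, LinearMap.comp_apply, LinearMap.mulLeft_apply, ih]
      rw [coordContract_extGen_mul, if_pos rfl, coordContract, koszulD_one]
      simp
  induction x using CliffordAlgebra.left_induction with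
  | algebraMap r =>
    rw [Algebra.algebraMap_eq_smul_one, map_smul, h1]
    erw [map_smul, map_one]
    rw [smul_eq_mul, mul_one, Algebra.algebraMap_eq_smul_one]
  | add x y hx hy => rw [map_add, map_add, map_add, hx, hy]
  | ι_mul x a _ =>
    have e : CliffordAlgebra.ι (0 : QuadraticForm Q (Fin c → Q)) a = ∑ i, a i • extGen Q i :=
      ι_eq_sum a
    have e2 : ExteriorAlgebra.algebraMapInv (∑ i, a i • extGen Q i) = (0 : Q) := by
      rw [← ι_eq_sum]; simp [ExteriorAlgebra.algebraMapInv]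
    have e3 : ExteriorAlgebra.algebraMapInv ((∑ i, a i • extGen Q i) * x) = (0 : Q) :=
      (map_mul ExteriorAlgebra.algebraMapInv _ _).trans (by rw [e2, zero_mul])
    rw [e]
    refine Eq.trans ?_ ((map_zero (algebraMap Q _)).symm.trans (congrArg _ e3.symm))
    rw [Finset.sum_mul, map_sum]
    refine Finset.sum_eq_zero fun i _ => ?_
    rw [smul_mul_assoc, map_smul, contractProj_extGen_mul, if_pos (List.mem_finRange i), smul_zero]

/-- An element with vanishing contractions satisfies `ρ_i (e_i x) = x` for each `i`, so it is fixed
by the projection to the scalars. This starts the induction for exactness. -/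
theorem eq_algebraMap_of_coordContract {x : ExteriorAlgebra Q (Fin c → Q)}
    (h : ∀ i, coordContract Q i x = 0) :
    x = algebraMap Q _ (ExteriorAlgebra.algebraMapInv x) := by
  have : ∀ l, contractProj Q l x = x := by
    intro l
    induction l with
    | nil => rfl
    | cons j l ih =>
      simp only [contractProj, LinearMap.comp_apply, LinearMap.mulLeft_apply, ih]
      rw [coordContract_extGen_mul, if_pos rfl, h, mul_zero, sub_zero]
  rw [← contractProj_all, this]

theorem exists_koszulD_eq_algebraMap (f : Fin c → Q) (j : ℕ) {q : Q} (hq : q ∈ partialIdeal f j) :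
    ∃ u : ExteriorAlgebra Q (Fin c → Q), (∀ i : Fin c, j ≤ i → coordContract Q i u = 0) ∧
      koszulD f u = algebraMap Q _ q := by
  induction hq using Submodule.span_induction with
  | mem q hq =>
    obtain ⟨i, hi, rfl⟩ := hq
    rw [Set.mem_ofPred_eq] at hi
    refine ⟨extGen Q i * 1, fun k hk => ?_, ?_⟩
    · rw [coordContract_extGen_mul, if_neg (by rintro rfl; omega), coordContract, koszulD_one,
        mul_zero, sub_zero]
    · rw [koszulD_extGen_mul, koszulD_one, mul_zero, sub_zero, Algebra.algebraMap_eq_smul_one]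
  | zero => exact ⟨0, by simp, by simp⟩
  | add p q _ _ hp hq =>
    obtain ⟨u, hu, hu'⟩ := hp
    obtain ⟨v, hv, hv'⟩ := hq
    exact ⟨u + v, fun i hi => by rw [map_add, hu i hi, hv i hi, add_zero],
      by rw [map_add, map_add, hu', hv']⟩
  | smul r q _ hq =>
    obtain ⟨u, hu, hu'⟩ := hq
    exact ⟨r • u, fun i hi => by rw [map_smul, hu i hi, smul_zero],
      by rw [map_smul, hu', smul_eq_mul, map_mul, Algebra.smul_def]⟩

/-- The scalar part of the differential is `∑ f_i · aug (ρ_i x)`, and only the generators that occur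
in `x` contribute. -/
theorem algebraMapInv_koszulD_mem (f : Fin c → Q) (j : ℕ) {x : ExteriorAlgebra Q (Fin c → Q)}
    (hx : ∀ i : Fin c, j ≤ i → coordContract Q i x = 0) :
    ExteriorAlgebra.algebraMapInv (koszulD f x) ∈ partialIdeal f j := by
  rw [koszulD_eq_sum, map_sum]
  refine sum_mem fun i _ => ?_
  rcases Nat.lt_or_ge i j with h | h
  · rw [map_smul]
    exact Ideal.mul_mem_right _ _ (mem_partialIdeal f h)
  · rw [hx i h, smul_zero, map_zero]
    exact zero_mem _

/-- Vanishing contractions with index at least `j` express that `x` involves only the first `j`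
generators. For such cycles the claim is proved by adding one generator at a time; the scalar `q`
records the homology in degree zero, so that no grading is needed in the induction. -/
theorem koszulD_exact_aux {f : Fin c → Q}
    (hreg : RingTheory.Sequence.IsRegular Q (List.ofFn f)) (j : ℕ) (hj : j ≤ c)
    {x : ExteriorAlgebra Q (Fin c → Q)} (hx : ∀ i : Fin c, j ≤ i → coordContract Q i x = 0)
    (hd : koszulD f x = 0) :
    ∃ u : ExteriorAlgebra Q (Fin c → Q), ∃ q : Q,
      (∀ i : Fin c, j ≤ i → coordContract Q i u = 0) ∧ x = koszulD f u + algebraMap Q _ q := by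
  induction j generalizing x with
  | zero =>
    refine ⟨0, ExteriorAlgebra.algebraMapInv x, by simp, ?_⟩
    rw [map_zero, zero_add]
    exact eq_algebraMap_of_coordContract fun i => hx i (Nat.zero_le _)
  | succ j ih =>
    let k : Fin c := ⟨j, hj⟩
    have hk : (k : ℕ) = j := rfl
    have anti : ∀ (i : Fin c) (y : ExteriorAlgebra Q (Fin c → Q)),
        coordContract Q i (koszulD f y) = -koszulD f (coordContract Q i y) :=
      fun i y => koszulD_anticomm _ _ _
    have hb : ∀ i : Fin c, j ≤ i → coordContract Q i (coordContract Q k x) = 0 := by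
      intro i hi
      by_cases hik : i = k
      · rw [hik]; exact koszulD_koszulD _ _
      · have : j + 1 ≤ i := by
          rcases Nat.lt_or_ge j i with h | h
          · exact h
          · exact absurd (Fin.ext (by omega)) hik
        refine (koszulD_anticomm _ _ _).trans ?_
        rw [show koszulD (Pi.single i 1) x = 0 from hx i this, map_zero, neg_zero]
    have hdb : koszulD f (coordContract Q k x) = 0 := by
      rw [← neg_eq_zero, ← anti, hd, map_zero]
    -- The decomposition `x = a + e_k b` with `a` and `b` free of `e_k`. Then `b` is a cycle and `d
    -- a = -f_k b`.
    set b := coordContract Q k x with hbdef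
    set a := x - extGen Q k * b with hadef
    have ha : ∀ i : Fin c, j ≤ i → coordContract Q i a = 0 := by
      intro i hi
      rw [hadef, map_sub, coordContract_extGen_mul, hb i hi, mul_zero, sub_zero]
      split_ifs with hik
      · rw [hik, ← hbdef, sub_self]
      · rw [sub_zero]
        refine hx i ?_
        rcases Nat.lt_or_ge j i with h | h
        · exact h
        · exact absurd (Fin.ext (by omega)) hik
    have hda : koszulD f a = -(f k • b) := by
      rw [hadef, map_sub, hd, koszulD_extGen_mul, hdb, mul_zero, sub_zero, zero_sub]
    obtain ⟨u, q, hu, huq⟩ := ih (by omega) hb hdb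
    -- With `b = d u + q`, the scalar `-f_k q` is the boundary of `a + f_k u`, so it lies in the
    -- ideal of the earlier elements. Regularity removes `f_k`; hence `q` is a boundary too and `b =
    -- d (u + u')`.
    have hq : q ∈ partialIdeal f j := by
      refine mem_partialIdeal_of_mul hreg k ?_
      have h1 : koszulD f (a + f k • u) = algebraMap Q _ (-(f k * q)) := by
        rw [map_add, map_smul, hda, huq, map_neg, map_mul, ← Algebra.smul_def, smul_add]
        abel
      have h2 := algebraMapInv_koszulD_mem f j (x := a + f k • u) (fun i hi => by
        rw [map_add, map_smul, ha i hi, hu i hi, smul_zero, add_zero])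
      rw [h1, ExteriorAlgebra.algebraMap_leftInverse] at h2
      simpa using h2
    obtain ⟨u', hu', hu'q⟩ := exists_koszulD_eq_algebraMap f j hq
    have hv : koszulD f (u + u') = b := by rw [map_add, hu'q, huq]
    -- Adding the boundary of `e_k (u + u')` to `x` removes `e_k b` and leaves the cycle `a + f_k (u
    -- + u')`, which no longer involves `e_k`.
    obtain ⟨u2, q2, hu2, hu2q⟩ := ih (by omega) (x := a + f k • (u + u')) (fun i hi => by
        rw [map_add, map_smul, map_add, ha i hi, hu i hi, hu' i hi, add_zero, smul_zero, add_zero])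
      (by rw [map_add, map_smul, hv, hda, neg_add_cancel])
    refine ⟨u2 - extGen Q k * (u + u'), q2, fun i hi => ?_, ?_⟩
    · rw [map_sub, hu2 i (by omega), coordContract_extGen_mul,
        if_neg (by rintro rfl; omega), map_add, hu i (by omega), hu' i (by omega)]
      simp
    · rw [map_sub, koszulD_extGen_mul, hv, sub_add_eq_add_sub, ← hu2q, hadef]
      abel

variable {R : Type v} [CommRing R] [Algebra Q R]

/-- The Koszul complex of a regular sequence is a resolution. -/
theorem koszul_quasiIso (hφ : Function.Surjective (algebraMap Q R)) {f : Fin c → Q}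
    (hreg : RingTheory.Sequence.IsRegular Q (List.ofFn f))
    (hf : RingHom.ker (algebraMap Q R) = Ideal.span (Set.range f)) :
    IsQuasiIso (koszulD f) (0 : R → R) (koszulAug Q c R) := by
  have haug : ∀ q, koszulAug Q c R (algebraMap Q _ q) = algebraMap Q R q := fun q =>
    AlgHom.commutes _ q
  refine ⟨fun x hx hy => ?_, fun y _ => ?_⟩
  · obtain ⟨_, hy⟩ := hy
    obtain ⟨u, q, -, hq⟩ := koszulD_exact_aux hreg c le_rfl
      (fun i hi => absurd i.2 (by omega)) hx
    rw [hq, map_add, koszulAug_d f hf, zero_add, haug, Pi.zero_apply] at hy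
    have hy' : q ∈ partialIdeal f c := by
      rw [partialIdeal_top, ← hf]; exact hy
    obtain ⟨u', -, hu'⟩ := exists_koszulD_eq_algebraMap f c hy'
    exact ⟨u + u', by rw [map_add, hu', hq]⟩
  · obtain ⟨q, rfl⟩ := hφ y
    exact ⟨algebraMap Q _ q, koszulD_algebraMap f q, 0, by rw [haug]; simp⟩

end Exactness

end AInfKoszul

end

noncomputable section

namespace AInfKoszul

open Module

/-! ### Koszulness of exterior algebras -/

section Cartan

variable {k : Type*} [Field k] {H : Type*} [Ring H] [Algebra k H] {c : ℕ}

/-- The differential `h ⊗ α ↦ ∑_j h e_j ⊗ (α - 1_j)` of the Cartan resolution. -/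
def cartanD (e : Fin c → H) : ((Fin c →₀ ℕ) →₀ H) →ₗ[H] ((Fin c →₀ ℕ) →₀ H) :=
  Finsupp.linearCombination H fun α =>
    ∑ j, if α j = 0 then 0 else Finsupp.single (α - Finsupp.single j 1) (e j)

theorem cartanD_single (e : Fin c → H) (α : Fin c →₀ ℕ) (x : H) :
    cartanD e (Finsupp.single α x)
      = ∑ j, if α j = 0 then 0 else Finsupp.single (α - Finsupp.single j 1) (x * e j) := by
  rw [cartanD, Finsupp.linearCombination_single, Finset.smul_sum]
  refine Finset.sum_congr rfl fun j _ => ?_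
  split_ifs <;> simp

/-- Exchanging the two removed indices pairs off the terms of the square: mixed terms cancel by
anticommutation and diagonal ones vanish because the generators square to zero. -/
theorem cartanD_cartanD {e : Fin c → H} (he : ∀ i, e i * e i = 0)
    (he' : ∀ i j, e i * e j = -(e j * e i)) (x : (Fin c →₀ ℕ) →₀ H) :
    cartanD e (cartanD e x) = 0 := by
  induction x using Finsupp.induction_linear with
  | zero => simp
  | add x y hx hy => rw [map_add, map_add, hx, hy, add_zero]
  | single α h =>
    have key : ∀ i, cartanD e (if α i = 0 then 0 else
        Finsupp.single (α - Finsupp.single i 1) (h * e i))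
        = ∑ j, if α i = 0 ∨ (α - Finsupp.single i 1 : Fin c →₀ ℕ) j = 0 then 0 else
          Finsupp.single (α - Finsupp.single i 1 - Finsupp.single j 1) (h * e i * e j) := by
      intro i
      by_cases hi : α i = 0
      · simp [hi]
      · rw [if_neg hi, cartanD_single]
        simp only [hi, false_or]
    rw [cartanD_single, map_sum, Finset.sum_congr rfl fun i _ => key i, ← Finset.sum_product']
    have hcond : ∀ i j : Fin c, i ≠ j →
        ((α i = 0 ∨ (α - Finsupp.single i 1 : Fin c →₀ ℕ) j = 0) ↔ (α j = 0 ∨ (α - Finsupp.single j 1 : Fin c →₀ ℕ) i = 0)) := by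
      intro i j hij
      simp [hij, hij.symm, or_comm]
    refine Finset.sum_involution (fun p _ => (p.2, p.1)) ?_ ?_ ?_ ?_
    · rintro ⟨i, j⟩ _
      by_cases hij : i = j
      · subst hij
        simp [mul_assoc, he]
      · simp only [hcond i j hij]
        split_ifs
        · simp
        · rw [tsub_right_comm, ← Finsupp.single_add, mul_assoc, mul_assoc, he' i j, mul_neg,
            neg_add_cancel, Finsupp.single_zero]
    · rintro ⟨i, j⟩ _ hne heq
      have hij : j = i := congrArg Prod.fst heq
      subst hij
      exact hne (by simp [mul_assoc, he])
    · simp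
    · simp

/-- The contracting homotopy in direction `j`. -/
def cartanH (ρ : Fin c → H →ₗ[k] H) (j : Fin c) :
    ((Fin c →₀ ℕ) →₀ H) →ₗ[k] ((Fin c →₀ ℕ) →₀ H) :=
  Finsupp.lsum k fun α => Finsupp.lsingle (α + Finsupp.single j 1) ∘ₗ ρ j

theorem cartanH_single (ρ : Fin c → H →ₗ[k] H) (j : Fin c) (α : Fin c →₀ ℕ) (x : H) :
    cartanH ρ j (Finsupp.single α x) = Finsupp.single (α + Finsupp.single j 1) (ρ j x) := by
  simp [cartanH]

/-- For `i ≠ j`, removing `i` and adding `j` in the two orders cancel by the skew Leibniz rule for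
`ρ j`. For `i = j` they add up to the identity if `j` occurs in `α`; otherwise the term from
`cartanD` is absent and `ρ_j (x e_j)` is left over. -/
theorem cartan_homotopy {e : Fin c → H} {ρ : Fin c → H →ₗ[k] H}
    (hρ : ∀ i j x, ρ j (x * e i) = (if i = j then x else 0) - ρ j x * e i) (j : Fin c)
    (α : Fin c →₀ ℕ) (x : H) :
    Finsupp.single α x - cartanD e (cartanH ρ j (Finsupp.single α x))
        - cartanH ρ j (cartanD e (Finsupp.single α x))
      = if α j = 0 then Finsupp.single α (ρ j (x * e j)) else 0 := by
  rw [cartanH_single, cartanD_single, cartanD_single, map_sum]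
  have h1 : ∀ i, (if (α + Finsupp.single j 1 : Fin c →₀ ℕ) i = 0 then 0 else
        Finsupp.single (α + Finsupp.single j 1 - Finsupp.single i 1) (ρ j x * e i))
      + cartanH ρ j (if α i = 0 then 0 else Finsupp.single (α - Finsupp.single i 1) (x * e i))
      = if i = j then (if α j = 0 then Finsupp.single α (ρ j x * e j) else Finsupp.single α x)
        else 0 := by
    intro i
    by_cases hij : i = j
    · subst hij
      rw [if_neg (by simp), if_pos rfl, add_tsub_cancel_right]
      by_cases hi : α i = 0
      · simp [hi]
      · rw [if_neg hi, if_neg hi, cartanH_single, hρ, if_pos rfl,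
          tsub_add_cancel_of_le (by simpa using Nat.one_le_iff_ne_zero.2 hi), ← Finsupp.single_add,
          add_sub_cancel]
    · have : (α + Finsupp.single j 1 : Fin c →₀ ℕ) i = α i := by
        simp [Ne.symm hij]
      rw [this, if_neg hij]
      by_cases hi : α i = 0
      · simp [hi]
      · rw [if_neg hi, if_neg hi, cartanH_single, hρ, if_neg hij, zero_sub,
          tsub_add_eq_add_tsub (by simpa using Nat.one_le_iff_ne_zero.2 hi), ← Finsupp.single_add,
          add_neg_cancel, Finsupp.single_zero]
  rw [sub_sub, ← Finset.sum_add_distrib, Finset.sum_congr rfl fun i _ => h1 i,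
    Finset.sum_ite_eq' Finset.univ j, if_pos (Finset.mem_univ _)]
  split_ifs
  · rw [← Finsupp.single_sub, hρ, if_pos rfl]
  · rw [sub_self]

/-- The multi-exponents of degree `n`. -/
abbrev Multidegree (c n : ℕ) : Set (Fin c →₀ ℕ) := {α | α.degree = n}

theorem cartanD_mem_supported (e : Fin c → H) {n : ℕ} {x : (Fin c →₀ ℕ) →₀ H}
    (hx : x ∈ Finsupp.supported H H (Multidegree c (n + 1))) :
    cartanD e x ∈ Finsupp.supported H H (Multidegree c n) := by
  rw [Finsupp.supported_eq_span_single] at hx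
  induction hx using Submodule.span_induction with
  | mem x hx =>
    obtain ⟨α, hα, rfl⟩ := hx
    rw [Set.mem_ofPred_eq] at hα
    simp only
    rw [cartanD_single]
    refine sum_mem fun j _ => ?_
    split_ifs with hj
    · exact zero_mem _
    · refine Finsupp.single_mem_supported _ _ ?_
      have h2 : α - Finsupp.single j 1 + Finsupp.single j 1 = α :=
        tsub_add_cancel_of_le (by simpa using Nat.one_le_iff_ne_zero.2 hj)
      have h3 := congrArg Finsupp.degree h2
      rw [map_add, Finsupp.degree_single] at h3
      show Finsupp.degree _ = n
      omega
  | zero => simp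
  | add x y _ _ hx hy => rw [map_add]; exact add_mem hx hy
  | smul r x _ hx => rw [map_smul]; exact Submodule.smul_mem _ _ hx

theorem cartanH_mem_supported (ρ : Fin c → H →ₗ[k] H) (j : Fin c) {n : ℕ}
    {x : (Fin c →₀ ℕ) →₀ H} (hx : x ∈ Finsupp.supported H H (Multidegree c n)) :
    cartanH ρ j x ∈ Finsupp.supported H H (Multidegree c (n + 1)) := by
  rw [← Finsupp.sum_single x, Finsupp.sum, map_sum]
  refine sum_mem fun α hα => ?_
  rw [cartanH_single]
  refine Finsupp.single_mem_supported _ _ ?_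
  have : α.degree = n := hx hα
  show Finsupp.degree _ = n + 1
  rw [map_add, Finsupp.degree_single, this]

/-- The homotopies are applied one direction after another. Each leaves, modulo boundaries, only
multi-exponents without its own index, and it does not enlarge the support, so earlier gains
persist. At the end only `α = 0` could survive, which is impossible in positive degree. Nothing is
divided by, so the characteristic plays no role. -/
theorem cartan_exact {e : Fin c → H} {ρ : Fin c → H →ₗ[k] H}
    (hρ : ∀ i j x, ρ j (x * e i) = (if i = j then x else 0) - ρ j x * e i)
    (he : ∀ i, e i * e i = 0) (he' : ∀ i j, e i * e j = -(e j * e i)) {n : ℕ}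
    {x : (Fin c →₀ ℕ) →₀ H} (hx : x ∈ Finsupp.supported H H (Multidegree c (n + 1)))
    (hd : cartanD e x = 0) :
    ∃ y ∈ Finsupp.supported H H (Multidegree c (n + 2)), cartanD e y = x := by
  have key : ∀ l : List (Fin c), ∃ y ∈ Finsupp.supported H H (Multidegree c (n + 2)),
      x - cartanD e y ∈ Finsupp.supported H H {α | ∀ j ∈ l, α j = 0} := by
    intro l
    induction l with
    | nil => exact ⟨0, zero_mem _, fun _ _ => by simp⟩
    | cons j l ih =>
      obtain ⟨y, hy, hy'⟩ := ih
      set p := x - cartanD e y with hp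
      have hpd : cartanD e p = 0 := by rw [hp, map_sub, hd, cartanD_cartanD he he', sub_zero]
      have hpn : p ∈ Finsupp.supported H H (Multidegree c (n + 1)) :=
        sub_mem hx (cartanD_mem_supported e hy)
      -- As `p` is a cycle, changing `y` by its homotopy replaces `p` by `p - D H p - H D p`, to
      -- which `cartan_homotopy` applies.
      refine ⟨y + cartanH ρ j p, add_mem hy (cartanH_mem_supported ρ j hpn), ?_⟩
      have e1 : x - cartanD e (y + cartanH ρ j p)
          = p - cartanD e (cartanH ρ j p) - cartanH ρ j (cartanD e p) := by
        rw [hpd, map_zero, sub_zero, map_add, ← sub_sub]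
      rw [e1]
      have e2 : p - cartanD e (cartanH ρ j p) - cartanH ρ j (cartanD e p)
          = ∑ α ∈ p.support, if α j = 0 then Finsupp.single α (ρ j (p α * e j)) else 0 := by
        conv_lhs => rw [← Finsupp.sum_single p, Finsupp.sum]
        simp only [map_sum, ← Finset.sum_sub_distrib, cartan_homotopy hρ]
      rw [e2]
      refine sum_mem fun α hα => ?_
      split_ifs with h0
      · refine Finsupp.single_mem_supported _ _ fun i hi => ?_
        rcases List.mem_cons.1 hi with rfl | hi
        · exact h0
        · exact hy' hα i hi
      · exact zero_mem _
  obtain ⟨y, hy, hy'⟩ := key (List.finRange c)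
  refine ⟨y, hy, ?_⟩
  have hpn : x - cartanD e y ∈ Finsupp.supported H H (Multidegree c (n + 1)) :=
    sub_mem hx (cartanD_mem_supported e hy)
  have h0 : x - cartanD e y = 0 := by
    rw [← Finsupp.support_eq_empty, Finset.eq_empty_iff_forall_notMem]
    intro α hα
    have h1 : α = 0 := Finsupp.ext fun j => hy' hα j (List.mem_finRange j)
    have h2 : α.degree = n + 1 := hpn hα
    rw [h1, map_zero] at h2
    omega
  rw [sub_eq_zero] at h0
  exact h0.symm

/-- The Cartan resolution is the linear resolution: its `i`-th module has the multi-exponents of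
degree `i` as basis, and the matrix entries are the generators `e_j`, of weight one. At the start of
the resolution the only condition is that the `e_j` generate the elements of positive weight as a
left ideal. -/
theorem isKoszulGrading_of_contractions {k : Type u} [Field k] {H : Type u} [Ring H] [Algebra k H]
    [Nontrivial H] (wt : ℕ → Submodule k H) (internal : DirectSum.IsInternal wt)
    (mul_mem : ∀ {i j : ℕ} {x y : H}, x ∈ wt i → y ∈ wt j → x * y ∈ wt (i + j))
    (wt_zero : wt 0 = 1) (e : Fin c → H) (he1 : ∀ i, e i ∈ wt 1)
    (gen : ∀ n, ∀ x ∈ wt (n + 1), x ∈ Submodule.span H (Set.range e)) (ρ : Fin c → H →ₗ[k] H)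
    (hρ : ∀ i j x, ρ j (x * e i) = (if i = j then x else 0) - ρ j x * e i)
    (he : ∀ i, e i * e i = 0) (he' : ∀ i j, e i * e j = -(e j * e i)) :
    IsKoszulGrading wt := by
  -- The index types of the resolution have to live in the universe of `H`. The maps `E` and `P`
  -- translate between them and functions on all multi-exponents, where the differential was
  -- defined.
  let F : ∀ i, ULift.{u} (Multidegree c i) → (Fin c →₀ ℕ) := fun i a => a.down.1
  have hF : ∀ i, Function.Injective (F i) := fun i a b h => ULift.ext _ _ (Subtype.ext h)
  let E : ∀ i, (ULift.{u} (Multidegree c i) →₀ H) →ₗ[H] ((Fin c →₀ ℕ) →₀ H) := fun i =>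
    Finsupp.lmapDomain H H (F i)
  have hE : ∀ i x, E i x ∈ Finsupp.supported H H (Multidegree c i) := by
    intro i x α hα
    have := Finsupp.mapDomain_support hα
    obtain ⟨a, -, rfl⟩ := Finset.mem_image.1 this
    exact a.down.2
  have hEinj : ∀ i, Function.Injective (E i) := fun i => Finsupp.mapDomain_injective (hF i)
  let P : ∀ i, ((Fin c →₀ ℕ) →₀ H) →ₗ[H] (ULift.{u} (Multidegree c i) →₀ H) := fun i =>
    Finsupp.lcomapDomain (F i) (hF i)
  have hEP : ∀ i x, x ∈ Finsupp.supported H H (Multidegree c i) → E i (P i x) = x := by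
    intro i x hx
    refine Finsupp.mapDomain_comapDomain _ (hF i) _ fun α hα => ?_
    exact ⟨⟨⟨α, hx hα⟩⟩, rfl⟩
  let δ : ∀ i, (ULift.{u} (Multidegree c (i + 1)) →₀ H) →ₗ[H] (ULift.{u} (Multidegree c i) →₀ H) :=
    fun i => P i ∘ₗ cartanD e ∘ₗ E (i + 1)
  have hδ : ∀ i x, E i (δ i x) = cartanD e (E (i + 1) x) := fun i x =>
    hEP i _ (cartanD_mem_supported e (hE _ x))
  let U : Unique (ULift.{u} (Multidegree c 0)) :=
    { default := ⟨⟨0, map_zero _⟩⟩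
      uniq := fun a => ULift.ext _ _ (Subtype.ext ((Finsupp.degree_eq_zero_iff _).1 a.down.2)) }
  have hE0 : ∀ (p : ULift.{u} (Multidegree c 0) →₀ H), E 0 p 0 = p default := by
    intro p
    exact Finsupp.mapDomain_apply (hF 0) p default
  refine ⟨inferInstance, internal, mul_mem, wt_zero, fun i => ULift (Multidegree c i), U, δ,
    ?_, ?_, ?_⟩
  · intro i x y
    have e1 : δ i (Finsupp.single x 1) y = cartanD e (E (i + 1) (Finsupp.single x 1)) (F i y) := by
      rw [← hδ]
      exact (Finsupp.mapDomain_apply (hF i) _ y).symm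
    have e2 : E (i + 1) (Finsupp.single x 1) = Finsupp.single (F (i + 1) x) 1 :=
      Finsupp.mapDomain_single
    rw [e1, e2, cartanD_single, Finsupp.finsetSum_apply]
    refine sum_mem fun j _ => ?_
    split_ifs
    · exact zero_mem _
    · rw [Finsupp.single_apply, one_mul]
      split_ifs
      · exact he1 j
      · exact zero_mem _
  · intro p
    constructor
    · rintro ⟨x, rfl⟩
      rw [← hE0, hδ]
      generalize hz : E (0 + 1) x = z
      have hmul : ∀ (h : H) (j : Fin c), h * e j ∈ ⨆ n : ℕ, wt (n + 1) := by
        intro h j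
        have : h ∈ ⨆ n, wt n := by
          rw [internal.submodule_iSup_eq_top]; trivial
        induction this using Submodule.iSup_induction' with
        | mem n h hn => exact Submodule.mem_iSup_of_mem n (mul_mem hn (he1 j))
        | zero => rw [zero_mul]; exact zero_mem _
        | add x y _ _ hx hy => rw [add_mul]; exact add_mem hx hy
      clear hz
      induction z using Finsupp.induction_linear with
      | zero => simp
      | add x y hx hy => rw [map_add, Finsupp.add_apply]; exact add_mem hx hy
      | single α h =>
        rw [cartanD_single, Finsupp.finsetSum_apply]
        refine sum_mem fun j _ => ?_
        split_ifs
        · exact zero_mem _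
        · rw [Finsupp.single_apply]
          split_ifs
          · exact hmul h j
          · exact zero_mem _
    · intro hp
      have h1 : p default ∈ Submodule.span H (Set.range e) := by
        generalize p default = q at hp
        induction hp using Submodule.iSup_induction' with
        | mem n h hn => exact gen n h hn
        | zero => exact zero_mem _
        | add x y _ _ hx hy => exact add_mem hx hy
      obtain ⟨y, hy⟩ := (Submodule.mem_span_range_iff_exists_fun H).1 h1
      refine ⟨∑ j, Finsupp.single ⟨⟨Finsupp.single j 1, Finsupp.degree_single j 1⟩⟩ (y j), ?_⟩
      refine hEinj 0 ?_
      rw [hδ, map_sum, map_sum]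
      have e3 : ∀ j, cartanD e (E (0 + 1) (Finsupp.single
          ⟨⟨Finsupp.single j 1, Finsupp.degree_single j 1⟩⟩ (y j)))
          = Finsupp.single 0 (y j * e j) := by
        intro j
        have e2 : E (0 + 1) (Finsupp.single
          ⟨⟨Finsupp.single j 1, Finsupp.degree_single j 1⟩⟩ (y j))
            = Finsupp.single (Finsupp.single j 1) (y j) := Finsupp.mapDomain_single
        rw [e2, cartanD_single, Finset.sum_eq_single j]
        · simp
        · intro i _ hij
          rw [if_pos (by simp [Ne.symm hij])]
        · simp
      rw [Finset.sum_congr rfl fun j _ => e3 j, ← Finsupp.single_finsetSum]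
      have e4 : ∑ j, y j * e j = p default := hy
      rw [e4]
      have e5 : p = Finsupp.single default (p default) := Finsupp.unique_single p
      have e6 : E 0 (Finsupp.single default (p default)) = Finsupp.single (F 0 default) (p default) :=
        Finsupp.mapDomain_single
      conv_rhs => rw [e5, e6]
      rfl
  · intro i x
    constructor
    · intro hx
      have h1 : cartanD e (E (i + 1) x) = 0 := by rw [← hδ, hx, map_zero]
      obtain ⟨y, hy, hy'⟩ := cartan_exact hρ he he' (hE (i + 1) x) h1
      refine ⟨P (i + 2) y, hEinj (i + 1) ?_⟩
      rw [hδ, hEP _ _ hy, hy']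
    · rintro ⟨y, rfl⟩
      refine hEinj i ?_
      rw [hδ, hδ, cartanD_cartanD he he', map_zero]

end Cartan

end AInfKoszul

end

noncomputable section

namespace AInfKoszul

open Module

/-! ### Exterior algebras, their base change and the Koszul property -/

section ExtKoszul

/-- The right contraction of the exterior algebra with a linear form. -/
def extContractRight {Q : Type*} [CommRing Q] {N : Type*} [AddCommGroup N] [Module Q N]
    (d : Module.Dual Q N) : ExteriorAlgebra Q N →ₗ[Q] ExteriorAlgebra Q N :=
  (CliffordAlgebra.contractRight (Q := (0 : QuadraticForm Q N))).flip d

theorem extContractRight_mul_ι {Q : Type*} [CommRing Q] {N : Type*} [AddCommGroup N] [Module Q N]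
    (d : Module.Dual Q N) (x : ExteriorAlgebra Q N) (a : N) :
    extContractRight d (x * ExteriorAlgebra.ι Q a)
      = d a • x - extContractRight d x * ExteriorAlgebra.ι Q a :=
  CliffordAlgebra.contractRight_mul_ι (Q := (0 : QuadraticForm Q N)) _ _ _

theorem mem_span_of_mem_exteriorPower {Q : Type*} [CommRing Q] {N : Type*} [AddCommGroup N]
    [Module Q N] {ι : Type*} [Fintype ι] (b : Basis ι Q N) (n : ℕ) {x : ExteriorAlgebra Q N}
    (hx : x ∈ ⋀[Q]^(n + 1) N) :
    x ∈ Submodule.span (ExteriorAlgebra Q N) (Set.range fun i => ExteriorAlgebra.ι Q (b i)) := by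
  rw [ExteriorAlgebra.exteriorPower, pow_succ] at hx
  induction hx using Submodule.mul_induction_on' with
  | mem_mul_mem y hy m hm =>
    obtain ⟨a, rfl⟩ := hm
    rw [← b.sum_repr a, map_sum, Finset.mul_sum]
    refine sum_mem fun i _ => ?_
    rw [map_smul, mul_smul_comm, ← smul_mul_assoc]
    exact Submodule.smul_mem _ _ (Submodule.subset_span ⟨i, rfl⟩)
  | add x _ z _ hx hz => exact add_mem hx hz

variable {c : ℕ}

/-- The differential of the Cartan resolution multiplies on the right, so the contracting operators
are right contractions with the dual basis, transported along `Φ`. -/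
theorem isKoszulGrading_of_equiv {k : Type u} [Field k] {U : Type u} [AddCommGroup U] [Module k U]
    (b : Basis (Fin c) k U) {H : Type u} [Ring H] [Algebra k H] (Φ : H ≃ₐ[k] ExteriorAlgebra k U)
    (wt : ℕ → Submodule k H) (hwt : ∀ n, (wt n).map Φ.toLinearMap = ⋀[k]^n U) :
    IsKoszulGrading wt := by
  have hwt' : ∀ n x, x ∈ wt n ↔ Φ x ∈ ⋀[k]^n U := by
    intro n x
    rw [← hwt n, Submodule.mem_map]
    exact ⟨fun h => ⟨x, h, rfl⟩, fun ⟨y, hy, hxy⟩ => Φ.injective hxy ▸ hy⟩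
  have : Nontrivial H := Φ.symm.injective.nontrivial
  have hanti : ∀ i j, ExteriorAlgebra.ι k (b i) * ExteriorAlgebra.ι k (b j)
      = -(ExteriorAlgebra.ι k (b j) * ExteriorAlgebra.ι k (b i)) :=
    fun i j => eq_neg_of_add_eq_zero_left (ExteriorAlgebra.ι_add_mul_swap _ _)
  refine isKoszulGrading_of_contractions wt ?_ ?_ ?_
    (fun i => Φ.symm (ExteriorAlgebra.ι k (b i))) ?_ ?_
    (fun j => Φ.symm.toLinearMap ∘ₗ extContractRight (b.coord j) ∘ₗ Φ.toLinearMap) ?_ ?_ ?_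
  · have h := DirectSum.Decomposition.isInternal (fun n : ℕ => ⋀[k]^n U)
    rw [DirectSum.isInternal_submodule_iff_iSupIndep_and_iSup_eq_top] at h ⊢
    let o : Submodule k H ≃o Submodule k (ExteriorAlgebra k U) :=
      Submodule.orderIsoMapComap Φ.toLinearEquiv
    have ho : (fun n : ℕ => ⋀[k]^n U) = o ∘ wt := funext fun n => (hwt n).symm
    rw [ho] at h
    refine ⟨(iSupIndep_map_orderIso_iff o).1 h.1, o.injective ?_⟩
    rw [o.map_iSup, o.map_top]
    exact h.2
  · intro i j x y hx hy
    rw [hwt'] at *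
    rw [map_mul]
    exact SetLike.GradedMul.mul_mem (A := fun i : ℕ => ⋀[k]^i U) hx hy
  · ext x
    rw [hwt', ExteriorAlgebra.exteriorPower, pow_zero, Submodule.mem_one, Submodule.mem_one]
    refine exists_congr fun r => ?_
    rw [← Φ.injective.eq_iff, AlgEquiv.commutes]
  · intro i
    rw [hwt', AlgEquiv.apply_symm_apply, ExteriorAlgebra.exteriorPower, pow_one]
    exact ⟨_, rfl⟩
  · intro n x hx
    rw [hwt'] at hx
    obtain ⟨y, hy⟩ := (Submodule.mem_span_range_iff_exists_fun _).1
      (mem_span_of_mem_exteriorPower b n hx)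
    refine (Submodule.mem_span_range_iff_exists_fun _).2 ⟨fun i => Φ.symm (y i), Φ.injective ?_⟩
    rw [← hy, map_sum]
    simp
  · intro i j x
    refine Φ.injective ?_
    simp only [LinearMap.comp_apply, AlgEquiv.toLinearMap_apply, map_mul, map_sub,
      AlgEquiv.apply_symm_apply, extContractRight_mul_ι, Basis.coord_apply, Basis.repr_self,
      Finsupp.single_apply]
    split_ifs <;> simp
  · intro i
    rw [← map_mul, ExteriorAlgebra.ι_sq_zero, map_zero]
  · intro i j
    rw [← map_mul Φ.symm, ← map_mul Φ.symm, ← map_neg Φ.symm, ← hanti]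

theorem quadMk_map_tensorWt {Q : Type u} [CommRing Q] {V : Type u} [AddCommGroup V] [Module Q V]
    (n : ℕ) : (quadWt (extRel Q V) n).map (extEquiv Q V).toLinearMap = ⋀[Q]^n V := by
  have h : ((extEquiv Q V).toAlgHom.comp (quadMk (extRel Q V))).toLinearMap ∘ₗ TensorAlgebra.ι Q
      = ExteriorAlgebra.ι Q := LinearMap.ext fun a => extEquiv_ι V a
  rw [quadWt, ← Submodule.map_comp, tensorWt, ExteriorAlgebra.exteriorPower, ← h,
    LinearMap.range_comp, ← Submodule.map_pow]
  rfl

/-- Squares are not additive, but expanding `x ⊗ x` for a sum of pure tensors gives squares and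
cross terms `x ⊗ y + y ⊗ x`. Having both kinds of generators makes the relations stable under base
change, in characteristic two as well. -/
theorem quadBaseChange_extRel {Q : Type u} [CommRing Q] (k : Type u) [CommRing k] [Algebra Q k]
    (V : Type u) [AddCommGroup V] [Module Q V] :
    quadBaseChange k (extRel Q V) = extRel k (k ⊗[Q] V) := by
  have e : ∀ (s : k) (a b : V), TensorProduct.AlgebraTensorModule.distribBaseChange Q k V V
      (s ⊗ₜ (a ⊗ₜ b)) = (s ⊗ₜ a) ⊗ₜ ((1 : k) ⊗ₜ b) := fun s a b => by simp
  have e2 : ∀ (s t : k) (a b : V), ((s ⊗ₜ[Q] a) ⊗ₜ[k] (t ⊗ₜ[Q] b) : (k ⊗[Q] V) ⊗[k] (k ⊗[Q] V))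
      = (s * t) • (((1 : k) ⊗ₜ[Q] a) ⊗ₜ[k] ((1 : k) ⊗ₜ[Q] b)) := by
    intro s t a b
    have : ∀ (s : k) (a : V), s ⊗ₜ[Q] a = s • ((1 : k) ⊗ₜ[Q] a) := fun s a => by
      rw [TensorProduct.smul_tmul', smul_eq_mul, mul_one]
    rw [this s, this t, TensorProduct.smul_tmul_smul]
  apply le_antisymm
  · rw [quadBaseChange, Submodule.map_le_iff_le_comap, Submodule.baseChange_eq_span,
      Submodule.span_le]
    rintro _ ⟨x, hx, rfl⟩
    simp only [Submodule.comap_coe, Set.mem_preimage, SetLike.mem_coe, TensorProduct.mk_apply]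
    rw [SetLike.mem_coe, extRel] at hx
    induction hx using Submodule.span_induction with
    | mem x hx =>
      rcases hx with ⟨a, rfl⟩ | ⟨a, b, rfl⟩
      · exact Submodule.subset_span (Or.inl ⟨_, e _ _ _⟩)
      · refine Submodule.subset_span (Or.inr ⟨1 ⊗ₜ a, 1 ⊗ₜ b, ?_⟩)
        rw [TensorProduct.tmul_add, map_add]
        exact congrArg₂ _ (e _ _ _) (e _ _ _)
    | zero => simp
    | add x y _ _ hx hy =>
      rw [TensorProduct.tmul_add, map_add]; exact add_mem hx hy
    | smul r x _ hx =>
      rw [TensorProduct.tmul_smul, ← algebraMap_smul k r, map_smul]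
      exact Submodule.smul_mem _ _ hx
  · have h1 : ∀ a : V, ((1 : k) ⊗ₜ[Q] a) ⊗ₜ[k] ((1 : k) ⊗ₜ[Q] a) ∈ quadBaseChange k (extRel Q V) :=
      fun a => ⟨1 ⊗ₜ (a ⊗ₜ a), Submodule.tmul_mem_baseChange_of_mem _
        (Submodule.subset_span (Or.inl ⟨a, rfl⟩)), e _ _ _⟩
    have h2 : ∀ a b : V, ((1 : k) ⊗ₜ[Q] a) ⊗ₜ[k] ((1 : k) ⊗ₜ[Q] b)
        + ((1 : k) ⊗ₜ[Q] b) ⊗ₜ[k] ((1 : k) ⊗ₜ[Q] a) ∈ quadBaseChange k (extRel Q V) := by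
      intro a b
      refine ⟨1 ⊗ₜ (a ⊗ₜ b + b ⊗ₜ a), Submodule.tmul_mem_baseChange_of_mem _
        (Submodule.subset_span (Or.inr ⟨a, b, rfl⟩)), ?_⟩
      rw [TensorProduct.tmul_add, map_add]
      exact congrArg₂ _ (e _ _ _) (e _ _ _)
    have h3 : ∀ x y : k ⊗[Q] V, x ⊗ₜ[k] y + y ⊗ₜ[k] x ∈ quadBaseChange k (extRel Q V) := by
      intro x y
      induction x using TensorProduct.induction_on with
      | zero => simp
      | tmul s a =>
        induction y using TensorProduct.induction_on with
        | zero => simp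
        | tmul t b =>
          rw [e2 s t, e2 t s, mul_comm t s, ← smul_add]
          exact Submodule.smul_mem _ _ (h2 a b)
        | add y z hy hz =>
          rw [TensorProduct.tmul_add, TensorProduct.add_tmul, add_add_add_comm]
          exact add_mem hy hz
      | add x z hx hz =>
        rw [TensorProduct.tmul_add, TensorProduct.add_tmul, add_add_add_comm]
        exact add_mem hx hz
    rw [extRel, Submodule.span_le]
    rintro _ (⟨x, rfl⟩ | ⟨x, y, rfl⟩)
    · rw [SetLike.mem_coe]
      induction x using TensorProduct.induction_on with
      | zero => simp
      | tmul s a =>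
        rw [e2]
        exact Submodule.smul_mem _ _ (h1 a)
      | add x y hx hy =>
        have : (x + y) ⊗ₜ[k] (x + y) = x ⊗ₜ x + y ⊗ₜ y + (x ⊗ₜ y + y ⊗ₜ x) := by
          simp only [TensorProduct.tmul_add, TensorProduct.add_tmul]
          abel
        rw [this]
        exact add_mem (add_mem hx hy) (h3 x y)
    · exact h3 x y

theorem isKoszulGrading_quadBaseChange (Q : Type u) [CommRing Q] (c : ℕ) (k : Type u) [Field k]
    [Algebra Q k] : IsKoszulGrading (quadWt (quadBaseChange k (extRel Q (Fin c → Q)))) := by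
  rw [quadBaseChange_extRel]
  exact isKoszulGrading_of_equiv ((Pi.basisFun Q (Fin c)).baseChange k)
    (extEquiv k (k ⊗[Q] (Fin c → Q))) _ quadMk_map_tensorWt

/-- The right contractions over `Q` are base changed directly, which avoids identifying `k ⊗ Λ` with
an exterior algebra over `k`. -/
theorem isKoszulGrading_baseChange (Q : Type u) [CommRing Q] (c : ℕ) (k : Type u) [Field k]
    [Algebra Q k] :
    IsKoszulGrading fun n : ℕ => (⋀[Q]^n (Fin c → Q) : Submodule Q _).baseChange k := by
  have hn : Nontrivial (k ⊗[Q] ExteriorAlgebra Q (Fin c → Q)) :=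
    (Algebra.TensorProduct.lift (Algebra.ofId k k) ((Algebra.ofId Q k).comp
      ExteriorAlgebra.algebraMapInv) (fun _ _ => mul_comm _ _)).toRingHom.domain_nontrivial
  refine isKoszulGrading_of_contractions _ (DirectSum.Decomposition.isInternal _)
    (fun hx hy => SetLike.GradedMul.mul_mem
      (A := fun n : ℕ => (⋀[Q]^n (Fin c → Q) : Submodule Q _).baseChange k) hx hy) ?_
    (fun i => 1 ⊗ₜ extGen Q i) ?_ ?_
    (fun j => (extContractRight (LinearMap.proj j)).baseChange k) ?_ ?_ ?_
  · apply le_antisymm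
    · rw [Submodule.baseChange_eq_span, Submodule.span_le]
      rintro _ ⟨x, hx, rfl⟩
      rw [SetLike.mem_coe, ExteriorAlgebra.exteriorPower, pow_zero, Submodule.mem_one] at hx
      obtain ⟨r, rfl⟩ := hx
      rw [SetLike.mem_coe, Submodule.mem_one]
      exact ⟨algebraMap Q k r, by
        simp [Algebra.algebraMap_eq_smul_one, Algebra.TensorProduct.one_def]⟩
    · rw [Submodule.one_le]
      exact Submodule.tmul_mem_baseChange_of_mem _
        (SetLike.GradedOne.one_mem (A := fun i : ℕ => ⋀[Q]^i (Fin c → Q)))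
  · intro i
    refine Submodule.tmul_mem_baseChange_of_mem _ ?_
    rw [ExteriorAlgebra.exteriorPower, pow_one]
    exact ⟨_, rfl⟩
  · intro n x hx
    rw [Submodule.baseChange_eq_span] at hx
    induction hx using Submodule.span_induction with
    | mem x hx =>
      obtain ⟨x, hx, rfl⟩ := hx
      obtain ⟨y, hy⟩ := (Submodule.mem_span_range_iff_exists_fun _).1
        (mem_span_of_mem_exteriorPower (Pi.basisFun Q (Fin c)) n hx)
      refine (Submodule.mem_span_range_iff_exists_fun _).2 ⟨fun i => 1 ⊗ₜ y i, ?_⟩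
      rw [← hy, map_sum]
      refine Finset.sum_congr rfl fun i _ => ?_
      simp [extGen]
    | zero => exact zero_mem _
    | add x y _ _ hx hy => exact add_mem hx hy
    | smul r x _ hx =>
      rw [Algebra.smul_def]
      exact Submodule.smul_mem _ _ hx
  · intro i j x
    induction x using TensorProduct.induction_on with
    | zero => simp
    | tmul s x =>
      rw [Algebra.TensorProduct.tmul_mul_tmul, mul_one, LinearMap.baseChange_tmul,
        LinearMap.baseChange_tmul, Algebra.TensorProduct.tmul_mul_tmul, mul_one, extGen,
        extContractRight_mul_ι, TensorProduct.tmul_sub, LinearMap.proj_apply, Pi.single_apply]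
      simp only [eq_comm (a := j)]
      split_ifs <;> simp
    | add x y hx hy =>
      rw [add_mul, map_add, hx, hy, map_add, add_mul]
      split_ifs
      · abel
      · abel
  · intro i
    rw [Algebra.TensorProduct.tmul_mul_tmul, extGen_mul_self, TensorProduct.tmul_zero]
  · intro i j
    rw [Algebra.TensorProduct.tmul_mul_tmul, Algebra.TensorProduct.tmul_mul_tmul, extGen_anticomm,
      TensorProduct.tmul_neg]

variable {Q : Type u} [CommRing Q]

theorem baseChange_koszulD (k : Type*) [CommRing k] [Algebra Q k] {f : Fin c → Q}
    (hk : ∀ i, algebraMap Q k (f i) = 0) : (koszulD f).baseChange k = 0 := by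
  refine LinearMap.ext fun x => ?_
  induction x using TensorProduct.induction_on with
  | zero => simp
  | tmul s x =>
    rw [LinearMap.baseChange_tmul, koszulD_eq_sum, TensorProduct.tmul_sum, LinearMap.zero_apply]
    refine Finset.sum_eq_zero fun i _ => ?_
    rw [TensorProduct.tmul_smul, TensorProduct.smul_tmul', Algebra.smul_def, hk, zero_mul,
      TensorProduct.zero_tmul]
  | add x y hx hy => rw [map_add, hx, hy, LinearMap.zero_apply, LinearMap.zero_apply,
      LinearMap.zero_apply, add_zero]

/-- The differential is `∑ f_i ρ_i`, which vanishes over `k`. The dg algebra is thus equal to its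
own homology and formality is trivial. -/
theorem isKoszulDG_koszul (k : Type u) [Field k] [Algebra Q k] {f : Fin c → Q}
    (hk : ∀ i, algebraMap Q k (f i) = 0) : IsKoszulDG ((koszulDG f).baseChange k) := by
  refine ⟨⟨_, (koszulDG f).baseChange k⟩, baseChange_koszulD k hk, Relation.EqvGen.refl _,
    fun n : ℕ => (⋀[Q]^n (Fin c → Q) : Submodule Q _).baseChange k, fun n => ?_,
    isKoszulGrading_baseChange Q c k⟩
  refine le_antisymm (le_iSup_of_le (n : ℤ) (le_inf le_rfl ?_)) (iSup_le fun _ => inf_le_left)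
  show _ ≤ (extDeg Q c n).baseChange k
  rw [extDeg_nat]

theorem extDeg_free (i : ℤ) : Module.Free Q (extDeg Q c i) := by
  rcases lt_or_ge i 0 with hi | hi
  · rw [extDeg_neg i hi]; infer_instance
  · lift i to ℕ using hi
    rw [extDeg_nat]; infer_instance

variable {R : Type v} [CommRing R] [Algebra Q R]

theorem isKoszulHom_of_regular [IsLocalRing Q] [IsLocalRing R]
    (hφ : Function.Surjective (algebraMap Q R)) {f : Fin c → Q}
    (hreg : RingTheory.Sequence.IsRegular Q (List.ofFn f))
    (hf : RingHom.ker (algebraMap Q R) = Ideal.span (Set.range f)) :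
    IsKoszulHom Q R := by
  have hm : ∀ i, algebraMap Q (IsLocalRing.ResidueField Q) (f i) = 0 := by
    intro i
    rw [IsLocalRing.ResidueField.algebraMap_eq, IsLocalRing.residue_eq_zero_iff]
    refine IsLocalRing.le_maximalIdeal (RingHom.ker_ne_top (algebraMap Q R)) ?_
    rw [hf]
    exact Ideal.subset_span ⟨i, rfl⟩
  exact ⟨hφ.isLocalHom _, Module.Finite.of_surjective (Algebra.linearMap Q R) hφ,
    IsLocalRing.residue_surjective.comp hφ, _, _, _, koszulDG f, koszulAug Q c R,
    ⟨extDeg_neg, extDeg_free, koszulAug_deg, koszulAug_d f hf, koszul_quasiIso hφ hreg hf⟩,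
    isKoszulDG_koszul _ hm⟩

end ExtKoszul

end AInfKoszul

end

noncomputable section

namespace AInfKoszul

open Module

/-! ### The strictly Koszul presentation -/

section TensorGradings

variable {Q : Type*} [CommRing Q] {N : Type*} [AddCommGroup N] [Module Q N]

theorem tensorWt_eq_span (n : ℕ) :
    tensorWt Q N n = Submodule.span Q (Set.range (TensorAlgebra.tprod Q N n)) := by
  apply le_antisymm
  · induction n with
    | zero =>
      rw [tensorWt, pow_zero, Submodule.one_le]
      refine Submodule.subset_span ⟨Fin.elim0, ?_⟩
      rw [TensorAlgebra.tprod_apply]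
      rfl
    | succ n ih =>
      rw [tensorWt, pow_succ']
      rw [Submodule.mul_le]
      rintro _ ⟨a, rfl⟩ y hy
      replace hy := ih hy
      induction hy using Submodule.span_induction with
      | mem y hy =>
        obtain ⟨b, rfl⟩ := hy
        refine Submodule.subset_span ⟨Fin.cons a b, ?_⟩
        simp [TensorAlgebra.tprod_apply, List.ofFn_succ]
      | zero => rw [mul_zero]; exact zero_mem _
      | add x y _ _ hx hy => rw [mul_add]; exact add_mem hx hy
      | smul r x _ hx => rw [mul_smul_comm]; exact Submodule.smul_mem _ _ hx
  · rw [Submodule.span_le]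
    rintro _ ⟨a, rfl⟩
    rw [SetLike.mem_coe, TensorAlgebra.tprod_apply, tensorWt]
    induction n with
    | zero => exact Submodule.one_le.1 le_rfl
    | succ n ih =>
      rw [List.ofFn_succ, List.prod_cons, pow_succ']
      exact Submodule.mul_mem_mul ⟨_, rfl⟩ (ih _)

theorem tprod_mem_tensorWt (n : ℕ) (a : Fin n → N) :
    TensorAlgebra.tprod Q N n a ∈ tensorWt Q N n := by
  rw [tensorWt_eq_span]; exact Submodule.subset_span ⟨a, rfl⟩

theorem concDeg_self (a : ℤ) : concDeg Q N a a = ⊤ := if_pos rfl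

theorem concDeg_ne {a i : ℤ} (h : i ≠ a) : concDeg Q N a i = ⊥ := if_neg h

theorem concDeg_internal (a : ℤ) : DirectSum.IsInternal (concDeg Q N a) := by
  rw [DirectSum.isInternal_submodule_iff_iSupIndep_and_iSup_eq_top]
  refine ⟨fun i => ?_, ?_⟩
  · by_cases hi : i = a
    · subst hi
      have : ⨆ j, ⨆ (_ : j ≠ i), concDeg Q N i j = ⊥ := by
        simp only [iSup_eq_bot]
        exact fun j hj => concDeg_ne hj
      rw [this]
      exact disjoint_bot_right
    · rw [concDeg_ne hi]
      exact disjoint_bot_left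
  · rw [eq_top_iff, ← concDeg_self (Q := Q) (N := N) a]
    exact le_iSup (concDeg Q N a) a

theorem tensorDeg_concDeg (a s i : ℤ) :
    tensorDeg (concDeg Q N a) s i = ⨆ (n : ℕ) (_ : n * (a + s) = i), tensorWt Q N n := by
  apply le_antisymm
  · rw [tensorDeg, Submodule.span_le]
    rintro _ ⟨n, b, δ, hb, hδ, rfl⟩
    by_cases h : ∀ j, δ j = a
    · have hn : n * (a + s) = i := by rw [← hδ]; simp [h, mul_add]
      exact Submodule.mem_iSup_of_mem n (Submodule.mem_iSup_of_mem hn (tprod_mem_tensorWt n b))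
    · push Not at h
      obtain ⟨j, hj⟩ := h
      have := hb j
      rw [concDeg_ne hj, Submodule.mem_bot] at this
      rw [(TensorAlgebra.tprod Q N n).map_coord_zero j this]
      exact zero_mem _
  · refine iSup₂_le fun n hn => ?_
    rw [tensorWt_eq_span, Submodule.span_le]
    rintro _ ⟨b, rfl⟩
    refine Submodule.subset_span ⟨n, b, fun _ => a, fun j => ?_, ?_, rfl⟩
    · rw [concDeg_self]; trivial
    · rw [← hn]; simp [mul_add]

theorem tensDeg_concDeg (N' : Type*) [AddCommGroup N'] [Module Q N'] (a b : ℤ) :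
    tensDeg (concDeg Q N a) (concDeg Q N' b) (a + b) = ⊤ := by
  rw [eq_top_iff]
  refine le_trans ?_ (le_iSup _ a)
  rw [add_sub_cancel_left, concDeg_self, concDeg_self, TensorProduct.map₂_mk_top_top_eq_top]

end TensorGradings

section Presentation

variable {Q : Type u} [CommRing Q] {c : ℕ}

/-- Polarisation: the symmetric relations follow from those for basis vectors by bilinearity, and
the squares of sums then follow from squares and symmetric relations. -/
theorem mem_span_extRel {V : Type u} [AddCommGroup V] [Module Q V] {ι : Type*} (b : Basis ι Q V)
    {x : V ⊗[Q] V} (hx : x ∈ extRel Q V) {p : Submodule Q (V ⊗[Q] V)}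
    (h1 : ∀ i, b i ⊗ₜ b i ∈ p) (h2 : ∀ i j, b i ⊗ₜ b j + b j ⊗ₜ b i ∈ p) : x ∈ p := by
  have h3 : ∀ x y : V, x ⊗ₜ y + y ⊗ₜ x ∈ p := by
    intro x y
    induction x using basis_induction b with
    | zero => simp
    | add x z hx hz =>
      rw [TensorProduct.tmul_add, TensorProduct.add_tmul, add_add_add_comm]
      exact add_mem hx hz
    | smul r x hx =>
      rw [TensorProduct.tmul_smul, ← TensorProduct.smul_tmul', ← smul_add]
      exact p.smul_mem _ hx
    | h i =>
      induction y using basis_induction b with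
      | zero => simp
      | add x z hx hz =>
        rw [TensorProduct.tmul_add, TensorProduct.add_tmul, add_add_add_comm]
        exact add_mem hx hz
      | smul r x hx =>
        rw [TensorProduct.tmul_smul, ← TensorProduct.smul_tmul', ← smul_add]
        exact p.smul_mem _ hx
      | h j => exact h2 i j
  have h4 : ∀ x : V, x ⊗ₜ x ∈ p := by
    intro x
    induction x using basis_induction b with
    | zero => simp
    | add x y hx hy =>
      have : (x + y) ⊗ₜ[Q] (x + y) = x ⊗ₜ x + y ⊗ₜ y + (x ⊗ₜ y + y ⊗ₜ x) := by
        simp only [TensorProduct.tmul_add, TensorProduct.add_tmul]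
        abel
      rw [this]
      exact add_mem (add_mem hx hy) (h3 x y)
    | smul r x hx =>
      rw [TensorProduct.tmul_smul, ← TensorProduct.smul_tmul']
      exact p.smul_mem _ (p.smul_mem _ hx)
    | h i => exact h1 i
  refine Submodule.span_le.2 ?_ hx
  rintro _ (⟨a, rfl⟩ | ⟨a, b, rfl⟩)
  · exact h4 a
  · exact h3 a b

/-- The complement is the kernel of a projector: `b_i ⊗ b_i` is kept, `b_i ⊗ b_j` with `i < j` is
sent to `b_i ⊗ b_j + b_j ⊗ b_i`, and the opposite order is sent to zero. Exactly one of the two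
orders contributes, so no factor of two appears. -/
theorem exists_isCompl_extRel {V : Type u} [AddCommGroup V] [Module Q V] {ι : Type*} [LinearOrder ι]
    (b : Basis ι Q V) : ∃ W', IsCompl (extRel Q V) W' := by
  let P : V ⊗[Q] V →ₗ[Q] V ⊗[Q] V := (b.tensorProduct b).constr Q fun p =>
    if p.1 = p.2 then b p.1 ⊗ₜ b p.1 else if p.1 < p.2 then b p.1 ⊗ₜ b p.2 + b p.2 ⊗ₜ b p.1 else 0
  have hP : ∀ i j, P (b i ⊗ₜ b j) = if i = j then b i ⊗ₜ b i else if i < j then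
      b i ⊗ₜ b j + b j ⊗ₜ b i else 0 := by
    intro i j
    have := (b.tensorProduct b).constr_basis Q (fun p => if p.1 = p.2 then b p.1 ⊗ₜ[Q] b p.1 else
      if p.1 < p.2 then b p.1 ⊗ₜ b p.2 + b p.2 ⊗ₜ b p.1 else 0) (i, j)
    rwa [Basis.tensorProduct_apply] at this
  have h1 : ∀ a : V, a ⊗ₜ[Q] a ∈ extRel Q V := fun a => Submodule.subset_span (Or.inl ⟨a, rfl⟩)
  have h2 : ∀ a b : V, a ⊗ₜ[Q] b + b ⊗ₜ[Q] a ∈ extRel Q V :=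
    fun a b => Submodule.subset_span (Or.inr ⟨a, b, rfl⟩)
  have hproj : LinearMap.IsProj (extRel Q V) P := by
    constructor
    · intro x
      induction x using basis_induction (b.tensorProduct b) with
      | zero => simp
      | add x y hx hy => rw [map_add]; exact add_mem hx hy
      | smul r x hx => rw [map_smul]; exact Submodule.smul_mem _ _ hx
      | h p =>
        rw [Basis.tensorProduct_apply', hP]
        split_ifs
        · exact h1 _
        · exact h2 _ _
        · exact zero_mem _
    · intro x hx
      refine mem_span_extRel b hx (p := LinearMap.eqLocus P LinearMap.id) ?_ ?_
      · intro i
        rw [LinearMap.mem_eqLocus, hP, if_pos rfl, LinearMap.id_apply]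
      · intro i j
        rw [LinearMap.mem_eqLocus, LinearMap.id_apply, map_add, hP, hP]
        rcases lt_trichotomy i j with h | rfl | h
        · rw [if_neg h.ne, if_pos h, if_neg h.ne', if_neg h.not_gt, add_zero]
        · simp
        · rw [if_neg h.ne', if_neg h.not_gt, if_neg h.ne, if_pos h, zero_add, add_comm]
  exact ⟨_, hproj.isCompl⟩

theorem quadMk_mem_exteriorPower {V : Type u} [AddCommGroup V] [Module Q V] {n : ℕ}
    {x : QuadAlg (extRel Q V)} (hx : x ∈ quadWt (extRel Q V) n) : extEquiv Q V x ∈ ⋀[Q]^n V := by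
  rw [← quadMk_map_tensorWt]
  exact ⟨x, hx, rfl⟩

theorem quadDeg_map (i : ℤ) :
    (quadDeg (concDeg Q (Fin c → Q) 1) (extRel Q (Fin c → Q)) i).map
      (extEquiv Q (Fin c → Q)).toLinearEquiv.toLinearMap = extDeg Q c i := by
  have h : ∀ n, ((tensorWt Q (Fin c → Q) n).map (quadMk (extRel Q (Fin c → Q))).toLinearMap).map
      (extEquiv Q (Fin c → Q)).toLinearEquiv.toLinearMap = ⋀[Q]^n (Fin c → Q) :=
    fun n => quadMk_map_tensorWt n
  rw [quadDeg, tensorDeg_concDeg]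
  simp only [Submodule.map_iSup, h]
  apply le_antisymm
  · refine iSup₂_le fun n hn => ?_
    rw [← hn, add_zero, mul_one, extDeg_nat]
  · rcases lt_or_ge i 0 with hi | hi
    · rw [extDeg_neg i hi]; exact bot_le
    · lift i to ℕ using hi
      rw [extDeg_nat]
      exact le_iSup₂_of_le i (by simp) le_rfl

theorem genMap_coe (f : Fin c → Q) (v : Fin c → Q) :
    (genMap (koszulAInf f) (extEquiv Q (Fin c → Q)).toLinearEquiv v :
      ExteriorAlgebra Q (Fin c → Q)) = ExteriorAlgebra.ι Q v := by
  have h : ∀ x, ((koszulAInf f).proj x : ExteriorAlgebra Q (Fin c → Q))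
      = x - ExteriorAlgebra.algebraMapInv x • (1 : ExteriorAlgebra Q (Fin c → Q)) := fun x => rfl
  rw [genMap]
  simp only [LinearMap.comp_apply]
  rw [h]
  have h2 : (extEquiv Q (Fin c → Q)).toLinearEquiv.toLinearMap
      ((quadMk (extRel Q (Fin c → Q))).toLinearMap (TensorAlgebra.ι Q v))
        = ExteriorAlgebra.ι Q v := extEquiv_ι _ v
  rw [h2]
  simp [ExteriorAlgebra.algebraMapInv]

theorem koszulAInf_proj_algebraMap (f : Fin c → Q) (r : Q) :
    (koszulAInf f).proj (algebraMap Q (ExteriorAlgebra Q (Fin c → Q)) r) = 0 := by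
  refine Subtype.ext ?_
  show algebraMap Q (ExteriorAlgebra Q (Fin c → Q)) r - ExteriorAlgebra.algebraMapInv
    (algebraMap Q (ExteriorAlgebra Q (Fin c → Q)) r) •
    (1 : ExteriorAlgebra Q (Fin c → Q)) = 0
  rw [ExteriorAlgebra.algebraMap_leftInverse, Algebra.algebraMap_eq_smul_one, sub_self]

theorem koszulD_ι (f : Fin c → Q) (v : Fin c → Q) :
    koszulD f (ExteriorAlgebra.ι Q v)
      = algebraMap Q (ExteriorAlgebra Q (Fin c → Q)) (seqForm f v) := by
  have := koszulD_ι_mul f v 1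
  rwa [mul_one, koszulD_one, mul_zero, sub_zero, ← Algebra.algebraMap_eq_smul_one] at this

/-- The differential of a generator is a scalar, which the projection to `Ā` forgets. It reappears
as the curvature in `barCurv_symElt`. -/
theorem mBar_one_genMap (f : Fin c → Q) (v : Fin c → Q) :
    (koszulAInf f).mBar 1 ![genMap (koszulAInf f) (extEquiv Q (Fin c → Q)).toLinearEquiv v] = 0 := by
  have : (koszulAInf f).mBar 1 ![genMap (koszulAInf f) (extEquiv Q (Fin c → Q)).toLinearEquiv v]
      = (koszulAInf f).proj (koszulD f
        (genMap (koszulAInf f) (extEquiv Q (Fin c → Q)).toLinearEquiv v :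
          ExteriorAlgebra Q (Fin c → Q))) := rfl
  rw [this, genMap_coe, koszulD_ι, koszulAInf_proj_algebraMap]

theorem evalFamily_ι_mul_ι {N : Type*} [AddCommGroup N] [Module Q N] {X : Type*} [AddCommGroup X]
    [Module Q X] (F : ∀ n : ℕ, MultilinearMap Q (fun _ : Fin n => N) X) (a b : N) :
    evalFamily F (TensorAlgebra.ι Q a * TensorAlgebra.ι Q b) = F 2 ![a, b] := by
  rw [← evalFamily_tprod, TensorAlgebra.tprod_apply]
  simp

theorem tensorMap_tprod {N N' : Type*} [AddCommGroup N] [Module Q N] [AddCommGroup N'] [Module Q N']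
    (g : N →ₗ[Q] N') (n : ℕ) (a : Fin n → N) :
    tensorMap g (TensorAlgebra.tprod Q N n a) = TensorAlgebra.tprod Q N' n fun i => g (a i) := by
  rw [TensorAlgebra.tprod_apply, TensorAlgebra.tprod_apply, map_list_prod, List.map_ofFn]
  congr 2
  funext i
  simp [tensorMap]

theorem mBar_two_coe (f : Fin c → Q) (a b : (koszulAInf f).bar) :
    (koszulAInf f).mBar 2 ![a, b]
      = (koszulAInf f).proj ((a : ExteriorAlgebra Q (Fin c → Q)) * b) := by
  have : (koszulAInf f).mBar 2 ![a, b] = (koszulAInf f).proj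
    (dgOps (koszulD f) 2 fun i => (![a, b] i : ExteriorAlgebra Q (Fin c → Q))) := rfl
  rw [this, dgOps_two]
  rfl

theorem mBar_ge (f : Fin c → Q) (n : ℕ) (hn : 3 ≤ n) : (koszulAInf f).mBar n = 0 := by
  have : (koszulAInf f).m n = 0 := dgOps_ge _ n hn
  rw [SplitAInfAlgebra.mBar, this]
  ext a
  simp

/-- In weight two the product kills the defining relations of the exterior algebra; in weight at
least three the operations themselves vanish. -/
theorem evalFamily_mBar_genMap (f : Fin c → Q) {n : ℕ} (hn : 2 ≤ n)
    {x : TensorAlgebra Q (Fin c → Q)} (hx : x ∈ quadInter (extRel Q (Fin c → Q)) n) :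
    evalFamily (koszulAInf f).mBar
      (tensorMap (genMap (koszulAInf f) (extEquiv Q (Fin c → Q)).toLinearEquiv) x) = 0 := by
  rcases hn.eq_or_lt with rfl | hn
  · have hx3 : x ∈ tensorWt Q (Fin c → Q) 0 * (extRel Q (Fin c → Q)).map (quadIncl Q (Fin c → Q))
        * tensorWt Q (Fin c → Q) 0 :=
      (iInf_le_of_le 0 (iInf_le_of_le 0 (iInf_le_of_le rfl le_rfl)) :
        (⨅ (i : ℕ) (j : ℕ) (_ : i + 2 + j = 2), tensorWt Q (Fin c → Q) i *
          (extRel Q (Fin c → Q)).map (quadIncl Q (Fin c → Q)) * tensorWt Q (Fin c → Q) j) ≤ _) hx.2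
    rw [tensorWt, pow_zero, one_mul, mul_one] at hx3
    obtain ⟨w, hw, rfl⟩ := hx3
    refine Submodule.span_induction (p := fun w _ => evalFamily (koszulAInf f).mBar
      (tensorMap (genMap (koszulAInf f) (extEquiv Q (Fin c → Q)).toLinearEquiv)
        (quadIncl Q (Fin c → Q) w)) = 0) ?_ (by simp) (fun x y _ _ hx hy => by simp [hx, hy])
      (fun r x _ hx => by simp [hx]) hw
    rintro _ (⟨a, rfl⟩ | ⟨a, b, rfl⟩)
    · rw [quadIncl_tmul, map_mul]
      simp only [tensorMap, TensorAlgebra.lift_ι_apply, LinearMap.comp_apply]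
      rw [evalFamily_ι_mul_ι, mBar_two_coe, genMap_coe, ExteriorAlgebra.ι_sq_zero, map_zero]
    · rw [map_add, quadIncl_tmul, quadIncl_tmul, map_add, map_mul, map_mul, map_add]
      simp only [tensorMap, TensorAlgebra.lift_ι_apply, LinearMap.comp_apply]
      rw [evalFamily_ι_mul_ι, evalFamily_ι_mul_ι, mBar_two_coe, mBar_two_coe, genMap_coe,
        genMap_coe, ← map_add, ExteriorAlgebra.ι_add_mul_swap, map_zero]
  · have hx1 := hx.1
    clear hx
    rw [SetLike.mem_coe, tensorWt_eq_span] at hx1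
    induction hx1 using Submodule.span_induction with
    | mem x hx =>
      obtain ⟨a, rfl⟩ := hx
      rw [tensorMap_tprod, evalFamily_tprod, mBar_ge f n hn]
      rfl
    | zero => simp
    | add x y _ _ hx hy => rw [map_add, map_add, hx, hy, add_zero]
    | smul r x _ hx => rw [map_smul, map_smul, hx, smul_zero]

theorem koszul_presentation [IsLocalRing Q] {R : Type v} [CommRing R] [IsLocalRing R] [Algebra Q R]
    (hφ : Function.Surjective (algebraMap Q R)) {f : Fin c → Q}
    (hreg : RingTheory.Sequence.IsRegular Q (List.ofFn f))
    (hf : RingHom.ker (algebraMap Q R) = Ideal.span (Set.range f)) :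
    IsStrictlyKoszulPresentation (R := R) (koszulAInf f) (concDeg Q (Fin c → Q) 1)
        (extRel Q (Fin c → Q)) (extEquiv Q (Fin c → Q)).toLinearEquiv
        (koszulAug Q c R).toLinearMap where
  V_internal := concDeg_internal 1
  V_nonneg i hi := concDeg_ne (by omega)
  V_free i := by
    by_cases h : i = 1
    · rw [h, concDeg_self]; exact Module.Free.of_equiv (Submodule.topEquiv (R := Q)).symm
    · rw [concDeg_ne h]; infer_instance
  V_finite i := by
    by_cases h : i = 1
    · rw [h, concDeg_self]; infer_instance
    · rw [concDeg_ne h]; infer_instance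
  W_summand := exists_isCompl_extRel (Pi.basisFun Q (Fin c))
  W_graded := by
    refine le_antisymm (le_iSup_of_le (1 + 1) ?_) (iSup_le fun _ => inf_le_left)
    rw [tensDeg_concDeg, inf_top_eq]
  e_deg := quadDeg_map
  e_one := map_one (extEquiv Q (Fin c → Q))
  e_aug n hn x hx := by
    obtain ⟨m, rfl⟩ := Nat.exists_eq_succ_of_ne_zero hn.ne'
    exact ext_aug_pos m _ (quadMk_mem_exteriorPower hx)
  koszul := isKoszulGrading_quadBaseChange Q c _
  mod_two x y := by
    have : (koszulAInf f).m 2 ![extEquiv Q (Fin c → Q) x, extEquiv Q (Fin c → Q) y]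
        = extEquiv Q (Fin c → Q) (x * y) := by
      rw [map_mul]
      exact dgOps_two (koszulD f) _
    have h2 : (koszulAInf f).m 2 ![(extEquiv Q (Fin c → Q)).toLinearEquiv x,
        (extEquiv Q (Fin c → Q)).toLinearEquiv y] - (extEquiv Q (Fin c → Q)).toLinearEquiv (x * y)
        = 0 := sub_eq_zero.2 this
    rw [h2]
    exact zero_mem _
  mod_ne n hn a := by
    have hm : ∀ i, f i ∈ IsLocalRing.maximalIdeal Q := by
      intro i
      refine IsLocalRing.le_maximalIdeal (RingHom.ker_ne_top (algebraMap Q R)) ?_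
      rw [hf]
      exact Ideal.subset_span ⟨i, rfl⟩
    match n with
    | 0 => exact zero_mem _
    | 1 =>
      show koszulD f (a 0) ∈ _
      rw [koszulD_eq_sum]
      exact sum_mem fun i _ => Submodule.smul_mem_smul (hm i) trivial
    | 2 => exact absurd rfl hn
    | n + 3 => exact zero_mem _
  ε_deg := koszulAug_deg
  ε_one := map_one (koszulAug Q c R)
  ε_two x y := by
    have : (koszulAInf f).m 2 ![x, y] = x * y := dgOps_two (koszulD f) _
    exact (congrArg (koszulAug Q c R) this).trans (map_mul (koszulAug Q c R) x y)
  ε_ne n hn a := by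
    match n with
    | 0 => exact map_zero _
    | 1 => exact koszulAug_d f hf (a 0)
    | 2 => exact absurd rfl hn
    | n + 3 => exact map_zero _
  quasiIso := koszul_quasiIso hφ hreg hf
  strict_one v := by
    rw [mBar_one_genMap]
    exact zero_mem _
  strict n hn x hx := by
    rw [evalFamily_mBar_genMap f hn hx]
    exact zero_mem _

end Presentation

end AInfKoszul

end

noncomputable section

namespace AInfKoszul

open Module

/-! ### Words and symmetric tensors -/

section Words

variable {Q : Type u} [CommRing Q] {c : ℕ}

/-- The basis of the tensor algebra on `Q^c` given by the words in the standard basis. -/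
def wordBasis (Q : Type u) [CommRing Q] (c : ℕ) :
    Basis (List (Fin c)) Q (TensorAlgebra Q (Fin c → Q)) :=
  (Pi.basisFun Q (Fin c)).tensorAlgebra.reindex FreeMonoid.toList

theorem wordBasis_eq (l : List (Fin c)) : wordBasis Q c l
    = (TensorAlgebra.equivFreeAlgebra (Pi.basisFun Q (Fin c))).symm
      (FreeAlgebra.equivMonoidAlgebraFreeMonoid.symm
        (MonoidAlgebra.of Q (FreeMonoid (Fin c)) (FreeMonoid.ofList l))) := by
  rw [wordBasis, Basis.reindex_apply, Basis.tensorAlgebra, Basis.map_apply,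
    FreeAlgebra.basisFreeMonoid, Basis.map_apply]
  rfl

theorem wordBasis_nil : wordBasis Q c [] = 1 := by
  rw [wordBasis_eq, FreeMonoid.ofList_nil, map_one, map_one, map_one]

theorem wordBasis_cons (i : Fin c) (l : List (Fin c)) :
    wordBasis Q c (i :: l) = TensorAlgebra.ι Q (Pi.single i 1) * wordBasis Q c l := by
  rw [wordBasis_eq, wordBasis_eq, FreeMonoid.ofList_cons, map_mul, map_mul, map_mul]
  congr 1
  rw [AlgEquiv.symm_apply_eq, AlgEquiv.symm_apply_eq]
  have := TensorAlgebra.equivFreeAlgebra_ι_apply (Pi.basisFun Q (Fin c)) i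
  rw [Pi.basisFun_apply] at this
  rw [this]
  simp [FreeAlgebra.equivMonoidAlgebraFreeMonoid]

theorem wordBasis_append (l l' : List (Fin c)) :
    wordBasis Q c (l ++ l') = wordBasis Q c l * wordBasis Q c l' := by
  induction l with
  | nil => rw [wordBasis_nil, one_mul, List.nil_append]
  | cons i l ih => rw [List.cons_append, wordBasis_cons, wordBasis_cons, ih, mul_assoc]

theorem wordBasis_eq_prod (l : List (Fin c)) : wordBasis Q c l
    = ((l.map fun i => (Pi.single i 1 : Fin c → Q)).map (TensorAlgebra.ι Q)).prod := by
  induction l with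
  | nil => exact wordBasis_nil
  | cons i l ih => rw [wordBasis_cons, ih]; simp

theorem wordBasis_mem_tensorWt (l : List (Fin c)) :
    wordBasis Q c l ∈ tensorWt Q (Fin c → Q) l.length := by
  induction l with
  | nil => rw [wordBasis_nil]; exact Submodule.one_le.1 le_rfl
  | cons i l ih =>
    rw [wordBasis_cons, tensorWt, List.length_cons, pow_succ']
    exact Submodule.mul_mem_mul ⟨_, rfl⟩ ih

/-- The coefficient of a word. -/
def wordCoef (l : List (Fin c)) : TensorAlgebra Q (Fin c → Q) →ₗ[Q] Q := (wordBasis Q c).coord l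

theorem wordCoef_wordBasis (l l' : List (Fin c)) :
    wordCoef l (wordBasis Q c l') = if l' = l then 1 else 0 := by
  rw [wordCoef, Basis.coord_apply, Basis.repr_self, Finsupp.single_apply]

theorem eq_of_wordCoef {x y : TensorAlgebra Q (Fin c → Q)}
    (h : ∀ l, wordCoef l x = wordCoef l y) : x = y :=
  (wordBasis Q c).ext_elem h

theorem wordCoef_nil (x : TensorAlgebra Q (Fin c → Q)) :
    wordCoef [] x = TensorAlgebra.algebraMapInv x := by
  induction x using basis_induction (wordBasis Q c) with
  | zero => simp
  | add x y hx hy => rw [map_add, map_add, hx, hy]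
  | smul r x hx => rw [map_smul, map_smul, hx]
  | h l =>
    rw [wordCoef_wordBasis]
    cases l with
    | nil => rw [wordBasis_nil, map_one, if_pos rfl]
    | cons i l => rw [wordBasis_cons, map_mul]; simp [TensorAlgebra.algebraMapInv]

theorem wordCoef_cons_ι_mul (i : Fin c) (l : List (Fin c)) (a : Fin c → Q)
    (x : TensorAlgebra Q (Fin c → Q)) :
    wordCoef (i :: l) (TensorAlgebra.ι Q a * x) = a i * wordCoef l x := by
  induction x using basis_induction (wordBasis Q c) with
  | zero => simp
  | add x y hx hy => rw [mul_add, map_add, map_add, hx, hy, mul_add]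
  | smul r x hx => rw [mul_smul_comm, map_smul, map_smul, hx, smul_eq_mul, smul_eq_mul]; ring
  | h l' =>
    have : TensorAlgebra.ι Q a * wordBasis Q c l' = ∑ j, a j • wordBasis Q c (j :: l') := by
      conv_lhs => rw [← (Pi.basisFun Q (Fin c)).sum_repr a]
      simp [Finset.sum_mul, wordBasis_cons]
    rw [this, map_sum, wordCoef_wordBasis]
    simp only [map_smul, wordCoef_wordBasis, List.cons.injEq]
    rw [Finset.sum_eq_single i]
    · simp
    · intro j _ hj
      simp [hj]
    · simp

theorem wordCoef_nil_ι_mul (a : Fin c → Q) (x : TensorAlgebra Q (Fin c → Q)) :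
    wordCoef [] (TensorAlgebra.ι Q a * x) = 0 := by
  rw [wordCoef_nil, map_mul]
  simp [TensorAlgebra.algebraMapInv]

theorem wordCoef_tprod {n : ℕ} (w : Fin n → Fin c) (a : Fin n → Fin c → Q) :
    wordCoef (List.ofFn w) (TensorAlgebra.tprod Q _ n a) = ∏ j, a j (w j) := by
  induction n with
  | zero => simp [TensorAlgebra.tprod_apply, wordCoef_nil]
  | succ n ih =>
    have := ih (fun j => w j.succ) (fun j => a j.succ)
    rw [TensorAlgebra.tprod_apply] at this ⊢
    rw [List.ofFn_succ, List.ofFn_succ, List.prod_cons, wordCoef_cons_ι_mul, this,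
      Fin.prod_univ_succ]

theorem wordCoef_append_mul {n : ℕ} {u : TensorAlgebra Q (Fin c → Q)}
    (hu : u ∈ tensorWt Q (Fin c → Q) n) {a : List (Fin c)} (ha : a.length = n) (l : List (Fin c))
    (x : TensorAlgebra Q (Fin c → Q)) :
    wordCoef (a ++ l) (u * x) = wordCoef a u * wordCoef l x := by
  induction n generalizing u a with
  | zero =>
    rw [tensorWt, pow_zero, Submodule.mem_one] at hu
    obtain ⟨r, rfl⟩ := hu
    rw [List.length_eq_zero_iff] at ha
    subst ha
    rw [← Algebra.smul_def, map_smul, List.nil_append, wordCoef_nil,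
      TensorAlgebra.algebraMap_leftInverse, smul_eq_mul]
  | succ n ih =>
    rw [tensorWt, pow_succ'] at hu
    cases a with
    | nil => simp at ha
    | cons i a =>
      induction hu using Submodule.mul_induction_on' with
      | mem_mul_mem m hm y hy =>
        obtain ⟨b, rfl⟩ := hm
        rw [mul_assoc, List.cons_append, wordCoef_cons_ι_mul, wordCoef_cons_ι_mul,
          ih hy (by simpa using ha), mul_assoc]
      | add y _ z _ hy hz => rw [add_mul, map_add, map_add, hy, hz, add_mul]

theorem wordCoef_eq_zero {n : ℕ} {x : TensorAlgebra Q (Fin c → Q)}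
    (hx : x ∈ tensorWt Q (Fin c → Q) n) {l : List (Fin c)} (hl : l.length ≠ n) :
    wordCoef l x = 0 := by
  induction n generalizing x l with
  | zero =>
    rw [tensorWt, pow_zero, Submodule.mem_one] at hx
    obtain ⟨r, rfl⟩ := hx
    rw [Algebra.algebraMap_eq_smul_one, map_smul, ← wordBasis_nil, wordCoef_wordBasis,
      if_neg (fun h => hl (by rw [← h]; rfl)), smul_zero]
  | succ n ih =>
    rw [tensorWt, pow_succ'] at hx
    induction hx using Submodule.mul_induction_on' with
    | mem_mul_mem m hm y hy =>
      obtain ⟨b, rfl⟩ := hm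
      cases l with
      | nil => exact wordCoef_nil_ι_mul _ _
      | cons i l => rw [wordCoef_cons_ι_mul, ih hy (by simpa using hl), mul_zero]
    | add y _ z _ hy hz => rw [map_add, hy, hz, add_zero]

/-- The multi-exponent of a word. -/
def content (l : List (Fin c)) : Fin c →₀ ℕ := (l.map fun i => Finsupp.single i 1).sum

theorem content_nil : content ([] : List (Fin c)) = 0 := rfl

theorem content_cons (i : Fin c) (l : List (Fin c)) :
    content (i :: l) = Finsupp.single i 1 + content l := by simp [content]

theorem content_append (l l' : List (Fin c)) : content (l ++ l') = content l + content l' := by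
  simp [content]

theorem toMultiset_content (l : List (Fin c)) : Finsupp.toMultiset (content l) = (l : Multiset _) := by
  induction l with
  | nil => simp [content_nil]
  | cons i l ih =>
    rw [content_cons, map_add, ih, Finsupp.toMultiset_single, one_smul]
    rfl

theorem content_eq_iff {l l' : List (Fin c)} : content l = content l' ↔ l.Perm l' := by
  rw [← Multiset.coe_eq_coe, ← toMultiset_content, ← toMultiset_content]
  exact Multiset.toFinsupp.symm.injective.eq_iff.symm

theorem degree_content (l : List (Fin c)) : (content l).degree = l.length := by
  induction l with
  | nil => simp [content_nil]
  | cons i l ih =>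
    rw [content_cons, map_add, ih, Finsupp.degree_single, List.length_cons, add_comm]

theorem content_ofFn {n : ℕ} (w : Fin n → Fin c) :
    content (List.ofFn w) = ∑ j, Finsupp.single (w j) 1 := by
  rw [content, List.map_ofFn, List.sum_ofFn]
  rfl

theorem content_stdWord (α : Fin c →₀ ℕ) : content (List.ofFn (stdWord α)) = α := by
  rw [content_ofFn, ← finSigmaFinEquiv.sum_comp]
  simp only [stdWord, Equiv.symm_apply_apply]
  rw [Fintype.sum_sigma]
  conv_rhs => rw [← Finsupp.univ_sum_single α]
  simp

theorem content_ofFn_comp {n : ℕ} (w : Fin n → Fin c) (τ : Equiv.Perm (Fin n)) :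
    content (List.ofFn (w ∘ τ)) = content (List.ofFn w) := by
  rw [content_ofFn, content_ofFn]
  exact Equiv.sum_comp τ fun j => Finsupp.single (w j) 1

theorem content_surjective : Function.Surjective (content (c := c)) :=
  fun α => ⟨_, content_stdWord α⟩

/-- The words with a given multi-exponent. -/
def wordsOf (α : Fin c →₀ ℕ) : Finset (List (Fin c)) :=
  Set.Finite.toFinset (s := {l | content l = α})
    ((List.finite_length_eq (Fin c) α.degree).subset fun l hl => by
      rw [Set.mem_ofPred_eq] at hl ⊢
      rw [← degree_content, hl])

theorem mem_wordsOf {α : Fin c →₀ ℕ} {l : List (Fin c)} : l ∈ wordsOf α ↔ content l = α :=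
  Set.Finite.mem_toFinset _

theorem stdWord_comp_mem (α : Fin c →₀ ℕ) (τ : Equiv.Perm (Fin (∑ i, α i))) :
    List.ofFn (stdWord α ∘ τ.symm) ∈ wordsOf α := by
  rw [mem_wordsOf]
  exact (content_ofFn_comp _ τ.symm).trans (content_stdWord α)

theorem stdWord_finSigmaFinEquiv (α : Fin c →₀ ℕ) (i : Fin c) (k : Fin (α i)) :
    stdWord α (finSigmaFinEquiv ⟨i, k⟩) = i := by
  rw [stdWord, Equiv.symm_apply_apply]

theorem range_shuffle {α : Fin c →₀ ℕ} (τ : Equiv.Perm (Fin (∑ i, α i))) (i : Fin c) :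
    Set.range (fun k : Fin (α i) => τ (finSigmaFinEquiv ⟨i, k⟩))
      = {j | stdWord α (τ.symm j) = i} := by
  ext j
  simp only [Set.mem_range, Set.mem_ofPred_eq]
  constructor
  · rintro ⟨k, rfl⟩
    rw [Equiv.symm_apply_apply, stdWord_finSigmaFinEquiv]
  · rintro rfl
    exact ⟨(finSigmaFinEquiv.symm (τ.symm j)).2, by
      rw [show (⟨stdWord α (τ.symm j), (finSigmaFinEquiv.symm (τ.symm j)).2⟩ :
        Σ i, Fin (α i)) = finSigmaFinEquiv.symm (τ.symm j) from rfl]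
      simp⟩

/-- On the block of the letter `i` a shuffle is increasing, hence determined by its image, and that
image is the set of positions of `i` in the shuffled word. -/
theorem shuffle_injective {α : Fin c →₀ ℕ} {τ τ' : Equiv.Perm (Fin (∑ i, α i))}
    (hτ : τ ∈ shuffles α) (hτ' : τ' ∈ shuffles α)
    (h : stdWord α ∘ τ.symm = stdWord α ∘ τ'.symm) : τ = τ' := by
  rw [shuffles, Finset.mem_filter] at hτ hτ'
  refine Equiv.ext fun j => ?_
  obtain ⟨⟨i, k⟩, rfl⟩ := finSigmaFinEquiv.surjective j
  have : (fun k : Fin (α i) => τ (finSigmaFinEquiv ⟨i, k⟩))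
      = fun k : Fin (α i) => τ' (finSigmaFinEquiv ⟨i, k⟩) := by
    refine (StrictMono.range_inj (hτ.2 i) (hτ'.2 i)).1 ?_
    rw [range_shuffle, range_shuffle]
    ext j
    exact iff_of_eq (congrArg (· = i) (congrFun h j))
  exact congrFun this k

/-- The shuffle sends the block of the letter `i` to the positions of `i` in the word, listed in
increasing order. -/
theorem exists_shuffle {α : Fin c →₀ ℕ} {l : List (Fin c)} (hl : content l = α) :
    ∃ τ ∈ shuffles α, l = List.ofFn (stdWord α ∘ τ.symm) := by
  have hlen : l.length = ∑ i, α i := by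
    rw [← degree_content, hl, Finsupp.degree_eq_sum]
  obtain ⟨w, rfl⟩ : ∃ w : Fin (∑ i, α i) → Fin c, l = List.ofFn w := by
    rw [← hlen]
    exact ⟨l.get, (List.ofFn_get l).symm⟩
  have hcard : ∀ i, (Finset.univ.filter fun j => w j = i).card = α i := by
    intro i
    have h1 := DFunLike.congr_fun hl i
    rw [content_ofFn, Finsupp.finsetSum_apply] at h1
    rw [← h1, Finset.card_filter]
    refine Finset.sum_congr rfl fun j _ => ?_
    rw [Finsupp.single_apply]
  let g : (Σ i, Fin (α i)) → Fin (∑ i, α i) := fun p =>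
    (Finset.univ.filter fun j => w j = p.1).orderEmbOfFin (hcard p.1) p.2
  have hg : ∀ p, w (g p) = p.1 := fun p =>
    (Finset.mem_filter.1 (Finset.orderEmbOfFin_mem _ (hcard p.1) p.2)).2
  have hginj : Function.Injective g := by
    rintro ⟨i, k⟩ ⟨i', k'⟩ h
    have : i = i' := (hg ⟨i, k⟩).symm.trans ((congrArg w h).trans (hg ⟨i', k'⟩))
    subst this
    have := (Finset.orderEmbOfFin _ (hcard i)).injective h
    exact congrArg (Sigma.mk i) this
  have hbij : Function.Bijective (g ∘ finSigmaFinEquiv.symm) :=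
    Finite.injective_iff_bijective.1 (hginj.comp finSigmaFinEquiv.symm.injective)
  refine ⟨Equiv.ofBijective _ hbij, ?_, ?_⟩
  · rw [shuffles, Finset.mem_filter]
    refine ⟨Finset.mem_univ _, fun i k k' hk => ?_⟩
    simp only [Equiv.ofBijective_apply, Function.comp_apply, Equiv.symm_apply_apply]
    exact (OrderEmbedding.strictMono _) hk
  · congr 1
    funext j
    obtain ⟨j, rfl⟩ := (Equiv.ofBijective _ hbij).surjective j
    rw [Function.comp_apply, Equiv.symm_apply_apply]
    exact hg _

theorem toTensorAlgebra_reindex {n : ℕ} (τ : Equiv.Perm (Fin n)) (a : Fin n → Fin c → Q) :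
    TensorPower.toTensorAlgebra (PiTensorProduct.reindex Q (fun _ => Fin c → Q) τ
      (PiTensorProduct.tprod Q a)) = TensorAlgebra.tprod Q _ n fun j => a (τ.symm j) := by
  rw [PiTensorProduct.reindex_tprod, TensorPower.toTensorAlgebra_tprod]

/-- Shuffles correspond bijectively to rearrangements of the standard word. After this, `y^(α)` is
handled as an indicator function on words and permutations no longer appear. -/
theorem symElt_eq_sum (α : Fin c →₀ ℕ) : symElt Q α = ∑ l ∈ wordsOf α, wordBasis Q c l := by
  rw [symElt]
  refine Finset.sum_bij (fun τ _ => List.ofFn (stdWord α ∘ τ.symm))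
    (fun τ _ => stdWord_comp_mem α τ) (fun τ hτ τ' hτ' h =>
      shuffle_injective hτ hτ' (List.ofFn_injective h)) (fun l hl => ?_) (fun τ _ => ?_)
  · obtain ⟨τ, hτ, h⟩ := exists_shuffle (mem_wordsOf.1 hl)
    exact ⟨τ, hτ, h.symm⟩
  · rw [toTensorAlgebra_reindex, wordBasis_eq_prod, List.map_ofFn, TensorAlgebra.tprod_apply,
      List.map_ofFn]
    rfl

theorem wordCoef_symElt (α : Fin c →₀ ℕ) (l : List (Fin c)) :
    wordCoef l (symElt Q α) = if content l = α then 1 else 0 := by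
  rw [symElt_eq_sum, map_sum]
  simp only [wordCoef_wordBasis]
  rw [Finset.sum_ite_eq']
  simp only [mem_wordsOf]

theorem symElt_mem_tensorWt (α : Fin c →₀ ℕ) : symElt Q α ∈ tensorWt Q (Fin c → Q) α.degree := by
  rw [symElt_eq_sum]
  refine sum_mem fun l hl => ?_
  rw [mem_wordsOf] at hl
  rw [← hl, degree_content]
  exact wordBasis_mem_tensorWt l

theorem symElt_content_singleton (i : Fin c) :
    symElt Q (Finsupp.single i 1) = TensorAlgebra.ι Q (Pi.single i 1) := by
  refine eq_of_wordCoef fun l => ?_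
  have h : TensorAlgebra.ι Q (Pi.single i 1) = wordBasis Q c [i] := by
    rw [wordBasis_cons, wordBasis_nil, mul_one]
  have h2 : Finsupp.single i 1 = content [i] := by rw [content_cons, content_nil, add_zero]
  rw [wordCoef_symElt, h, wordCoef_wordBasis, h2]
  simp only [content_eq_iff, List.perm_singleton, eq_comm (a := l)]

theorem symElt_zero : symElt Q (0 : Fin c →₀ ℕ) = 1 := by
  refine eq_of_wordCoef fun l => ?_
  rw [wordCoef_symElt, ← wordBasis_nil, wordCoef_wordBasis, ← content_nil]
  simp only [content_eq_iff, List.perm_nil, eq_comm (a := l)]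

theorem deconc_wordBasis (l : List (Fin c)) : deconc (wordBasis Q c l)
    = ∑ i ∈ Finset.range (l.length + 1), wordBasis Q c (l.take i) ⊗ₜ[Q] wordBasis Q c (l.drop i) := by
  rw [wordBasis_eq_prod, deconc_list_prod, List.length_map]
  refine Finset.sum_congr rfl fun i _ => ?_
  simp only [wordBasis_eq_prod, List.map_take, List.map_drop]

/-- A word of content `α` with a cutting position is the same as a pair of words whose contents add
up to `α`. -/
theorem deconc_symElt (α : Fin c →₀ ℕ) : deconc (symElt Q α)
    = ∑ p ∈ Finset.HasAntidiagonal.antidiagonal α, symElt Q p.1 ⊗ₜ[Q] symElt Q p.2 := by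
  have h2 : ∀ p : (Fin c →₀ ℕ) × (Fin c →₀ ℕ), symElt Q p.1 ⊗ₜ[Q] symElt Q p.2
      = ∑ q ∈ wordsOf p.1 ×ˢ wordsOf p.2, wordBasis Q c q.1 ⊗ₜ[Q] wordBasis Q c q.2 := by
    intro p
    rw [symElt_eq_sum, symElt_eq_sum, TensorProduct.sum_tmul, Finset.sum_product]
    simp only [TensorProduct.tmul_sum]
  rw [symElt_eq_sum, map_sum]
  simp only [deconc_wordBasis, h2]
  rw [Finset.sum_sigma', Finset.sum_sigma']
  refine Finset.sum_bij'
    (fun x _ => ⟨(content (x.1.take x.2), content (x.1.drop x.2)), (x.1.take x.2, x.1.drop x.2)⟩)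
    (fun y _ => ⟨y.2.1 ++ y.2.2, y.2.1.length⟩) ?_ ?_ ?_ ?_ ?_
  · rintro ⟨l, i⟩ hx
    simp only [Finset.mem_sigma, mem_wordsOf, Finset.mem_range] at hx
    simp only [Finset.mem_sigma, Finset.mem_product, mem_wordsOf, and_self, and_true,
      Finset.HasAntidiagonal.mem_antidiagonal]
    rw [← content_append, List.take_append_drop]
    exact hx.1
  · rintro ⟨⟨β, β'⟩, ⟨l, l'⟩⟩ hy
    simp only [Finset.mem_sigma, Finset.mem_product, mem_wordsOf,
      Finset.HasAntidiagonal.mem_antidiagonal] at hy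
    simp only [Finset.mem_sigma, mem_wordsOf, Finset.mem_range, content_append, List.length_append]
    exact ⟨by rw [hy.2.1, hy.2.2, hy.1], by omega⟩
  · rintro ⟨l, i⟩ hx
    simp only [Finset.mem_sigma, mem_wordsOf, Finset.mem_range] at hx
    simp only [List.take_append_drop, List.length_take, Sigma.mk.injEq, heq_eq_eq, true_and]
    omega
  · rintro ⟨⟨β, β'⟩, ⟨l, l'⟩⟩ hy
    simp only [Finset.mem_sigma, Finset.mem_product, mem_wordsOf,
      Finset.HasAntidiagonal.mem_antidiagonal] at hy
    obtain ⟨-, rfl, rfl⟩ := hy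
    simp
  · rintro ⟨l, i⟩ _
    rfl

/-- The same cutting at a fixed position `n`, so that the first factor has weight `n` and words are
recovered by concatenation. -/
theorem symElt_eq_sum_mul (α : Fin c →₀ ℕ) (n : ℕ) (hn : n ≤ α.degree) : symElt Q α
    = ∑ p ∈ (Finset.HasAntidiagonal.antidiagonal α).filter (fun p => p.1.degree = n),
        symElt Q p.1 * symElt Q p.2 := by
  have h2 : ∀ p : (Fin c →₀ ℕ) × (Fin c →₀ ℕ), symElt Q p.1 * symElt Q p.2
      = ∑ q ∈ wordsOf p.1 ×ˢ wordsOf p.2, wordBasis Q c (q.1 ++ q.2) := by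
    intro p
    rw [symElt_eq_sum, symElt_eq_sum, Finset.sum_mul_sum, Finset.sum_product]
    simp only [wordBasis_append]
  rw [symElt_eq_sum]
  simp only [h2]
  rw [Finset.sum_sigma']
  refine Finset.sum_bij'
    (fun l _ => ⟨(content (l.take n), content (l.drop n)), (l.take n, l.drop n)⟩)
    (fun y _ => y.2.1 ++ y.2.2) ?_ ?_ ?_ ?_ ?_
  · intro l hl
    rw [mem_wordsOf] at hl
    simp only [Finset.mem_sigma, Finset.mem_product, mem_wordsOf, and_self, and_true,
      Finset.HasAntidiagonal.mem_antidiagonal, Finset.mem_filter, degree_content, List.length_take]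
    rw [← content_append, List.take_append_drop]
    refine ⟨hl, ?_⟩
    rw [← hl, degree_content] at hn
    omega
  · rintro ⟨⟨β, β'⟩, ⟨l, l'⟩⟩ hy
    simp only [Finset.mem_sigma, Finset.mem_product, mem_wordsOf, Finset.mem_filter,
      Finset.HasAntidiagonal.mem_antidiagonal] at hy
    simp only [mem_wordsOf, content_append]
    rw [hy.2.1, hy.2.2, hy.1.1]
  · intro l _
    exact List.take_append_drop n l
  · rintro ⟨⟨β, β'⟩, ⟨l, l'⟩⟩ hy
    simp only [Finset.mem_sigma, Finset.mem_product, mem_wordsOf, Finset.mem_filter,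
      Finset.HasAntidiagonal.mem_antidiagonal] at hy
    obtain ⟨⟨-, h1⟩, rfl, rfl⟩ := hy
    rw [degree_content] at h1
    subst h1
    simp
  · intro l _
    rw [List.take_append_drop]

end Words

end AInfKoszul

end

noncomputable section

namespace AInfKoszul

open Module

/-! ### Symmetric tensors as invariant coefficients -/

section SymTensors

variable {Q : Type u} [CommRing Q] {c : ℕ}

theorem toTensorAlgebra_mem_tensorWt {N : Type*} [AddCommGroup N] [Module Q N] {n : ℕ}
    (t : ⨂[Q]^n N) : TensorPower.toTensorAlgebra t ∈ tensorWt Q N n := by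
  have h : t ∈ Submodule.span Q (Set.range (PiTensorProduct.tprod Q (s := fun _ : Fin n => N))) := by
    rw [PiTensorProduct.span_tprod_eq_top]; trivial
  induction h using Submodule.span_induction with
  | mem t ht =>
    obtain ⟨a, rfl⟩ := ht
    rw [TensorPower.toTensorAlgebra_tprod]
    exact tprod_mem_tensorWt n a
  | zero => rw [map_zero]; exact zero_mem _
  | add x y _ _ hx hy => rw [map_add]; exact add_mem hx hy
  | smul r x _ hx => rw [map_smul]; exact Submodule.smul_mem _ _ hx

theorem toTensorAlgebra_injective {N : Type*} [AddCommGroup N] [Module Q N] (n : ℕ) :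
    Function.Injective (TensorPower.toTensorAlgebra : ⨂[Q]^n N → TensorAlgebra Q N) := by
  have h : ∀ t : ⨂[Q]^n N, TensorPower.toTensorAlgebra t
      = TensorAlgebra.equivDirectSum.symm (DirectSum.of (fun n => ⨂[Q]^n N) n t) := fun t =>
    (DirectSum.toAddMonoid_of (fun _ => LinearMap.toAddMonoidHom TensorPower.toTensorAlgebra) _ _).symm
  intro t t' htt
  rw [h, h] at htt
  exact DirectSum.of_injective n (TensorAlgebra.equivDirectSum.symm.injective htt)

theorem wordCoef_reindex {n : ℕ} (τ : Equiv.Perm (Fin n)) (w : Fin n → Fin c)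
    (t : ⨂[Q]^n (Fin c → Q)) :
    wordCoef (List.ofFn w)
        (TensorPower.toTensorAlgebra (PiTensorProduct.reindex Q (fun _ => Fin c → Q) τ t))
      = wordCoef (List.ofFn (w ∘ τ)) (TensorPower.toTensorAlgebra t) := by
  have h : wordCoef (List.ofFn w) ∘ₗ TensorPower.toTensorAlgebra ∘ₗ
      (PiTensorProduct.reindex Q (fun _ => Fin c → Q) τ).toLinearMap
      = wordCoef (List.ofFn (w ∘ τ)) ∘ₗ TensorPower.toTensorAlgebra := by
    refine PiTensorProduct.ext (MultilinearMap.ext fun a => ?_)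
    simp only [LinearMap.compMultilinearMap_apply, LinearMap.comp_apply, LinearEquiv.coe_coe]
    rw [toTensorAlgebra_reindex, TensorPower.toTensorAlgebra_tprod, wordCoef_tprod, wordCoef_tprod,
      ← Equiv.prod_comp τ]
    simp
  exact LinearMap.congr_fun h t

/-- Invariance of the coefficients under permutations of words. -/
def IsSymm (x : TensorAlgebra Q (Fin c → Q)) : Prop :=
  ∀ l l' : List (Fin c), l.Perm l' → wordCoef l x = wordCoef l' x

theorem isSymm_of_mem_symTensors {x : TensorAlgebra Q (Fin c → Q)}
    (hx : x ∈ symTensors Q (Fin c → Q)) : IsSymm x := by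
  rw [symTensors] at hx
  induction hx using Submodule.iSup_induction' with
  | mem n x hx =>
    obtain ⟨t, ht, rfl⟩ := hx
    have ht' : ∀ τ : Equiv.Perm (Fin n), PiTensorProduct.reindex Q (fun _ => Fin c → Q) τ t = t :=
      fun τ => (Submodule.mem_iInf _).1 ht τ
    have key : ∀ l : List (Fin c), l.length = n → ∀ α, content l = α →
        wordCoef l (TensorPower.toTensorAlgebra t)
          = wordCoef (List.ofFn (stdWord α)) (TensorPower.toTensorAlgebra t) := by
      rintro l hl α hα
      have hn : n = ∑ i, α i := by
        rw [← hl, ← degree_content, hα, Finsupp.degree_eq_sum]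
      subst hn
      obtain ⟨τ, -, rfl⟩ := exists_shuffle hα
      rw [← wordCoef_reindex, ht']
    intro l l' hll
    by_cases hl : l.length = n
    · rw [key l hl _ rfl, key l' (hll.length_eq ▸ hl) _ rfl, content_eq_iff.2 hll]
    · rw [wordCoef_eq_zero (toTensorAlgebra_mem_tensorWt t) hl,
        wordCoef_eq_zero (toTensorAlgebra_mem_tensorWt t) (hll.length_eq ▸ hl)]
  | zero => intro l l' _; simp
  | add x y _ _ hx hy => intro l l' h; rw [map_add, map_add, hx l l' h, hy l l' h]

/-- The coefficient of a word in `y^(α)` depends only on its content, which permutations of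
positions preserve. -/
theorem symElt_mem_symTensors (α : Fin c →₀ ℕ) : symElt Q α ∈ symTensors Q (Fin c → Q) := by
  refine Submodule.mem_iSup_of_mem (∑ i, α i) ⟨∑ τ ∈ shuffles α,
    PiTensorProduct.reindex Q (fun _ => Fin c → Q) τ
      (PiTensorProduct.tprod Q fun j => (Pi.single (stdWord α j) 1 : Fin c → Q)), ?_, ?_⟩
  · rw [SetLike.mem_coe, symPower, Submodule.mem_iInf]
    intro τ
    rw [LinearMap.mem_eqLocus]
    set t := ∑ τ ∈ shuffles α, PiTensorProduct.reindex Q (fun _ => Fin c → Q) τ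
      (PiTensorProduct.tprod Q fun j => (Pi.single (stdWord α j) 1 : Fin c → Q)) with ht
    have hsym : TensorPower.toTensorAlgebra t = symElt Q α := by rw [ht, map_sum]; rfl
    refine toTensorAlgebra_injective _ (eq_of_wordCoef fun l => ?_)
    rw [LinearMap.id_apply]
    by_cases hl : l.length = ∑ i, α i
    · obtain ⟨w, rfl⟩ : ∃ w : Fin (∑ i, α i) → Fin c, l = List.ofFn w := by
        rw [← hl]
        exact ⟨l.get, (List.ofFn_get l).symm⟩
      rw [LinearEquiv.coe_coe, wordCoef_reindex, hsym, wordCoef_symElt, wordCoef_symElt,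
        content_ofFn_comp]
    · rw [wordCoef_eq_zero (toTensorAlgebra_mem_tensorWt _) hl,
        wordCoef_eq_zero (toTensorAlgebra_mem_tensorWt _) hl]
  · rw [map_sum]
    rfl

/-- Invariant coefficients are constant on words of equal content, so collecting words by content
writes `x` as a combination of the `y^(α)`. -/
theorem mem_span_symElt_of_isSymm {x : TensorAlgebra Q (Fin c → Q)} (hx : IsSymm x) :
    x ∈ Submodule.span Q (Set.range (symElt Q (c := c))) := by
  classical
  have h : x = ∑ α ∈ ((wordBasis Q c).repr x).support.image content,
      wordCoef (List.ofFn (stdWord α)) x • symElt Q α := by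
    refine eq_of_wordCoef fun l => ?_
    rw [map_sum]
    simp only [map_smul, wordCoef_symElt, smul_eq_mul, mul_ite, mul_one, mul_zero]
    rw [Finset.sum_ite_eq]
    split_ifs with hl
    · exact hx _ _ (content_eq_iff.1 (content_stdWord _).symm)
    · by_contra hne
      exact hl (Finset.mem_image_of_mem _ (Finsupp.mem_support_iff.2 hne))
  rw [h]
  exact sum_mem fun α _ => Submodule.smul_mem _ _ (Submodule.subset_span ⟨α, rfl⟩)

theorem symTensors_eq_span : symTensors Q (Fin c → Q)
    = Submodule.span Q (Set.range (symElt Q (c := c))) := by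
  apply le_antisymm
  · exact fun x hx => mem_span_symElt_of_isSymm (isSymm_of_mem_symTensors hx)
  · rw [Submodule.span_le]
    rintro _ ⟨α, rfl⟩
    exact symElt_mem_symTensors α

theorem mem_symTensors_iff {x : TensorAlgebra Q (Fin c → Q)} :
    x ∈ symTensors Q (Fin c → Q) ↔ IsSymm x :=
  ⟨isSymm_of_mem_symTensors, fun h => symTensors_eq_span.ge (mem_span_symElt_of_isSymm h)⟩

theorem symElt_linearIndependent : LinearIndependent Q (symElt Q (c := c)) := by
  rw [linearIndependent_iff']
  intro s g hg α hα
  have := congrArg (wordCoef (List.ofFn (stdWord α))) hg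
  rw [map_sum, map_zero] at this
  simp only [map_smul, wordCoef_symElt, content_stdWord, smul_eq_mul, mul_ite, mul_one,
    mul_zero] at this
  rwa [Finset.sum_ite_eq, if_pos hα] at this

/-- The basis of the symmetric tensors. -/
def symBasis (Q : Type u) [CommRing Q] (c : ℕ) :
    Basis (Fin c →₀ ℕ) Q (symTensors Q (Fin c → Q)) :=
  (Basis.span symElt_linearIndependent).map (LinearEquiv.ofEq _ _ symTensors_eq_span.symm)

theorem symBasis_coe (α : Fin c →₀ ℕ) :
    (symBasis Q c α : TensorAlgebra Q (Fin c → Q)) = symElt Q α := by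
  rw [symBasis, Basis.map_apply, LinearEquiv.coe_ofEq_apply, Basis.span_apply]

theorem symBasis_repr (x : symTensors Q (Fin c → Q)) (α : Fin c →₀ ℕ) :
    (symBasis Q c).repr x α = wordCoef (List.ofFn (stdWord α)) (x : TensorAlgebra Q (Fin c → Q)) := by
  induction x using basis_induction (symBasis Q c) with
  | zero => simp
  | add x y hx hy => rw [map_add, Finsupp.add_apply, hx, hy, Submodule.coe_add, map_add]
  | smul r x hx => rw [map_smul, Finsupp.smul_apply, hx, Submodule.coe_smul, map_smul]
  | h β =>
    rw [Basis.repr_self, symBasis_coe, wordCoef_symElt, content_stdWord, Finsupp.single_apply]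
    simp only [eq_comm]

/-! ### The Priddy coalgebra -/

/-- `V` is concentrated in degree one, so the sign involution is `-1` and the suspension does not
change the submodule. The relations of the exterior algebra are already the symmetric tensors of
weight two. -/
theorem map_gradeSign_extRel (hV : DirectSum.IsInternal (concDeg Q (Fin c → Q) 1)) :
    (extRel Q (Fin c → Q)).map
      (TensorProduct.map (gradeSign (concDeg Q (Fin c → Q) 1) hV) LinearMap.id)
      = extRel Q (Fin c → Q) := by
  have h1 : gradeSign (concDeg Q (Fin c → Q) 1) hV = -LinearMap.id := by
    refine LinearMap.ext fun x => ?_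
    rw [gradeSign_of_mem _ hV (i := 1) (by rw [concDeg_self]; trivial), sgn_one]
    simp
  have h2 : TensorProduct.map (-LinearMap.id : (Fin c → Q) →ₗ[Q] (Fin c → Q))
      (LinearMap.id : (Fin c → Q) →ₗ[Q] (Fin c → Q)) = -LinearMap.id := by
    refine TensorProduct.ext' fun x y => ?_
    simp [TensorProduct.neg_tmul]
  rw [h1, h2, Submodule.map_neg, Submodule.map_id]

/-- Both kinds of generators of `W` have symmetric coefficients, which is all that is needed about
`W` for the invariance under adjacent transpositions. -/
theorem wordCoef_swap_quadIncl {w : (Fin c → Q) ⊗[Q] (Fin c → Q)} (hw : w ∈ extRel Q (Fin c → Q))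
    (p q : Fin c) (b : List (Fin c)) (x : TensorAlgebra Q (Fin c → Q)) :
    wordCoef (p :: q :: b) (quadIncl Q (Fin c → Q) w * x)
      = wordCoef (q :: p :: b) (quadIncl Q (Fin c → Q) w * x) := by
  rw [extRel] at hw
  induction hw using Submodule.span_induction with
  | mem w hw =>
    rcases hw with ⟨a, rfl⟩ | ⟨a, b, rfl⟩
    · rw [quadIncl_tmul, mul_assoc]
      simp only [wordCoef_cons_ι_mul]
      ring
    · rw [map_add, quadIncl_tmul, quadIncl_tmul, add_mul, map_add, map_add, mul_assoc, mul_assoc]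
      simp only [wordCoef_cons_ι_mul]
      ring
  | zero => simp
  | add x y _ _ hx hy => rw [map_add, add_mul, map_add, map_add, hx, hy]
  | smul r x _ hx => rw [map_smul, smul_mul_assoc, map_smul, map_smul, hx]

theorem eq_of_perm_of_swap {X : Type*} (g : List (Fin c) → X)
    (h : ∀ a p q b, g (a ++ p :: q :: b) = g (a ++ q :: p :: b)) {l l' : List (Fin c)}
    (hl : l.Perm l') : g l = g l' := by
  have key : ∀ a, g (a ++ l) = g (a ++ l') := by
    induction hl with
    | nil => exact fun _ => rfl
    | cons x _ ih =>
      intro a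
      have := ih (a ++ [x])
      simpa using this
    | swap x y l => exact fun a => h a y x l
    | trans _ _ ih1 ih2 => exact fun a => (ih1 a).trans (ih2 a)
  exact key []

/-- The condition for the pair `(i, j)` makes the coefficients invariant under exchange of the
letters in positions `i` and `i + 1`, and adjacent transpositions generate all permutations. Words
of a length other than `n` have coefficient zero. -/
theorem quadInter_le_symTensors (n : ℕ) :
    quadInter (extRel Q (Fin c → Q)) n ≤ symTensors Q (Fin c → Q) := by
  intro x hx
  rw [mem_symTensors_iff]
  intro l l' hll
  refine eq_of_perm_of_swap (fun l => wordCoef l x) (fun a p q b => ?_) hll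
  by_cases hn : a.length + 2 + b.length = n
  · have hx3 : x ∈ tensorWt Q (Fin c → Q) a.length *
        (extRel Q (Fin c → Q)).map (quadIncl Q (Fin c → Q)) * tensorWt Q (Fin c → Q) b.length :=
      (iInf_le_of_le a.length (iInf_le_of_le b.length (iInf_le_of_le hn le_rfl)) :
        (⨅ (i : ℕ) (j : ℕ) (_ : i + 2 + j = n), tensorWt Q (Fin c → Q) i *
          (extRel Q (Fin c → Q)).map (quadIncl Q (Fin c → Q)) * tensorWt Q (Fin c → Q) j) ≤ _) hx.2
    clear hx
    induction hx3 using Submodule.mul_induction_on' with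
    | mem_mul_mem y hy z hz =>
      induction hy using Submodule.mul_induction_on' with
      | mem_mul_mem u hu y hy =>
        obtain ⟨w, hw, rfl⟩ := hy
        rw [mul_assoc, wordCoef_append_mul hu rfl, wordCoef_append_mul hu rfl,
          wordCoef_swap_quadIncl hw]
      | add y _ y' _ hy hy' => rw [add_mul, map_add, map_add, hy, hy']
    | add y _ y' _ hy hy' => rw [map_add, map_add, hy, hy']
  · rw [wordCoef_eq_zero hx.1 (by simp; omega), wordCoef_eq_zero hx.1 (by simp; omega)]

theorem symElt_mem_map_quadIncl {γ : Fin c →₀ ℕ} (hγ : γ.degree = 2) :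
    symElt Q γ ∈ (extRel Q (Fin c → Q)).map (quadIncl Q (Fin c → Q)) := by
  obtain ⟨l, rfl⟩ := content_surjective γ
  rw [degree_content, List.length_eq_two] at hγ
  obtain ⟨i, j, rfl⟩ := hγ
  have hmem : ∀ l, l ∈ wordsOf (content [i, j]) ↔ l = [i, j] ∨ l = [j, i] := by
    intro l
    rw [mem_wordsOf, content_eq_iff, List.perm_pair]
  have hw : ∀ i j : Fin c, wordBasis Q c [i, j]
      = TensorAlgebra.ι Q (Pi.single i 1) * TensorAlgebra.ι Q (Pi.single j 1) := by
    intro i j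
    rw [wordBasis_cons, wordBasis_cons, wordBasis_nil, mul_one]
  rw [symElt_eq_sum]
  by_cases hij : i = j
  · subst hij
    have : wordsOf (content [i, i]) = {[i, i]} := by
      ext l; rw [hmem, Finset.mem_singleton, or_self]
    rw [this, Finset.sum_singleton, hw, ← quadIncl_tmul]
    exact Submodule.mem_map_of_mem (Submodule.subset_span (Or.inl ⟨_, rfl⟩))
  · have : wordsOf (content [i, j]) = {[i, j], [j, i]} := by
      ext l; rw [hmem, Finset.mem_insert, Finset.mem_singleton]
    rw [this, Finset.sum_pair (by simp [hij]), hw, hw, ← quadIncl_tmul, ← quadIncl_tmul, ← map_add]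
    exact Submodule.mem_map_of_mem (Submodule.subset_span (Or.inr ⟨_, _, rfl⟩))

/-- Cutting `y^(α)` at positions `i` and `i + 2` leaves middle factors `y^(γ)` of weight two, and
these are generators of `W`. -/
theorem symElt_mem_quadInter (α : Fin c →₀ ℕ) :
    symElt Q α ∈ quadInter (extRel Q (Fin c → Q)) α.degree := by
  refine ⟨symElt_mem_tensorWt α, ?_⟩
  rw [SetLike.mem_coe]
  simp only [Submodule.mem_iInf]
  intro i j hij
  rw [symElt_eq_sum_mul α (i + 2) (by omega)]
  refine sum_mem fun p hp => ?_
  rw [Finset.mem_filter, Finset.HasAntidiagonal.mem_antidiagonal] at hp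
  have hdeg := congrArg Finsupp.degree hp.1
  rw [map_add, hp.2] at hdeg
  refine Submodule.mul_mem_mul ?_ ?_
  · rw [symElt_eq_sum_mul p.1 i (by omega)]
    refine sum_mem fun q hq => ?_
    rw [Finset.mem_filter, Finset.HasAntidiagonal.mem_antidiagonal] at hq
    have hdeg' := congrArg Finsupp.degree hq.1
    rw [map_add, hq.2] at hdeg'
    exact Submodule.mul_mem_mul (hq.2 ▸ symElt_mem_tensorWt q.1)
      (symElt_mem_map_quadIncl (by omega))
  · have : p.2.degree = j := by omega
    exact this ▸ symElt_mem_tensorWt p.2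

theorem priddy_eq_symTensors (hV : DirectSum.IsInternal (concDeg Q (Fin c → Q) 1)) :
    priddy (concDeg Q (Fin c → Q) 1) hV (extRel Q (Fin c → Q)) = symTensors Q (Fin c → Q) := by
  rw [priddy, map_gradeSign_extRel]
  apply le_antisymm
  · exact iSup_le quadInter_le_symTensors
  · rw [symTensors_eq_span, Submodule.span_le]
    rintro _ ⟨α, rfl⟩
    exact Submodule.mem_iSup_of_mem α.degree (symElt_mem_quadInter α)

end SymTensors

end AInfKoszul

end

noncomputable section

namespace AInfKoszul

open Module

/-! ### The curved coalgebra of symmetric tensors -/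

theorem sum_antidiagonal_assoc {A X : Type*} [AddMonoid A] [Finset.HasAntidiagonal A]
    [AddCommMonoid X] (n : A) (F : A → A → A → X) :
    ∑ p ∈ Finset.HasAntidiagonal.antidiagonal n, ∑ q ∈ Finset.HasAntidiagonal.antidiagonal p.1,
        F q.1 q.2 p.2
      = ∑ p ∈ Finset.HasAntidiagonal.antidiagonal n, ∑ q ∈ Finset.HasAntidiagonal.antidiagonal p.2,
        F p.1 q.1 q.2 := by
  rw [Finset.sum_sigma', Finset.sum_sigma']
  refine Finset.sum_bij' (fun x _ => ⟨(x.2.1, x.2.2 + x.1.2), (x.2.2, x.1.2)⟩)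
    (fun x _ => ⟨(x.1.1 + x.2.1, x.2.2), (x.1.1, x.2.1)⟩) ?_ ?_ ?_ ?_ ?_
  · rintro ⟨⟨a, b⟩, ⟨d, e⟩⟩ h
    simp only [Finset.mem_sigma, Finset.HasAntidiagonal.mem_antidiagonal] at h ⊢
    rw [← add_assoc, h.2]
    exact ⟨h.1, trivial⟩
  · rintro ⟨⟨a, b⟩, ⟨d, e⟩⟩ h
    simp only [Finset.mem_sigma, Finset.HasAntidiagonal.mem_antidiagonal] at h ⊢
    rw [add_assoc, h.2]
    exact ⟨h.1, trivial⟩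
  · rintro ⟨⟨a, b⟩, ⟨d, e⟩⟩ h
    simp only [Finset.mem_sigma, Finset.HasAntidiagonal.mem_antidiagonal] at h
    simp only [Sigma.mk.injEq, Prod.mk.injEq, heq_eq_eq, and_true]
    exact h.2
  · rintro ⟨⟨a, b⟩, ⟨d, e⟩⟩ h
    simp only [Finset.mem_sigma, Finset.HasAntidiagonal.mem_antidiagonal] at h
    simp only [Sigma.mk.injEq, Prod.mk.injEq, heq_eq_eq, true_and, and_true]
    exact h.2
  · rintro ⟨⟨a, b⟩, ⟨d, e⟩⟩ _
    rfl

section SymCoalgebra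

variable {Q : Type u} [CommRing Q] {c : ℕ}

/-- The coproduct of the coalgebra of symmetric tensors. -/
def symComul (Q : Type u) [CommRing Q] (c : ℕ) : symTensors Q (Fin c → Q) →ₗ[Q]
    symTensors Q (Fin c → Q) ⊗[Q] symTensors Q (Fin c → Q) :=
  (symBasis Q c).constr Q fun α =>
    ∑ p ∈ Finset.HasAntidiagonal.antidiagonal α, symBasis Q c p.1 ⊗ₜ[Q] symBasis Q c p.2

theorem symComul_symBasis (α : Fin c →₀ ℕ) : symComul Q c (symBasis Q c α)
    = ∑ p ∈ Finset.HasAntidiagonal.antidiagonal α, symBasis Q c p.1 ⊗ₜ[Q] symBasis Q c p.2 := by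
  rw [symComul, Basis.constr_basis]

theorem symComul_subtype : TensorProduct.map (symTensors Q (Fin c → Q)).subtype
      (symTensors Q (Fin c → Q)).subtype ∘ₗ symComul Q c
    = deconc ∘ₗ (symTensors Q (Fin c → Q)).subtype := by
  refine (symBasis Q c).ext fun α => ?_
  rw [LinearMap.comp_apply, symComul_symBasis, map_sum, LinearMap.comp_apply,
    Submodule.subtype_apply, symBasis_coe, deconc_symElt]
  refine Finset.sum_congr rfl fun p _ => ?_
  rw [TensorProduct.map_tmul, Submodule.subtype_apply, Submodule.subtype_apply, symBasis_coe,
    symBasis_coe]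

/-- The counit of the coalgebra of symmetric tensors. -/
def symCounit (Q : Type u) [CommRing Q] (c : ℕ) : symTensors Q (Fin c → Q) →ₗ[Q] Q :=
  TensorAlgebra.algebraMapInv.toLinearMap ∘ₗ (symTensors Q (Fin c → Q)).subtype

theorem symCounit_symBasis (α : Fin c →₀ ℕ) :
    symCounit Q c (symBasis Q c α) = if α = 0 then 1 else 0 := by
  rw [symCounit, LinearMap.comp_apply, Submodule.subtype_apply, symBasis_coe,
    AlgHom.toLinearMap_apply, ← wordCoef_nil, wordCoef_symElt, content_nil]
  simp only [eq_comm]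

/-- The homological grading of the coalgebra of symmetric tensors. -/
def symDeg (Q : Type u) [CommRing Q] (c : ℕ) (i : ℤ) : Submodule Q (symTensors Q (Fin c → Q)) :=
  (tensorDeg (concDeg Q (Fin c → Q) 2) 0 i).comap (symTensors Q (Fin c → Q)).subtype

theorem symDeg_eq_span (i : ℤ) : symDeg Q c i
    = Submodule.span Q (symBasis Q c '' {α | 2 * (α.degree : ℤ) = i}) := by
  rw [symDeg, tensorDeg_concDeg]
  apply le_antisymm
  · intro x hx
    rw [Basis.mem_span_image]
    intro α hα
    by_contra hne
    rw [Finset.mem_coe, Finsupp.mem_support_iff, symBasis_repr] at hα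
    refine hα ?_
    rw [Submodule.mem_comap, Submodule.subtype_apply] at hx
    generalize (x : TensorAlgebra Q (Fin c → Q)) = y at hx
    induction hx using Submodule.iSup_induction' with
    | mem n y hy =>
      by_cases hn : n * (2 + 0 : ℤ) = i
      · rw [iSup_pos hn] at hy
        refine wordCoef_eq_zero hy ?_
        rw [← degree_content, content_stdWord]
        rw [Set.mem_ofPred_eq] at hne
        omega
      · rw [iSup_neg hn, Submodule.mem_bot] at hy
        rw [hy, map_zero]
    | zero => exact map_zero _
    | add y z _ _ hy hz => rw [map_add, hy, hz, add_zero]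
  · rw [Submodule.span_le]
    rintro _ ⟨α, hα, rfl⟩
    rw [Set.mem_ofPred_eq] at hα
    rw [SetLike.mem_coe, Submodule.mem_comap, Submodule.subtype_apply, symBasis_coe]
    exact Submodule.mem_iSup_of_mem α.degree (Submodule.mem_iSup_of_mem (by omega)
      (symElt_mem_tensorWt α))

theorem symBasis_mem_symDeg {α : Fin c →₀ ℕ} {i : ℤ} (h : 2 * (α.degree : ℤ) = i) :
    symBasis Q c α ∈ symDeg Q c i := by
  rw [symDeg_eq_span]
  exact Submodule.subset_span ⟨α, h, rfl⟩

theorem symDeg_le {i : ℤ} {p : Submodule Q (symTensors Q (Fin c → Q))}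
    (h : ∀ α : Fin c →₀ ℕ, 2 * (α.degree : ℤ) = i → symBasis Q c α ∈ p) : symDeg Q c i ≤ p := by
  rw [symDeg_eq_span, Submodule.span_le]
  rintro _ ⟨α, hα, rfl⟩
  exact h α hα

theorem symDeg_internal : DirectSum.IsInternal (symDeg Q c) :=
  internal_of_basis (symBasis Q c) (fun α => 2 * (α.degree : ℤ)) _ symDeg_eq_span

/-- The curvature of the coalgebra of symmetric tensors. -/
def symCurv (f : Fin c → Q) : symTensors Q (Fin c → Q) →ₗ[Q] Q :=
  seqForm f ∘ₗ TensorAlgebra.ιInv ∘ₗ (symTensors Q (Fin c → Q)).subtype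

theorem ιInv_ι_mul_ι_mul {N : Type*} [AddCommGroup N] [Module Q N] (a b : N)
    (x : TensorAlgebra Q N) :
    TensorAlgebra.ιInv (TensorAlgebra.ι Q a * (TensorAlgebra.ι Q b * x)) = 0 := by
  simp [TensorAlgebra.ιInv, TensorAlgebra.toTrivSqZeroExt]
  exact zero_smul _ _

theorem ιInv_of_mem_tensorWt {N : Type*} [AddCommGroup N] [Module Q N] {n : ℕ} (hn : n ≠ 1)
    {x : TensorAlgebra Q N} (hx : x ∈ tensorWt Q N n) : TensorAlgebra.ιInv x = 0 := by
  match n with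
  | 0 =>
    rw [tensorWt, pow_zero, Submodule.mem_one] at hx
    obtain ⟨r, rfl⟩ := hx
    simp [TensorAlgebra.ιInv, TensorAlgebra.toTrivSqZeroExt]
    rfl
  | 1 => exact absurd rfl hn
  | n + 2 =>
    rw [tensorWt_eq_span] at hx
    induction hx using Submodule.span_induction with
    | mem x hx =>
      obtain ⟨a, rfl⟩ := hx
      rw [TensorAlgebra.tprod_apply, List.ofFn_succ, List.ofFn_succ, List.prod_cons, List.prod_cons,
        ιInv_ι_mul_ι_mul]
    | zero => exact map_zero _
    | add x y _ _ hx hy => rw [map_add, hx, hy, add_zero]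
    | smul r x _ hx => rw [map_smul, hx, smul_zero]

theorem symCurv_symBasis (f : Fin c → Q) (i : Fin c) :
    symCurv f (symBasis Q c (Finsupp.single i 1)) = f i := by
  rw [symCurv, LinearMap.comp_apply, LinearMap.comp_apply, Submodule.subtype_apply, symBasis_coe,
    symElt_content_singleton, TensorAlgebra.ι_leftInverse, seqForm_single]

theorem symCurv_symBasis_of_ne (f : Fin c → Q) {α : Fin c →₀ ℕ} (hα : α.degree ≠ 1) :
    symCurv f (symBasis Q c α) = 0 := by
  rw [symCurv, LinearMap.comp_apply, LinearMap.comp_apply, Submodule.subtype_apply, symBasis_coe,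
    ιInv_of_mem_tensorWt hα (symElt_mem_tensorWt α), map_zero]

/-- The curved coalgebra of symmetric tensors. -/
def symCoalgebra (f : Fin c → Q) : CurvedDGCoalgebra Q (symTensors Q (Fin c → Q)) where
  comul := symComul Q c
  counit := symCounit Q c
  coassoc := by
    refine (symBasis Q c).ext fun α => ?_
    simp only [LinearMap.comp_apply, symComul_symBasis, map_sum, LinearMap.rTensor_tmul,
      LinearMap.lTensor_tmul, TensorProduct.sum_tmul, TensorProduct.tmul_sum, LinearEquiv.coe_coe,
      TensorProduct.assoc_tmul]
    exact sum_antidiagonal_assoc α fun a b d =>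
      symBasis Q c a ⊗ₜ[Q] (symBasis Q c b ⊗ₜ[Q] symBasis Q c d)
  rTensor_counit_comp_comul := by
    refine (symBasis Q c).ext fun α => ?_
    rw [LinearMap.comp_apply, symComul_symBasis, map_sum, Finset.sum_eq_single (0, α)]
    · rw [LinearMap.rTensor_tmul, symCounit_symBasis, if_pos rfl]; rfl
    · rintro ⟨β, β'⟩ hp hne
      rw [LinearMap.rTensor_tmul, symCounit_symBasis, if_neg, TensorProduct.zero_tmul]
      rintro rfl
      rw [Finset.HasAntidiagonal.mem_antidiagonal, zero_add] at hp
      exact hne (by rw [← hp])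
    · simp
  lTensor_counit_comp_comul := by
    refine (symBasis Q c).ext fun α => ?_
    rw [LinearMap.comp_apply, symComul_symBasis, map_sum, Finset.sum_eq_single (α, 0)]
    · rw [LinearMap.lTensor_tmul, symCounit_symBasis, if_pos rfl]; rfl
    · rintro ⟨β, β'⟩ hp hne
      rw [LinearMap.lTensor_tmul, symCounit_symBasis, if_neg, TensorProduct.tmul_zero]
      rintro rfl
      rw [Finset.HasAntidiagonal.mem_antidiagonal, add_zero] at hp
      exact hne (by rw [← hp])
    · simp
  deg := symDeg Q c
  internal := symDeg_internal
  comul_mem i x hx := by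
    refine symDeg_le (p := (tensDeg (symDeg Q c) (symDeg Q c) i).comap (symComul Q c))
      (fun α hα => ?_) hx
    rw [Submodule.mem_comap, symComul_symBasis]
    refine sum_mem fun p hp => Submodule.mem_iSup_of_mem (2 * (p.1.degree : ℤ))
      (Submodule.apply_mem_map₂ _ (symBasis_mem_symDeg rfl) (symBasis_mem_symDeg ?_))
    rw [Finset.HasAntidiagonal.mem_antidiagonal] at hp
    rw [← hα, ← hp, map_add]
    push_cast
    ring
  counit_deg i hi x hx := by
    refine symDeg_le (p := LinearMap.ker (symCounit Q c)) (fun α hα => ?_) hx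
    rw [LinearMap.mem_ker, symCounit_symBasis, if_neg]
    rintro rfl
    exact hi (by simp [← hα])
  nonneg i hi := by
    rw [eq_bot_iff]
    exact symDeg_le fun α hα => by omega
  connected := by
    have h0 : symDeg Q c 0 = Submodule.span Q {symBasis Q c 0} := by
      rw [symDeg_eq_span, ← Set.image_singleton]
      congr 2
      ext α
      simp [Finsupp.degree_eq_zero_iff]
    constructor
    · rintro ⟨x, hx⟩ ⟨y, hy⟩ hxy
      rw [h0, Submodule.mem_span_singleton] at hx hy
      obtain ⟨r, rfl⟩ := hx
      obtain ⟨s, rfl⟩ := hy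
      simp only [map_smul, symCounit_symBasis, if_true, smul_eq_mul, mul_one] at hxy
      subst hxy
      rfl
    · intro r
      refine ⟨⟨r • symBasis Q c 0, Submodule.smul_mem _ _ (symBasis_mem_symDeg (by simp))⟩, ?_⟩
      simp only [map_smul, symCounit_symBasis, if_true, smul_eq_mul, mul_one]
  d := 0
  d_mem i x _ := zero_mem _
  coderivation := by
    rw [LinearMap.comp_zero, TensorProduct.map_zero_left, TensorProduct.map_zero_right, add_zero,
      LinearMap.zero_comp]
  h := symCurv f
  h_deg i hi x hx := by
    refine symDeg_le (p := LinearMap.ker (symCurv f)) (fun α hα => ?_) hx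
    exact symCurv_symBasis_of_ne f (by omega)
  d_d := by
    refine (symBasis Q c).ext fun α => ?_
    rw [LinearMap.comp_apply, LinearMap.comp_apply, symComul_symBasis, LinearMap.zero_apply,
      LinearMap.sub_apply, eq_comm, sub_eq_zero]
    simp only [map_sum, LinearMap.comp_apply, TensorProduct.map_tmul, LinearEquiv.coe_coe,
      TensorProduct.lid_tmul, TensorProduct.rid_tmul, LinearMap.id_apply]
    -- Cocommutativity: the two curvature terms agree, consistently with the differential being
    -- zero.
    exact Finsupp.sum_antidiagonal_swap α fun a b => symCurv f (symBasis Q c a) • symBasis Q c b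
  h_d := LinearMap.comp_zero _

theorem isCurvedSymCoalgebra (f : Fin c → Q) : IsCurvedSymCoalgebra f (symCoalgebra f) where
  deg_eq _ := rfl
  comul := symComul_subtype
  counit := rfl
  d := rfl
  h := rfl

end SymCoalgebra

end AInfKoszul

end

noncomputable section

namespace AInfKoszul

open Module

/-! ### Maps out of the tensor algebra, weight by weight -/

section EvalFamily

variable {Q : Type*} [CommRing Q] {N : Type*} [AddCommGroup N] [Module Q N]
  {X : Type*} [AddCommGroup X] [Module Q X]

theorem evalFamily_congr {F F' : ∀ n : ℕ, MultilinearMap Q (fun _ : Fin n => N) X} {n : ℕ}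
    (h : F n = F' n) {x : TensorAlgebra Q N} (hx : x ∈ tensorWt Q N n) :
    evalFamily F x = evalFamily F' x := by
  rw [tensorWt_eq_span] at hx
  induction hx using Submodule.span_induction with
  | mem x hx =>
    obtain ⟨a, rfl⟩ := hx
    rw [evalFamily_tprod, evalFamily_tprod, h]
  | zero => rw [map_zero, map_zero]
  | add x y _ _ hx hy => rw [map_add, map_add, hx, hy]
  | smul r x _ hx => rw [map_smul, map_smul, hx]

theorem evalFamily_eq_zero {F : ∀ n : ℕ, MultilinearMap Q (fun _ : Fin n => N) X} {n : ℕ}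
    (h : F n = 0) {x : TensorAlgebra Q N} (hx : x ∈ tensorWt Q N n) : evalFamily F x = 0 := by
  rw [tensorWt_eq_span] at hx
  induction hx using Submodule.span_induction with
  | mem x hx =>
    obtain ⟨a, rfl⟩ := hx
    rw [evalFamily_tprod, h]
    rfl
  | zero => rw [map_zero]
  | add x y _ _ hx hy => rw [map_add, hx, hy, add_zero]
  | smul r x _ hx => rw [map_smul, hx, smul_zero]

theorem evalFamily_zsmul (z : ℕ → ℤ) (F : ∀ n : ℕ, MultilinearMap Q (fun _ : Fin n => N) X) {n : ℕ}
    {x : TensorAlgebra Q N} (hx : x ∈ tensorWt Q N n) :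
    evalFamily (fun n => z n • F n) x = z n • evalFamily F x := by
  rw [tensorWt_eq_span] at hx
  induction hx using Submodule.span_induction with
  | mem x hx =>
    obtain ⟨a, rfl⟩ := hx
    rw [evalFamily_tprod, evalFamily_tprod]
    rfl
  | zero => rw [map_zero, map_zero, smul_zero]
  | add x y _ _ hx hy => rw [map_add, map_add, hx, hy, smul_add]
  | smul r x _ hx => rw [map_smul, map_smul, hx, smul_comm]

theorem evalFamily_ι (F : ∀ n : ℕ, MultilinearMap Q (fun _ : Fin n => N) X) (a : N) :
    evalFamily F (TensorAlgebra.ι Q a) = F 1 ![a] := by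
  rw [← evalFamily_tprod, TensorAlgebra.tprod_apply]
  simp

theorem evalFamily_one (F : ∀ n : ℕ, MultilinearMap Q (fun _ : Fin n => N) X) :
    evalFamily F 1 = F 0 ![] := by
  rw [← evalFamily_tprod, TensorAlgebra.tprod_apply]
  simp

theorem tensorMap_comp {N' N'' : Type*} [AddCommGroup N'] [Module Q N'] [AddCommGroup N'']
    [Module Q N''] (g : N →ₗ[Q] N') (g' : N' →ₗ[Q] N'') (x : TensorAlgebra Q N) :
    tensorMap g' (tensorMap g x) = tensorMap (g' ∘ₗ g) x := by
  have : (tensorMap g').comp (tensorMap g) = tensorMap (g' ∘ₗ g) := by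
    ext a
    simp [tensorMap]
  exact AlgHom.congr_fun this x

theorem tensorMap_id (x : TensorAlgebra Q N) : tensorMap LinearMap.id x = x := by
  have : tensorMap (LinearMap.id : N →ₗ[Q] N) = AlgHom.id Q _ := by
    ext a
    simp [tensorMap]
  exact AlgHom.congr_fun this x

theorem tensorMap_mem_tensorWt {N' : Type*} [AddCommGroup N'] [Module Q N'] (g : N →ₗ[Q] N')
    {n : ℕ} {x : TensorAlgebra Q N} (hx : x ∈ tensorWt Q N n) : tensorMap g x ∈ tensorWt Q N' n := by
  rw [tensorWt_eq_span] at hx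
  induction hx using Submodule.span_induction with
  | mem x hx =>
    obtain ⟨a, rfl⟩ := hx
    rw [tensorMap_tprod]
    exact tprod_mem_tensorWt _ _
  | zero => rw [map_zero]; exact zero_mem _
  | add x y _ _ hx hy => rw [map_add]; exact add_mem hx hy
  | smul r x _ hx => rw [map_smul]; exact Submodule.smul_mem _ _ hx

theorem tensorMap_mem_tensorDeg {N' : Type*} [AddCommGroup N'] [Module Q N'] (g : N →ₗ[Q] N')
    {deg : ℤ → Submodule Q N} {deg' : ℤ → Submodule Q N'} (hg : ∀ i, ∀ a ∈ deg i, g a ∈ deg' i)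
    {s i : ℤ} {x : TensorAlgebra Q N} (hx : x ∈ tensorDeg deg s i) :
    tensorMap g x ∈ tensorDeg deg' s i := by
  rw [tensorDeg] at hx
  induction hx using Submodule.span_induction with
  | mem x hx =>
    obtain ⟨n, a, δ, ha, hδ, rfl⟩ := hx
    rw [tensorMap_tprod]
    exact Submodule.subset_span ⟨n, _, δ, fun j => hg _ _ (ha j), hδ, rfl⟩
  | zero => rw [map_zero]; exact zero_mem _
  | add x y _ _ hx hy => rw [map_add]; exact add_mem hx hy
  | smul r x _ hx => rw [map_smul]; exact Submodule.smul_mem _ _ hx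

end EvalFamily

/-! ### Symmetric tensors inside the bar construction -/

section KoszulIncl

variable {Q : Type u} [CommRing Q] {c : ℕ} (f : Fin c → Q)

/-- The inclusion of `Σ Q^c` into the augmentation ideal of the Koszul complex. -/
def koszulGen : (Fin c → Q) →ₗ[Q] (koszulAInf f).bar :=
  genMap (koszulAInf f) (extEquiv Q (Fin c → Q)).toLinearEquiv

theorem koszulIncl_apply (x : TensorAlgebra Q (Fin c → Q)) :
    koszulIncl f x = tensorMap (koszulGen f) x := rfl

theorem koszulGen_coe (v : Fin c → Q) :
    (koszulGen f v : ExteriorAlgebra Q (Fin c → Q)) = ExteriorAlgebra.ι Q v := genMap_coe f v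

theorem ι_mem_extDeg (v : Fin c → Q) : ExteriorAlgebra.ι Q v ∈ extDeg Q c 1 := by
  have := extDeg_nat (Q := Q) (c := c) 1
  rw [Nat.cast_one] at this
  rw [this, ExteriorAlgebra.exteriorPower, pow_one]
  exact ⟨v, rfl⟩

theorem koszulGen_mem (v : Fin c → Q) : koszulGen f v ∈ (koszulAInf f).barDeg 1 := by
  rw [SplitAInfAlgebra.barDeg, Submodule.mem_comap, Submodule.subtype_apply, koszulGen_coe]
  exact ι_mem_extDeg v

/-- The suspended generators have even degree, so no Koszul signs arise from desuspending them;
`evalFamily_desusp` records the consequence. -/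
theorem suspSign_koszulGen (v : Fin c → Q) :
    (koszulAInf f).suspSign (koszulGen f v) = koszulGen f v := by
  have h1 : gradeSign (koszulAInf f).deg (koszulAInf f).internal
      (koszulGen f v : ExteriorAlgebra Q (Fin c → Q)) = -ExteriorAlgebra.ι Q v := by
    have h := gradeSign_of_mem _ (koszulAInf f).internal (i := 1)
      (x := (koszulGen f v : ExteriorAlgebra Q (Fin c → Q))) (koszulGen_mem f v)
    rw [sgn_one, neg_one_zsmul] at h
    rw [h, koszulGen_coe]
  have h2 : (koszulAInf f).suspSign (koszulGen f v)
      = -(koszulAInf f).proj (gradeSign (koszulAInf f).deg (koszulAInf f).internal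
        (koszulGen f v : ExteriorAlgebra Q (Fin c → Q))) := rfl
  rw [h2, h1, map_neg, neg_neg]
  refine Subtype.ext ?_
  rw [koszulGen_coe]
  have h3 : ((koszulAInf f).proj (ExteriorAlgebra.ι Q v) : ExteriorAlgebra Q (Fin c → Q))
      = ExteriorAlgebra.ι Q v - ExteriorAlgebra.algebraMapInv (ExteriorAlgebra.ι Q v) •
        (1 : ExteriorAlgebra Q (Fin c → Q)) := rfl
  rw [h3]
  simp [ExteriorAlgebra.algebraMapInv]

theorem suspSign_pow_koszulGen (n : ℕ) (v : Fin c → Q) :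
    ((koszulAInf f).suspSign ^ n) (koszulGen f v) = koszulGen f v := by
  induction n with
  | zero => rfl
  | succ n ih => rw [pow_succ, Module.End.mul_apply, suspSign_koszulGen, ih]

theorem wordBasis_eq_tprod (l : List (Fin c)) : wordBasis Q c l
    = TensorAlgebra.tprod Q _ l.length fun j => Pi.single (l.get j) 1 := by
  rw [TensorAlgebra.tprod_apply, wordBasis_eq_prod]
  conv_lhs => rw [← List.ofFn_get l, List.map_ofFn, List.map_ofFn]
  rfl

theorem evalFamily_desusp {X : Type*} [AddCommGroup X] [Module Q X]
    (F : ∀ n : ℕ, MultilinearMap Q (fun _ : Fin n => (koszulAInf f).bar) X)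
    (x : TensorAlgebra Q (Fin c → Q)) :
    evalFamily (fun n => (koszulAInf f).desusp (F n)) (koszulIncl f x)
      = evalFamily F (koszulIncl f x) := by
  induction x using basis_induction (wordBasis Q c) with
  | zero => simp
  | add x y hx hy => rw [map_add, map_add, map_add, hx, hy]
  | smul r x hx => rw [map_smul, map_smul, map_smul, hx]
  | h l =>
    rw [koszulIncl_apply, wordBasis_eq_tprod, tensorMap_tprod, evalFamily_tprod, evalFamily_tprod,
      SplitAInfAlgebra.desusp, MultilinearMap.compLinearMap_apply]
    congr 1
    funext j
    exact suspSign_pow_koszulGen f _ _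

theorem koszulIncl_symElt_mem (α : Fin c →₀ ℕ) :
    koszulIncl f (symElt Q α) ∈ tensorWt Q (koszulAInf f).bar α.degree :=
  tensorMap_mem_tensorWt _ (symElt_mem_tensorWt α)

/-- In weight one the differential of a generator is scalar and disappears in `Ā`; in higher weight
`y^(α)` lies in the intersections on which the operations were shown to vanish. -/
theorem barOp_symElt (α : Fin c →₀ ℕ) :
    (koszulAInf f).barOp (koszulIncl f (symElt Q α)) = 0 := by
  rw [SplitAInfAlgebra.barOp, evalFamily_zsmul (fun k => sgn ((k * (k + 1) / 2 : ℕ) : ℤ))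
    (fun k => (koszulAInf f).desusp ((koszulAInf f).mBar k)) (koszulIncl_symElt_mem f α),
    evalFamily_desusp]
  rcases Nat.lt_or_ge α.degree 2 with h | h
  · obtain ⟨l, rfl⟩ := content_surjective α
    rw [degree_content] at h
    match l with
    | [] =>
      have : (koszulAInf f).mBar 0 ![] = 0 := map_zero (koszulAInf f).proj
      rw [content_nil, symElt_zero, koszulIncl_apply, map_one, evalFamily_one, this, smul_zero]
    | [i] =>
      rw [content_cons, content_nil, add_zero, symElt_content_singleton, koszulIncl_apply, tensorMap,
        TensorAlgebra.lift_ι_apply, LinearMap.comp_apply, evalFamily_ι]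
      erw [mBar_one_genMap]
      rw [smul_zero]
    | _ :: _ :: _ => simp at h
  · have := evalFamily_mBar_genMap f h (symElt_mem_quadInter α)
    rw [koszulIncl_apply]
    erw [this]
    rw [smul_zero]

theorem deconc_tensorMap {N : Type*} [AddCommGroup N] [Module Q N] (g : (Fin c → Q) →ₗ[Q] N)
    (x : TensorAlgebra Q (Fin c → Q)) : deconc (tensorMap g x)
      = TensorProduct.map (tensorMap g).toLinearMap (tensorMap g).toLinearMap (deconc x) := by
  have h : ∀ l, tensorMap g (wordBasis Q c l) = ((l.map fun i => g (Pi.single i 1)).map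
      (TensorAlgebra.ι Q)).prod := by
    intro l
    rw [wordBasis_eq_prod, map_list_prod, List.map_map, List.map_map, List.map_map]
    congr 2
    funext i
    simp [tensorMap]
  induction x using basis_induction (wordBasis Q c) with
  | zero => simp
  | add x y hx hy => rw [map_add, map_add, map_add, map_add, hx, hy]
  | smul r x hx => rw [map_smul, map_smul, map_smul, map_smul, hx]
  | h l =>
    rw [h, deconc_list_prod, deconc_wordBasis, map_sum, List.length_map]
    refine Finset.sum_congr rfl fun i _ => ?_
    rw [TensorProduct.map_tmul, AlgHom.toLinearMap_apply, AlgHom.toLinearMap_apply, h, h]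
    simp only [List.map_take, List.map_drop]

theorem deconc_koszulIncl (x : TensorAlgebra Q (Fin c → Q)) : deconc (koszulIncl f x)
    = TensorProduct.map (koszulIncl f) (koszulIncl f) (deconc x) :=
  deconc_tensorMap (koszulGen f) x

/-- The elements `y α` span a subcoalgebra, so if the corestriction of a coderivation vanishes on
all of them, then so does the coderivation. -/
theorem mul_map_deconc_eq_zero {N : Type*} [AddCommGroup N] [Module Q N]
    (y : (Fin c →₀ ℕ) → TensorAlgebra Q N) (hy : ∀ α, deconc (y α)
      = ∑ p ∈ Finset.HasAntidiagonal.antidiagonal α, y p.1 ⊗ₜ[Q] y p.2)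
    (s op : TensorAlgebra Q N →ₗ[Q] TensorAlgebra Q N) (h : ∀ α, op (y α) = 0) (α : Fin c →₀ ℕ) :
    (LinearMap.mul' Q _ ∘ₗ TensorProduct.map (LinearMap.mul' Q _ ∘ₗ TensorProduct.map s op ∘ₗ deconc)
      LinearMap.id ∘ₗ deconc) (y α) = 0 := by
  have h1 : ∀ β, (LinearMap.mul' Q _ ∘ₗ TensorProduct.map s op ∘ₗ deconc) (y β) = 0 := by
    intro β
    rw [LinearMap.comp_apply, LinearMap.comp_apply, hy, map_sum]
    simp only [TensorProduct.map_tmul, h, TensorProduct.tmul_zero, Finset.sum_const_zero, map_zero]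
  rw [LinearMap.comp_apply, LinearMap.comp_apply, hy, map_sum]
  simp only [TensorProduct.map_tmul, h1, TensorProduct.zero_tmul, Finset.sum_const_zero, map_zero]

theorem deconc_koszulIncl_symElt (α : Fin c →₀ ℕ) : deconc (koszulIncl f (symElt Q α))
    = ∑ p ∈ Finset.HasAntidiagonal.antidiagonal α,
      koszulIncl f (symElt Q p.1) ⊗ₜ[Q] koszulIncl f (symElt Q p.2) := by
  rw [deconc_koszulIncl, deconc_symElt, map_sum]
  exact Finset.sum_congr rfl fun p _ => TensorProduct.map_tmul _ _ _ _

theorem barD_symElt (α : Fin c →₀ ℕ) : (koszulAInf f).barD (koszulIncl f (symElt Q α)) = 0 :=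
  mul_map_deconc_eq_zero (fun α => koszulIncl f (symElt Q α)) (deconc_koszulIncl_symElt f)
    (tensorMap (koszulAInf f).suspSign).toLinearMap (TensorAlgebra.ι Q ∘ₗ (koszulAInf f).barOp)
    (fun α => by rw [LinearMap.comp_apply, barOp_symElt, map_zero]) α

theorem hBar_two (a b : Fin c → Q) :
    (koszulAInf f).hBar 2 ![koszulGen f a, koszulGen f b] = 0 := by
  have h1 : (koszulAInf f).hBar 2 ![koszulGen f a, koszulGen f b] = ExteriorAlgebra.algebraMapInv
    (dgOps (koszulD f) 2 fun i => (![koszulGen f a, koszulGen f b] i :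
      ExteriorAlgebra Q (Fin c → Q))) := rfl
  rw [h1, dgOps_two]
  simp only [Matrix.cons_val_zero, Matrix.cons_val_one]
  rw [koszulGen_coe, map_mul]
  simp [ExteriorAlgebra.algebraMapInv]

/-- In weight one the curvature is the scalar `d e_i = f_i`. In weight two it is the augmentation of
a product of two generators, which is zero. -/
theorem barCurv_symElt (α : Fin c →₀ ℕ) :
    (koszulAInf f).barCurv (koszulIncl f (symElt Q α)) = symCurv f (symBasis Q c α) := by
  rw [SplitAInfAlgebra.barCurv]
  by_cases h1 : α.degree = 1
  · rw [evalFamily_congr (F' := fun n => (koszulAInf f).desusp ((koszulAInf f).hBar n)) (n := 1) rfl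
      (h1 ▸ koszulIncl_symElt_mem f α), evalFamily_desusp]
    obtain ⟨l, rfl⟩ := content_surjective α
    rw [degree_content, List.length_eq_one_iff] at h1
    obtain ⟨i, rfl⟩ := h1
    rw [content_cons, content_nil, add_zero, symElt_content_singleton, symCurv_symBasis,
      koszulIncl_apply, tensorMap, TensorAlgebra.lift_ι_apply, LinearMap.comp_apply, evalFamily_ι]
    have h2 : (koszulAInf f).hBar 1 ![koszulGen f (Pi.single i 1)]
        = ExteriorAlgebra.algebraMapInv (koszulD f (koszulGen f (Pi.single i 1) :
          ExteriorAlgebra Q (Fin c → Q))) := rfl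
    rw [h2, koszulGen_coe, koszulD_ι, ExteriorAlgebra.algebraMap_leftInverse, seqForm_single]
  · rw [symCurv_symBasis_of_ne f h1]
    by_cases h2 : α.degree = 2
    · rw [evalFamily_congr (F' := fun n => (koszulAInf f).desusp ((koszulAInf f).hBar n)) (n := 2)
        rfl (h2 ▸ koszulIncl_symElt_mem f α), evalFamily_desusp, symElt_eq_sum, map_sum, map_sum]
      refine Finset.sum_eq_zero fun l hl => ?_
      rw [mem_wordsOf] at hl
      rw [← hl, degree_content, List.length_eq_two] at h2
      obtain ⟨i, j, rfl⟩ := h2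
      rw [wordBasis_cons, wordBasis_cons, wordBasis_nil, mul_one, koszulIncl_apply, map_mul,
        tensorMap, TensorAlgebra.lift_ι_apply, TensorAlgebra.lift_ι_apply, LinearMap.comp_apply,
        LinearMap.comp_apply, evalFamily_ι_mul_ι, hBar_two]
    · refine evalFamily_eq_zero ?_ (koszulIncl_symElt_mem f α)
      rw [if_neg (by omega)]

/-- A retraction of the augmentation ideal of the Koszul complex onto `Σ Q^c`. -/
def koszulRetract : (koszulAInf f).bar →ₗ[Q] (Fin c → Q) :=
  ExteriorAlgebra.ιInv ∘ₗ (koszulAInf f).bar.subtype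

theorem koszulRetract_comp : koszulRetract f ∘ₗ koszulGen f = LinearMap.id := by
  refine LinearMap.ext fun v => ?_
  rw [koszulRetract, LinearMap.comp_apply, LinearMap.comp_apply, Submodule.subtype_apply,
    koszulGen_coe]
  exact ExteriorAlgebra.ι_leftInverse v

theorem tensorMap_koszulRetract (x : TensorAlgebra Q (Fin c → Q)) :
    tensorMap (koszulRetract f) (koszulIncl f x) = x := by
  rw [koszulIncl_apply, tensorMap_comp, koszulRetract_comp, tensorMap_id]

theorem exteriorAlgebra_ιInv_ι_mul_ι_mul {N : Type*} [AddCommGroup N] [Module Q N] (a b : N)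
    (x : ExteriorAlgebra Q N) :
    ExteriorAlgebra.ιInv (ExteriorAlgebra.ι Q a * (ExteriorAlgebra.ι Q b * x)) = 0 := by
  -- The projection to degree one factors through the trivial square-zero extension, where products
  -- of two infinitesimals vanish; its ring structure needs a right action.
  let _ : Module Qᵐᵒᵖ N := Module.compHom _ ((RingHom.id Q).fromOpposite mul_comm)
  have _ : IsCentralScalar Q N := ⟨fun r m => rfl⟩
  have h : ∀ y : ExteriorAlgebra Q N, ExteriorAlgebra.ιInv y
    = (ExteriorAlgebra.toTrivSqZeroExt y).snd := fun y => rfl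
  rw [h, map_mul, map_mul, ExteriorAlgebra.toTrivSqZeroExt_ι, ExteriorAlgebra.toTrivSqZeroExt_ι,
    ← mul_assoc, TrivSqZeroExt.inr_mul_inr, zero_mul, TrivSqZeroExt.snd_zero]

theorem ιInv_of_mem_extDeg {i : ℤ} (hi : i ≠ 1) {x : ExteriorAlgebra Q (Fin c → Q)}
    (hx : x ∈ extDeg Q c i) : ExteriorAlgebra.ιInv x = 0 := by
  rcases lt_or_ge i 0 with h0 | h0
  · rw [extDeg_neg i h0, Submodule.mem_bot] at hx
    rw [hx, map_zero]
  lift i to ℕ using h0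
  rw [extDeg_nat, ExteriorAlgebra.exteriorPower] at hx
  match i with
  | 0 =>
    rw [pow_zero, Submodule.mem_one] at hx
    obtain ⟨r, rfl⟩ := hx
    simp [ExteriorAlgebra.ιInv, ExteriorAlgebra.toTrivSqZeroExt]
    rfl
  | 1 => exact absurd rfl hi
  | n + 2 =>
    rw [pow_succ'] at hx
    induction hx using Submodule.mul_induction_on' with
    | mem_mul_mem m hm y hy =>
      obtain ⟨a, rfl⟩ := hm
      rw [pow_succ'] at hy
      induction hy using Submodule.mul_induction_on' with
      | mem_mul_mem m hm y hy =>
        obtain ⟨b, rfl⟩ := hm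
        exact exteriorAlgebra_ιInv_ι_mul_ι_mul a b y
      | add y _ z _ hy hz => rw [mul_add, map_add, hy, hz, add_zero]
    | add y _ z _ hy hz => rw [map_add, hy, hz, add_zero]

/-- The retraction respects degrees. It therefore shows not only that the symmetric tensors inject
into the bar construction but also that their grading is the restricted one. -/
theorem koszulRetract_mem (i : ℤ) (x : (koszulAInf f).bar) (hx : x ∈ (koszulAInf f).barDeg i) :
    koszulRetract f x ∈ concDeg Q (Fin c → Q) 1 i := by
  by_cases hi : i = 1
  · rw [hi, concDeg_self]; trivial
  · rw [concDeg_ne hi, Submodule.mem_bot]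
    exact ιInv_of_mem_extDeg hi hx

theorem isPriddyCoalgebra [IsLocalRing Q] {R : Type v} [CommRing R] [Algebra Q R]
    (P : IsStrictlyKoszulPresentation (R := R) (koszulAInf f) (concDeg Q (Fin c → Q) 1)
        (extRel Q (Fin c → Q)) (extEquiv Q (Fin c → Q)).toLinearEquiv
        (koszulAug Q c R).toLinearMap) :
    IsPriddyCoalgebra P (symCoalgebra f) (symIncl f) where
  injective x y h := by
    have := congrArg (tensorMap (koszulRetract f)) h
    rw [symIncl, LinearMap.comp_apply, LinearMap.comp_apply, tensorMap_koszulRetract,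
      tensorMap_koszulRetract] at this
    exact Subtype.ext this
  range_eq := by
    rw [priddy_eq_symTensors, symIncl, LinearMap.range_comp, Submodule.range_subtype]
    rfl
  deg_eq i := by
    -- Generators in degree two without suspension and generators in degree one with suspension give
    -- the same grading of the tensor algebra.
    have hdeg : tensorDeg (concDeg Q (Fin c → Q) 2) 0 i = tensorDeg (concDeg Q (Fin c → Q) 1) 1 i := by
      rw [tensorDeg_concDeg, tensorDeg_concDeg]
      rfl
    show symDeg Q c i = _
    ext x
    rw [symDeg, hdeg, Submodule.mem_comap, Submodule.mem_comap]
    constructor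
    · intro hx
      refine tensorMap_mem_tensorDeg (koszulGen f) (fun j a ha => ?_) hx
      by_cases hj : j = 1
      · rw [hj]; exact koszulGen_mem f a
      · rw [concDeg_ne hj, Submodule.mem_bot] at ha
        rw [ha, map_zero]
        exact zero_mem _
    · intro hx
      have := tensorMap_mem_tensorDeg (koszulRetract f) (koszulRetract_mem f) hx
      rwa [symIncl, LinearMap.comp_apply, tensorMap_koszulRetract] at this
  comul := by
    refine LinearMap.ext fun x => ?_
    have h := LinearMap.congr_fun (symComul_subtype (Q := Q) (c := c)) x
    rw [LinearMap.comp_apply, LinearMap.comp_apply] at h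
    rw [LinearMap.comp_apply, LinearMap.comp_apply, symIncl, LinearMap.comp_apply,
      deconc_koszulIncl, ← h, TensorProduct.map_comp]
    rfl
  counit := by
    refine LinearMap.ext fun x => ?_
    have : (TensorAlgebra.algebraMapInv : TensorAlgebra Q (koszulAInf f).bar →ₐ[Q] Q).comp
        (tensorMap (koszulGen f)) = TensorAlgebra.algebraMapInv := by
      ext a
      simp [tensorMap, TensorAlgebra.algebraMapInv]
    exact (AlgHom.congr_fun this (x : TensorAlgebra Q (Fin c → Q))).symm
  d := by
    refine (symBasis Q c).ext fun α => ?_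
    have : (koszulAInf f).barD (symIncl f (symBasis Q c α)) = 0 := by
      rw [symIncl, LinearMap.comp_apply, Submodule.subtype_apply, symBasis_coe, barD_symElt]
    rw [LinearMap.comp_apply, LinearMap.comp_apply, this]
    exact map_zero _
  h := by
    refine (symBasis Q c).ext fun α => ?_
    rw [LinearMap.comp_apply, symIncl, LinearMap.comp_apply, Submodule.subtype_apply, symBasis_coe,
      barCurv_symElt]
    rfl

end KoszulIncl

end AInfKoszul

end

noncomputable section

namespace AInfKoszul

open Module

/-! ### Stasheff identities summed over words -/

section HomotopySystem

variable {Q : Type u} [CommRing Q] {c : ℕ}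

/-- The sequence of the generators of the exterior algebra indexed by the letters of a word. -/
def wordArg (Q : Type u) [CommRing Q] (l : List (Fin c)) (j : ℕ) :
    ExteriorAlgebra Q (Fin c → Q) :=
  (l[j]?).elim 0 fun i => ExteriorAlgebra.ι Q (Pi.single i 1)

theorem wordArg_of_lt (l : List (Fin c)) {j : ℕ} (hj : j < l.length) :
    wordArg Q l j = ExteriorAlgebra.ι Q (Pi.single l[j] 1) := by
  rw [wordArg, List.getElem?_eq_getElem hj]
  rfl

theorem wordArg_take (l : List (Fin c)) {r j : ℕ} (hj : j < r) :
    wordArg Q (l.take r) j = wordArg Q l j := by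
  rw [wordArg, wordArg, List.getElem?_take_of_lt hj]

theorem wordArg_drop (l : List (Fin c)) (r j : ℕ) :
    wordArg Q (l.drop r) j = wordArg Q l (r + j) := by
  rw [wordArg, wordArg, List.getElem?_drop]

theorem wordArg_mem (l : List (Fin c)) (j : ℕ) : wordArg Q l j ∈ extDeg Q c 1 := by
  rw [wordArg]
  cases l[j]? with
  | none => exact zero_mem _
  | some i => exact ι_mem_extDeg _

variable {f : Fin c → Q} {G : Type w} [AddCommGroup G] [Module Q G]
  (𝒢 : AInfModule (koszulAInf f) G)

theorem act_wordArg_of_le {n n' : ℕ} (h : n = n') {a a' : ℕ → ExteriorAlgebra Q (Fin c → Q)}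
    (ha : ∀ i < n, a i = a' i) :
    𝒢.act n (fun i => a i) = 𝒢.act n' (fun i => a' i) := by
  subst h
  congr 1
  funext i
  exact ha i i.2

theorem twist_word (l : List (Fin c)) : 𝒢.twist (koszulIncl f (wordBasis Q c l))
    = sgn ((l.length * (l.length - 1) / 2 : ℕ) : ℤ) • 𝒢.act l.length (fun j => wordArg Q l j) := by
  have h : koszulIncl f (wordBasis Q c l) = TensorAlgebra.tprod Q _ l.length
      (fun j => koszulGen f (Pi.single (l.get j) 1)) := by
    rw [koszulIncl_apply, wordBasis_eq_tprod, tensorMap_tprod]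
  rw [AInfModule.twist, evalFamily_zsmul (fun n => sgn ((n * (n - 1) / 2 : ℕ) : ℤ))
    (fun n => (koszulAInf f).desusp (𝒢.actBar n)) (h ▸ tprod_mem_tensorWt _ _), evalFamily_desusp, h,
    evalFamily_tprod, AInfModule.actBar, MultilinearMap.compLinearMap_apply]
  congr 2
  funext j
  rw [wordArg_of_lt _ j.2, Submodule.subtype_apply, koszulGen_coe, List.get_eq_getElem]

theorem homotopy_eq_twist (α : Fin c →₀ ℕ) :
    homotopy 𝒢 α = 𝒢.twist (koszulIncl f (symElt Q α)) := by
  rw [AInfModule.twist, evalFamily_zsmul (fun n => sgn ((n * (n - 1) / 2 : ℕ) : ℤ))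
    (fun n => (koszulAInf f).desusp (𝒢.actBar n)) (koszulIncl_symElt_mem f α), homotopy,
    AInfModule.desuspAct, Finsupp.degree_eq_sum]

theorem homotopy_eq_sum (α : Fin c →₀ ℕ) : homotopy 𝒢 α
    = ∑ l ∈ wordsOf α, sgn ((l.length * (l.length - 1) / 2 : ℕ) : ℤ) •
        𝒢.act l.length (fun j => wordArg Q l j) := by
  rw [homotopy_eq_twist, symElt_eq_sum, map_sum, map_sum]
  exact Finset.sum_congr rfl fun l _ => twist_word 𝒢 l

/-- Vandermonde for `choose 2`: splitting `r + s` produces the extra term `r s`, which is the sign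
in front of a composite in the Stasheff identity with arguments of degree one. -/
theorem sgn_choose_add (r s : ℕ) : sgn (((r + s) * (r + s - 1) / 2 : ℕ) : ℤ)
    * sgn ((r * s : ℕ) : ℤ)
    = sgn ((r * (r - 1) / 2 : ℕ) : ℤ) * sgn ((s * (s - 1) / 2 : ℕ) : ℤ) := by
  rw [← sgn_add, ← sgn_add]
  apply sgn_eq_of_even
  have h : ∀ n : ℕ, (n * (n - 1) / 2) = n.choose 2 := fun n => (Nat.choose_two_right n).symm
  have h' : (r + s).choose 2 = r.choose 2 + s.choose 2 + r * s := by
    induction s with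
    | zero => simp
    | succ s ih =>
      rw [← add_assoc, Nat.choose_succ_succ' (r + s) 1, ih, Nat.choose_succ_succ' s 1,
        Nat.choose_one_right, Nat.choose_one_right]
      ring
  rw [h, h, h, h']
  push_cast
  exact ⟨r * s, by ring⟩

/-- The composition of the operations twisted by the two factors of a tensor. -/
def twistMul : TensorAlgebra Q (Fin c → Q) ⊗[Q] TensorAlgebra Q (Fin c → Q) →ₗ[Q] Module.End Q G :=
  LinearMap.mul' Q (Module.End Q G) ∘ₗ
    TensorProduct.map (𝒢.twist ∘ₗ koszulIncl f) (𝒢.twist ∘ₗ koszulIncl f)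

theorem twistMul_tmul (x y : TensorAlgebra Q (Fin c → Q)) :
    twistMul 𝒢 (x ⊗ₜ y) = 𝒢.twist (koszulIncl f x) ∘ₗ 𝒢.twist (koszulIncl f y) := rfl

theorem twistMul_deconc_symElt (α : Fin c →₀ ℕ) : twistMul 𝒢 (deconc (symElt Q α))
    = ∑ p ∈ Finset.HasAntidiagonal.antidiagonal α, homotopy 𝒢 p.1 ∘ₗ homotopy 𝒢 p.2 := by
  rw [deconc_symElt, map_sum]
  refine Finset.sum_congr rfl fun p _ => ?_
  rw [twistMul_tmul, homotopy_eq_twist, homotopy_eq_twist]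

/-- Deconcatenating a word and composing the twists of the two parts gives exactly the composite
terms of its Stasheff identity, up to the overall prefactor. -/
theorem twistMul_deconc_word (l : List (Fin c)) (g : G) :
    twistMul 𝒢 (deconc (wordBasis Q c l)) g
      = sgn ((l.length * (l.length - 1) / 2 : ℕ) : ℤ) • ∑ r ∈ Finset.range (l.length + 1),
        sgn (r + (l.length - r + 1) * ∑ _i ∈ Finset.range r, (1 : ℤ)) •
          𝒢.act r (fun i => wordArg Q l i)
            (𝒢.act (l.length - r) (fun j => wordArg Q l (r + j)) g) := by
  rw [deconc_wordBasis, map_sum, LinearMap.sum_apply, Finset.smul_sum]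
  refine Finset.sum_congr rfl fun r hr => ?_
  rw [Finset.mem_range, Nat.lt_succ_iff] at hr
  have h1 : (l.take r).length = r := by simp [hr]
  have h2 : (l.drop r).length = l.length - r := by simp
  obtain ⟨s, hs⟩ := Nat.exists_eq_add_of_le hr
  have h3 := act_wordArg_of_le 𝒢 h1 (a := wordArg Q (l.take r)) (a' := wordArg Q l)
    fun _ hi => wordArg_take l (h1 ▸ hi)
  have h4 := act_wordArg_of_le 𝒢 h2 (a := wordArg Q (l.drop r)) (a' := fun j => wordArg Q l (r + j))
    fun _ _ => wordArg_drop l r _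
  rw [twistMul_tmul, twist_word, twist_word, h3, h4, h1, h2, hs, Nat.add_sub_cancel_left,
    LinearMap.comp_apply, LinearMap.smul_apply, LinearMap.smul_apply, map_zsmul, smul_smul, smul_smul,
    ← sgn_choose_add]
  congr 2
  apply sgn_eq_of_even
  simp only [Finset.sum_const, Finset.card_range]
  push_cast
  exact ⟨-r, by simp; ring⟩

/-- For exterior generators every argument has degree one, so the signs simplify, and the inner
operations reduce to the differential and the product. -/
theorem stasheff_word (l : List (Fin c)) (g : G) :
    ∑ r ∈ Finset.range l.length,
      (sgn (r + l.length) • 𝒢.act l.length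
          (fun i => insertOp (wordArg Q l) r 1 (koszulD f (wordArg Q l r)) i) g +
        if 2 ≤ l.length - r then sgn r • 𝒢.act (l.length - 2 + 1)
          (fun i => insertOp (wordArg Q l) r 2 (wordArg Q l r * wordArg Q l (r + 1)) i) g else 0)
    + ∑ r ∈ Finset.range (l.length + 1),
        sgn (r + (l.length - r + 1) * ∑ _i ∈ Finset.range r, (1 : ℤ)) •
          𝒢.act r (fun i => wordArg Q l i)
            (𝒢.act (l.length - r) (fun j => wordArg Q l (r + j)) g) = 0 := by
  refine Eq.trans ?_ (𝒢.stasheff l.length (wordArg Q l) (fun _ => 1) (fun j => wordArg_mem l j) g)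
  congr 1
  refine Finset.sum_congr rfl fun r hr => ?_
  rw [Finset.mem_range] at hr
  have hr' : 1 ≤ l.length - r := by omega
  rw [sum_Icc_eq_of_three_le, if_pos hr']
  · congr 1
    · rw [Nat.sub_add_cancel (by omega)]
      congr 1
      apply sgn_eq_of_even
      simp only [Finset.sum_const, Finset.card_range]
      push_cast
      exact ⟨0, by simp; ring⟩
    · congr 1
      have : (koszulAInf f).m 2 (fun j => wordArg Q l (r + j)) = wordArg Q l r * wordArg Q l (r + 1) :=
        dgOps_two (koszulD f) _
      rw [this]
      congr 1
      apply sgn_eq_of_even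
      simp only [Finset.sum_const, Finset.card_range]
      push_cast
      exact ⟨-(l.length + 1 - 2), by simp; ring⟩
  · intro s hs hs'
    have : (koszulAInf f).m s = 0 := dgOps_ge _ s hs
    rw [(𝒢.act _).map_coord_zero ⟨r, by omega⟩ (by simp [insertOp, this]), LinearMap.zero_apply,
      smul_zero]

theorem koszulD_wordArg (l : List (Fin c)) {r : ℕ} (hr : r < l.length) :
    koszulD f (wordArg Q l r) = f l[r] • (1 : ExteriorAlgebra Q (Fin c → Q)) := by
  rw [wordArg_of_lt l hr, koszulD_ι, seqForm_single, Algebra.algebraMap_eq_smul_one]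

/-- The scalar comes out by multilinearity, and strict unitality kills an operation with at least
two algebra arguments when one of them is the unit. This disposes of the terms with `d e_i = f_i ·
1`. -/
theorem act_smul_one {n : ℕ} (hn : 1 < n) (a : Fin n → ExteriorAlgebra Q (Fin c → Q)) (i : Fin n)
    (q : Q) (ha : a i = q • 1) : 𝒢.act n a = 0 := by
  have : a = Function.update a i (q • 1) := by rw [← ha, Function.update_eq_self]
  rw [this, MultilinearMap.map_update_smul,
    show 𝒢.act n (Function.update a i 1) = 0 from
      𝒢.act_unit n hn _ ⟨i, Function.update_self _ _ _⟩, smul_zero]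

/-- The word with the letters in positions `r` and `r + 1` interchanged. -/
def swapLetters (r : ℕ) (l : List (Fin c)) : List (Fin c) :=
  if h : r + 1 < l.length then (l.set r l[r + 1]).set (r + 1) l[r] else l

theorem swapLetters_length (r : ℕ) (l : List (Fin c)) :
    (swapLetters r l).length = l.length := by
  rw [swapLetters]; split_ifs <;> simp

theorem swapLetters_content (r : ℕ) (l : List (Fin c)) :
    content (swapLetters r l) = content l := by
  rw [swapLetters]
  split_ifs with h
  · exact content_eq_iff.2 (List.set_set_perm _ _)
  · rfl

theorem getElem?_swapLetters {r : ℕ} {l : List (Fin c)} (h : r + 1 < l.length) (j : ℕ) :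
    (swapLetters r l)[j]? = if j = r then l[r + 1]? else if j = r + 1 then l[r]? else l[j]? := by
  rw [swapLetters, dif_pos h]
  grind

theorem swapLetters_swapLetters (r : ℕ) (l : List (Fin c)) :
    swapLetters r (swapLetters r l) = l := by
  by_cases h : r + 1 < l.length
  · refine List.ext_getElem? fun j => ?_
    rw [getElem?_swapLetters (by rwa [swapLetters_length]), getElem?_swapLetters h,
      getElem?_swapLetters h, getElem?_swapLetters h]
    grind
  · simp [swapLetters, h]

theorem wordArg_swapLetters {r : ℕ} {l : List (Fin c)} (h : r + 1 < l.length) (j : ℕ) :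
    wordArg Q (swapLetters r l) j
      = if j = r then wordArg Q l (r + 1) else if j = r + 1 then wordArg Q l r else wordArg Q l j := by
  simp only [wordArg, getElem?_swapLetters h]
  split_ifs <;> rfl

/-- After the letters in positions `r` and `r + 1` are multiplied, the two words differ only in that
product, and the two products are negatives of each other. -/
theorem act_mul_swapLetters {r : ℕ} {l : List (Fin c)} (h : r + 1 < l.length) (n : ℕ) (hn : r < n) :
    𝒢.act n (fun i => insertOp (wordArg Q l) r 2 (wordArg Q l r * wordArg Q l (r + 1)) i)
      + 𝒢.act n (fun i => insertOp (wordArg Q (swapLetters r l)) r 2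
        (wordArg Q (swapLetters r l) r * wordArg Q (swapLetters r l) (r + 1)) i) = 0 := by
  have key : ∀ x, (fun i : Fin n => insertOp (wordArg Q (swapLetters r l)) r 2 x i)
      = Function.update (fun i : Fin n => insertOp (wordArg Q l) r 2
        (wordArg Q l r * wordArg Q l (r + 1)) i) ⟨r, hn⟩ x := by
    intro x
    funext i
    by_cases hi : i = ⟨r, hn⟩
    · subst hi
      rw [Function.update_self]
      simp [insertOp]
    · have hi' : (i : ℕ) ≠ r := fun h => hi (Fin.ext h)
      rw [Function.update_of_ne hi]
      simp only [insertOp, wordArg_swapLetters h, if_neg hi']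
      split_ifs <;> first | rfl | omega
  rw [key, wordArg_swapLetters h, wordArg_swapLetters h, if_pos rfl, if_neg (by omega), if_pos rfl]
  nth_rewrite 1 [show (fun i : Fin n => insertOp (wordArg Q l) r 2
        (wordArg Q l r * wordArg Q l (r + 1)) i) = Function.update (fun i : Fin n =>
          insertOp (wordArg Q l) r 2 (wordArg Q l r * wordArg Q l (r + 1)) i) ⟨r, hn⟩
            (wordArg Q l r * wordArg Q l (r + 1)) from by
    rw [eq_comm, Function.update_eq_self_iff]; simp [insertOp]]
  rw [← MultilinearMap.map_update_add]
  refine MultilinearMap.map_coord_zero _ ⟨r, hn⟩ ?_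
  rw [Function.update_self, wordArg_of_lt l (by omega), wordArg_of_lt l h,
    ExteriorAlgebra.ι_add_mul_swap]

/-- Exchanging two neighbouring letters is an involution on the words of content `α` that pairs
terms of opposite value. For a fixed word the two letters agree and the product is a square, hence
zero. -/
theorem sum_act_mul_eq_zero (α : Fin c →₀ ℕ) {r : ℕ} (hr : r + 1 < α.degree) :
    ∑ l ∈ wordsOf α, 𝒢.act (α.degree - 2 + 1)
      (fun i => insertOp (wordArg Q l) r 2 (wordArg Q l r * wordArg Q l (r + 1)) i) = 0 := by
  have hlen : ∀ l ∈ wordsOf α, l.length = α.degree := fun l hl => by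
    rw [mem_wordsOf] at hl; rw [← hl, degree_content]
  refine Finset.sum_involution (fun l _ => swapLetters r l) (fun l hl => ?_) (fun l hl h => ?_)
    (fun l hl => ?_) (fun l hl => swapLetters_swapLetters r l)
  · exact act_mul_swapLetters 𝒢 (by rw [hlen l hl]; exact hr) _ (by omega)
  · intro hl'
    have h' : r + 1 < l.length := by rw [hlen l hl]; exact hr
    have h1 := wordArg_swapLetters (Q := Q) h' r
    rw [hl', if_pos rfl] at h1
    refine h (MultilinearMap.map_coord_zero _ ⟨r, by omega⟩ ?_)
    simp only [insertOp, lt_irrefl, if_false, if_true]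
    rw [← h1, wordArg_of_lt l (by omega), ExteriorAlgebra.ι_sq_zero]
  · rw [mem_wordsOf] at hl ⊢
    rw [swapLetters_content, hl]

theorem wordsOf_single (i : Fin c) : wordsOf (Finsupp.single i 1) = {[i]} := by
  ext l
  rw [mem_wordsOf, Finset.mem_singleton]
  constructor
  · intro h
    have h1 : content l = content [i] := by rw [h, content_cons, content_nil, add_zero]
    exact List.perm_singleton.1 (content_eq_iff.1 h1)
  · rintro rfl
    rw [content_cons, content_nil, add_zero]

theorem homotopy_mem (α : Fin c →₀ ℕ) (i : ℤ) (g : G) (hg : g ∈ 𝒢.deg i) :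
    homotopy 𝒢 α g ∈ 𝒢.deg (i + (2 * (∑ j, α j : ℕ) - 1)) := by
  rw [homotopy_eq_sum, LinearMap.sum_apply]
  refine Submodule.sum_mem _ fun l hl => ?_
  rw [LinearMap.smul_apply]
  refine zsmul_mem ?_ _
  have h := 𝒢.act_mem l.length (fun j => wordArg Q l j) (fun _ => 1) (fun j => wordArg_mem l j) i g hg
  rw [mem_wordsOf] at hl
  have h1 : (∑ j, α j) = l.length := by
    rw [← hl, ← degree_content, Finsupp.degree_eq_sum]
  convert h using 2
  rw [h1, Finset.sum_const, Finset.card_univ, Fintype.card_fin]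
  simp
  ring

theorem wordsOf_zero : wordsOf (0 : Fin c →₀ ℕ) = {[]} := by
  ext l
  rw [mem_wordsOf, Finset.mem_singleton]
  constructor
  · intro h
    rw [← content_nil] at h
    exact List.perm_nil.1 (content_eq_iff.1 h)
  · rintro rfl
    exact content_nil

theorem homotopy_zero : homotopy 𝒢 0 = 𝒢.act 0 ![] := by
  rw [homotopy_eq_sum, wordsOf_zero, Finset.sum_singleton, List.length_nil]
  have : sgn ((0 * (0 - 1) / 2 : ℕ) : ℤ) = 1 := sgn_zero
  rw [this, one_smul]
  congr 1
  exact Subsingleton.elim _ _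

/-- For a single letter the only term besides the composites is the action of `d e_i = f_i · 1`, and
the unit acts as the identity. -/
theorem sum_homotopy_comp_single (i : Fin c) :
    ∑ p ∈ Finset.HasAntidiagonal.antidiagonal (Finsupp.single i 1 : Fin c →₀ ℕ),
      homotopy 𝒢 p.1 ∘ₗ homotopy 𝒢 p.2 = f i • LinearMap.id := by
  rw [← twistMul_deconc_symElt, symElt_eq_sum, wordsOf_single, Finset.sum_singleton]
  refine LinearMap.ext fun g => ?_
  rw [twistMul_deconc_word]
  have h := stasheff_word 𝒢 [i] g
  rw [add_comm, ← eq_neg_iff_add_eq_zero] at h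
  rw [h, List.length_singleton, Finset.sum_range_one, if_neg (by omega), add_zero,
    koszulD_wordArg _ (by simp)]
  have h1 : (fun i_1 : Fin 1 => insertOp (wordArg Q [i]) 0 1
      (f [i][0] • (1 : ExteriorAlgebra Q (Fin c → Q))) i_1)
      = fun j => f i • (fun _ => (1 : ExteriorAlgebra Q (Fin c → Q))) j := by
    funext j
    rw [Subsingleton.elim j 0]
    rfl
  have h2 : 𝒢.act 1 (fun _ => (1 : ExteriorAlgebra Q (Fin c → Q))) g = g := 𝒢.one_act g
  have h3 : sgn ((1 * (1 - 1) / 2 : ℕ) : ℤ) = 1 := sgn_zero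
  have h4 : sgn (((0 : ℕ) : ℤ) + ((1 : ℕ) : ℤ)) = -1 := sgn_one
  rw [h1, MultilinearMap.map_smul_univ, h3, h4]
  simp [h2]

/-- The composites equal minus the remaining Stasheff terms: those with a differentiated letter
vanish by strict unitality, those with a product cancel after summation over the words of content
`α`. -/
theorem sum_homotopy_comp {α : Fin c →₀ ℕ} (hα : 1 < α.degree) :
    ∑ p ∈ Finset.HasAntidiagonal.antidiagonal α, homotopy 𝒢 p.1 ∘ₗ homotopy 𝒢 p.2 = 0 := by
  rw [← twistMul_deconc_symElt, symElt_eq_sum, map_sum, map_sum]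
  have hlen : ∀ l ∈ wordsOf α, l.length = α.degree := fun l hl => by
    rw [mem_wordsOf] at hl; rw [← hl, degree_content]
  refine LinearMap.ext fun g => ?_
  have key : ∀ l ∈ wordsOf α, twistMul 𝒢 (deconc (wordBasis Q c l)) g
      = -(sgn ((α.degree * (α.degree - 1) / 2 : ℕ) : ℤ) • ∑ r ∈ Finset.range α.degree,
        if 2 ≤ α.degree - r then sgn r • 𝒢.act (α.degree - 2 + 1)
          (fun i => insertOp (wordArg Q l) r 2 (wordArg Q l r * wordArg Q l (r + 1)) i) g else 0) := by
    intro l hl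
    rw [twistMul_deconc_word]
    have h := stasheff_word 𝒢 l g
    rw [add_comm, ← eq_neg_iff_add_eq_zero] at h
    rw [h, smul_neg, hlen l hl]
    congr 2
    refine Finset.sum_congr rfl fun r hr => ?_
    rw [Finset.mem_range] at hr
    have : 𝒢.act α.degree
        (fun i => insertOp (wordArg Q l) r 1 (koszulD f (wordArg Q l r)) i) = 0 := by
      refine act_smul_one 𝒢 hα _ ⟨r, hr⟩ (f (l[r]'(by rw [hlen l hl]; exact hr))) ?_
      simp only [insertOp, lt_irrefl, if_false, if_true]
      exact koszulD_wordArg l _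
    rw [this, LinearMap.zero_apply, smul_zero, zero_add]
  rw [LinearMap.sum_apply, Finset.sum_congr rfl key, Finset.sum_neg_distrib, ← Finset.smul_sum,
    Finset.sum_comm, Finset.sum_eq_zero, smul_zero, neg_zero, LinearMap.zero_apply]
  intro r hr
  by_cases h2 : 2 ≤ α.degree - r
  · simp only [if_pos h2]
    rw [← Finset.smul_sum, ← LinearMap.sum_apply, sum_act_mul_eq_zero 𝒢 α (by omega),
      LinearMap.zero_apply, smul_zero]
  · simp only [if_neg h2, Finset.sum_const_zero]

end HomotopySystem

/-! ### The system of higher homotopies -/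

section System

variable {Q : Type u} [CommRing Q] {c : ℕ} {R : Type v} [CommRing R] [Algebra Q R]
  {M : Type w} [AddCommGroup M] [Module Q M] [Module R M] [IsScalarTower Q R M]

theorem isSystemOfHigherHomotopies {f : Fin c → Q}
    (hf : RingHom.ker (algebraMap Q R) = Ideal.span (Set.range f))
    {degM : ℤ → Submodule R M} {dM : M →ₗ[R] M} (hM : IsComplex degM dM)
    {G : Type w'} [AddCommGroup G] [Module Q G] {γ : G →ₗ[Q] M} (𝒢 : AInfModule (koszulAInf f) G)
    (h : IsStrictMorphism 𝒢 (koszulRestrict f hf degM dM hM) γ) :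
    IsSystemOfHigherHomotopies f 𝒢.deg (𝒢.act 0 ![]) γ (homotopy 𝒢) where
  degree α i x hx := homotopy_mem 𝒢 α i x hx
  zero := homotopy_zero 𝒢
  single i := by
    rw [← sum_homotopy_comp_single 𝒢]
    rw [Finsupp.antidiagonal_single, Finset.Nat.antidiagonal_succ]
    simp
  higher α hα := sum_homotopy_comp 𝒢 (by rwa [Finsupp.degree_eq_sum])
  aug α hα := by
    refine LinearMap.ext fun g => ?_
    rw [LinearMap.comp_apply, homotopy_eq_sum, LinearMap.sum_apply, map_sum, LinearMap.zero_apply]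
    refine Finset.sum_eq_zero fun l hl => ?_
    have hl' : 0 < l.length := by
      rw [mem_wordsOf] at hl
      rwa [← degree_content, hl, Finsupp.degree_eq_sum]
    -- Strictness moves `γ` inside, and on `M` the operations vanish: elements of degree one act by
    -- zero, and there are no operations with more algebra arguments.
    have key : (koszulRestrict f hf degM dM hM).act l.length (fun j => wordArg Q l j) = 0 := by
      generalize l.length = n at hl'
      match n with
      | 0 => omega
      | 1 =>
        refine LinearMap.ext fun x => ?_
        have h1 : (koszulRestrict f hf degM dM hM).act 1 (fun j => wordArg Q l j) x
          = koszulAug Q c R (wordArg Q l 0) • x := rfl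
        rw [h1, koszulAug_deg 1 one_ne_zero _ (wordArg_mem l 0), zero_smul, LinearMap.zero_apply]
      | n + 2 => exact congrFun (congrArg DFunLike.coe
          (dgActs_ge (koszulAug Q c R) (dM.restrictScalars Q) (n + 2) (by omega))) _
    rw [LinearMap.smul_apply, map_zsmul, h.comm, key, LinearMap.zero_apply, smul_zero]

end System

end AInfKoszul

end

noncomputable section

namespace AInfKoszul

open Module

/-! ### Divisibility by an ideal and base change -/

section IdealSmul

variable {Q : Type*} [CommRing Q] {X : Type*} [AddCommGroup X] [Module Q X]

theorem map_mem_smul_top {Y : Type*} [AddCommGroup Y] [Module Q Y] {I : Ideal Q} (T : X →ₗ[Q] Y)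
    {x : X} (hx : x ∈ (I • ⊤ : Submodule Q X)) : T x ∈ (I • ⊤ : Submodule Q Y) :=
  Submodule.smul_top_le_comap_smul_top I T hx

theorem mem_smul_top_iff_repr {I : Ideal Q} {ι : Type*} (b : Basis ι Q X) (x : X) :
    x ∈ (I • ⊤ : Submodule Q X) ↔ ∀ i, b.repr x i ∈ I := by
  constructor
  · intro hx i
    have h := map_mem_smul_top (b.coord i) hx
    rwa [smul_eq_mul, Ideal.mul_top] at h
  · intro h
    rw [← b.linearCombination_repr x, Finsupp.linearCombination_apply]
    exact Submodule.sum_mem _ fun i _ => Submodule.smul_mem_smul (h i) trivial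

/-- Freeness lets vanishing in `R ⊗ X` be read off from coordinates. Cycles over `R` can thus be
treated as elements over `Q` whose differential is divisible by the kernel. -/
theorem mem_smul_top_of_one_tmul_eq_zero {R : Type*} [CommRing R] [Algebra Q R] {ι : Type*}
    (b : Basis ι Q X) {x : X} (hx : (1 : R) ⊗ₜ[Q] x = 0) :
    x ∈ (RingHom.ker (algebraMap Q R) • ⊤ : Submodule Q X) := by
  rw [mem_smul_top_iff_repr b]
  intro i
  have h := Basis.baseChange_repr_tmul R b (1 : R) x i
  rw [hx, map_zero, Finsupp.zero_apply, ← Algebra.algebraMap_eq_smul_one] at h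
  exact h.symm

theorem one_tmul_eq_zero_of_mem_smul_top {R : Type*} [CommRing R] [Algebra Q R] {x : X}
    (hx : x ∈ (RingHom.ker (algebraMap Q R) • ⊤ : Submodule Q X)) : (1 : R) ⊗ₜ[Q] x = 0 := by
  induction hx using Submodule.smul_induction_on' with
  | smul r hr y _ =>
    rw [← TensorProduct.smul_tmul, ← Algebra.algebraMap_eq_smul_one, (RingHom.mem_ker).1 hr,
      TensorProduct.zero_tmul]
  | add x _ y _ hx hy => rw [TensorProduct.tmul_add, hx, hy, add_zero]

end IdealSmul

/-! ### Eliminating the variables with the regular sequence -/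

section Cycles

variable {Q : Type*} [CommRing Q] {c : ℕ} {f : Fin c → Q} {X : Type*} [AddCommGroup X] [Module Q X]
  {G : Type*} [AddCommGroup G] [Module Q G] {D : X →ₗ[Q] X} {χ u : Fin c → X →ₗ[Q] X}
  {ι : G →ₗ[Q] X} {dG : G →ₗ[Q] G}

/-- The operators `1 - u_k χ_k` are composed over `S`. Each makes `χ_k` vanish, preserves the
vanishing of the other `χ_i`, and fixes elements already killed by `χ_k`. -/
theorem exists_projection (hχu : ∀ i x, χ i (u i x) = x)
    (hχu' : ∀ i k, i ≠ k → ∀ x, χ i (u k x) = u k (χ i x))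
    (hχχ : ∀ i k x, χ i (χ k x) = χ k (χ i x)) (S : Finset (Fin c)) :
    ∃ P : X →ₗ[Q] X, (∀ i ∈ S, ∀ x, χ i (P x) = 0) ∧ ∀ x, (∀ i ∈ S, χ i x = 0) → P x = x := by
  classical
  induction S using Finset.induction_on with
  | empty => exact ⟨LinearMap.id, by simp, fun x _ => rfl⟩
  | insert k S hk ih =>
    obtain ⟨P, h1, h2⟩ := ih
    refine ⟨(LinearMap.id - u k ∘ₗ χ k) ∘ₗ P, fun i hi x => ?_, fun x hx => ?_⟩
    · simp only [LinearMap.comp_apply, LinearMap.sub_apply, LinearMap.id_apply, map_sub]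
      rcases Finset.mem_insert.1 hi with rfl | hi'
      · rw [hχu, sub_self]
      · rw [hχu' _ _ (by rintro rfl; exact hk hi'), hχχ, h1 i hi', map_zero, map_zero, sub_zero]
    · simp only [LinearMap.comp_apply, LinearMap.sub_apply, LinearMap.id_apply]
      rw [h2 x fun i hi => hx i (Finset.mem_insert_of_mem hi), hx k (Finset.mem_insert_self _ _),
        map_zero, sub_zero]

/-- Any expression of `x` through the generators of the ideal can be pushed through the projection,
which fixes `x`. So the coefficient of `f j` may be taken to be killed by the later `χ_i` as well.
-/
theorem exists_of_mem_partialIdeal_succ (hχu : ∀ i x, χ i (u i x) = x)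
    (hχu' : ∀ i k, i ≠ k → ∀ x, χ i (u k x) = u k (χ i x))
    (hχχ : ∀ i k x, χ i (χ k x) = χ k (χ i x)) (j : Fin c) {x : X}
    (hx : x ∈ (partialIdeal f (j + 1) • ⊤ : Submodule Q X)) (h : ∀ i, j < i → χ i x = 0) :
    ∃ y w, x = f j • y + w ∧ w ∈ (partialIdeal f j • ⊤ : Submodule Q X) ∧ ∀ i, j < i → χ i y = 0 := by
  classical
  obtain ⟨P, h1, h2⟩ := exists_projection hχu hχu' hχχ (Finset.univ.filter (j < ·))
  simp only [Finset.mem_filter, Finset.mem_univ, true_and] at h1 h2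
  rw [partialIdeal_succ, Submodule.sup_smul, Submodule.mem_sup] at hx
  obtain ⟨w, hw, z, hz, rfl⟩ := hx
  rw [Submodule.ideal_span_singleton_smul] at hz
  obtain ⟨y, _, rfl⟩ := hz
  refine ⟨P y, P w, ?_, map_mem_smul_top P hw, fun i hi => h1 i hi y⟩
  rw [← h2 _ h, map_add, add_comm, DistribSMul.toLinearMap_apply, map_smul]

/-- An abstract form in which `D² = ∑ f_i χ_i` and each `χ_i` is split surjective. Induction on the
number of variables that `x` involves: `D² x` is computed modulo the earlier `f_i` in two ways, and
regularity of `f_j` lets `x` be changed by a boundary so that the variable `j` can be dropped. -/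
theorem exists_cycle_of_mem_smul_top (hχu : ∀ i x, χ i (u i x) = x)
    (hχu' : ∀ i k, i ≠ k → ∀ x, χ i (u k x) = u k (χ i x))
    (hχχ : ∀ i k x, χ i (χ k x) = χ k (χ i x)) (hDχ : ∀ i x, D (χ i x) = χ i (D x))
    (hDD : ∀ x, D (D x) = ∑ i, f i • χ i x) (hι : ∀ x, (∀ i, χ i x = 0) → ∃ g, x = ι g)
    (hDι : ∀ g, D (ι g) = ι (dG g)) (hι' : Function.Injective ι)
    (hreg : ∀ (j : Fin c) (x : X), f j • x ∈ (partialIdeal f j • ⊤ : Submodule Q X) →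
      x ∈ (partialIdeal f j • ⊤ : Submodule Q X)) (j : ℕ) (hj : j ≤ c) (x : X)
    (hx : ∀ i : Fin c, j ≤ i → χ i x = 0) (hDx : D x ∈ (partialIdeal f j • ⊤ : Submodule Q X)) :
    ∃ g z, dG g = 0 ∧ x - ι g - D z ∈ (partialIdeal f j • ⊤ : Submodule Q X) := by
  induction j generalizing x with
  | zero =>
    rw [partialIdeal_zero, Submodule.bot_smul, Submodule.mem_bot] at hDx
    obtain ⟨g, rfl⟩ := hι x fun i => hx i (Nat.zero_le _)
    refine ⟨g, 0, hι' ?_, by simp⟩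
    rw [← hDι, hDx, map_zero]
  | succ k ih =>
    have hk : k < c := hj
    set j : Fin c := ⟨k, hk⟩
    have hmono : (partialIdeal f k • ⊤ : Submodule Q X) ≤ partialIdeal f (k + 1) • ⊤ :=
      Submodule.smul_mono_left (partialIdeal_mono f (Nat.le_succ k))
    have hlt : ∀ i : Fin c, j < i → χ i x = 0 := fun i hi => hx i hi
    obtain ⟨y, w, hyw, hw, hy⟩ := exists_of_mem_partialIdeal_succ hχu hχu' hχχ j hDx
      fun i hi => by rw [← hDχ, hlt i hi, map_zero]
    -- Modulo the earlier elements only the term of index `j` survives in `D²`, since the later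
    -- `χ_i` kill `z`.
    have hsum : ∀ z, (∀ i, j < i → χ i z = 0) →
        D (D z) - f j • χ j z ∈ (partialIdeal f k • ⊤ : Submodule Q X) := by
      intro z hz
      rw [hDD, ← Finset.add_sum_erase _ _ (Finset.mem_univ j), add_sub_cancel_left]
      refine Submodule.sum_mem _ fun i hi => ?_
      rcases lt_or_gt_of_ne (Finset.ne_of_mem_erase hi) with h | h
      · exact Submodule.smul_mem_smul (mem_partialIdeal f h) trivial
      · rw [hz i h, smul_zero]
        exact zero_mem _
    -- `D² x` is congruent both to `f_j χ_j x` and to `f_j D y`, so `f_j` times the difference is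
    -- divisible by the earlier elements.
    have h1 : χ j x - D y ∈ (partialIdeal f k • ⊤ : Submodule Q X) := by
      refine hreg j _ ?_
      have h2 := hsum x hlt
      rw [hyw, map_add, map_smul] at h2
      have h3 : f j • (χ j x - D y) = D w - (f j • D y + D w - f j • χ j x) := by
        rw [smul_sub]; abel
      rw [h3]
      exact sub_mem (map_mem_smul_top D hw) h2
    have huy : ∀ i, j < i → χ i (u j y) = 0 := fun i hi => by
      rw [hχu' i j hi.ne', hy i hi, map_zero]
    -- This boundary corrects both defects: `χ_j x₁ = χ_j x - D y` is divisible by the earlier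
    -- elements, and `D² (u_j y)` cancels `f_j y` in `D x`.
    set x₁ := x - D (u j y) with hx₁
    have hx₁χ : χ j x₁ ∈ (partialIdeal f k • ⊤ : Submodule Q X) := by
      rw [hx₁, map_sub, ← hDχ, hχu]
      exact h1
    have hx₁' : ∀ i, j < i → χ i x₁ = 0 := fun i hi => by
      rw [hx₁, map_sub, ← hDχ, huy i hi, hlt i hi, map_zero, sub_zero]
    have hDx₁ : D x₁ ∈ (partialIdeal f k • ⊤ : Submodule Q X) := by
      have h2 := hsum (u j y) huy
      rw [hχu] at h2
      have h3 : D x₁ = w - (D (D (u j y)) - f j • y) := by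
        rw [hx₁, map_sub, hyw]; abel
      rw [h3]
      exact sub_mem hw h2
    have hdiff : u j (χ j x₁) ∈ (partialIdeal f k • ⊤ : Submodule Q X) := map_mem_smul_top _ hx₁χ
    -- Subtracting the divisible term `u_j χ_j x₁` makes `χ_j` vanish exactly and leaves an element
    -- to which the previous case applies.
    obtain ⟨g, z, hg, hz⟩ := ih hk.le (x₁ - u j (χ j x₁)) (fun i hi => by
        rw [map_sub]
        rcases eq_or_lt_of_le (show j ≤ i from hi) with rfl | hi
        · rw [hχu, sub_self]
        · rw [hχu' i j hi.ne', hχχ, hx₁' i hi, map_zero, map_zero, sub_zero])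
      (by rw [map_sub]; exact sub_mem hDx₁ (map_mem_smul_top D hdiff))
    refine ⟨g, u j y + z, hg, hmono ?_⟩
    have h4 : x - ι g - D (u j y + z) = (x₁ - u j (χ j x₁) - ι g - D z) + u j (χ j x₁) := by
      rw [hx₁, map_add]; abel
    rw [h4]
    exact add_mem hz hdiff

end Cycles

end AInfKoszul

end

noncomputable section

namespace AInfKoszul

open Module

/-! ### The twisted differential on a basis indexed by multi-exponents -/

section DividedBasis

variable {Q : Type*} [CommRing Q] {c : ℕ} {C : Type*} [AddCommGroup C] [Module Q C]
  (y : Basis (Fin c →₀ ℕ) Q C)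

/-- The operator lowering the `i`-th exponent of the basis elements. -/
def lowerExp (i : Fin c) : C →ₗ[Q] C :=
  y.constr Q fun α => if α i = 0 then 0 else y (α - Finsupp.single i 1)

/-- The operator raising the `i`-th exponent of the basis elements. -/
def raiseExp (i : Fin c) : C →ₗ[Q] C := y.constr Q fun α => y (α + Finsupp.single i 1)

theorem lowerExp_basis (i : Fin c) (α : Fin c →₀ ℕ) :
    lowerExp y i (y α) = if α i = 0 then 0 else y (α - Finsupp.single i 1) :=
  y.constr_basis Q _ α

theorem lowerExp_add (i : Fin c) (α : Fin c →₀ ℕ) :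
    lowerExp y i (y (α + Finsupp.single i 1)) = y α := by
  rw [lowerExp_basis, if_neg (by simp), add_tsub_cancel_right]

theorem raiseExp_basis (i : Fin c) (α : Fin c →₀ ℕ) :
    raiseExp y i (y α) = y (α + Finsupp.single i 1) := y.constr_basis Q _ α

theorem exists_eq_add_single {i : Fin c} {α : Fin c →₀ ℕ} (h : α i ≠ 0) :
    ∃ β, α = β + Finsupp.single i 1 :=
  ⟨α - Finsupp.single i 1, (tsub_add_cancel_of_le (by
    rw [Finsupp.single_le_iff]; exact Nat.one_le_iff_ne_zero.2 h)).symm⟩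

theorem lowerExp_comp_raiseExp (i : Fin c) : lowerExp y i ∘ₗ raiseExp y i = LinearMap.id :=
  y.ext fun α => by
    rw [LinearMap.comp_apply, raiseExp_basis, lowerExp_add, LinearMap.id_apply]

theorem lowerExp_comp_raiseExp_of_ne {i k : Fin c} (h : i ≠ k) :
    lowerExp y i ∘ₗ raiseExp y k = raiseExp y k ∘ₗ lowerExp y i := by
  refine y.ext fun α => ?_
  rw [LinearMap.comp_apply, LinearMap.comp_apply, raiseExp_basis, lowerExp_basis, lowerExp_basis]
  have h1 : (α + Finsupp.single k 1 : Fin c →₀ ℕ) i = α i := by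
    rw [Finsupp.add_apply, Finsupp.single_eq_of_ne h, add_zero]
  rw [h1]
  by_cases h0 : α i = 0
  · rw [if_pos h0, if_pos h0, map_zero]
  · obtain ⟨β, rfl⟩ := exists_eq_add_single h0
    rw [if_neg h0, if_neg h0, raiseExp_basis, add_right_comm, add_tsub_cancel_right,
      add_tsub_cancel_right]

theorem lowerExp_comm (i k : Fin c) :
    lowerExp y i ∘ₗ lowerExp y k = lowerExp y k ∘ₗ lowerExp y i := by
  by_cases hik : i = k
  · rw [hik]
  refine y.ext fun α => ?_
  rw [LinearMap.comp_apply, LinearMap.comp_apply]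
  have key : ∀ {i k : Fin c}, i ≠ k → α i = 0 → lowerExp y i (lowerExp y k (y α)) = 0 := by
    intro i k hik h0
    rw [lowerExp_basis]
    split_ifs
    · exact map_zero _
    · rw [lowerExp_basis, if_pos (by simp [h0])]
  by_cases h0 : α i = 0
  · rw [key hik h0, lowerExp_basis, if_pos h0, map_zero]
  by_cases h1 : α k = 0
  · rw [key (Ne.symm hik) h1, lowerExp_basis, if_pos h1, map_zero]
  obtain ⟨β, rfl⟩ := exists_eq_add_single h0
  have h2 : β k ≠ 0 := by
    rwa [Finsupp.add_apply, Finsupp.single_eq_of_ne (Ne.symm hik), add_zero] at h1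
  obtain ⟨δ, rfl⟩ := exists_eq_add_single h2
  rw [lowerExp_add, lowerExp_add, add_right_comm, lowerExp_add, lowerExp_add]

variable {G : Type*} [AddCommGroup G] [Module Q G]

theorem tensorProduct_ext_basis {Y : Type*} [AddCommGroup Y] [Module Q Y]
    {T T' : C ⊗[Q] G →ₗ[Q] Y} (h : ∀ α g, T (y α ⊗ₜ g) = T' (y α ⊗ₜ g)) : T = T' :=
  TensorProduct.ext (y.ext fun α => LinearMap.ext fun g => h α g)

theorem coord_lowerExp (i : Fin c) (x : C ⊗[Q] G) (α : Fin c →₀ ℕ) :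
    TensorProduct.equivFinsuppOfBasisLeft y ((lowerExp y i).rTensor G x) α
      = TensorProduct.equivFinsuppOfBasisLeft y x (α + Finsupp.single i 1) := by
  have : Finsupp.lapply α ∘ₗ (TensorProduct.equivFinsuppOfBasisLeft y).toLinearMap ∘ₗ
      (lowerExp y i).rTensor G = (Finsupp.lapply (α + Finsupp.single i 1) : _ →ₗ[Q] G) ∘ₗ
        (TensorProduct.equivFinsuppOfBasisLeft y).toLinearMap := by
    refine tensorProduct_ext_basis y fun β g => ?_
    simp only [LinearMap.comp_apply, LinearMap.rTensor_tmul, Finsupp.lapply_apply,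
      LinearEquiv.coe_coe, TensorProduct.equivFinsuppOfBasisLeft_apply_tmul_apply]
    by_cases h : β i = 0
    · rw [lowerExp_basis, if_pos h, map_zero, Finsupp.zero_apply, zero_smul, Basis.repr_self,
        Finsupp.single_eq_of_ne, zero_smul]
      rintro rfl
      simp at h
    · obtain ⟨δ, rfl⟩ := exists_eq_add_single h
      rw [lowerExp_add, Basis.repr_self, Basis.repr_self, Finsupp.single_apply, Finsupp.single_apply]
      simp
  exact LinearMap.congr_fun this x

/-- The coordinate of `x` at `β + 1_i` is the coordinate of the lowered element at `β`, so only the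
coordinate at zero can survive. -/
theorem eq_tmul_of_lowerExp_eq_zero {x : C ⊗[Q] G} (hx : ∀ i, (lowerExp y i).rTensor G x = 0) :
    ∃ g, x = y 0 ⊗ₜ g := by
  refine ⟨TensorProduct.equivFinsuppOfBasisLeft y x 0,
    (TensorProduct.equivFinsuppOfBasisLeft y).injective (Finsupp.ext fun α => ?_)⟩
  rw [TensorProduct.equivFinsuppOfBasisLeft_apply_tmul_apply, Basis.repr_self]
  by_cases h : α = 0
  · subst h
    rw [Finsupp.single_eq_same, one_smul]
  · rw [Finsupp.single_eq_of_ne h, zero_smul]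
    obtain ⟨i, hi⟩ : ∃ i, α i ≠ 0 := by
      by_contra! h'
      exact h (Finsupp.ext h')
    obtain ⟨β, rfl⟩ := exists_eq_add_single hi
    rw [← coord_lowerExp, hx, map_zero, Finsupp.zero_apply]

theorem tmul_injective (α : Fin c →₀ ℕ) :
    Function.Injective (TensorProduct.mk Q C G (y α)) := by
  intro g g' h
  have := congrArg (fun z => TensorProduct.equivFinsuppOfBasisLeft y z α) h
  simpa [TensorProduct.equivFinsuppOfBasisLeft_apply_tmul_apply] using this

section Differential

variable {σ : (Fin c →₀ ℕ) → G →ₗ[Q] G} {D : C ⊗[Q] G →ₗ[Q] C ⊗[Q] G}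

theorem sum_antidiagonal_lowerExp {Y : Type*} [AddCommGroup Y] (F : C →+ (Fin c →₀ ℕ) → Y)
    (i : Fin c) (α : Fin c →₀ ℕ) :
    ∑ p ∈ Finset.HasAntidiagonal.antidiagonal (α + Finsupp.single i 1), F (lowerExp y i (y p.1)) p.2
      = ∑ p ∈ Finset.HasAntidiagonal.antidiagonal α, F (y p.1) p.2 := by
  classical
  have h1 : ∑ p ∈ Finset.HasAntidiagonal.antidiagonal (α + Finsupp.single i 1),
      F (lowerExp y i (y p.1)) p.2 = ∑ p ∈ (Finset.HasAntidiagonal.antidiagonal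
        (α + Finsupp.single i 1)).filter (fun p : (Fin c →₀ ℕ) × (Fin c →₀ ℕ) => p.1 i ≠ 0), F (lowerExp y i (y p.1)) p.2 := by
    rw [Finset.sum_filter]
    refine Finset.sum_congr rfl fun p _ => ?_
    split_ifs with h
    · rfl
    · rw [not_not] at h
      rw [lowerExp_basis, if_pos h, map_zero, Pi.zero_apply]
  rw [h1]
  symm
  refine Finset.sum_nbij' (fun p => (p.1 + Finsupp.single i 1, p.2))
    (fun p => (p.1 - Finsupp.single i 1, p.2)) (fun p hp => ?_) (fun p hp => ?_) (fun p hp => ?_)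
    (fun p hp => ?_) (fun p hp => ?_)
  · rw [Finset.HasAntidiagonal.mem_antidiagonal] at hp
    rw [Finset.mem_filter, Finset.HasAntidiagonal.mem_antidiagonal, ← hp]
    exact ⟨add_right_comm _ _ _, by simp⟩
  · rw [Finset.mem_filter, Finset.HasAntidiagonal.mem_antidiagonal] at hp
    obtain ⟨β, hβ⟩ := exists_eq_add_single hp.2
    rw [Finset.HasAntidiagonal.mem_antidiagonal]
    simp only [hβ, add_tsub_cancel_right]
    have := hp.1
    rw [hβ, add_right_comm] at this
    exact add_right_cancel this
  · simp
  · rw [Finset.mem_filter] at hp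
    obtain ⟨β, hβ⟩ := exists_eq_add_single hp.2
    refine Prod.ext ?_ rfl
    simp only [hβ, add_tsub_cancel_right]
  · rw [lowerExp_add]

/-- Decompositions of `α + 1_i` whose first part contains `i` are, after lowering that part, the
decompositions of `α`; the others are killed. -/
theorem lowerExp_comm_differential
    (hD : ∀ α g, D (y α ⊗ₜ g) = ∑ p ∈ Finset.HasAntidiagonal.antidiagonal α, y p.1 ⊗ₜ σ p.2 g)
    (i : Fin c) :
    D ∘ₗ (lowerExp y i).rTensor G = (lowerExp y i).rTensor G ∘ₗ D := by
  refine tensorProduct_ext_basis y fun α g => ?_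
  simp only [LinearMap.comp_apply, LinearMap.rTensor_tmul, hD, map_sum]
  by_cases h : α i = 0
  · rw [lowerExp_basis, if_pos h, TensorProduct.zero_tmul, map_zero]
    refine (Finset.sum_eq_zero fun p hp => ?_).symm
    rw [Finset.HasAntidiagonal.mem_antidiagonal] at hp
    have : p.1 i = 0 := by
      have := DFunLike.congr_fun hp i
      rw [Finsupp.add_apply, h] at this
      omega
    rw [lowerExp_basis, if_pos this, TensorProduct.zero_tmul]
  · obtain ⟨β, rfl⟩ := exists_eq_add_single h
    rw [lowerExp_add, hD]
    exact (sum_antidiagonal_lowerExp y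
      (AddMonoidHom.mk' (fun x δ => x ⊗ₜ[Q] σ δ g) fun x x' => funext fun δ =>
        TensorProduct.add_tmul x x' _) i β).symm

theorem differential_differential
    (hD : ∀ α g, D (y α ⊗ₜ g) = ∑ p ∈ Finset.HasAntidiagonal.antidiagonal α, y p.1 ⊗ₜ σ p.2 g)
    {h : (Fin c →₀ ℕ) → Q}
    (hσ : ∀ α, ∑ p ∈ Finset.HasAntidiagonal.antidiagonal α, σ p.1 ∘ₗ σ p.2 = h α • LinearMap.id)
    (α : Fin c →₀ ℕ) (g : G) :
    D (D (y α ⊗ₜ g)) = ∑ p ∈ Finset.HasAntidiagonal.antidiagonal α, h p.2 • (y p.1 ⊗ₜ[Q] g) := by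
  simp only [hD, map_sum]
  rw [sum_antidiagonal_assoc α fun β β' β'' => y β ⊗ₜ[Q] σ β' (σ β'' g)]
  refine Finset.sum_congr rfl fun p _ => ?_
  rw [← TensorProduct.tmul_sum, ← TensorProduct.tmul_smul]
  congr 1
  have := LinearMap.congr_fun (hσ p.2) g
  rwa [LinearMap.sum_apply] at this

/-- Reassociating the double decomposition puts the sums `∑ σ σ` next to a basis element. By the
homotopy relations these are `f_i` at `1_i` and zero elsewhere, so the square lowers one exponent
and multiplies by `f_i`. -/
theorem differential_differential_eq_sum
    (hD : ∀ α g, D (y α ⊗ₜ g) = ∑ p ∈ Finset.HasAntidiagonal.antidiagonal α, y p.1 ⊗ₜ σ p.2 g)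
    {f : Fin c → Q} (h0 : σ 0 ∘ₗ σ 0 = 0)
    (h1 : ∀ i, σ 0 ∘ₗ σ (Finsupp.single i 1) + σ (Finsupp.single i 1) ∘ₗ σ 0 = f i • LinearMap.id)
    (h2 : ∀ α : Fin c →₀ ℕ, 1 < α.degree →
      ∑ p ∈ Finset.HasAntidiagonal.antidiagonal α, σ p.1 ∘ₗ σ p.2 = 0) (x : C ⊗[Q] G) :
    D (D x) = ∑ i, f i • (lowerExp y i).rTensor G x := by
  classical
  have hσ : ∀ α : Fin c →₀ ℕ, ∑ p ∈ Finset.HasAntidiagonal.antidiagonal α, σ p.1 ∘ₗ σ p.2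
      = (∑ i, if α = Finsupp.single i 1 then f i else 0) • LinearMap.id := by
    intro α
    rcases Nat.lt_or_ge 1 α.degree with h | h
    · rw [h2 α h, Finset.sum_eq_zero, zero_smul]
      intro i _
      rw [if_neg]
      rintro rfl
      rw [Finsupp.degree_single] at h
      omega
    · rcases Nat.lt_or_ge 0 α.degree with h' | h'
      · obtain ⟨l, rfl⟩ := content_surjective α
        rw [degree_content] at h h'
        obtain ⟨i, rfl⟩ := List.length_eq_one_iff.1 (le_antisymm h h')
        rw [content_cons, content_nil, add_zero]
        rw [Finset.sum_eq_single i]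
        · rw [if_pos rfl, ← h1 i, Finsupp.antidiagonal_single, Finset.Nat.antidiagonal_succ]
          simp
        · intro k _ hk
          rw [if_neg]
          intro h3
          exact hk ((Finsupp.single_left_inj one_ne_zero).1 h3).symm
        · simp
      · obtain rfl := (Finsupp.degree_eq_zero_iff α).1 (by omega)
        rw [Finsupp.antidiagonal_zero, Finset.sum_singleton, h0, Finset.sum_eq_zero, zero_smul]
        intro i _
        rw [if_neg]
        intro h3
        have := DFunLike.congr_fun h3 i
        simp at this
  have key : D ∘ₗ D = ∑ i, f i • (lowerExp y i).rTensor G := by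
    refine tensorProduct_ext_basis y fun α g => ?_
    rw [LinearMap.comp_apply, differential_differential y hD hσ, LinearMap.sum_apply]
    simp only [Finset.sum_smul]
    rw [Finset.sum_comm]
    refine Finset.sum_congr rfl fun i _ => ?_
    rw [LinearMap.smul_apply, LinearMap.rTensor_tmul]
    by_cases h : α i = 0
    · rw [lowerExp_basis, if_pos h, TensorProduct.zero_tmul, smul_zero]
      refine Finset.sum_eq_zero fun p hp => ?_
      rw [if_neg, zero_smul]
      intro h3
      rw [Finset.HasAntidiagonal.mem_antidiagonal] at hp
      have := DFunLike.congr_fun hp i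
      rw [Finsupp.add_apply, h3, Finsupp.single_eq_same, h] at this
      omega
    · obtain ⟨β, rfl⟩ := exists_eq_add_single h
      rw [lowerExp_add]
      refine (Finset.sum_eq_single (β, Finsupp.single i 1) (fun p hp hne => ?_)
        (fun hp => ?_)).trans ?_
      · rw [if_neg, zero_smul]
        intro h3
        rw [Finset.HasAntidiagonal.mem_antidiagonal, h3] at hp
        exact hne (Prod.ext (add_right_cancel hp) h3)
      · rw [Finset.HasAntidiagonal.mem_antidiagonal] at hp
        exact absurd rfl hp
      · rw [if_pos rfl]
  have := LinearMap.congr_fun key x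
  rwa [LinearMap.comp_apply, LinearMap.sum_apply] at this

end Differential

end DividedBasis

end AInfKoszul

end

noncomputable section

namespace AInfKoszul

open Module

/-! ### Homogeneous bases of the resolutions -/

section Grading

variable {Q : Type*} [CommRing Q] {C : Type*} [AddCommGroup C] [Module Q C]
  {G : Type*} [AddCommGroup G] [Module Q G] {I J : Type*}

theorem tensDeg_eq_span (y : Basis I Q C) (b : Basis J Q G) {degC : ℤ → Submodule Q C}
    {degG : ℤ → Submodule Q G} {ε : I → ℤ} {δ : J → ℤ}
    (hC : ∀ n, degC n = Submodule.span Q (y '' {i | ε i = n}))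
    (hG : ∀ n, degG n = Submodule.span Q (b '' {j | δ j = n})) (n : ℤ) :
    tensDeg degC degG n
      = Submodule.span Q (y.tensorProduct b '' {p | ε p.1 + δ p.2 = n}) := by
  rw [tensDeg]
  simp only [hC, hG, Submodule.map₂_span_span]
  rw [← Submodule.span_iUnion]
  congr 1
  ext x
  simp only [Set.mem_iUnion, Set.mem_image2, Set.mem_image, Set.mem_ofPred_eq]
  constructor
  · rintro ⟨p, _, ⟨i, hi, rfl⟩, _, ⟨j, hj, rfl⟩, rfl⟩
    exact ⟨(i, j), by simp only; omega, Basis.tensorProduct_apply _ _ _ _⟩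
  · rintro ⟨⟨i, j⟩, hij, rfl⟩
    refine ⟨ε i, y i, ⟨i, rfl, rfl⟩, b j, ⟨j, ?_, rfl⟩, (Basis.tensorProduct_apply _ _ _ _).symm⟩
    simp only at hij
    omega

theorem resDeg_eq_span (R : Type*) [CommRing R] [Algebra Q R] (y : Basis I Q C) (b : Basis J Q G)
    {degC : ℤ → Submodule Q C} {degG : ℤ → Submodule Q G} {ε : I → ℤ} {δ : J → ℤ}
    (hC : ∀ n, degC n = Submodule.span Q (y '' {i | ε i = n}))
    (hG : ∀ n, degG n = Submodule.span Q (b '' {j | δ j = n})) (n : ℤ) :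
    resDeg R degC degG n
      = Submodule.span R ((y.tensorProduct b).baseChange R '' {p | ε p.1 + δ p.2 = n}) := by
  rw [resDeg, tensDeg_eq_span y b hC hG, Submodule.baseChange_span, ← Set.image_comp]
  congr 1
  refine Set.image_congr fun p _ => ?_
  rw [Function.comp_apply, Basis.baseChange_apply, TensorProduct.mk_apply]

theorem resAug_tmul (R : Type*) [CommRing R] [Algebra Q R] {M : Type*} [AddCommGroup M] [Module Q M]
    [Module R M] [IsScalarTower Q R M] (η : C →ₗ[Q] Q) (γ : G →ₗ[Q] M) (r : R) (x : C) (g : G) :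
    resAug R η γ (r ⊗ₜ (x ⊗ₜ g)) = r • η x • γ g := by
  simp [resAug]

end Grading

/-! ### The Eisenbud–Shamash resolution for any such basis -/

section Shamash

variable {Q : Type*} [CommRing Q] {R : Type*} [CommRing R] [Algebra Q R] {c : ℕ}
  {f : Fin c → Q} {C : Type*} [AddCommGroup C] [Module Q C]
  (y : Basis (Fin c →₀ ℕ) Q C) {degC : ℤ → Submodule Q C} {η : C →ₗ[Q] Q}
  {M : Type*} [AddCommGroup M] [Module Q M] [Module R M] [IsScalarTower Q R M]
  {degM : ℤ → Submodule R M} {dM : M →ₗ[R] M}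
  {G : Type*} [AddCommGroup G] [Module Q G] {degG : ℤ → Submodule Q G} {dG : G →ₗ[Q] G}
  {γ : G →ₗ[Q] M} {σ : (Fin c →₀ ℕ) → G →ₗ[Q] G} {D : C ⊗[Q] G →ₗ[Q] C ⊗[Q] G}

theorem exists_cycle_of_mem_smul_ker
    (hreg : RingTheory.Sequence.IsRegular Q (List.ofFn f))
    {J : Type*} (b : Basis J Q G)
    (hD : ∀ α g, D (y α ⊗ₜ g) = ∑ p ∈ Finset.HasAntidiagonal.antidiagonal α, y p.1 ⊗ₜ σ p.2 g)
    (h0 : σ 0 ∘ₗ σ 0 = 0)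
    (h1 : ∀ i, σ 0 ∘ₗ σ (Finsupp.single i 1) + σ (Finsupp.single i 1) ∘ₗ σ 0 = f i • LinearMap.id)
    (h2 : ∀ α : Fin c →₀ ℕ, 1 < α.degree →
      ∑ p ∈ Finset.HasAntidiagonal.antidiagonal α, σ p.1 ∘ₗ σ p.2 = 0) {x : C ⊗[Q] G}
    (hx : D x ∈ (Ideal.span (Set.range f) • ⊤ : Submodule Q (C ⊗[Q] G))) :
    ∃ g z, σ 0 g = 0 ∧
      x - y 0 ⊗ₜ g - D z ∈ (Ideal.span (Set.range f) • ⊤ : Submodule Q (C ⊗[Q] G)) := by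
  rw [← partialIdeal_top] at hx ⊢
  refine exists_cycle_of_mem_smul_top (ι := TensorProduct.mk Q C G (y 0))
    (χ := fun i => (lowerExp y i).rTensor G) (u := fun i => (raiseExp y i).rTensor G)
    (fun i x => ?_) (fun i k hik x => ?_) (fun i k x => ?_) (fun i x => ?_)
    (differential_differential_eq_sum y hD h0 h1 h2) (fun x => eq_tmul_of_lowerExp_eq_zero y)
    (fun g => ?_) (tmul_injective y 0) (fun j x hjx => ?_) c le_rfl x (fun i hi => ?_) hx
  · rw [← LinearMap.comp_apply, ← LinearMap.rTensor_comp, lowerExp_comp_raiseExp,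
      LinearMap.rTensor_id, LinearMap.id_apply]
  · rw [← LinearMap.comp_apply, ← LinearMap.rTensor_comp, lowerExp_comp_raiseExp_of_ne y hik,
      LinearMap.rTensor_comp, LinearMap.comp_apply]
  · rw [← LinearMap.comp_apply, ← LinearMap.rTensor_comp, lowerExp_comm,
      LinearMap.rTensor_comp, LinearMap.comp_apply]
  · exact LinearMap.congr_fun (lowerExp_comm_differential y hD i) x
  · rw [TensorProduct.mk_apply, TensorProduct.mk_apply, hD, Finsupp.antidiagonal_zero,
      Finset.sum_singleton]
  · rw [mem_smul_top_iff_repr (y.tensorProduct b)] at hjx ⊢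
    intro i
    refine mem_partialIdeal_of_mul hreg j ?_
    have := hjx i
    rwa [map_smul, Finsupp.smul_apply, smul_eq_mul] at this
  · exact absurd i.2 (by omega)

/-- The square vanishes over `R` because it is a combination of the `f_i`. Semifreeness comes from a
lexicographic order on the basis of `C ⊗ G`. -/
theorem isSemifree_shamash (hf : RingHom.ker (algebraMap Q R) = Ideal.span (Set.range f))
    (hdegC : ∀ n, degC n = Submodule.span Q (y '' {α | 2 * (α.degree : ℤ) = n}))
    (hD : ∀ α g, D (y α ⊗ₜ g) = ∑ p ∈ Finset.HasAntidiagonal.antidiagonal α, y p.1 ⊗ₜ σ p.2 g)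
    {N : Type*} [AddCommGroup N] [Module Q N] {γ : G →ₗ[Q] N}
    (hG : IsSemifree degG dG) (hσ : IsSystemOfHigherHomotopies f degG dG γ σ) :
    IsSemifree (resDeg R degC degG) (D.baseChange R) := by
  obtain ⟨I, b, rank, δ, hb, hrank⟩ := hG.exists_basis
  have hdegG := eq_span_of_basis b δ degG hG.internal hb
  have hspan := resDeg_eq_span R y b hdegC hdegG
  set B := (y.tensorProduct b).baseChange R with hB
  have hBapp : ∀ p, B p = 1 ⊗ₜ (y p.1 ⊗ₜ b p.2) := fun p => by
    rw [hB, Basis.baseChange_apply, Basis.tensorProduct_apply']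
  have hDB : ∀ p, D.baseChange R (B p) = ∑ q ∈ Finset.HasAntidiagonal.antidiagonal p.1,
      1 ⊗ₜ (y q.1 ⊗ₜ σ q.2 (b p.2)) := fun p => by
    rw [hBapp, LinearMap.baseChange_tmul, hD, TensorProduct.tmul_sum]
  have hmem : ∀ {α : Fin c →₀ ℕ} {n : ℤ} {g : G}, g ∈ degG n →
      (1 : R) ⊗ₜ[Q] (y α ⊗ₜ[Q] g) ∈ resDeg R degC degG (2 * (α.degree : ℤ) + n) := by
    intro α n g hg
    refine Submodule.tmul_mem_baseChange_of_mem 1 (Submodule.mem_iSup_of_mem (2 * (α.degree : ℤ)) ?_)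
    rw [add_sub_cancel_left]
    refine Submodule.apply_mem_map₂ _ ?_ hg
    rw [hdegC]
    exact Submodule.subset_span ⟨α, rfl, rfl⟩
  -- A term with nontrivial homotopy lowers the degree of the multi-exponent, possibly raising the
  -- rank in `G`; the term with `σ 0` keeps the exponent and lowers the rank.
  refine isSemifree_of_basis (r := InvImage (Prod.Lex (· < ·) (· < ·))
    fun p : (Fin c →₀ ℕ) × I => (p.1.degree, rank p.2)) ⟨?_, ?_, ?_⟩ B
    (fun p => ⟨2 * (p.1.degree : ℤ) + δ p.2, by rw [hBapp]; exact hmem (hb _)⟩)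
    (InvImage.wf _ (WellFounded.prod_lex Nat.lt_wfRel.wf Nat.lt_wfRel.wf)) (fun p => ?_)
  · exact internal_of_basis B _ _ hspan
  · intro n x hx
    rw [hspan] at hx
    induction hx using Submodule.span_induction with
    | mem x hx =>
      obtain ⟨p, hp, rfl⟩ := hx
      rw [hDB]
      refine Submodule.sum_mem _ fun q hq => ?_
      rw [Finset.HasAntidiagonal.mem_antidiagonal] at hq
      have h := hmem (α := q.1) (hσ.degree q.2 _ _ (hb p.2))
      convert h using 2
      rw [← hp, ← Finsupp.degree_eq_sum, ← hq, map_add]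
      push_cast
      ring
    | zero => rw [map_zero]; exact zero_mem _
    | add x y _ _ hx hy => rw [map_add]; exact add_mem hx hy
    | smul r x _ hx => rw [map_smul]; exact Submodule.smul_mem _ _ hx
  · intro x
    have h0 : σ 0 ∘ₗ σ 0 = 0 := by
      rw [hσ.zero]; exact LinearMap.ext hG.d_d
    have : D.baseChange R ∘ₗ D.baseChange R = 0 := by
      refine B.ext fun p => ?_
      rw [hBapp, LinearMap.comp_apply, LinearMap.baseChange_tmul, LinearMap.baseChange_tmul,
        differential_differential_eq_sum y hD h0 hσ.single
          (fun α hα => hσ.higher α (by rwa [← Finsupp.degree_eq_sum]))]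
      refine one_tmul_eq_zero_of_mem_smul_top (Submodule.sum_mem _ fun i _ => ?_)
      refine Submodule.smul_mem_smul ?_ trivial
      rw [hf]
      exact Ideal.subset_span ⟨i, rfl⟩
    exact LinearMap.congr_fun this x
  · rw [hDB]
    refine Submodule.sum_mem _ fun q hq => ?_
    rw [Finset.HasAntidiagonal.mem_antidiagonal] at hq
    have hsp : ∀ (s : Set I) (g : G), g ∈ Submodule.span Q (b '' s) →
        (1 : R) ⊗ₜ[Q] (y q.1 ⊗ₜ[Q] g) ∈ Submodule.span R (B '' ((fun i => (q.1, i)) '' s)) := by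
      intro s g hg
      induction hg using Submodule.span_induction with
      | mem x hx =>
        obtain ⟨i, hi, rfl⟩ := hx
        exact Submodule.subset_span ⟨(q.1, i), ⟨i, hi, rfl⟩, hBapp _⟩
      | zero => rw [TensorProduct.tmul_zero, TensorProduct.tmul_zero]; exact zero_mem _
      | add x y _ _ hx hy =>
        rw [TensorProduct.tmul_add, TensorProduct.tmul_add]; exact add_mem hx hy
      | smul r x _ hx =>
        rw [TensorProduct.tmul_smul, TensorProduct.tmul_smul, ← algebraMap_smul R r]
        exact Submodule.smul_mem _ _ hx
    by_cases h : q.2 = 0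
    · have h1 : q.1 = p.1 := by rw [← hq, h, add_zero]
      rw [h, hσ.zero]
      refine Submodule.span_mono (Set.image_mono ?_) (hsp _ _ (hrank p.2))
      rintro _ ⟨i, hi, rfl⟩
      show Prod.Lex _ _ _ _
      simp only [h1]
      exact Prod.Lex.right _ hi
    · refine Submodule.span_mono (Set.image_mono ?_) (hsp Set.univ _ (by
        rw [Set.image_univ, b.span_eq]; trivial))
      rintro _ ⟨i, _, rfl⟩
      refine Prod.Lex.left _ _ ?_
      have h2 : q.2.degree ≠ 0 := fun h' => h ((Finsupp.degree_eq_zero_iff _).1 h')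
      simp only
      rw [← hq, map_add]
      omega

/-- Stated for an arbitrary basis indexed by multi-exponents, so that it applies both to the
symmetric tensors and to the graded dual. Surjectivity, in homology too, is seen on `y 0 ⊗ G`;
injectivity in homology is `exists_cycle_of_mem_smul_ker`. -/
theorem isSemifreeResolution_shamash (hφ : Function.Surjective (algebraMap Q R))
    (hreg : RingTheory.Sequence.IsRegular Q (List.ofFn f))
    (hf : RingHom.ker (algebraMap Q R) = Ideal.span (Set.range f))
    (hdegC : ∀ n, degC n = Submodule.span Q (y '' {α | 2 * (α.degree : ℤ) = n}))
    (hη : ∀ α, η (y α) = if α = 0 then 1 else 0)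
    (hD : ∀ α g, D (y α ⊗ₜ g) = ∑ p ∈ Finset.HasAntidiagonal.antidiagonal α, y p.1 ⊗ₜ σ p.2 g)
    (hγ : IsSemifreeResolution degG dG (fun i => (degM i).restrictScalars Q)
      (dM.restrictScalars Q) γ)
    (hσ : IsSystemOfHigherHomotopies f degG dG γ σ) :
    IsSemifreeResolution (resDeg R degC degG) (D.baseChange R) degM dM (resAug R η γ) := by
  have haug : ∀ r α g, resAug R η γ (r ⊗ₜ (y α ⊗ₜ g)) = if α = 0 then r • γ g else 0 := by
    intro r α g
    rw [resAug_tmul, hη]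
    split_ifs
    · rw [one_smul]
    · rw [zero_smul, smul_zero]
  have hD0 : ∀ g, D (y 0 ⊗ₜ g) = y 0 ⊗ₜ dG g := fun g => by
    rw [hD, Finsupp.antidiagonal_zero, Finset.sum_singleton, hσ.zero]
  have hcomm : ∀ x, resAug R η γ (D.baseChange R x) = dM (resAug R η γ x) := by
    have : (resAug R η γ ∘ₗ D.baseChange R).restrictScalars Q
        = (dM ∘ₗ resAug R η γ).restrictScalars Q := by
      refine TensorProduct.ext (LinearMap.ext fun r => tensorProduct_ext_basis y fun α g => ?_)
      show resAug R η γ (D.baseChange R (r ⊗ₜ (y α ⊗ₜ g))) = dM (resAug R η γ (r ⊗ₜ (y α ⊗ₜ g)))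
      rw [LinearMap.baseChange_tmul, hD, TensorProduct.tmul_sum, map_sum, haug,
        Finset.sum_eq_single (0, α)]
      · rw [haug, if_pos rfl]
        by_cases h : α = 0
        · rw [if_pos h, h, hσ.zero, map_smul, hγ.comm]
          rfl
        · have h2 : α.degree ≠ 0 := fun h' => h ((Finsupp.degree_eq_zero_iff _).1 h')
          have h3 := LinearMap.congr_fun (hσ.aug α (by rw [← Finsupp.degree_eq_sum]; omega)) g
          rw [LinearMap.comp_apply, LinearMap.zero_apply] at h3
          rw [if_neg h, h3, smul_zero, map_zero]
      · intro q hq hne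
        rw [haug, if_neg]
        intro h
        rw [Finset.HasAntidiagonal.mem_antidiagonal, h, zero_add] at hq
        exact hne (Prod.ext h hq)
      · intro h
        rw [Finset.HasAntidiagonal.mem_antidiagonal, zero_add] at h
        exact absurd rfl h
    exact fun x => LinearMap.congr_fun this x
  obtain ⟨I, b, rank, δ, hb, hrank⟩ := hγ.semifree.exists_basis
  have hdegG := eq_span_of_basis b δ degG hγ.semifree.internal hb
  have hspan := resDeg_eq_span R y b hdegC hdegG
  refine ⟨isSemifree_shamash y hf hdegC hD hγ.semifree hσ, ?_, hcomm, fun m => ?_, ?_, ?_⟩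
  · intro n x hx
    rw [hspan] at hx
    induction hx using Submodule.span_induction with
    | mem x hx =>
      obtain ⟨p, hp, rfl⟩ := hx
      rw [Basis.baseChange_apply, Basis.tensorProduct_apply', haug]
      split_ifs with h
      · rw [one_smul]
        have h1 : δ p.2 = n := by
          rw [← hp, h]; simp
        rw [← h1]
        exact hγ.mem (hb p.2)
      · exact zero_mem _
    | zero => rw [map_zero]; exact zero_mem _
    | add x y _ _ hx hy => rw [map_add]; exact add_mem hx hy
    | smul r x _ hx => rw [map_smul]; exact Submodule.smul_mem _ _ hx
  · obtain ⟨g, rfl⟩ := hγ.surjective m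
    exact ⟨1 ⊗ₜ (y 0 ⊗ₜ g), by rw [haug, if_pos rfl, one_smul]⟩
  · rintro x hx ⟨m, hm⟩
    -- A cycle over `R` lifts to `C ⊗ G`; its differential there is divisible by the ideal of the
    -- `f_i`.
    obtain ⟨x, rfl⟩ := TensorProduct.mk_surjective Q (C ⊗[Q] G) R hφ x
    rw [TensorProduct.mk_apply] at hx hm ⊢
    rw [LinearMap.baseChange_tmul] at hx
    have hx' := mem_smul_top_of_one_tmul_eq_zero (y.tensorProduct b) hx
    rw [hf] at hx'
    have h0 : σ 0 ∘ₗ σ 0 = 0 := by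
      rw [hσ.zero]; exact LinearMap.ext hγ.semifree.d_d
    obtain ⟨g, z, hg, hz⟩ := exists_cycle_of_mem_smul_ker y hreg b hD h0 hσ.single
      (fun α hα => hσ.higher α (by rwa [← Finsupp.degree_eq_sum])) hx'
    rw [hσ.zero] at hg
    rw [← hf] at hz
    have hz' := one_tmul_eq_zero_of_mem_smul_top hz
    rw [TensorProduct.tmul_sub, TensorProduct.tmul_sub, sub_sub, sub_eq_zero] at hz'
    -- The cycle is homologous to `y 0 ⊗ g`, whose image `γ g` is therefore a boundary in `M`. As
    -- `γ` is injective in homology, `g` is itself a boundary.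
    have hg' : ∃ m, γ g = dM m := by
      refine ⟨m - resAug R η γ (1 ⊗ₜ z), ?_⟩
      rw [map_sub, ← hm, hz', map_add, haug, if_pos rfl, one_smul, ← hcomm,
        LinearMap.baseChange_tmul, add_sub_cancel_right]
    obtain ⟨g', rfl⟩ := hγ.quasiIso.1 g hg hg'
    refine ⟨1 ⊗ₜ (y 0 ⊗ₜ g') + 1 ⊗ₜ z, ?_⟩
    rw [hz', map_add, LinearMap.baseChange_tmul, LinearMap.baseChange_tmul, hD0]
  · intro m hm
    obtain ⟨g, hg, z, hz⟩ := hγ.quasiIso.2 m hm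
    refine ⟨1 ⊗ₜ (y 0 ⊗ₜ g), ?_, z, ?_⟩
    · rw [LinearMap.baseChange_tmul, hD0, hg, TensorProduct.tmul_zero, TensorProduct.tmul_zero]
    · rw [haug, if_pos rfl, one_smul]
      exact hz

end Shamash

end AInfKoszul

end

noncomputable section

namespace AInfKoszul

open Module

/-! ### The graded dual of the polynomial ring -/

section DualBasis

variable {Q : Type u} [CommRing Q] {c : ℕ}

theorem GradedDual.ext_monomial {φ ψ : GradedDual Q c}
    (h : ∀ α, φ.form (MvPolynomial.monomial α 1) = ψ.form (MvPolynomial.monomial α 1)) : φ = ψ :=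
  GradedDual.form_injective (MvPolynomial.basisMonomials (Fin c) Q |>.ext fun α => h α)

theorem dualMonomial_form (α : Fin c →₀ ℕ) (p : MvPolynomial (Fin c) Q) :
    (dualMonomial Q α).form p = p.coeff α := rfl

theorem gradedDual_finite (φ : GradedDual Q c) :
    {α : Fin c →₀ ℕ | φ.form (MvPolynomial.monomial α 1) ≠ 0}.Finite := by
  refine (chiAct_finite φ).subset fun α hα h => hα ?_
  have := chiAct_apply α φ 1
  rw [h, mul_one] at this
  rw [← this, map_zero, LinearMap.zero_apply]

/-- The basis of the graded dual that is dual to the monomials. -/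
def dualBasis (Q : Type u) [CommRing Q] (c : ℕ) : Basis (Fin c →₀ ℕ) Q (GradedDual Q c) :=
  Basis.mk (v := dualMonomial Q) (by
    rw [linearIndependent_iff]
    intro l hl
    refine Finsupp.ext fun α => ?_
    have h := congrArg (fun φ => GradedDual.form φ (MvPolynomial.monomial α 1)) hl
    simp only [Finsupp.linearCombination_apply, Finsupp.sum, map_sum, LinearMap.sum_apply, map_smul,
      LinearMap.smul_apply, dualMonomial_form, MvPolynomial.coeff_monomial, map_zero,
      LinearMap.zero_apply, smul_eq_mul, mul_ite, mul_one, mul_zero] at h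
    rw [Finset.sum_ite_eq] at h
    by_contra h0
    rw [Finsupp.zero_apply] at h0
    rw [if_pos (Finsupp.mem_support_iff.2 h0)] at h
    exact h0 h) (by
    intro φ _
    have : φ = ∑ α ∈ (gradedDual_finite φ).toFinset,
        φ.form (MvPolynomial.monomial α 1) • dualMonomial Q α := by
      refine GradedDual.ext_monomial fun β => ?_
      simp only [map_sum, LinearMap.sum_apply, map_smul, LinearMap.smul_apply, dualMonomial_form,
        MvPolynomial.coeff_monomial, smul_eq_mul, mul_ite, mul_one, mul_zero]
      rw [Finset.sum_ite_eq]
      split_ifs with h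
      · rfl
      · rw [Set.Finite.mem_toFinset, Set.mem_ofPred_eq, not_not] at h
        exact h
    rw [this]
    exact Submodule.sum_mem _ fun α _ => Submodule.smul_mem _ _ (Submodule.subset_span ⟨α, rfl⟩))

theorem dualBasis_apply (α : Fin c →₀ ℕ) : dualBasis Q c α = dualMonomial Q α :=
  Basis.mk_apply _ _ α

theorem dualBasis_repr (φ : GradedDual Q c) (α : Fin c →₀ ℕ) :
    (dualBasis Q c).repr φ α = φ.form (MvPolynomial.monomial α 1) := by
  have : (dualBasis Q c).coord α
      = LinearMap.applyₗ (MvPolynomial.monomial α (1 : Q)) ∘ₗ GradedDual.form := by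
    refine (dualBasis Q c).ext fun β => ?_
    rw [Basis.coord_apply, Basis.repr_self, LinearMap.comp_apply, LinearMap.applyₗ_apply_apply,
      dualBasis_apply, dualMonomial_form, MvPolynomial.coeff_monomial, Finsupp.single_apply]
    simp only [eq_comm]
  exact LinearMap.congr_fun this φ

theorem dualDeg_eq_span (i : ℤ) : dualDeg Q c i
    = Submodule.span Q (dualBasis Q c '' {α | 2 * (α.degree : ℤ) = i}) := by
  apply le_antisymm
  · intro φ hφ
    rw [Basis.mem_span_image]
    intro α hα
    rw [Finset.mem_coe, Finsupp.mem_support_iff, dualBasis_repr] at hα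
    by_contra h
    exact hα (hφ α.degree h _ (MvPolynomial.isHomogeneous_monomial 1 rfl))
  · rw [Submodule.span_le]
    rintro _ ⟨α, hα, rfl⟩ n hn p hp
    rw [Set.mem_ofPred_eq] at hα
    rw [dualBasis_apply, dualMonomial_form]
    exact hp.coeff_eq_zero fun h => hn (by rw [← h]; exact hα)

theorem dualCounit_dualBasis (α : Fin c →₀ ℕ) :
    dualCounit Q c (dualBasis Q c α) = if α = 0 then 1 else 0 := by
  rw [dualCounit, LinearMap.comp_apply, LinearMap.applyₗ_apply_apply, dualBasis_apply,
    dualMonomial_form, MvPolynomial.coeff_one]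
  simp only [eq_comm]

theorem chiAct_dualMonomial_add (α β : Fin c →₀ ℕ) :
    chiAct β (dualMonomial Q (α + β)) = dualMonomial Q α := by
  refine GradedDual.ext_monomial fun δ => ?_
  rw [chiAct_apply, dualMonomial_form, dualMonomial_form, MvPolynomial.monomial_mul, mul_one,
    MvPolynomial.coeff_monomial, MvPolynomial.coeff_monomial, add_comm β]
  simp only [add_left_inj]

theorem exists_add_eq_of_chiAct_ne_zero {α β : Fin c →₀ ℕ} (h : chiAct β (dualMonomial Q α) ≠ 0) :
    ∃ δ, δ + β = α := by
  by_contra! h'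
  refine h (GradedDual.ext_monomial fun δ => ?_)
  rw [chiAct_apply, dualMonomial_form, MvPolynomial.monomial_mul, MvPolynomial.coeff_monomial,
    if_neg (by rw [add_comm]; exact h' δ), map_zero, LinearMap.zero_apply]

variable {G : Type w} [AddCommGroup G] [Module Q G]

/-- Multiplication by `χ^β` transposed sends `(χ^α)^∨` to `(χ^(α - β))^∨`, or to zero if `β` is not
below `α`. The sum over all exponents thus becomes a sum over decompositions of `α`. -/
theorem eisenbudMap_dualBasis (σ : (Fin c →₀ ℕ) → (G →ₗ[Q] G)) (α : Fin c →₀ ℕ) (g : G) :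
    eisenbudMap σ (dualBasis Q c α ⊗ₜ g)
      = ∑ p ∈ Finset.HasAntidiagonal.antidiagonal α, dualBasis Q c p.1 ⊗ₜ σ p.2 g := by
  classical
  have h1 : eisenbudMap σ (dualBasis Q c α ⊗ₜ g)
      = ∑ᶠ β : Fin c →₀ ℕ, chiAct β (dualBasis Q c α) ⊗ₜ[Q] σ β g := rfl
  rw [h1, dualBasis_apply, finsum_eq_sum_of_support_subset
    (s := (Finset.HasAntidiagonal.antidiagonal α).image Prod.snd), Finset.sum_image]
  · refine Finset.sum_congr rfl fun p hp => ?_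
    rw [Finset.HasAntidiagonal.mem_antidiagonal] at hp
    rw [← hp, chiAct_dualMonomial_add, dualBasis_apply]
  · intro p hp q hq h
    rw [Finset.mem_coe, Finset.HasAntidiagonal.mem_antidiagonal] at hp hq
    refine Prod.ext ?_ h
    rw [← hq, h] at hp
    exact add_right_cancel hp
  · intro β hβ
    rw [Function.mem_support] at hβ
    obtain ⟨δ, hδ⟩ := exists_add_eq_of_chiAct_ne_zero (Q := Q) (α := α) (β := β) (by
      intro h; rw [h, TensorProduct.zero_tmul] at hβ; exact hβ rfl)
    rw [Finset.mem_coe, Finset.mem_image]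
    exact ⟨(δ, β), Finset.HasAntidiagonal.mem_antidiagonal.2 hδ, rfl⟩

end DualBasis

/-! ### The Priddy differential on the basis of symmetric tensors -/

section Priddy

variable {Q : Type u} [CommRing Q] {c : ℕ} {f : Fin c → Q} {G : Type w} [AddCommGroup G] [Module Q G]

/-- The differential of `C ⊗ G` twisted by the operations of an A∞-module, where `C` is the coalgebra
of symmetric tensors. -/
def symTwistedDiff (𝒢 : AInfModule (koszulAInf f) G) :
    symTensors Q (Fin c → Q) ⊗[Q] G →ₗ[Q] symTensors Q (Fin c → Q) ⊗[Q] G :=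
  TensorProduct.map (symCoalgebra f).d LinearMap.id +
    TensorProduct.map (gradeSign (symCoalgebra f).deg (symCoalgebra f).internal)
      (TensorProduct.lift (𝒢.twist ∘ₗ symIncl f)) ∘ₗ
      (TensorProduct.assoc Q _ _ G).toLinearMap ∘ₗ
        TensorProduct.map (symCoalgebra f).comul LinearMap.id

theorem gradeSign_symBasis (α : Fin c →₀ ℕ) :
    gradeSign (symCoalgebra f).deg (symCoalgebra f).internal (symBasis Q c α) = symBasis Q c α := by
  rw [gradeSign_of_mem (symCoalgebra f).deg (symCoalgebra f).internal (i := 2 * (α.degree : ℤ))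
    (symBasis_mem_symDeg rfl), sgn_two_mul, one_smul]

/-- All symmetric tensors have even degree, so the Koszul sign is trivial and the coproduct formula
gives the same shape as for the Eisenbud–Shamash differential. -/
theorem symTwistedDiff_symBasis (𝒢 : AInfModule (koszulAInf f) G) (α : Fin c →₀ ℕ) (g : G) :
    symTwistedDiff 𝒢 (symBasis Q c α ⊗ₜ g)
      = ∑ p ∈ Finset.HasAntidiagonal.antidiagonal α, symBasis Q c p.1 ⊗ₜ homotopy 𝒢 p.2 g := by
  have h1 : (symCoalgebra f).d = 0 := rfl
  have h2 : (symCoalgebra f).comul = symComul Q c := rfl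
  rw [symTwistedDiff, h1, h2, TensorProduct.map_zero_left, zero_add, LinearMap.comp_apply,
    LinearMap.comp_apply, TensorProduct.map_tmul, symComul_symBasis, TensorProduct.sum_tmul,
    map_sum, map_sum]
  refine Finset.sum_congr rfl fun p _ => ?_
  rw [LinearEquiv.coe_coe, TensorProduct.assoc_tmul, TensorProduct.map_tmul, gradeSign_symBasis,
    TensorProduct.lift.tmul, LinearMap.comp_apply, symIncl, LinearMap.comp_apply,
    Submodule.subtype_apply, symBasis_coe, homotopy_eq_twist, LinearMap.id_apply]

end Priddy

/-! ### Matching two bases -/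

section Comparison

variable {Q : Type*} [CommRing Q] (R : Type*) [CommRing R] [Algebra Q R] {c : ℕ}
  {C C' : Type*} [AddCommGroup C] [Module Q C] [AddCommGroup C'] [Module Q C']
  (y : Basis (Fin c →₀ ℕ) Q C) (y' : Basis (Fin c →₀ ℕ) Q C')
  {G : Type*} [AddCommGroup G] [Module Q G]

/-- The isomorphism of `R ⊗ C ⊗ G` and `R ⊗ C' ⊗ G` matching bases of `C` and `C'`. -/
def resEquiv (G : Type*) [AddCommGroup G] [Module Q G] :
    R ⊗[Q] (C ⊗[Q] G) ≃ₗ[R] R ⊗[Q] (C' ⊗[Q] G) :=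
  LinearEquiv.baseChange Q R _ _
    (TensorProduct.congr (y.equiv y' (Equiv.refl _)) (LinearEquiv.refl Q G))

theorem resEquiv_tmul (r : R) (x : C) (g : G) :
    resEquiv R y y' G (r ⊗ₜ (x ⊗ₜ g)) = r ⊗ₜ (y.equiv y' (Equiv.refl _) x ⊗ₜ g) := rfl

theorem resEquiv_basis (r : R) (α : Fin c →₀ ℕ) (g : G) :
    resEquiv R y y' G (r ⊗ₜ (y α ⊗ₜ g)) = r ⊗ₜ (y' α ⊗ₜ g) := by
  rw [resEquiv_tmul, Basis.equiv_apply, Equiv.refl_apply]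

theorem res_ext {Y : Type*} [AddCommGroup Y] [Module R Y] {T T' : R ⊗[Q] (C ⊗[Q] G) →ₗ[R] Y}
    (h : ∀ r α g, T (r ⊗ₜ (y α ⊗ₜ g)) = T' (r ⊗ₜ (y α ⊗ₜ g))) : T = T' := by
  -- `Y` carries only an `R`-action, and the comparison over `Q` needs the restricted one.
  let _ : Module Q Y := Module.compHom Y (algebraMap Q R)
  have _ : IsScalarTower Q R Y := ⟨fun q r z => by
    rw [Algebra.smul_def, mul_smul]; rfl⟩
  have : T.restrictScalars Q = T'.restrictScalars Q :=
    TensorProduct.ext (LinearMap.ext fun r => tensorProduct_ext_basis y fun α g => h r α g)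
  exact LinearMap.ext fun x => LinearMap.congr_fun this x

variable {y y'}

theorem resEquiv_diff {σ : (Fin c →₀ ℕ) → G →ₗ[Q] G} {D : C ⊗[Q] G →ₗ[Q] C ⊗[Q] G}
    {D' : C' ⊗[Q] G →ₗ[Q] C' ⊗[Q] G}
    (hD : ∀ α g, D (y α ⊗ₜ g) = ∑ p ∈ Finset.HasAntidiagonal.antidiagonal α, y p.1 ⊗ₜ σ p.2 g)
    (hD' : ∀ α g, D' (y' α ⊗ₜ g) = ∑ p ∈ Finset.HasAntidiagonal.antidiagonal α, y' p.1 ⊗ₜ σ p.2 g)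
    (x : R ⊗[Q] (C ⊗[Q] G)) :
    resEquiv R y y' G (D.baseChange R x) = D'.baseChange R (resEquiv R y y' G x) := by
  have : (resEquiv R y y' G).toLinearMap ∘ₗ D.baseChange R
      = D'.baseChange R ∘ₗ (resEquiv R y y' G).toLinearMap := by
    refine res_ext R y fun r α g => ?_
    rw [LinearMap.comp_apply, LinearMap.comp_apply, LinearEquiv.coe_coe, resEquiv_basis,
      LinearMap.baseChange_tmul, LinearMap.baseChange_tmul, hD, hD', TensorProduct.tmul_sum,
      TensorProduct.tmul_sum, map_sum]
    exact Finset.sum_congr rfl fun p _ => resEquiv_basis R y y' r p.1 _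
  exact LinearMap.congr_fun this x

theorem resEquiv_aug {M : Type*} [AddCommGroup M] [Module Q M]
    [Module R M] [IsScalarTower Q R M] {η : C →ₗ[Q] Q} {η' : C' →ₗ[Q] Q} (γ : G →ₗ[Q] M)
    (hη : ∀ α, η (y α) = η' (y' α)) (x : R ⊗[Q] (C ⊗[Q] G)) :
    resAug R η' γ (resEquiv R y y' G x) = resAug R η γ x := by
  have : resAug R η' γ ∘ₗ (resEquiv R y y' G).toLinearMap = resAug R η γ := by
    refine res_ext R y fun r α g => ?_
    rw [LinearMap.comp_apply, LinearEquiv.coe_coe, resEquiv_basis, resAug_tmul, resAug_tmul, hη]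
  exact LinearMap.congr_fun this x

theorem map_resEquiv {degC : ℤ → Submodule Q C} {degC' : ℤ → Submodule Q C'}
    {degG : ℤ → Submodule Q G} {dG : G →ₗ[Q] G} {ε : (Fin c →₀ ℕ) → ℤ}
    (hC : ∀ n, degC n = Submodule.span Q (y '' {i | ε i = n}))
    (hC' : ∀ n, degC' n = Submodule.span Q (y' '' {i | ε i = n}))
    (hG : IsSemifree degG dG) (n : ℤ) :
    (resDeg R degC degG n).map (resEquiv R y y' G).toLinearMap = resDeg R degC' degG n := by
  obtain ⟨I, b, rank, δ, hb, hrank⟩ := hG.exists_basis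
  have hdegG := eq_span_of_basis b δ degG hG.internal hb
  rw [resDeg_eq_span R y b hC hdegG, resDeg_eq_span R y' b hC' hdegG, Submodule.map_span,
    ← Set.image_comp]
  congr 1
  refine Set.image_congr fun p _ => ?_
  rw [Function.comp_apply, Basis.baseChange_apply, Basis.baseChange_apply,
    Basis.tensorProduct_apply', Basis.tensorProduct_apply', LinearEquiv.coe_coe, resEquiv_basis]

end Comparison

end AInfKoszul

end

theorem mainTheorem4 {Q : Type u} {R : Type v} [CommRing Q] [IsLocalRing Q] [IsNoetherianRing Q]
    [CommRing R] [IsLocalRing R] [Algebra Q R] (hφ : Function.Surjective (algebraMap Q R))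
    {c : ℕ} (f : Fin c → Q) (hreg : RingTheory.Sequence.IsRegular Q (List.ofFn f))
    (hf : RingHom.ker (algebraMap Q R) = Ideal.span (Set.range f)) :
    IsStrictlyKoszul Q R ∧
    ∃ (P : IsStrictlyKoszulPresentation (R := R) (koszulAInf f) (concDeg Q (Fin c → Q) 1)
        (extRel Q (Fin c → Q)) (extEquiv Q (Fin c → Q)).toLinearEquiv
        (koszulAug Q c R).toLinearMap)
      (𝒞 : CurvedDGCoalgebra Q (symTensors Q (Fin c → Q))),
      priddy (concDeg Q (Fin c → Q) 1) P.V_internal (extRel Q (Fin c → Q))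
        = symTensors Q (Fin c → Q) ∧
      IsCurvedSymCoalgebra f 𝒞 ∧
      IsPriddyCoalgebra P 𝒞 (symIncl f) ∧
      ∀ {M : Type w} [AddCommGroup M] [Module Q M] [Module R M] [IsScalarTower Q R M]
        (degM : ℤ → Submodule R M) (dM : M →ₗ[R] M) (hM : IsComplex degM dM)
        {G : Type w'} [AddCommGroup G] [Module Q G]
        (degG : ℤ → Submodule Q G) (dG : G →ₗ[Q] G) (γ : G →ₗ[Q] M),
        IsSemifreeResolution degG dG (fun i => (degM i).restrictScalars Q)
          (dM.restrictScalars Q) γ →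
        (∃ 𝒢 : AInfModule (koszulAInf f) G, 𝒢.deg = degG ∧ 𝒢.act 0 ![] = dG ∧
          IsStrictMorphism 𝒢 (koszulRestrict f hf degM dM hM) γ) ∧
        ∀ 𝒢 : AInfModule (koszulAInf f) G, 𝒢.deg = degG → 𝒢.act 0 ![] = dG →
          IsStrictMorphism 𝒢 (koszulRestrict f hf degM dM hM) γ →
          IsSystemOfHigherHomotopies f degG dG γ (homotopy 𝒢) ∧
          IsSemifreeResolution (resDeg R 𝒞.deg degG)
            (priddyDiff R 𝒢 𝒞 (symIncl f))
            degM dM (resAug R 𝒞.counit γ) ∧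
          IsSemifreeResolution (resDeg R (dualDeg Q c) degG) (eisenbudDiff R (homotopy 𝒢))
            degM dM (resAug R (dualCounit Q c) γ) ∧
          ∃ θ : GradedDual Q c ≃ₗ[Q] symTensors Q (Fin c → Q),
            (∀ α : Fin c →₀ ℕ,
              (θ (dualMonomial Q α) : TensorAlgebra Q (Fin c → Q)) = symElt Q α) ∧
            ∃ ψ : R ⊗[Q] (GradedDual Q c ⊗[Q] G) ≃ₗ[R] R ⊗[Q] (symTensors Q (Fin c → Q) ⊗[Q] G),
              (∀ r φ g, ψ (r ⊗ₜ (φ ⊗ₜ g)) = r ⊗ₜ (θ φ ⊗ₜ g)) ∧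
              (∀ i, (resDeg R (dualDeg Q c) degG i).map ψ.toLinearMap = resDeg R 𝒞.deg degG i) ∧
              (∀ x, ψ (eisenbudDiff R (homotopy 𝒢) x)
                = priddyDiff R 𝒢 𝒞 (symIncl f) (ψ x)) ∧
              (∀ x, resAug R 𝒞.counit γ (ψ x) = resAug R (dualCounit Q c) γ x) := by

  refine ⟨⟨isKoszulHom_of_regular hφ hreg hf, _, _, _, koszulAInf f, _, _, _, _, _, _, _,
    koszul_presentation hφ hreg hf⟩, koszul_presentation hφ hreg hf, symCoalgebra f,
    priddy_eq_symTensors _, isCurvedSymCoalgebra f, isPriddyCoalgebra f _, ?_⟩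
  intro M _ _ _ _ degM dM hM G _ _ degG dG γ hγ
  refine ⟨exists_koszul_ainfModule f hf degM dM hM degG dG γ hγ, ?_⟩
  rintro 𝒢 rfl rfl h𝒢
  have hσ := isSystemOfHigherHomotopies hf hM 𝒢 h𝒢
  -- By unfolding, the Priddy and Eisenbud–Shamash differentials are the base changes of
  -- `symTwistedDiff` and `eisenbudMap`; the general result is applied once for each basis.
  refine ⟨hσ, isSemifreeResolution_shamash (symBasis Q c) hφ hreg hf symDeg_eq_span
      symCounit_symBasis (symTwistedDiff_symBasis 𝒢) hγ hσ,
    isSemifreeResolution_shamash (dualBasis Q c) hφ hreg hf dualDeg_eq_span dualCounit_dualBasis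
      (eisenbudMap_dualBasis (homotopy 𝒢)) hγ hσ,
    (dualBasis Q c).equiv (symBasis Q c) (Equiv.refl _), fun α => ?_,
    resEquiv R (dualBasis Q c) (symBasis Q c) G, fun r φ g => rfl,
    map_resEquiv R dualDeg_eq_span symDeg_eq_span hγ.semifree,
    resEquiv_diff R (eisenbudMap_dualBasis (homotopy 𝒢)) (symTwistedDiff_symBasis 𝒢),
    resEquiv_aug R γ fun α => ?_⟩
  · rw [← dualBasis_apply, Module.Basis.equiv_apply, Equiv.refl_apply, symBasis_coe]
  · rw [dualCounit_dualBasis]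
    exact (symCounit_symBasis α).symm
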